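/- **Setting.** Let $G$ be a compact connected Lie group, realised as a closed connected subgroup of the unitary group $U(V)$ of a finite-dimensional complex Hilbert space $V$ (every compact Lie group is of this form). Let $\mathfrak g=\{X:\ e^{tX}\in G\ \forall t\in\mathbb R\}$, let $\mathfrak g_{\mathbb C}=\mathfrak g+i\mathfrak g\subset\mathfrak{gl}(V)$ with conjugation $\bar X=-X^\dagger$ ($X^\dagger$ the Hermitian adjoint), let $G_{\mathbb C}\subset GL(V)$ be the complexification of $G$, and let $\mathrm{tr}=c\,\kappa_{\mathrm{ad}}$ be a constant multiple, $c\in\mathbb C$, of the Killing form of $\mathfrak g_{\mathbb C}$ (for $\mathfrak g_{\mathbb C}$ simple the standard choice is the multiple for which the longest root has squared length $2$). We write $\mathrm{tr}(XY)$ for $\mathrm{tr}(X,Y)$. Let $L^\omega\mathfrak g_{\mathbb C}$ be the complex Lie algebra (with pointwise bracket) of maps $u:\mathbb S^1\to\mathfrak g_{\mathbb C}$ that extend holomorphically to a neighbourhood of $\mathbb S^1$. Put $u^*(z)=\overline{u(1/\bar z)}$ and $\omega_{\mathrm{KM}}(u,v)=\frac1{2\pi}\oint_{\mathbb S^1}\mathrm{tr}(u\,\partial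 v)$. Let $L^\omega G$ be the group of loops $\mathbb S^1\to G$ that extend holomorphically to a neighbourhood of $\mathbb S^1$, and let $L^\omega_1G$ be the set of $\gamma\in L^\omega G$ of the form $\gamma=g\hat g^{-1}$, with $g$ (resp. $\hat g$) holomorphic and invertible in a neighbourhood of the closed unit disc (resp. of $\{|z|\ge1\}\cup\{\infty\}$) and $g(0)=1$. Let $\mathcal A$ be the space of holomorphic $\mathfrak g_{\mathbb C}$-valued $(1,0)$-forms on the open unit disc $\mathbb D$, with the topology of locally uniform convergence. Each $\alpha\in\mathcal A$ is $\alpha=g^{-1}\partial g$ for a unique holomorphic $g:\mathbb D\to G_{\mathbb C}$ with $g(0)=1$. Its reflected form is $\alpha^{\mathrm{r}}:=-\partial g\,g^{-1}$, and for $u\in L^\omega\mathfrak g_{\mathbb C}$ we put $\alpha^{\mathrm r}(u):=\frac1{2i\pi}\oint_{|z|=r}\mathrm{tr}(u\,\alpha^{\mathrm r})$ for $r<1$ close to $1$. For a holomorphic invertible $\chi$ near $\mathbb S^1$, write $\chi\cdot\alpha=\beta=g'^{-1}\partial g'\in\mathcal A$ (with $g'(0)=1$) if $g'=\chi g h^{-1}$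 on an annulus $\rho<|z|<1$ for some $h$ holomorphic and invertible on $\{|z|>\rho\}\cup\{\infty\}$. Such a $\beta$ is unique, and for each $\alpha$ it exists when $\chi$ is a $G$-valued analytic loop close to $1$; this is the (locally defined) left action. **Lie derivatives.** For $u\in L^\omega\mathfrak g_{\mathbb C}$, a function $F:\mathcal A\to\mathbb C$ is left-differentiable at $\alpha$ in direction $u$, with derivatives $\mathcal L_uF(\alpha)$ and $\mathcal L_{u^*}F(\alpha)$, if for every $C^1$-family $(\chi_t)$ in $L^\omega_1G$, defined for $t$ in a complex neighbourhood of $0$, with $\chi_0=1$, $\partial_t\chi_t|_{t=0}=u$ and $\partial_{\bar t}\chi_t|_{t=0}=u^*$, $$F(\chi_t^{-1}\cdot\alpha)=F(\alpha)+t\,\mathcal L_uF(\alpha)+\bar t\,\mathcal L_{u^*}F(\alpha)+o(t)\qquad(t\to0).$$ ($C^1$ means that all $\chi_t$ are holomorphic on a common annulus around $\mathbb S^1$ and that the real differential in $t$ is continuous in $(t,z)$.) Let $C^\infty(\mathcal A)$ be the space of those continuous $F:\mathcal A\to\mathbb C$ all of whose iterated derivatives $\mathcal L_{u_1}\cdots\mathcal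 L_{u_n}F$, $u_i\in L^\omega\mathfrak g_{\mathbb C}$, exist everywhere and are continuous. **Proposition.** 1. For every $v\in L^\omega\mathfrak g_{\mathbb C}$, the function $\alpha\mapsto\alpha^{\mathrm r}(v)$ belongs to $C^\infty(\mathcal A)$, and for all $u,v\in L^\omega\mathfrak g_{\mathbb C}$ and $\alpha\in\mathcal A$ $$\mathcal L_u\big(\alpha^{\mathrm r}(v)\big)-\mathcal L_v\big(\alpha^{\mathrm r}(u)\big)-\alpha^{\mathrm r}([u,v])=i\,\omega_{\mathrm{KM}}(u,v).$$ 2. For every $\check\kappa\in\mathbb C$, the operators $\mathbf L_u:=\mathcal L_u+\check\kappa\,\alpha^{\mathrm r}(u)\,\mathrm{Id}$ map $C^\infty(\mathcal A)$ to itself, are linear there, depend $\mathbb C$-linearly on $u\in L^\omega\mathfrak g_{\mathbb C}$, and form a representation of the Kac–Moody algebra at level $\check\kappa$: for all $u,v\in L^\omega\mathfrak g_{\mathbb C}$, $$[\mathbf L_u,\mathbf L_v]=\mathbf L_{[u,v]}+i\,\check\kappa\,\omega_{\mathrm{KM}}(u,v)\,\mathrm{Id}.$$ -/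

import Mathlib

noncomputable section

attribute [local instance 100] LieRing.ofAssociativeRing

open Filter Topology Asymptotics ComplexConjugate

namespace LoopRep

variable {V : Type*} [NormedAddCommGroup V] [InnerProductSpace ℂ V] [CompleteSpace V]

/-- The algebra `gl(V)` of matrices, i.e. linear maps of a finite-dimensional complex Hilbert space
`V ≅ ℂ^N`. `star` is the conjugate transpose, `unitary (Mat V)` is the unitary group `U(N)`, the Lie
bracket is the commutator, and `Ring.inverse` is the inverse of an invertible matrix. -/
abbrev Mat (V : Type*) [NormedAddCommGroup V] [InnerProductSpace ℂ V] : Type _ := V →L[ℂ] V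

/-- The open annulus `ρ < |z| < 1/ρ`. For `0 < ρ < 1` these form a basis of neighbourhoods of the
unit circle. -/
def annulus (ρ : ℝ) : Set ℂ := {z | ρ < ‖z‖ ∧ ‖z‖ < ρ⁻¹}

/-! ### The group, its Lie algebra and the invariant form

A compact Lie group is given as a closed subgroup `G` of some unitary group `U(V)`. The conjugation
of `gl(V)` with respect to `u(V)` is `X ↦ -X^*`. -/

/-- The (real) Lie algebra `𝔤 = {X | exp(tX) ∈ G for all real t}` of `G`. -/
def realLie (G : Subgroup (unitary (Mat V))) : Set (Mat V) :=
  {X | ∀ t : ℝ, ∃ g ∈ G, (g : Mat V) = NormedSpace.exp (t • X)}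

/-- The complexified Lie algebra `𝔤_ℂ = 𝔤 + i𝔤 ⊆ gl(V)`: the complex Lie subalgebra
generated by `𝔤`. -/
def complexLie (G : Subgroup (unitary (Mat V))) : LieSubalgebra ℂ (Mat V) :=
  LieSubalgebra.lieSpan ℂ (Mat V) (realLie G)

open Classical in
/-- A matrix regarded as an element of `𝔤_ℂ` (only used for matrices that do lie in `𝔤_ℂ`). -/
def toLie (G : Subgroup (unitary (Mat V))) (X : Mat V) : complexLie G :=
  if h : X ∈ complexLie G then ⟨X, h⟩ else 0

/-- The multiple `tr = c κ_ad` of the Killing form `κ_ad` of `𝔤_ℂ`. The usual normalisation for a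
simple `𝔤_ℂ` is `c = 2 / κ_ad(θ, θ)` with `θ` the (coroot of the) longest root. -/
def trForm (G : Subgroup (unitary (Mat V))) (c : ℂ) (X Y : Mat V) : ℂ :=
  c * killingForm ℂ (complexLie G) (toLie G X) (toLie G Y)

/-! ### The loop algebra -/

/-- The Lie algebra of analytic loops in `𝔤_ℂ`: the maps from the unit circle to `𝔤_ℂ` that extend
holomorphically to a neighbourhood of the circle, with pointwise operations. (By the identity
theorem the extension is unique near the circle and takes values in `𝔤_ℂ` there.) -/
def loopAlgebra (G : Subgroup (unitary (Mat V))) :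
    LieSubalgebra ℂ (Circle → Mat V) where
  carrier := {u | (∀ z, u z ∈ complexLie G) ∧
    ∃ U : ℂ → Mat V, AnalyticOnNhd ℂ U (Metric.sphere 0 1) ∧ ∀ z : Circle, U z = u z}
  zero_mem' := ⟨fun _ => zero_mem _, fun _ => 0, analyticOnNhd_const, fun _ => rfl⟩
  add_mem' := by
    rintro u v ⟨hu, U, hU, hUu⟩ ⟨hv, V, hV, hVv⟩
    exact ⟨fun z => add_mem (hu z) (hv z), U + V, hU.add hV, fun z => by simp [hUu, hVv]⟩
  smul_mem' := by
    rintro a u ⟨hu, U, hU, hUu⟩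
    exact ⟨fun z => (complexLie G).smul_mem a (hu z), fun z => a • U z,
      analyticOnNhd_const.smul hU,
      fun z => by simp [hUu]⟩
  lie_mem' := by
    rintro u v ⟨hu, U, hU, hUu⟩ ⟨hv, V, hV, hVv⟩
    exact ⟨fun z => (complexLie G).lie_mem (hu z) (hv z), U * V - V * U,
      (hU.mul hV).sub (hV.mul hU), fun z => by simp [hUu, hVv, Ring.lie_def]⟩

/-- The holomorphic extension of a loop to a neighbourhood of the circle. -/
def loopExt {G : Subgroup (unitary (Mat V))} (u : loopAlgebra G) : ℂ → Mat V :=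
  Classical.choose u.2.2

/-- The Kac--Moody cocycle `ω(u,v) = (1/2π) ∮ tr(u ∂v)` over the unit circle. -/
def omegaKM (G : Subgroup (unitary (Mat V))) (c : ℂ) (u v : loopAlgebra G) : ℂ :=
  (2 * (Real.pi : ℂ))⁻¹ * ∮ z in C(0, 1), trForm G c (loopExt u z) (deriv (loopExt v) z)

/-! ### Holomorphic forms on the disc -/

/-- The space `𝒜` of holomorphic `𝔤_ℂ`-valued `(1,0)`-forms `α(z) dz` on the open unit disc, with
the topology of locally uniform convergence (the compact-open topology). -/
def Forms (G : Subgroup (unitary (Mat V))) : Type _ :=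
  {α : C(Metric.ball (0 : ℂ) 1, Mat V) // (∀ z, α z ∈ complexLie G) ∧
    ∃ f : ℂ → Mat V, DifferentiableOn ℂ f (Metric.ball 0 1) ∧
      ∀ z : Metric.ball (0 : ℂ) 1, f z = α z}

instance (G : Subgroup (unitary (Mat V))) : TopologicalSpace (Forms G) :=
  inferInstanceAs (TopologicalSpace (Subtype _))

variable {G : Subgroup (unitary (Mat V))}

/-- `g` is the solution of `g⁻¹ ∂g = α`, `g(0) = 1` on the unit disc; as `α` is `𝔤_ℂ`-valued, it
takes its values in the complexification `G_ℂ ⊆ GL(V)`. -/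
def IsFrame (α : Forms G) (g : ℂ → Mat V) : Prop :=
  DifferentiableOn ℂ g (Metric.ball 0 1) ∧ g 0 = 1 ∧
    ∀ z : Metric.ball (0 : ℂ) 1, IsUnit (g z) ∧ Ring.inverse (g z) * deriv g z = α.1 z

/-- The holomorphic map `g : 𝔻 → G_ℂ` with `g(0) = 1` that corresponds to `α = g⁻¹ ∂g`. -/
def frame (α : Forms G) : ℂ → Mat V := Classical.epsilon (IsFrame α)

/-- The reflected form `-∂g g⁻¹` of `α = g⁻¹ ∂g`. -/
def reflected (α : Forms G) (z : ℂ) : Mat V := -(deriv (frame α) z * Ring.inverse (frame α z))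

/-- The pairing `(1/2πi) ∮ tr(u (-∂g g⁻¹))` of the reflected form with a loop `u`; the contour is
`|z| = r` for `r < 1` close to `1` (the integral does not depend on such an `r`, so it is its limit
as `r ↑ 1`). -/
def reflectedPairing (c : ℂ) (α : Forms G) (u : loopAlgebra G) : ℂ :=
  limUnder (𝓝[<] (1 : ℝ)) fun r : ℝ =>
    (2 * (Real.pi : ℂ) * Complex.I)⁻¹ *
      ∮ z in C(0, r), trForm G c (loopExt u z) (reflected α z)

/-! ### The left action of loops -/

/-- `γ`, holomorphic on an annulus around the unit circle, is a loop in `G` whose Birkhoff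
factorisation `γ = g λ ĝ⁻¹` has trivial homomorphism `λ`: it is a product `γ(z) ĝ(z) = g(z)` with
`g` holomorphic and invertible on a neighbourhood of the closed unit disc, `g(0) = 1`, and
`ĝ(z) = k(1/z)` holomorphic and invertible on a neighbourhood of the closed exterior disc
(including `∞`). -/
def IsLoopOne (G : Subgroup (unitary (Mat V))) (γ : ℂ → Mat V) : Prop :=
  (∀ z : Circle, ∃ x ∈ G, γ z = (x : Mat V)) ∧
  ∃ ρ : ℝ, 0 < ρ ∧ ρ < 1 ∧ DifferentiableOn ℂ γ (annulus ρ) ∧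
  ∃ g k : ℂ → Mat V,
    DifferentiableOn ℂ g (Metric.ball 0 ρ⁻¹) ∧ (∀ z ∈ Metric.ball 0 ρ⁻¹, IsUnit (g z)) ∧
    g 0 = 1 ∧
    DifferentiableOn ℂ k (Metric.ball 0 ρ⁻¹) ∧ (∀ w ∈ Metric.ball 0 ρ⁻¹, IsUnit (k w)) ∧
    ∀ z ∈ annulus ρ, γ z * k z⁻¹ = g z

/-- The relation `β = χ · α` of the left action: with `α = g⁻¹ ∂g` and `β = g'⁻¹ ∂g'`, there is an
invertible holomorphic `h` on a neighbourhood `|z| > ρ` of the closed exterior disc (including `∞`;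
`h(z) = k(1/z)`) such that `g' = χ g h⁻¹` on `ρ < |z| < 1`. By Liouville's theorem `β` is unique if
it exists, and `h` takes values in `G_ℂ` since `χ`, `g` and `g'` do. -/
def ActsTo (χ : ℂ → Mat V) (α β : Forms G) : Prop :=
  ∃ ρ : ℝ, 0 < ρ ∧ ρ < 1 ∧ DifferentiableOn ℂ χ (annulus ρ) ∧ (∀ z ∈ annulus ρ, IsUnit (χ z)) ∧
  ∃ k : ℂ → Mat V,
    DifferentiableOn ℂ k (Metric.ball 0 ρ⁻¹) ∧ (∀ w ∈ Metric.ball 0 ρ⁻¹, IsUnit (k w)) ∧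
    ∀ z : ℂ, ρ < ‖z‖ → ‖z‖ < 1 → frame β z = χ z * frame α z * Ring.inverse (k z⁻¹)

/-- `(χ_t)`, `t` in a complex neighbourhood of `0`, is a `C¹`-family of analytic loops in `G` (with
trivial `λ` in their Birkhoff factorisation) such that `χ_0 = 1`, `∂_t χ_t = u` and
`∂_{t̄} χ_t = u^*` at `t = 0`, where `u^*` is the conjugate `-star u` of `u` on the circle.
`C¹` means: all `χ_t` are holomorphic on a common annulus, and the real derivative in `t` exists and
is jointly continuous in `(t, z)`. -/
def IsC1Family (u : loopAlgebra G) (χ : ℂ → ℂ → Mat V) : Prop :=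
  ∃ ε ρ : ℝ, 0 < ε ∧ 0 < ρ ∧ ρ < 1 ∧
    (∀ t ∈ Metric.ball (0 : ℂ) ε, DifferentiableOn ℂ (χ t) (annulus ρ) ∧ IsLoopOne G (χ t)) ∧
    (∀ z ∈ annulus ρ, χ 0 z = 1) ∧
    ∃ D : ℂ → ℂ → (ℂ →L[ℝ] Mat V),
      (∀ t ∈ Metric.ball (0 : ℂ) ε, ∀ z ∈ annulus ρ, HasFDerivAt (fun s => χ s z) (D t z) t) ∧
      ContinuousOn (fun p : ℂ × ℂ => D p.1 p.2) (Metric.ball (0 : ℂ) ε ×ˢ annulus ρ) ∧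
      ∀ (z : Circle) (s : ℂ),
        D 0 z s = s • u.1 z + conj s • (-star (u.1 z))

/-! ### Lie derivatives and smooth functions -/

/-- `F` is left-differentiable at `α` in direction `u`, with `ℒ_u F(α) = a` and `ℒ_{u^*} F(α) = b`:
`F(χ_t⁻¹ · α) = F(α) + t a + t̄ b + o(t)` for all `C¹`-families as above. -/
def HasLeftDeriv (F : Forms G → ℂ) (α : Forms G) (u : loopAlgebra G) (a b : ℂ) : Prop :=
  ∀ χ : ℂ → ℂ → Mat V, IsC1Family u χ → ∀ β : ℂ → Forms G,
    (∀ᶠ t in 𝓝 (0 : ℂ), ActsTo (fun z => Ring.inverse (χ t z)) α (β t)) →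
    (fun t : ℂ => F (β t) - F α - t * a - conj t * b) =o[𝓝 0] fun t : ℂ => t

/-- The Lie derivative `ℒ_u F`. -/
def lieDeriv (u : loopAlgebra G) (F : Forms G → ℂ) (α : Forms G) : ℂ :=
  Classical.epsilon fun a => ∃ b, HasLeftDeriv F α u a b

/-- `F` is of class `C^n`: it is continuous, and if `n ≥ 1` it is left-differentiable everywhere in
all directions, with all `ℒ_u F` of class `C^{n-1}`. -/
def IsCk : ℕ → (Forms G → ℂ) → Prop
  | 0, F => Continuous F
  | n + 1, F => Continuous F ∧ ∀ u : loopAlgebra G, ∃ A B : Forms G → ℂ,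
      (∀ α, HasLeftDeriv F α u (A α) (B α)) ∧ IsCk n A

theorem IsCk.zero (n : ℕ) : IsCk n (0 : Forms G → ℂ) := by
  induction n with
  | zero => exact continuous_const
  | succ n ih =>
    exact ⟨continuous_const, fun u => ⟨0, 0, fun α χ _ β _ => by simp, ih⟩⟩

theorem IsCk.add {n : ℕ} {F F' : Forms G → ℂ} (h : IsCk n F) (h' : IsCk n F') :
    IsCk n (F + F') := by
  induction n generalizing F F' with
  | zero => exact Continuous.add h h'
  | succ n ih =>
    refine ⟨h.1.add h'.1, fun u => ?_⟩
    obtain ⟨A, B, hd, hA⟩ := h.2 u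
    obtain ⟨A', B', hd', hA'⟩ := h'.2 u
    refine ⟨A + A', B + B', fun α χ hχ β hβ => ?_, ih hA hA'⟩
    refine ((hd α χ hχ β hβ).add (hd' α χ hχ β hβ)).congr_left fun t => ?_
    simp only [Pi.add_apply]
    ring

theorem IsCk.smul {n : ℕ} {F : Forms G → ℂ} (a : ℂ) (h : IsCk n F) : IsCk n (a • F) := by
  induction n generalizing F with
  | zero => exact Continuous.const_smul h a
  | succ n ih =>
    refine ⟨h.1.const_smul a, fun u => ?_⟩
    obtain ⟨A, B, hd, hA⟩ := h.2 u
    refine ⟨a • A, a • B, fun α χ hχ β hβ => ?_, ih hA⟩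
    refine ((hd α χ hχ β hβ).const_mul_left a).congr_left fun t => ?_
    simp only [Pi.smul_apply, smul_eq_mul]
    ring

/-- The space `C^∞(𝒜)` of smooth functions. -/
def Smooth (G : Subgroup (unitary (Mat V))) : Submodule ℂ (Forms G → ℂ) where
  carrier := {F | ∀ n, IsCk n F}
  zero_mem' := IsCk.zero
  add_mem' := fun h h' n => (h n).add (h' n)
  smul_mem' := fun a _ h n => (h n).smul a

/-- The operator `𝐋_u = ℒ_u + κ · (reflected α)(u)`. -/
def opL (c κ : ℂ) (u : loopAlgebra G) (F : Forms G → ℂ) (α : Forms G) : ℂ :=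
  lieDeriv u F α + κ * reflectedPairing c α u * F α

end LoopRep

end

/-!
The analysis takes place in the Banach algebras `Hol Ω` of bounded holomorphic functions on discs
and annuli with values in `gl(V)`. On an annulus `r < |z| < R` the projection `posPart` onto the
Fourier modes of positive degree, `f ↦ f₊`, is bounded, and a function `1 + a` with `a` small has a
Birkhoff factorisation `(1 + a) k = p`, where `k` solves the linear equation `k + (a k)₋ = 1` and
`p = innerFactor r R a` extends over the disc with `p(0) = 1`; the derivative of `p` at `a = 0` is
`a ↦ a₊`. If `g` is the frame of `α` and `χ` is a loop close to `1`, the frame of `χ · α` is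
therefore `g p`, with `p` the inner factor of `g⁻¹ χ g` (`ActsTo.frameOn_eq`). That `χ · α` is again
`𝔤_ℂ`-valued follows from Liouville's theorem modulo `𝔤_ℂ`, for conjugation by the factors first and
for `p⁻¹ ∂p` afterwards (`exists_actsTo`).

Along a `C¹`-family of velocity `u` the frame thus has, for `χ_t⁻¹`, the velocity
`-g (g⁻¹ U g)₊` in `t` and the same with `u^*` in `t̄`. A smooth function of the frame on a disc
`|z| < R`, `R < 1`, has Lie derivatives of the same kind, and belongs to `C^∞(𝒜)`
(`IsFrameSmooth.mem_smooth`). Here frames depend continuously on the form by Grönwall's inequality.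
The pairing `α^r(v)` is such a function, and
`ℒ_u α^r(v) = (1/2πi) ∮ tr(g⁻¹ V g, ∂(g⁻¹ U g)₊)` (`lieDeriv_reflectedPairing`). The difference of
this expression and the one with `u` and `v` exchanged is `(1/2πi) ∮ tr(g⁻¹ V g, ∂(g⁻¹ U g))`
(`integral_pairing_deriv`), which equals `α^r([u, v]) + i ω_KM(u, v)` because `tr` is invariant.

For the representation property one needs, for every `F` in `C^∞(𝒜)`, that `u ↦ ℒ_u F` is complex
linear and that `[ℒ_u, ℒ_v] = ℒ_{[u, v]}`. Since `𝔤_ℂ = 𝔤 + i𝔤`, every loop is `x + i y` with `x`,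
`y` real, and the derivatives are determined by the flows `e^{-sx} · α` and `e^{-sy} · α`
(`HasLeftDeriv.unique`): comparing real and imaginary `t` gives `ℒ_{x + i y} = ℒ_x + i ℒ_y`, which
leaves real linearity in real loops, a matter of products of flows. For real `X`, `Y`
the action of the commutator `c(s)` of `e^{sX}` and `e^{sY}` is a composition of four flows, and
the second-order expansion of `F` along it has no term of first order, the term of second order
being `[ℒ_X, ℒ_Y] F`. But `τ ↦ c(√τ)` is a `C¹`-curve of velocity `[X, Y]`, so this term is also
`ℒ_{[X, Y]} F` (`lieDeriv_lie`). With the Leibniz rule and the cocycle formula the commutator of the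
operators `ℒ_u + κ α^r(u)` is then a direct computation.
-/

noncomputable section

open Filter Topology Asymptotics ComplexConjugate
open scoped BoundedContinuousFunction

namespace LoopRep

section

/-! ### Bounded holomorphic functions with values in a Banach algebra -/

section Hol

set_option linter.unusedSectionVars false

variable {𝔸 : Type*} [NormedRing 𝔸] [NormedAlgebra ℂ 𝔸]

/-- Extension by zero of a function on a subset of the plane. -/
def zeroExt {Ω : Set ℂ} (f : Ω →ᵇ 𝔸) (z : ℂ) : 𝔸 :=
  open Classical in if h : z ∈ Ω then f ⟨z, h⟩ else 0

theorem zeroExt_of_mem {Ω : Set ℂ} (f : Ω →ᵇ 𝔸) {z : ℂ} (h : z ∈ Ω) :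
    zeroExt f z = f ⟨z, h⟩ := dif_pos h

theorem zeroExt_of_notMem {Ω : Set ℂ} (f : Ω →ᵇ 𝔸) {z : ℂ} (h : z ∉ Ω) :
    zeroExt f z = 0 := dif_neg h

/-- The algebra of bounded holomorphic `𝔸`-valued functions on `Ω`, with the supremum norm. -/
def holAlgebra (Ω : Set ℂ) (𝔸 : Type*) [NormedRing 𝔸] [NormedAlgebra ℂ 𝔸] :
    Subalgebra ℂ (Ω →ᵇ 𝔸) where
  carrier := {f | DifferentiableOn ℂ (zeroExt f) Ω}
  mul_mem' {f g} hf hg := (hf.mul hg).congr fun z hz => by simp [zeroExt_of_mem _ hz]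
  add_mem' {f g} hf hg := (hf.add hg).congr fun z hz => by simp [zeroExt_of_mem _ hz]
  algebraMap_mem' a := (differentiableOn_const (algebraMap ℂ 𝔸 a)).congr
    fun z hz => by simp [zeroExt_of_mem _ hz, Algebra.algebraMap_eq_smul_one]

/-- The type of bounded holomorphic `𝔸`-valued functions on `Ω`. -/
def Hol (Ω : Set ℂ) (𝔸 : Type*) [NormedRing 𝔸] [NormedAlgebra ℂ 𝔸] : Type _ := holAlgebra Ω 𝔸

instance (Ω : Set ℂ) : NormedRing (Hol Ω 𝔸) := inferInstanceAs (NormedRing (holAlgebra Ω 𝔸))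

instance (Ω : Set ℂ) : NormedAlgebra ℂ (Hol Ω 𝔸) :=
  inferInstanceAs (NormedAlgebra ℂ (holAlgebra Ω 𝔸))

namespace Hol

variable {Ω Ω' : Set ℂ}

/-- The values of a bounded holomorphic function (`0` outside of its domain). -/
def ev (f : Hol Ω 𝔸) : ℂ → 𝔸 := zeroExt f.1

theorem differentiableOn (f : Hol Ω 𝔸) : DifferentiableOn ℂ f.ev Ω := f.2

theorem ev_of_notMem (f : Hol Ω 𝔸) {z : ℂ} (h : z ∉ Ω) : f.ev z = 0 := zeroExt_of_notMem _ h

@[simp] theorem ev_add (f g : Hol Ω 𝔸) (z : ℂ) : (f + g).ev z = f.ev z + g.ev z := by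
  by_cases h : z ∈ Ω
  · rw [ev, ev, ev, zeroExt_of_mem _ h, zeroExt_of_mem _ h, zeroExt_of_mem _ h]; rfl
  · simp [ev_of_notMem _ h]

@[simp] theorem ev_sub (f g : Hol Ω 𝔸) (z : ℂ) : (f - g).ev z = f.ev z - g.ev z := by
  by_cases h : z ∈ Ω
  · rw [ev, ev, ev, zeroExt_of_mem _ h, zeroExt_of_mem _ h, zeroExt_of_mem _ h]; rfl
  · simp [ev_of_notMem _ h]

@[simp] theorem ev_neg (f : Hol Ω 𝔸) (z : ℂ) : (-f).ev z = -f.ev z := by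
  by_cases h : z ∈ Ω
  · rw [ev, ev, zeroExt_of_mem _ h, zeroExt_of_mem _ h]; rfl
  · simp [ev_of_notMem _ h]

@[simp] theorem ev_mul (f g : Hol Ω 𝔸) (z : ℂ) : (f * g).ev z = f.ev z * g.ev z := by
  by_cases h : z ∈ Ω
  · rw [ev, ev, ev, zeroExt_of_mem _ h, zeroExt_of_mem _ h, zeroExt_of_mem _ h]; rfl
  · simp [ev_of_notMem _ h]

@[simp] theorem ev_smul (a : ℂ) (f : Hol Ω 𝔸) (z : ℂ) : (a • f).ev z = a • f.ev z := by
  by_cases h : z ∈ Ω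
  · rw [ev, ev, zeroExt_of_mem _ h, zeroExt_of_mem _ h]; rfl
  · simp [ev_of_notMem _ h]

theorem ev_one {z : ℂ} (h : z ∈ Ω) : (1 : Hol Ω 𝔸).ev z = 1 := by
  rw [ev, zeroExt_of_mem _ h]; rfl

theorem norm_ev_le (f : Hol Ω 𝔸) (z : ℂ) : ‖f.ev z‖ ≤ ‖f‖ := by
  by_cases h : z ∈ Ω
  · rw [ev, zeroExt_of_mem _ h]; exact BoundedContinuousFunction.norm_coe_le_norm f.1 _
  · simp [ev_of_notMem _ h]

theorem norm_le (f : Hol Ω 𝔸) {C : ℝ} (hC : 0 ≤ C) (h : ∀ z ∈ Ω, ‖f.ev z‖ ≤ C) : ‖f‖ ≤ C := by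
  refine (BoundedContinuousFunction.norm_le hC).2 fun z => ?_
  simpa [ev, zeroExt_of_mem _ z.2] using h z z.2

theorem ext_ev {f g : Hol Ω 𝔸} (h : ∀ z ∈ Ω, f.ev z = g.ev z) : f = g := by
  refine Subtype.ext (BoundedContinuousFunction.ext fun z => ?_)
  simpa [ev, zeroExt_of_mem _ z.2] using h z z.2

/-- A bounded holomorphic function as an element of `Hol Ω 𝔸`. -/
def mk (f : ℂ → 𝔸) (hf : DifferentiableOn ℂ f Ω) (C : ℝ) (hC : ∀ z ∈ Ω, ‖f z‖ ≤ C) : Hol Ω 𝔸 :=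
  ⟨BoundedContinuousFunction.ofNormedAddCommGroup (fun z : Ω => f z)
    (continuousOn_iff_continuous_domRestrict.1 hf.continuousOn) C fun z => hC z z.2,
    hf.congr fun z hz => by
      rw [zeroExt_of_mem _ hz]; rfl⟩

theorem ev_mk {f : ℂ → 𝔸} (hf : DifferentiableOn ℂ f Ω) {C : ℝ} (hC : ∀ z ∈ Ω, ‖f z‖ ≤ C)
    {z : ℂ} (hz : z ∈ Ω) : (mk f hf C hC).ev z = f z := by
  rw [ev, zeroExt_of_mem _ hz]; rfl

open Classical in
/-- The restriction of `f` to `Ω` as an element of `Hol Ω 𝔸`, for `f` bounded and holomorphic there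
(and `0` for other `f`). -/
def of (Ω : Set ℂ) (f : ℂ → 𝔸) : Hol Ω 𝔸 :=
  if h : DifferentiableOn ℂ f Ω ∧ ∃ C, ∀ z ∈ Ω, ‖f z‖ ≤ C then mk f h.1 h.2.choose h.2.choose_spec
  else 0

theorem ev_of {f : ℂ → 𝔸} (hf : DifferentiableOn ℂ f Ω) {C : ℝ} (hC : ∀ z ∈ Ω, ‖f z‖ ≤ C)
    {z : ℂ} (hz : z ∈ Ω) : (of Ω f).ev z = f z := by
  rw [of, dif_pos ⟨hf, C, hC⟩, ev_mk _ _ hz]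

/-- A function that is holomorphic near a compact set restricts to a bounded holomorphic function
on the subsets of this compact set. -/
theorem ev_of_compact {f : ℂ → 𝔸} {S K : Set ℂ} (hf : DifferentiableOn ℂ f S) (hK : IsCompact K)
    (hKS : K ⊆ S) (hΩ : Ω ⊆ K) {z : ℂ} (hz : z ∈ Ω) : (of Ω f).ev z = f z := by
  obtain ⟨C, hC⟩ := hK.exists_bound_of_continuousOn (hf.continuousOn.mono hKS)
  exact ev_of (hf.mono (hΩ.trans hKS)) (fun w hw => hC w (hΩ hw)) hz

/-- Restriction to a smaller domain. -/
def res (h : Ω' ⊆ Ω) : Hol Ω 𝔸 →L[ℂ] Hol Ω' 𝔸 :=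
  LinearMap.mkContinuous
    { toFun := fun f => mk f.ev (f.differentiableOn.mono h) ‖f‖ fun z _ => f.norm_ev_le z
      map_add' := fun f g => ext_ev fun z hz => by rw [ev_add]; simp only [ev_mk _ _ hz, ev_add]
      map_smul' := fun a f => ext_ev fun z hz => by
        rw [RingHom.id_apply, ev_smul]; simp only [ev_mk _ _ hz, ev_smul] }
    1 fun f => by
      rw [one_mul]
      exact norm_le _ (norm_nonneg _) fun z hz => by
        simpa [ev_mk _ _ hz] using f.norm_ev_le z

theorem ev_res (h : Ω' ⊆ Ω) (f : Hol Ω 𝔸) {z : ℂ} (hz : z ∈ Ω') : (res h f).ev z = f.ev z :=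
  ev_mk (f.differentiableOn.mono h) (fun z _ => f.norm_ev_le z) hz

theorem res_mul (h : Ω' ⊆ Ω) (f g : Hol Ω 𝔸) : res h (f * g) = res h f * res h g :=
  ext_ev fun z hz => by simp only [ev_mul, ev_res h _ hz]

theorem res_one (h : Ω' ⊆ Ω) : res h (1 : Hol Ω 𝔸) = 1 :=
  ext_ev fun z hz => by rw [ev_res h _ hz, ev_one (h hz), ev_one hz]

theorem isUnit_ev {f : Hol Ω 𝔸} (hf : IsUnit f) {z : ℂ} (hz : z ∈ Ω) : IsUnit (f.ev z) := by
  obtain ⟨u, rfl⟩ := hf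
  refine ⟨⟨u.1.ev z, u.2.ev z, ?_, ?_⟩, rfl⟩ <;> rw [← ev_mul] <;> simp [ev_one hz]

theorem ev_inverse {f : Hol Ω 𝔸} (hf : IsUnit f) {z : ℂ} (hz : z ∈ Ω) :
    (Ring.inverse f).ev z = Ring.inverse (f.ev z) := by
  have h := congrArg (fun g => g.ev z) (Ring.mul_inverse_cancel f hf)
  simp only [ev_mul, ev_one hz] at h
  rw [← Ring.inverse_mul_cancel_left (f.ev z) ((Ring.inverse f).ev z) (isUnit_ev hf hz), h, mul_one]

theorem isClosed [CompleteSpace 𝔸] (hΩ : IsOpen Ω) : IsClosed (holAlgebra Ω 𝔸 : Set (Ω →ᵇ 𝔸)) := by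
  refine isClosed_of_closure_subset fun f hf => ?_
  obtain ⟨x, hx, hxf⟩ := mem_closure_iff_seq_limit.1 hf
  have h : TendstoUniformlyOn (fun n => zeroExt (x n)) (zeroExt f) atTop Ω := by
    rw [Metric.tendstoUniformlyOn_iff]
    intro ε hε
    filter_upwards [Metric.tendsto_nhds.1 hxf ε hε] with n hn z hz
    rw [zeroExt_of_mem _ hz, zeroExt_of_mem _ hz, dist_comm]
    exact (BoundedContinuousFunction.dist_coe_le_dist _).trans_lt hn
  exact h.tendstoLocallyUniformlyOn.differentiableOn (Eventually.of_forall hx) hΩ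

theorem completeSpace [CompleteSpace 𝔸] (hΩ : IsOpen Ω) : CompleteSpace (Hol Ω 𝔸) :=
  (isClosed (𝔸 := 𝔸) hΩ).completeSpace_coe

/-- A function on `Ω` with an inverse that is bounded and holomorphic is a unit of `Hol Ω 𝔸`. -/
theorem isUnit_of {f : Hol Ω 𝔸} {g : Hol Ω 𝔸} (h : ∀ z ∈ Ω, f.ev z * g.ev z = 1)
    (h' : ∀ z ∈ Ω, g.ev z * f.ev z = 1) : IsUnit f :=
  ⟨⟨f, g, ext_ev fun z hz => by rw [ev_mul, ev_one hz, h z hz],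
    ext_ev fun z hz => by rw [ev_mul, ev_one hz, h' z hz]⟩, rfl⟩

theorem isUnit_of_norm_sub_one_lt [CompleteSpace 𝔸] {x : 𝔸} (h : ‖x - 1‖ < 1) : IsUnit x := by
  have := (isUnit_one_sub_of_norm_lt_one (x := 1 - x) (by rwa [norm_sub_rev]))
  simpa using this

/-- Convergence in `Hol Ω 𝔸` is uniform convergence. -/
theorem tendsto_of {ι : Type*} {l : Filter ι} {F : ι → Hol Ω 𝔸} {f : Hol Ω 𝔸}
    (h : TendstoUniformlyOn (fun i => (F i).ev) f.ev l Ω) : Tendsto F l (𝓝 f) := by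
  rw [Metric.tendsto_nhds]
  intro ε hε
  filter_upwards [Metric.tendstoUniformlyOn_iff.1 h (ε / 2) (by positivity)] with i hi
  rw [dist_eq_norm]
  refine (norm_le _ (by positivity) fun z hz => ?_).trans_lt (half_lt_self hε)
  rw [ev_sub, ← dist_eq_norm, dist_comm]
  exact (hi z hz).le

theorem tendstoUniformly {ι : Type*} {l : Filter ι} {F : ι → Hol Ω 𝔸} {f : Hol Ω 𝔸}
    (h : Tendsto F l (𝓝 f)) : TendstoUniformly (fun i => (F i).ev) f.ev l := by
  rw [Metric.tendstoUniformly_iff]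
  intro ε hε
  filter_upwards [Metric.tendsto_nhds.1 h ε hε] with i hi z
  rw [dist_comm, dist_eq_norm, ← ev_sub]
  exact (norm_ev_le _ z).trans_lt (by rwa [← dist_eq_norm])

end Hol

end Hol

end

section

/-! ### Laurent splitting on an annulus -/

section Splitting

variable {E : Type*} [NormedAddCommGroup E] [NormedSpace ℂ E]

/-- The open annulus `r < |z| < R`. -/
def ann (r R : ℝ) : Set ℂ := {z | r < ‖z‖ ∧ ‖z‖ < R}

theorem isOpen_ann (r R : ℝ) : IsOpen (ann r R) :=
  (isOpen_lt continuous_const continuous_norm).inter (isOpen_lt continuous_norm continuous_const)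

theorem ann_mono {r R r' R' : ℝ} (h : r ≤ r') (h' : R' ≤ R) : ann r' R' ⊆ ann r R :=
  fun _ hz => ⟨h.trans_lt hz.1, hz.2.trans_le h'⟩

theorem ann_subset_ball (r R : ℝ) : ann r R ⊆ Metric.ball 0 R :=
  fun z hz => by simpa using hz.2

theorem inv_mem_ball {r : ℝ} (hr : 0 < r) {z : ℂ} (hz : r < ‖z‖) : z⁻¹ ∈ Metric.ball (0 : ℂ) r⁻¹ := by
  simpa using inv_strictAnti₀ hr hz

/-- Two holomorphic functions on open sets which agree on the overlap glue. -/
theorem differentiableOn_glue {U W : Set ℂ} (hU : IsOpen U) (hW : IsOpen W) {f g : ℂ → E}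
    [DecidablePred (· ∈ U)] (hf : DifferentiableOn ℂ f U) (hg : DifferentiableOn ℂ g W)
    (h : ∀ z ∈ U, z ∈ W → f z = g z) :
    DifferentiableOn ℂ (fun z => if z ∈ U then f z else g z) (U ∪ W) := by
  rintro z (hz | hz)
  · refine ((hf.differentiableAt (hU.mem_nhds hz)).congr_of_eventuallyEq ?_).differentiableWithinAt
    filter_upwards [hU.mem_nhds hz] with w hw
    rw [if_pos hw]
  · refine ((hg.differentiableAt (hW.mem_nhds hz)).congr_of_eventuallyEq ?_).differentiableWithinAt
    filter_upwards [hW.mem_nhds hz] with w hw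
    split_ifs with hwU
    · exact h w hwU hw
    · rfl

theorem differentiableOn_comp_inv {m : ℂ → E} {r : ℝ} (hr : 0 < r)
    (hm : DifferentiableOn ℂ m (Metric.ball 0 r⁻¹)) :
    DifferentiableOn ℂ (fun z => m z⁻¹) {z | r < ‖z‖} := by
  refine hm.comp (fun z hz => ?_) fun z hz => inv_mem_ball hr hz
  have : z ≠ 0 := norm_pos_iff.1 (hr.trans hz)
  exact (differentiableAt_inv this).differentiableWithinAt

/-- **Liouville's theorem on the Riemann sphere**: a holomorphic function on a disc which extends
holomorphically over the complementary disc around infinity is constant. -/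
theorem liouville_sphere {f m : ℂ → E} {r R : ℝ} (hr : 0 < r) (hR : r < R)
    (hf : DifferentiableOn ℂ f (Metric.ball 0 R)) (hm : DifferentiableOn ℂ m (Metric.ball 0 r⁻¹))
    (h : ∀ z ∈ ann r R, f z = m z⁻¹) :
    (∀ z ∈ Metric.ball (0 : ℂ) R, f z = m 0) ∧ ∀ w ∈ Metric.ball (0 : ℂ) r⁻¹, m w = m 0 := by
  classical
  set F : ℂ → E := fun z => if z ∈ Metric.ball (0 : ℂ) R then f z else m z⁻¹ with hF
  have hFm : ∀ z : ℂ, r < ‖z‖ → F z = m z⁻¹ := fun z hz => by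
    by_cases hz' : z ∈ Metric.ball (0 : ℂ) R
    · rw [hF]; simp only [if_pos hz']
      exact h z ⟨hz, by simpa using hz'⟩
    · rw [hF]; simp only [if_neg hz']
  have hd : Differentiable ℂ F := by
    have := differentiableOn_glue Metric.isOpen_ball
      (isOpen_lt continuous_const continuous_norm) hf (differentiableOn_comp_inv hr hm)
      fun z hz hz' => h z ⟨hz', by simpa using hz⟩
    rw [← differentiableOn_univ]
    convert this using 1
    symm
    rw [Set.eq_univ_iff_forall]
    intro z
    rcases lt_or_ge ‖z‖ R with hz | hz
    · left; simpa using hz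
    · right; exact hR.trans_le hz
  have ht : Tendsto F (cocompact ℂ) (𝓝 (m 0)) := by
    have h0 : Tendsto (fun z : ℂ => m z⁻¹) (cocompact ℂ) (𝓝 (m 0)) := by
      have hc : ContinuousAt m 0 :=
        (hm.differentiableAt (Metric.ball_mem_nhds 0 (inv_pos.2 hr))).continuousAt
      rw [← Metric.cobounded_eq_cocompact]
      exact hc.tendsto.comp tendsto_inv₀_cobounded
    refine h0.congr' ?_
    filter_upwards [(tendsto_norm_cocompact_atTop (E := ℂ)).eventually_gt_atTop r] with z hz
    exact (hFm z hz).symm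
  have hconst := hd.eq_const_of_tendsto_cocompact ht
  refine ⟨fun z hz => ?_, fun w hw => ?_⟩
  · have := congrFun hconst z
    rw [Function.const_apply] at this
    simpa only [hF, if_pos hz] using this
  · by_cases hw0 : w = 0
    · rw [hw0]
    have hw' : r < ‖w⁻¹‖ := by
      rw [norm_inv]
      exact (lt_inv_comm₀ (norm_pos_iff.2 hw0) hr).1 (by simpa using hw)
    have := congrFun hconst w⁻¹
    rwa [hFm _ hw', inv_inv] at this

/-- The substitution `z = 1/w` in a contour integral; it reduces functions holomorphic near `∞` to
Cauchy's theorem on a disc. -/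
theorem circleIntegral_inversion (F : ℂ → E) (R : ℝ) :
    (∮ z in C(0, R), F z) = ∮ w in C(0, R⁻¹), (w ^ 2)⁻¹ • F w⁻¹ := by
  set h : ℝ → E := fun θ => deriv (circleMap 0 R) θ • F (circleMap 0 R θ) with hh
  have hp : Function.Periodic h (2 * Real.pi) := fun θ => by
    simp only [hh, deriv_circleMap, periodic_circleMap 0 R θ]
  have h1 : (∮ w in C(0, R⁻¹), (w ^ 2)⁻¹ • F w⁻¹) = ∫ θ in (0 : ℝ)..2 * Real.pi, h (-θ) := by
    refine intervalIntegral.integral_congr fun θ _ => ?_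
    simp only [hh, deriv_circleMap, smul_smul]
    rw [circleMap_zero_inv, inv_inv, ← inv_pow, circleMap_zero_inv, inv_inv]
    congr 1
    by_cases hR : R = 0
    · simp [hR, circleMap]
    · have hR' : (R : ℂ) ≠ 0 := by exact_mod_cast hR
      simp only [circleMap, zero_add, Complex.ofReal_inv, Complex.ofReal_neg, neg_mul]
      have := Complex.exp_ne_zero ((θ : ℂ) * Complex.I)
      rw [Complex.exp_neg]
      field_simp
  rw [h1, intervalIntegral.integral_comp_neg h]
  have := hp.intervalIntegral_add_eq 0 (-(2 * Real.pi))
  rw [neg_add_cancel, zero_add] at this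
  rw [neg_zero, ← this]
  rfl

variable [CompleteSpace E]

/-- The Cauchy integral of `f` over the circle `|ζ| = s`. -/
def cauchyInt (s : ℝ) (f : ℂ → E) (z : ℂ) : E :=
  (2 * Real.pi * Complex.I : ℂ)⁻¹ • ∮ ζ in C(0, s), (ζ - z)⁻¹ • f ζ

theorem differentiableOn_cauchyInt {s : ℝ} (hs : 0 < s) {f : ℂ → E}
    (hf : ContinuousOn f (Metric.sphere 0 s)) :
    DifferentiableOn ℂ (cauchyInt s f) (Metric.ball 0 s) := by
  lift s to NNReal using hs.le
  have := (hasFPowerSeriesOn_cauchy_integral (hf.circleIntegrable s.2) hs).differentiableOn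
  rw [Metric.eball_coe] at this
  exact this

/-- The Cauchy integral at exterior points, as a function of `w = 1/z`. -/
def cauchyIntExt (s : ℝ) (f : ℂ → E) (w : ℂ) : E :=
  w • cauchyInt s⁻¹ (fun ω => ω⁻¹ • f ω⁻¹) w

theorem differentiableOn_cauchyIntExt {s : ℝ} (hs : 0 < s) {f : ℂ → E}
    (hf : ContinuousOn f (Metric.sphere 0 s)) :
    DifferentiableOn ℂ (cauchyIntExt s f) (Metric.ball 0 s⁻¹) := by
  refine differentiableOn_id.smul (differentiableOn_cauchyInt (inv_pos.2 hs) ?_)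
  have h0 : ∀ z ∈ Metric.sphere (0 : ℂ) s⁻¹, z ≠ 0 := fun z hz h => by
    simp [h, hs.ne'] at hz
    exact hs.ne hz
  have hinv : ContinuousOn (fun z : ℂ => z⁻¹) (Metric.sphere (0 : ℂ) s⁻¹) :=
    continuousOn_id.inv₀ h0
  refine hinv.smul (hf.comp hinv fun z hz => ?_)
  simp only [mem_sphere_iff_norm, sub_zero] at hz ⊢
  rw [norm_inv, hz, inv_inv]

theorem cauchyIntExt_inv {s : ℝ} (hs : 0 < s) (f : ℂ → E) {z : ℂ} (hz : s < ‖z‖) :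
    cauchyIntExt s f z⁻¹ = -cauchyInt s f z := by
  have hz0 : z ≠ 0 := norm_pos_iff.1 (hs.trans hz)
  suffices h : z⁻¹ • (∮ ω in C(0, s⁻¹), (ω - z⁻¹)⁻¹ • ω⁻¹ • f ω⁻¹) =
      (-1 : ℂ) • ∮ w in C(0, s⁻¹), (w ^ 2)⁻¹ • (w⁻¹ - z)⁻¹ • f w⁻¹ by
    rw [cauchyIntExt, cauchyInt, cauchyInt, circleIntegral_inversion _ s, smul_comm, h,
      neg_one_smul, smul_neg]
  rw [← circleIntegral.integral_smul, ← circleIntegral.integral_smul]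
  refine circleIntegral.integral_congr (inv_nonneg.2 hs.le) fun w hw => ?_
  simp only [mem_sphere_iff_norm, sub_zero] at hw
  have hw0 : w ≠ 0 := by
    rintro rfl
    simp only [norm_zero] at hw
    exact (inv_pos.2 hs).ne hw
  have hzw : w * z ≠ 1 := fun h => by
    have := congrArg norm h
    rw [norm_mul, hw, norm_one, inv_mul_eq_one₀ hs.ne'] at this
    exact hz.ne this
  simp only [smul_smul]
  congr 1
  have h1 : w - z⁻¹ = (w * z - 1) / z := by field_simp
  have h2 : w⁻¹ - z = -(w * z - 1) / w := by field_simp; ring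
  have h3 : w * z - 1 ≠ 0 := sub_ne_zero.2 hzw
  rw [h1, h2]
  field_simp

theorem norm_cauchyInt_le {s d M : ℝ} (hs : 0 ≤ s) (hd : 0 < d) {f : ℂ → E} {z : ℂ}
    (hM : ∀ ζ ∈ Metric.sphere (0 : ℂ) s, ‖f ζ‖ ≤ M)
    (h : ∀ ζ ∈ Metric.sphere (0 : ℂ) s, d ≤ ‖ζ - z‖) :
    ‖cauchyInt s f z‖ ≤ s * (d⁻¹ * M) := by
  refine circleIntegral.norm_two_pi_i_inv_smul_integral_le_of_norm_le_const hs fun ζ hζ => ?_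
  rw [norm_smul, norm_inv]
  have := inv_anti₀ hd (h ζ hζ)
  have := hM ζ hζ
  gcongr

theorem circleIntegral_eq_of_ann {f : ℂ → E} {r R s t : ℝ} (hr : 0 ≤ r)
    (hf : DifferentiableOn ℂ f (ann r R)) (hs : s ∈ Set.Ioo r R) (ht : t ∈ Set.Ioo r R) :
    (∮ z in C(0, s), f z) = ∮ z in C(0, t), f z := by
  wlog hst : t ≤ s generalizing s t
  · exact (this ht hs (le_of_not_ge hst)).symm
  refine Complex.circleIntegral_eq_of_differentiable_on_annulus_off_countable (s := ∅)
    (hr.trans_lt ht.1) hst Set.countable_empty (hf.continuousOn.mono ?_) ?_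
  · rintro z ⟨hz, hz'⟩
    simp only [Metric.mem_closedBall, dist_zero_right, Metric.mem_ball, not_lt] at hz hz'
    exact ⟨ht.1.trans_le hz', hz.trans_lt hs.2⟩
  · rintro z ⟨⟨hz, hz'⟩, -⟩
    simp only [Metric.mem_closedBall, dist_zero_right, Metric.mem_ball, not_le] at hz hz'
    exact hf.differentiableAt ((isOpen_ann r R).mem_nhds ⟨ht.1.trans hz', hz.trans hs.2⟩)

/-- Cauchy's formula on an annulus. -/
theorem cauchyInt_sub_cauchyInt {f : ℂ → E} {r R s t : ℝ} (hr : 0 ≤ r)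
    (hf : DifferentiableOn ℂ f (ann r R)) (hs : s ∈ Set.Ioo r R) (ht : t ∈ Set.Ioo r R) {z : ℂ}
    (hz : z ∈ ann s t) : cauchyInt t f z - cauchyInt s f z = f z := by
  have hs0 : 0 < s := hr.trans_lt hs.1
  have ht0 : 0 < t := hr.trans_lt ht.1
  have hza : z ∈ ann r R := ⟨hs.1.trans hz.1, hz.2.trans ht.2⟩
  have hd : DifferentiableOn ℂ (dslope f z) (ann r R) :=
    (Complex.differentiableOn_dslope ((isOpen_ann r R).mem_nhds hza)).2 hf
  have key := circleIntegral_eq_of_ann hr hd ht hs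
  have hfc : ∀ u ∈ Set.Ioo r R, ContinuousOn f (Metric.sphere 0 u) := fun u hu =>
    hf.continuousOn.mono fun w hw => by
      simp only [mem_sphere_iff_norm, sub_zero] at hw
      exact ⟨hw.symm ▸ hu.1, hw.symm ▸ hu.2⟩
  have hne : ∀ u, u ≠ ‖z‖ → ∀ w ∈ Metric.sphere (0 : ℂ) u, w - z ≠ 0 := fun u hu w hw h => by
    simp only [mem_sphere_iff_norm, sub_zero] at hw
    rw [sub_eq_zero.1 h] at hw
    exact hu hw.symm
  have hcalc : ∀ u ∈ Set.Ioo r R, u ≠ ‖z‖ → (∮ w in C(0, u), dslope f z w) =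
      (∮ w in C(0, u), (w - z)⁻¹ • f w) - (∮ w in C(0, u), (w - z)⁻¹) • f z := by
    intro u hu huz
    have hu0 : 0 ≤ u := (hr.trans_lt hu.1).le
    have hi : ContinuousOn (fun w : ℂ => (w - z)⁻¹) (Metric.sphere 0 u) :=
      (continuousOn_id.sub continuousOn_const).inv₀ (hne u huz)
    rw [← circleIntegral.integral_smul_const, ← circleIntegral.integral_sub]
    · refine circleIntegral.integral_congr hu0 fun w hw => ?_
      rw [dslope_of_ne _ (sub_ne_zero.1 (hne u huz w hw)), slope_def_module, smul_sub]
    · exact (hi.smul (hfc u hu)).circleIntegrable hu0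
    · exact (hi.smul continuousOn_const).circleIntegrable hu0
  rw [hcalc t ht hz.2.ne', hcalc s hs hz.1.ne,
    circleIntegral.integral_sub_inv_of_mem_ball (by simpa using hz.2)] at key
  have hzero : (∮ w in C(0, s), (w - z)⁻¹) = 0 := by
    refine Complex.circleIntegral_eq_zero_of_differentiable_on_off_countable hs0.le
      Set.countable_empty (f := fun w => (w - z)⁻¹) ?_ ?_
    · refine (continuousOn_id.sub continuousOn_const).inv₀ fun w hw h => ?_
      simp only [Metric.mem_closedBall, dist_zero_right] at hw
      rw [show w = z from sub_eq_zero.1 h] at hw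
      exact hz.1.not_ge hw
    · rintro w ⟨hw, -⟩
      simp only [Metric.mem_ball, dist_zero_right] at hw
      refine (differentiableAt_id.sub_const z).inv fun h => ?_
      rw [← sub_eq_zero.1 h] at hz
      exact (hz.1.trans hw).false
  rw [hzero, zero_smul, sub_zero] at key
  rw [cauchyInt, cauchyInt, ← smul_sub, ← key, sub_sub_cancel, smul_smul,
    inv_mul_cancel₀ (by simp [Real.pi_ne_zero]), one_smul]

/-- The Laurent splitting of a bounded holomorphic function on an annulus, with an estimate. The
interior part is bounded because near the outer boundary it differs from `f` by the exterior part,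
which is controlled there by a Cauchy integral. -/
theorem exists_splitting {r R : ℝ} (hr : 0 < r) (hR : r < R) :
    ∃ C : ℝ, 0 ≤ C ∧ ∀ (f : ℂ → E) (M : ℝ), DifferentiableOn ℂ f (ann r R) →
      (∀ z ∈ ann r R, ‖f z‖ ≤ M) → ∃ q m : ℂ → E,
        DifferentiableOn ℂ q (Metric.ball 0 R) ∧ q 0 = 0 ∧
        (∀ z ∈ Metric.ball (0 : ℂ) R, ‖q z‖ ≤ C * M) ∧
        DifferentiableOn ℂ m (Metric.ball 0 r⁻¹) ∧ ∀ z ∈ ann r R, f z = q z + m z⁻¹ := by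
  classical
  obtain ⟨c, hrc, hcR⟩ := exists_between hR
  obtain ⟨s, hrs, hsc⟩ := exists_between hrc
  obtain ⟨t, hct, htR⟩ := exists_between hcR
  have hs0 : 0 < s := hr.trans hrs
  have hc0 : 0 < c := hs0.trans hsc
  have ht0 : 0 < t := hc0.trans hct
  have hsm : s ∈ Set.Ioo r R := ⟨hrs, hsc.trans hcR⟩
  have htm : t ∈ Set.Ioo r R := ⟨hrc.trans hct, htR⟩
  have hst : s < t := hsc.trans hct
  have hA : 0 ≤ t * (t - c)⁻¹ := by have := sub_pos.2 hct; positivity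
  have hB : 0 ≤ s * (c - s)⁻¹ := by have := sub_pos.2 hsc; positivity
  refine ⟨2 * (1 + t * (t - c)⁻¹ + s * (c - s)⁻¹), by positivity, fun f M hf hM => ?_⟩
  have hsph : ∀ u ∈ Set.Ioo r R, Metric.sphere (0 : ℂ) u ⊆ ann r R := fun u hu w hw => by
    simp only [mem_sphere_iff_norm, sub_zero] at hw
    exact ⟨hw.symm ▸ hu.1, hw.symm ▸ hu.2⟩
  have hM0 : 0 ≤ M := (norm_nonneg _).trans (hM c (by
    simpa [ann, abs_of_pos hc0] using ⟨hrc, hcR⟩))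
  have hfc : ∀ u ∈ Set.Ioo r R, ContinuousOn f (Metric.sphere 0 u) := fun u hu =>
    hf.continuousOn.mono (hsph u hu)
  have hin := differentiableOn_cauchyInt ht0 (hfc t htm)
  have hout := differentiableOn_cauchyIntExt hs0 (hfc s hsm)
  have hid : ∀ z ∈ ann s t, cauchyInt t f z = f z - cauchyIntExt s f z⁻¹ := fun z hz => by
    rw [cauchyIntExt_inv hs0 f hz.1, ← cauchyInt_sub_cauchyInt hr.le hf hsm htm hz]
    abel
  set q₀ : ℂ → E := fun z =>
    if z ∈ Metric.ball (0 : ℂ) t then cauchyInt t f z else f z - cauchyIntExt s f z⁻¹ with hq₀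
  set m₀ : ℂ → E := fun w =>
    if w ∈ Metric.ball (0 : ℂ) s⁻¹ then cauchyIntExt s f w else f w⁻¹ - cauchyInt t f w⁻¹ with hm₀
  have hq₀d : DifferentiableOn ℂ q₀ (Metric.ball 0 R) := by
    refine (differentiableOn_glue Metric.isOpen_ball (isOpen_ann s R) hin
      ((hf.mono (ann_mono hrs.le le_rfl)).sub
        ((differentiableOn_comp_inv hs0 hout).mono fun z hz => hz.1)) fun z hz hz' => ?_).mono ?_
    · exact hid z ⟨hz'.1, by simpa using hz⟩
    · intro z hz
      rcases lt_or_ge ‖z‖ t with h | h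
      · left; simpa using h
      · right; exact ⟨hst.trans_le h, by simpa using hz⟩
  have hm₀d : DifferentiableOn ℂ m₀ (Metric.ball 0 r⁻¹) := by
    have hmaps : ∀ z ∈ ann t⁻¹ r⁻¹, z⁻¹ ∈ ann r t := fun z hz => by
      have hz0 : 0 < ‖z‖ := (inv_pos.2 ht0).trans hz.1
      refine ⟨?_, ?_⟩ <;> rw [norm_inv]
      · exact (lt_inv_comm₀ hz0 hr).1 hz.2
      · exact (inv_lt_comm₀ ht0 hz0).1 hz.1
    have hinv : DifferentiableOn ℂ (fun z : ℂ => z⁻¹) (ann t⁻¹ r⁻¹) := fun z hz =>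
      (differentiableAt_inv (norm_pos_iff.1 ((inv_pos.2 ht0).trans hz.1))).differentiableWithinAt
    refine (differentiableOn_glue Metric.isOpen_ball (isOpen_ann t⁻¹ r⁻¹) hout
      (((hf.mono (ann_mono le_rfl htR.le)).sub
        (hin.mono (ann_subset_ball r t))).comp hinv hmaps) fun z hz hz' => ?_).mono ?_
    · have hz0 : 0 < ‖z‖ := (inv_pos.2 ht0).trans hz'.1
      have hz1 : ‖z‖ < s⁻¹ := by simpa using hz
      have : z⁻¹ ∈ ann s t := ⟨by rw [norm_inv]; exact (lt_inv_comm₀ hz0 hs0).1 hz1,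
        (hmaps z hz').2⟩
      have := hid _ this
      rw [inv_inv] at this
      simp only [Function.comp, Pi.sub_apply, this, sub_sub_cancel]
    · intro z hz
      rcases lt_or_ge ‖z‖ s⁻¹ with h | h
      · left; simpa using h
      · right; exact ⟨(inv_strictAnti₀ hs0 hst).trans_le h, by simpa using hz⟩
  have hqM : ∀ z ∈ Metric.ball (0 : ℂ) R, ‖q₀ z‖ ≤ (1 + t * (t - c)⁻¹ + s * (c - s)⁻¹) * M := by
    intro z hz
    have hzR : ‖z‖ < R := by simpa using hz
    rcases lt_or_ge ‖z‖ c with h | h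
    · have hzt : z ∈ Metric.ball (0 : ℂ) t := by simpa using h.trans hct
      simp only [hq₀, if_pos hzt]
      refine (norm_cauchyInt_le ht0.le (sub_pos.2 hct) (fun ζ hζ => hM ζ (hsph t htm hζ))
        fun ζ hζ => ?_).trans ?_
      · simp only [mem_sphere_iff_norm, sub_zero] at hζ
        have := norm_sub_norm_le ζ z
        rw [hζ] at this; linarith
      · rw [← mul_assoc]; gcongr; linarith
    · have hsz : s < ‖z‖ := hsc.trans_le h
      have : q₀ z = f z - cauchyIntExt s f z⁻¹ := by
        simp only [hq₀]
        split_ifs with hzt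
        · exact hid z ⟨hsz, by simpa using hzt⟩
        · rfl
      rw [this, cauchyIntExt_inv hs0 f hsz, sub_neg_eq_add]
      refine (norm_add_le _ _).trans ?_
      have h1 := hM z ⟨hrs.trans hsz, hzR⟩
      have h2 := norm_cauchyInt_le (z := z) hs0.le (sub_pos.2 hsc)
        (fun ζ hζ => hM ζ (hsph s hsm hζ)) fun ζ hζ => by
          simp only [mem_sphere_iff_norm, sub_zero] at hζ
          have := norm_sub_norm_le z ζ
          rw [hζ, norm_sub_rev] at this; linarith
      have h3 : 0 ≤ t * (t - c)⁻¹ * M := by positivity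
      nlinarith
  have h0R : (0 : ℂ) ∈ Metric.ball (0 : ℂ) R := by simpa using hr.trans hR
  refine ⟨fun z => q₀ z - q₀ 0, fun w => m₀ w + q₀ 0, hq₀d.sub_const _, sub_self _,
    fun z hz => ?_, hm₀d.add_const _, fun z hz => ?_⟩
  · refine (norm_sub_le _ _).trans ?_
    have := hqM z hz
    have := hqM 0 h0R
    linarith
  · have hz0 : 0 < ‖z‖ := hr.trans hz.1
    have : q₀ z + m₀ z⁻¹ = f z := by
      simp only [hq₀, hm₀, Metric.mem_ball, dist_zero_right, norm_inv, inv_inv]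
      by_cases h1 : ‖z‖ < t
      · by_cases h2 : s < ‖z‖
        · rw [if_pos h1, if_pos (inv_strictAnti₀ hs0 h2), hid z ⟨h2, h1⟩]; abel
        · rw [if_pos h1, if_neg (not_lt.2 (inv_anti₀ hz0 (not_lt.1 h2)))]; abel
      · rw [if_neg h1, if_pos (inv_strictAnti₀ hs0 (hst.trans_le (not_lt.1 h1)))]; abel
    rw [← this, sub_add_add_cancel]

end Splitting

end

section

/-! ### Birkhoff factorisation near the identity -/

section Factorisation

variable {𝔸 : Type*} [NormedRing 𝔸] [NormedAlgebra ℂ 𝔸] [CompleteSpace 𝔸]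

/-- The Laurent decomposition is unique. -/
theorem eq_of_splitting {r R : ℝ} (hr : 0 < r) (hR : r < R) {q q' m m' : ℂ → 𝔸}
    (hq : DifferentiableOn ℂ q (Metric.ball 0 R)) (hq' : DifferentiableOn ℂ q' (Metric.ball 0 R))
    (hm : DifferentiableOn ℂ m (Metric.ball 0 r⁻¹))
    (hm' : DifferentiableOn ℂ m' (Metric.ball 0 r⁻¹)) (h0 : q 0 = q' 0)
    (h : ∀ z ∈ ann r R, q z + m z⁻¹ = q' z + m' z⁻¹) {z : ℂ} (hz : z ∈ Metric.ball (0 : ℂ) R) :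
    q z = q' z := by
  have key := (liouville_sphere hr hR (hq.sub hq') (hm'.sub hm) fun z hz => by
    simp only [Pi.sub_apply]
    rw [sub_eq_sub_iff_add_eq_add, h z hz, add_comm]).1
  have h1 := key z hz
  rw [← key 0 (by simpa using hr.trans hR)] at h1
  simp only [Pi.sub_apply, h0, sub_self] at h1
  exact sub_eq_zero.1 h1

theorem exists_posPart {r R : ℝ} (hr : 0 < r) (hR : r < R) :
    ∃ Q : Hol (ann r R) 𝔸 →L[ℂ] Hol (Metric.ball 0 R) 𝔸, ∀ f, (Q f).ev 0 = 0 ∧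
      ∃ m : ℂ → 𝔸, DifferentiableOn ℂ m (Metric.ball 0 r⁻¹) ∧
        ∀ z ∈ ann r R, f.ev z = (Q f).ev z + m z⁻¹ := by
  obtain ⟨C, -, hC⟩ := exists_splitting (E := 𝔸) hr hR
  have h0R : (0 : ℂ) ∈ Metric.ball (0 : ℂ) R := by simpa using hr.trans hR
  have hex : ∀ f : Hol (ann r R) 𝔸, ∃ q : Hol (Metric.ball 0 R) 𝔸, q.ev 0 = 0 ∧
      ‖q‖ ≤ C * ‖f‖ ∧ ∃ m : ℂ → 𝔸, DifferentiableOn ℂ m (Metric.ball 0 r⁻¹) ∧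
        ∀ z ∈ ann r R, f.ev z = q.ev z + m z⁻¹ := by
    intro f
    obtain ⟨q, m, hq, hq0, hqC, hm, h⟩ := hC f.ev ‖f‖ f.differentiableOn fun z _ => f.norm_ev_le z
    refine ⟨Hol.mk q hq _ hqC, by rw [Hol.ev_mk hq hqC h0R, hq0],
      Hol.norm_le _ ((norm_nonneg _).trans (hqC 0 h0R)) fun z hz => ?_, m, hm, fun z hz => ?_⟩
    · rw [Hol.ev_mk hq hqC hz]; exact hqC z hz
    · rw [Hol.ev_mk hq hqC (ann_subset_ball r R hz), h z hz]
  choose q hq0 hqC m hm h using hex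
  refine ⟨LinearMap.mkContinuous { toFun := q, map_add' := fun f g => ?_, map_smul' := fun a f => ?_ }
    C hqC, fun f => ⟨hq0 f, m f, hm f, h f⟩⟩
  · refine Hol.ext_ev fun z hz => eq_of_splitting hr hR (q (f + g)).differentiableOn
      (q f + q g).differentiableOn (hm (f + g)) ((hm f).add (hm g)) ?_ (fun w hw => ?_) hz
    · simp [hq0]
    · rw [← h _ w hw, Hol.ev_add, Hol.ev_add, h f w hw, h g w hw, Pi.add_apply]; abel
  · refine Hol.ext_ev fun z hz => eq_of_splitting hr hR (q (a • f)).differentiableOn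
      (a • q f).differentiableOn (hm (a • f)) ((hm f).const_smul a) ?_ (fun w hw => ?_) hz
    · simp [hq0]
    · rw [← h _ w hw, Hol.ev_smul, Hol.ev_smul, h f w hw, smul_add, Pi.smul_apply]

open Classical in
/-- The projection of a function on the annulus `r < |z| < R` onto its Fourier modes of positive
degree, which extend over the disc. -/
def posPart (r R : ℝ) : Hol (ann r R) 𝔸 →L[ℂ] Hol (Metric.ball 0 R) 𝔸 :=
  if h : 0 < r ∧ r < R then (exists_posPart h.1 h.2).choose else 0

theorem posPart_ev_zero {r R : ℝ} (hr : 0 < r) (hR : r < R) (f : Hol (ann r R) 𝔸) :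
    (posPart r R f).ev 0 = 0 := by
  rw [posPart, dif_pos ⟨hr, hR⟩]
  exact ((exists_posPart hr hR).choose_spec f).1

theorem exists_ev_eq_posPart_add {r R : ℝ} (hr : 0 < r) (hR : r < R) (f : Hol (ann r R) 𝔸) :
    ∃ m : ℂ → 𝔸, DifferentiableOn ℂ m (Metric.ball 0 r⁻¹) ∧
      ∀ z ∈ ann r R, f.ev z = (posPart r R f).ev z + m z⁻¹ := by
  rw [posPart, dif_pos ⟨hr, hR⟩]
  exact ((exists_posPart hr hR).choose_spec f).2

/-- The restriction of functions on a disc to an annulus. -/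
abbrev toAnn (r R : ℝ) : Hol (Metric.ball 0 R) 𝔸 →L[ℂ] Hol (ann r R) 𝔸 :=
  Hol.res (ann_subset_ball r R)

/-- The linear operator `k ↦ k + (a k)₋`, where `(a k)₋` consists of the modes of degree `≤ 0`. -/
def factorOp (r R : ℝ) (a : Hol (ann r R) 𝔸) : Hol (ann r R) 𝔸 →L[ℂ] Hol (ann r R) 𝔸 :=
  1 + (ContinuousLinearMap.id ℂ _ - toAnn r R ∘L posPart r R) ∘L
    ContinuousLinearMap.mul ℂ (Hol (ann r R) 𝔸) a

/-- The factor `k` of the Birkhoff factorisation `(1 + a) k = p`: it has no modes of positive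
degree. -/
def outerFactor (r R : ℝ) (a : Hol (ann r R) 𝔸) : Hol (ann r R) 𝔸 :=
  Ring.inverse (factorOp r R a) 1

/-- The factor `p` of the Birkhoff factorisation `(1 + a) k = p`: it extends to the disc, with
value `1` at the origin. -/
def innerFactor (r R : ℝ) (a : Hol (ann r R) 𝔸) : Hol (Metric.ball 0 R) 𝔸 :=
  1 + posPart r R (a * outerFactor r R a)

variable {r R : ℝ}

@[simp] theorem factorOp_zero : factorOp r R (0 : Hol (ann r R) 𝔸) = 1 := by
  simp [factorOp]

theorem continuous_factorOp : Continuous (factorOp (𝔸 := 𝔸) r R) :=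
  continuous_const.add (continuous_const.clm_comp (ContinuousLinearMap.mul ℂ _).continuous)

@[simp] theorem outerFactor_zero : outerFactor r R (0 : Hol (ann r R) 𝔸) = 1 := by
  simp [outerFactor]

@[simp] theorem innerFactor_zero : innerFactor r R (0 : Hol (ann r R) 𝔸) = 1 := by
  simp [innerFactor]

theorem completeSpace_clm : CompleteSpace (Hol (ann r R) 𝔸 →L[ℂ] Hol (ann r R) 𝔸) := by
  have := Hol.completeSpace (𝔸 := 𝔸) (isOpen_ann r R)
  infer_instance

theorem eventually_isUnit_factorOp : ∀ᶠ a in 𝓝 (0 : Hol (ann r R) 𝔸), IsUnit (factorOp r R a) := by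
  have := completeSpace_clm (𝔸 := 𝔸) (r := r) (R := R)
  have h := (continuous_factorOp (𝔸 := 𝔸) (r := r) (R := R)).tendsto 0
  rw [factorOp_zero] at h
  exact h.eventually (p := IsUnit) (Units.isOpen.mem_nhds isUnit_one)

theorem continuousAt_outerFactor : ContinuousAt (outerFactor (𝔸 := 𝔸) r R) 0 := by
  have := completeSpace_clm (𝔸 := 𝔸) (r := r) (R := R)
  have h : ContinuousAt (fun a : Hol (ann r R) 𝔸 => Ring.inverse (factorOp r R a)) 0 := by
    refine ContinuousAt.comp (g := Ring.inverse) ?_ continuous_factorOp.continuousAt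
    rw [factorOp_zero]
    exact NormedRing.inverse_continuousAt (1 : (Hol (ann r R) 𝔸 →L[ℂ] Hol (ann r R) 𝔸)ˣ)
  exact h.clm_apply continuousAt_const

theorem tendsto_outerFactor : Tendsto (outerFactor (𝔸 := 𝔸) r R) (𝓝 0) (𝓝 1) := by
  simpa [ContinuousAt] using continuousAt_outerFactor (𝔸 := 𝔸) (r := r) (R := R)

/-- To first order, the inner factor of `1 + a` is `1 + ` the positive modes of `a`. -/
theorem hasFDerivAt_innerFactor :
    HasFDerivAt (innerFactor (𝔸 := 𝔸) r R) (posPart r R) 0 := by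
  have h1 : HasFDerivAt (fun a : Hol (ann r R) 𝔸 => a * outerFactor r R a)
      (ContinuousLinearMap.id ℂ _) 0 := by
    refine HasFDerivAt.of_isLittleO ?_
    have : (fun a : Hol (ann r R) 𝔸 => a * (outerFactor r R a - 1)) =o[𝓝 0] fun a => a := by
      have h0 := tendsto_sub_nhds_zero_iff.2 (tendsto_outerFactor (𝔸 := 𝔸) (r := r) (R := R))
      refine isLittleO_iff.2 fun c hc => ?_
      filter_upwards [Metric.tendsto_nhds.1 h0 c hc] with a ha
      rw [dist_zero_right] at ha
      refine (norm_mul_le _ _).trans ?_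
      rw [mul_comm]
      gcongr
    simpa [mul_sub] using this
  exact ((posPart r R).hasFDerivAt.comp 0 h1).const_add 1

theorem tendsto_innerFactor : Tendsto (innerFactor (𝔸 := 𝔸) r R) (𝓝 0) (𝓝 1) := by
  simpa [ContinuousAt] using (hasFDerivAt_innerFactor (𝔸 := 𝔸) (r := r) (R := R)).continuousAt

theorem innerFactor_ev_zero (hr : 0 < r) (hR : r < R) (a : Hol (ann r R) 𝔸) :
    (innerFactor r R a).ev 0 = 1 := by
  rw [innerFactor, Hol.ev_add, posPart_ev_zero hr hR, add_zero,
    Hol.ev_one (by simpa using hr.trans hR)]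

/-- The Birkhoff factorisation `(1 + a) k = p` for `a` near `0`. -/
theorem mul_outerFactor {a : Hol (ann r R) 𝔸} (ha : IsUnit (factorOp r R a)) {z : ℂ}
    (hz : z ∈ ann r R) :
    (1 + a.ev z) * (outerFactor r R a).ev z = (innerFactor r R a).ev z := by
  have h : factorOp r R a (outerFactor r R a) = 1 := by
    rw [outerFactor, ← mul_apply_eq_comp, Ring.mul_inverse_cancel _ ha,
      one_apply_eq_self]
  have h1 : (1 + a) * outerFactor r R a = toAnn r R (innerFactor r R a) := by
    rw [innerFactor, map_add, toAnn, Hol.res_one, add_mul, one_mul]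
    simp only [factorOp, add_apply, one_apply_eq_self,
      ContinuousLinearMap.comp_apply, sub_apply,
      ContinuousLinearMap.id_apply, ContinuousLinearMap.mul_apply'] at h
    rw [← h]; abel
  have h2 := congrArg (fun f => f.ev z) h1
  simpa [Hol.ev_one hz, Hol.ev_res (ann_subset_ball r R) _ hz] using h2

theorem exists_ext_outerFactor (hr : 0 < r) (hR : r < R) {a : Hol (ann r R) 𝔸}
    (ha : IsUnit (factorOp r R a)) : ∃ m : ℂ → 𝔸, DifferentiableOn ℂ m (Metric.ball 0 r⁻¹) ∧
      ∀ z ∈ ann r R, (outerFactor r R a).ev z = m z⁻¹ := by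
  obtain ⟨m, hm, h⟩ := exists_ev_eq_posPart_add hr hR (a * outerFactor r R a)
  refine ⟨fun w => 1 - m w, (differentiableOn_const 1).sub hm, fun z hz => ?_⟩
  have h1 := mul_outerFactor ha hz
  rw [innerFactor, Hol.ev_add, Hol.ev_one (ann_subset_ball r R hz), add_mul, one_mul,
    ← Hol.ev_mul, h z hz] at h1
  rw [eq_sub_iff_add_eq, ← add_right_cancel_iff (a := (posPart r R (a * outerFactor r R a)).ev z),
    ← h1]
  abel

/-- A holomorphic function on the exterior domain is bounded by its values near the boundary. -/
theorem norm_le_of_norm_le_ann {E : Type*} [NormedAddCommGroup E] [NormedSpace ℂ E] {m : ℂ → E}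
    {s t C : ℝ} (hs : 0 < s) (hst : s < t) (hm : DifferentiableOn ℂ m (Metric.ball 0 t))
    (h : ∀ z ∈ ann s t, ‖m z‖ ≤ C) {z : ℂ} (hz : z ∈ Metric.ball (0 : ℂ) t) : ‖m z‖ ≤ C := by
  rcases lt_or_ge s ‖z‖ with h1 | h1
  · exact h z ⟨h1, by simpa using hz⟩
  obtain ⟨u, hsu, hut⟩ := exists_between hst
  refine Complex.norm_le_of_forall_mem_frontier_norm_le (U := Metric.ball 0 u)
    Metric.isBounded_ball ?_ (fun w hw => ?_) (subset_closure ?_)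
  · refine DifferentiableOn.diffContOnCl (hm.mono ?_)
    rw [closure_ball _ (hs.trans hsu).ne']
    exact Metric.closedBall_subset_ball hut
  · rw [frontier_ball _ (hs.trans hsu).ne'] at hw
    simp only [mem_sphere_iff_norm, sub_zero] at hw
    exact h w ⟨hw.symm ▸ hsu, hw.symm ▸ hut⟩
  · simpa using h1.trans_lt hsu

/-- For `a` near `0`, the outer factor of `1 + a` extends to a function of `1/z` near `1`. -/
theorem eventually_exists_outer (hr : 0 < r) (hR : r < R) {ε : ℝ} (hε : 0 < ε) :
    ∀ᶠ a in 𝓝 (0 : Hol (ann r R) 𝔸), IsUnit (factorOp r R a) ∧ ∃ m : ℂ → 𝔸,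
      DifferentiableOn ℂ m (Metric.ball 0 r⁻¹) ∧
      (∀ z ∈ ann r R, (outerFactor r R a).ev z = m z⁻¹) ∧
      ∀ w ∈ Metric.ball (0 : ℂ) r⁻¹, ‖m w - 1‖ ≤ ε := by
  filter_upwards [eventually_isUnit_factorOp, (tendsto_outerFactor (𝔸 := 𝔸)).eventually
    (Metric.ball_mem_nhds 1 hε)] with a ha hε
  obtain ⟨m, hm, h⟩ := exists_ext_outerFactor hr hR ha
  refine ⟨ha, m, hm, h, fun w hw => ?_⟩
  refine norm_le_of_norm_le_ann (inv_pos.2 (hr.trans hR)) (inv_strictAnti₀ hr hR)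
    (hm.sub_const 1) (fun z hz => ?_) hw
  have hz0 : 0 < ‖z‖ := (inv_pos.2 (hr.trans hR)).trans hz.1
  have hz' : z⁻¹ ∈ ann r R := by
    refine ⟨?_, ?_⟩ <;> rw [norm_inv]
    · exact (lt_inv_comm₀ hz0 hr).1 hz.2
    · exact (inv_lt_comm₀ (hr.trans hR) hz0).1 hz.1
  have h1 := h _ hz'
  rw [inv_inv] at h1
  rw [← h1, ← Hol.ev_one hz', ← Hol.ev_sub]
  refine (Hol.norm_ev_le _ _).trans ?_
  rw [← dist_eq_norm]; exact hε.le

end Factorisation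

end

section

/-! ### Linear differential equations on a disc -/

section LinearODE

variable {W : Type*} [NormedAddCommGroup W] [NormedSpace ℂ W]

theorem hasDerivAt_ray {f : ℂ → W} {f' : W} {z : ℂ} {t : ℝ} (h : HasDerivAt f f' ((t : ℂ) * z)) :
    HasDerivAt (fun s : ℝ => f ((s : ℂ) * z)) (z • f') t := by
  have h1 : HasDerivAt (fun s : ℝ => (s : ℂ) * z) z t := by
    simpa using (Complex.ofRealCLM.hasDerivAt (x := t)).mul_const z
  exact h.scomp t h1

theorem norm_ray_le {z : ℂ} {t r : ℝ} (ht : t ∈ Set.Icc (0 : ℝ) 1) (hz : ‖z‖ ≤ r) :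
    ‖(t : ℂ) * z‖ ≤ r := by
  rw [norm_mul, Complex.norm_real, Real.norm_of_nonneg ht.1]
  exact (mul_le_of_le_one_left (norm_nonneg _) ht.2).trans hz

/-- Grönwall's inequality along the rays of a disc. -/
theorem norm_le_gronwall {f f' : ℂ → W} {r K ε δ : ℝ} (hr : r ≤ 1)
    (hf : ∀ z : ℂ, ‖z‖ ≤ r → HasDerivAt f (f' z) z)
    (h : ∀ z : ℂ, ‖z‖ ≤ r → ‖f' z‖ ≤ K * ‖f z‖ + ε) (h0 : ‖f 0‖ ≤ δ) {z : ℂ} (hz : ‖z‖ ≤ r) :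
    ‖f z‖ ≤ gronwallBound δ K ε 1 := by
  have hd : ∀ t ∈ Set.Icc (0 : ℝ) 1, HasDerivAt (fun s : ℝ => f ((s : ℂ) * z))
      (z • f' ((t : ℂ) * z)) t := fun t ht => hasDerivAt_ray (hf _ (norm_ray_le ht hz))
  have := norm_le_gronwallBound_of_norm_deriv_right_le (f := fun s : ℝ => f ((s : ℂ) * z))
    (f' := fun t : ℝ => z • f' ((t : ℂ) * z)) (δ := δ) (K := K) (ε := ε) (a := 0) (b := 1)
    (fun t ht => (hd t ht).continuousAt.continuousWithinAt)
    (fun t ht => (hd t (Set.Ico_subset_Icc_self ht)).hasDerivWithinAt) (by simpa using h0)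
    (fun t ht => ?_) 1 (by simp)
  · simpa using this
  · rw [norm_smul]
    have h1 := h _ (norm_ray_le (Set.Ico_subset_Icc_self ht) hz)
    exact (mul_le_of_le_one_left (norm_nonneg _) (hz.trans hr)).trans h1

/-- Solutions of a linear differential equation on the disc are determined by their value at `0`. -/
theorem eq_zero_of_linearODE {L : ℂ → W →L[ℂ] W} (hL : ContinuousOn L (Metric.ball 0 1))
    {f : ℂ → W} (hf : ∀ z ∈ Metric.ball (0 : ℂ) 1, HasDerivAt f (L z (f z)) z) (h0 : f 0 = 0)
    {z : ℂ} (hz : z ∈ Metric.ball (0 : ℂ) 1) : f z = 0 := by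
  have hz1 : ‖z‖ < 1 := by simpa using hz
  have hsub : ∀ w : ℂ, ‖w‖ ≤ ‖z‖ → w ∈ Metric.ball (0 : ℂ) 1 := fun w hw => by
    simpa using hw.trans_lt hz1
  obtain ⟨K, hK⟩ := (isCompact_closedBall (0 : ℂ) ‖z‖).exists_bound_of_continuousOn
    (hL.mono fun w hw => hsub w (by simpa using hw))
  have := norm_le_gronwall (f := f) (K := K) (ε := 0) (δ := 0) hz1.le
    (fun w hw => hf w (hsub w hw)) (fun w hw => ?_) (by simp [h0]) le_rfl
  · rw [gronwallBound_ε0_δ0] at this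
    exact norm_le_zero_iff.1 this
  · rw [add_zero]
    exact (L w).le_of_opNorm_le (hK w (by simpa using hw)) _

variable [CompleteSpace W]

/-- Picard iteration for the equation `f' = L f`. -/
theorem exists_picard {L : ℂ → W →L[ℂ] W} (hL : DifferentiableOn ℂ L (Metric.ball 0 1)) (w₀ : W) :
    ∃ y : ℕ → ℂ → W, (∀ z, y 0 z = w₀) ∧ (∀ n, y (n + 1) 0 = 0) ∧
      ∀ n, ∀ z ∈ Metric.ball (0 : ℂ) 1, HasDerivAt (y (n + 1)) (L z (y n z)) z := by
  have step : ∀ f : {f : ℂ → W // DifferentiableOn ℂ f (Metric.ball 0 1)},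
      ∃ g : {g : ℂ → W // DifferentiableOn ℂ g (Metric.ball 0 1)}, g.1 0 = 0 ∧
        ∀ z ∈ Metric.ball (0 : ℂ) 1, HasDerivAt g.1 (L z (f.1 z)) z := by
    rintro ⟨f, hf⟩
    obtain ⟨g, hg0, hg⟩ := ((hL.clm_apply hf).isExactOn_ball).with_val_at 0 0
    exact ⟨⟨g, fun z hz => (hg z hz).differentiableAt.differentiableWithinAt⟩, hg0, hg⟩
  choose s hs0 hs using step
  refine ⟨fun n => (s^[n] ⟨fun _ => w₀, differentiableOn_const w₀⟩).1, fun z => rfl,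
    fun n => ?_, fun n z hz => ?_⟩
  · simp only [Function.iterate_succ_apply']; exact hs0 _
  · simp only [Function.iterate_succ_apply']; exact hs _ z hz

/-- A linear differential equation on the disc with holomorphic coefficients has a solution on the
whole disc. -/
theorem exists_linearODE {L : ℂ → W →L[ℂ] W} (hL : DifferentiableOn ℂ L (Metric.ball 0 1)) (w₀ : W) :
    ∃ f : ℂ → W, f 0 = w₀ ∧ ∀ z ∈ Metric.ball (0 : ℂ) 1, HasDerivAt f (L z (f z)) z := by
  obtain ⟨y, hy0, hyz, hy⟩ := exists_picard hL w₀
  have hyd : ∀ n, DifferentiableOn ℂ (y n) (Metric.ball 0 1) := fun n => by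
    cases n with
    | zero => exact (differentiableOn_const w₀).congr fun z _ => hy0 z
    | succ n => exact fun z hz => (hy n z hz).differentiableAt.differentiableWithinAt
  have hbound : ∀ r < 1, ∀ M : ℝ, (∀ z : ℂ, ‖z‖ ≤ r → ‖L z‖ ≤ M) → ∀ n, ∀ z : ℂ, ‖z‖ ≤ r →
      ‖y n z‖ ≤ ‖w₀‖ * (M * ‖z‖) ^ n / n.factorial := by
    intro r hr M hM n
    induction n with
    | zero => intro z _; simp [hy0]
    | succ n ih =>
      intro z hz
      have hM0 : 0 ≤ M := (norm_nonneg _).trans (hM z hz)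
      have hmem : ∀ t ∈ Set.Icc (0 : ℝ) 1, (t : ℂ) * z ∈ Metric.ball (0 : ℂ) 1 := fun t ht => by
        simpa using (norm_ray_le ht hz).trans_lt hr
      have hd : ∀ t ∈ Set.Icc (0 : ℝ) 1, HasDerivAt (fun s : ℝ => y (n + 1) ((s : ℂ) * z))
          (z • L ((t : ℂ) * z) (y n ((t : ℂ) * z))) t := fun t ht =>
        hasDerivAt_ray (hy n _ (hmem t ht))
      have hB : ∀ t : ℝ, HasDerivAt
          (fun t : ℝ => ‖w₀‖ * (M * (t * ‖z‖)) ^ (n + 1) / (n + 1).factorial)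
          (‖z‖ * (M * (‖w₀‖ * (M * (t * ‖z‖)) ^ n / n.factorial))) t := by
        intro t
        have h1 : HasDerivAt (fun t : ℝ => M * (t * ‖z‖)) (M * (1 * ‖z‖)) t :=
          ((hasDerivAt_id t).mul_const _).const_mul M
        refine (((h1.pow (n + 1)).const_mul ‖w₀‖).div_const ((n + 1).factorial : ℝ)).congr_deriv ?_
        rw [Nat.factorial_succ]
        push_cast
        have : (n.factorial : ℝ) ≠ 0 := by positivity
        field_simp
      have := image_norm_le_of_norm_deriv_right_le_deriv_boundary
        (f := fun s : ℝ => y (n + 1) ((s : ℂ) * z)) (a := 0) (b := 1)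
        (fun t ht => (hd t ht).continuousAt.continuousWithinAt)
        (fun t ht => (hd t (Set.Ico_subset_Icc_self ht)).hasDerivWithinAt)
        (by simp [hyz]) hB (fun t ht => ?_) (Set.right_mem_Icc.2 zero_le_one)
      · simpa using this
      · rw [norm_smul]
        have ht' := Set.Ico_subset_Icc_self ht
        have h1 := ih _ (norm_ray_le ht' hz)
        rw [norm_mul (t : ℂ), Complex.norm_real, Real.norm_of_nonneg ht.1] at h1
        have h2 := (L ((t : ℂ) * z)).le_of_opNorm_le (hM _ (norm_ray_le ht' hz)) (y n (t * z))
        gcongr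
        exact h2.trans (by gcongr)
  have hsum : ∀ r < 1, ∃ u : ℕ → ℝ, Summable u ∧ ∀ n, ∀ z ∈ Metric.ball (0 : ℂ) r,
      ‖y n z‖ ≤ u n := by
    intro r hr
    obtain ⟨M, hM⟩ := (isCompact_closedBall (0 : ℂ) r).exists_bound_of_continuousOn
      (hL.continuousOn.mono (Metric.closedBall_subset_ball hr))
    refine ⟨fun n => ‖w₀‖ * ((M * r) ^ n / n.factorial),
      (Real.summable_pow_div_factorial _).mul_left _, fun n z hz => ?_⟩
    have hz' : ‖z‖ ≤ r := by simpa using (Metric.ball_subset_closedBall hz)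
    have hM0 : 0 ≤ M := (norm_nonneg _).trans (hM z (by simpa using hz'))
    refine (hbound r hr M (fun z hz => hM z (by simpa using hz)) n z hz').trans ?_
    rw [mul_div_assoc]
    refine mul_le_mul_of_nonneg_left (div_le_div_of_nonneg_right (pow_le_pow_left₀
      (by positivity) (mul_le_mul_of_nonneg_left hz' hM0) n) (by positivity)) (norm_nonneg _)
  refine ⟨fun z => ∑' n, y n z, ?_, fun z hz => ?_⟩
  · simp only
    rw [tsum_eq_single 0 fun n hn => ?_, hy0]
    obtain ⟨m, rfl⟩ := Nat.exists_eq_succ_of_ne_zero hn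
    exact hyz m
  · obtain ⟨r, hzr, hr⟩ := exists_between (show ‖z‖ < 1 by simpa using hz)
    obtain ⟨u, hu, hle⟩ := hsum r hr
    have hzr' : z ∈ Metric.ball (0 : ℂ) r := by simpa using hzr
    have hsub := Metric.ball_subset_ball (x := (0 : ℂ)) hr.le
    have hdiff := Complex.differentiableOn_tsum_of_summable_norm hu (fun n => (hyd n).mono hsub)
      Metric.isOpen_ball hle
    have h1 := (hdiff.differentiableAt (Metric.isOpen_ball.mem_nhds hzr')).hasDerivAt
    have h2 := Complex.hasSum_deriv_of_summable_norm hu (fun n => (hyd n).mono hsub)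
      Metric.isOpen_ball hle hzr'
    have hyz' : Summable fun n => y n z := hu.of_norm_bounded fun n => hle n z hzr'
    have h3 : HasSum (fun n => deriv (y (n + 1)) z) (L z (∑' n, y n z)) := by
      have := (L z).hasSum hyz'.hasSum
      refine this.congr_fun fun n => ?_
      exact (hy n z hz).deriv
    have h4 : deriv (y 0) z = 0 := by
      have : y 0 = fun _ => w₀ := funext hy0
      rw [this, deriv_const]
    have h5 := (hasSum_nat_add_iff' 1).2 h2
    rw [Finset.sum_range_one, h4, sub_zero] at h5
    rwa [h5.unique h3] at h1

end LinearODE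

end

section

/-! ### Frames of holomorphic forms -/

section Inverse

variable {𝕜 𝔸 : Type*} [NontriviallyNormedField 𝕜] [NormedRing 𝔸] [NormedAlgebra 𝕜 𝔸]
  [CompleteSpace 𝔸]

theorem hasDerivAt_inverse {f : 𝕜 → 𝔸} {f' : 𝔸} {z : 𝕜} (hf : HasDerivAt f f' z)
    (hu : IsUnit (f z)) : HasDerivAt (fun w => Ring.inverse (f w))
      (-(Ring.inverse (f z) * f' * Ring.inverse (f z))) z := by
  obtain ⟨u, hu⟩ := hu
  have h := hasFDerivAt_ringInverse (𝕜 := 𝕜) u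
  rw [hu] at h
  have h1 : Ring.inverse (f z) = ↑u⁻¹ := by rw [← hu, Ring.inverse_unit]
  rw [h1]
  exact (h.comp_hasDerivAt z hf).congr_deriv (by simp)

theorem differentiableOn_inverse {f : 𝕜 → 𝔸} {s : Set 𝕜} (hf : DifferentiableOn 𝕜 f s)
    (hu : ∀ z ∈ s, IsUnit (f z)) : DifferentiableOn 𝕜 (fun w => Ring.inverse (f w)) s :=
  fun z hz => (differentiableAt_inverse (𝕜 := 𝕜) (hu z hz)).comp_differentiableWithinAt z (hf z hz)

end Inverse

variable {V : Type*} [NormedAddCommGroup V] [InnerProductSpace ℂ V] [CompleteSpace V]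
  {G : Subgroup (unitary (Mat V))}

/-- A holomorphic function on the disc that represents a form. -/
def formFun (α : Forms G) : ℂ → Mat V := α.2.2.choose

theorem formFun_differentiableOn (α : Forms G) :
    DifferentiableOn ℂ (formFun α) (Metric.ball 0 1) := α.2.2.choose_spec.1

theorem formFun_eq (α : Forms G) (z : Metric.ball (0 : ℂ) 1) : formFun α z = α.1 z :=
  α.2.2.choose_spec.2 z

theorem formFun_mem (α : Forms G) {z : ℂ} (hz : z ∈ Metric.ball (0 : ℂ) 1) :
    formFun α z ∈ complexLie G := by
  rw [formFun_eq α ⟨z, hz⟩]; exact α.2.1 _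

theorem forms_ext {α β : Forms G} (h : ∀ z ∈ Metric.ball (0 : ℂ) 1, formFun α z = formFun β z) :
    α = β :=
  Subtype.ext (ContinuousMap.ext fun z => by rw [← formFun_eq, ← formFun_eq, h z z.2])

/-- The topology of the space of forms is that of locally uniform convergence. -/
theorem tendsto_forms_iff {ι : Type*} {l : Filter ι} {a : ι → Forms G} {α : Forms G} :
    Tendsto a l (𝓝 α) ↔ ∀ r < 1, TendstoUniformlyOn (fun i => formFun (a i)) (formFun α) l
      (Metric.closedBall 0 r) := by
  have h0 : Tendsto a l (𝓝 α) ↔ Tendsto (fun i => (a i).1) l (𝓝 α.1) :=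
    tendsto_subtype_rng
  rw [h0, ContinuousMap.tendsto_iff_forall_isCompact_tendstoUniformlyOn]
  constructor
  · intro h r hr
    have hsub := Metric.closedBall_subset_ball (x := (0 : ℂ)) hr
    have hK : IsCompact ((↑) ⁻¹' Metric.closedBall (0 : ℂ) r : Set (Metric.ball (0 : ℂ) 1)) := by
      refine (Topology.IsInducing.subtypeVal.isCompact_preimage_iff ?_).2 (isCompact_closedBall 0 r)
      rwa [Subtype.range_coe]
    have := h _ hK
    rw [Metric.tendstoUniformlyOn_iff] at this ⊢
    intro ε hε
    filter_upwards [this ε hε] with i hi z hz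
    have := hi ⟨z, hsub hz⟩ hz
    rwa [← formFun_eq, ← formFun_eq] at this
  · intro h K hK
    obtain ⟨r, hr, hKr⟩ : ∃ r < 1, ∀ z ∈ K, ‖(z : ℂ)‖ ≤ r := by
      rcases K.eq_empty_or_nonempty with rfl | hne
      · exact ⟨0, one_pos, by simp⟩
      obtain ⟨z, hz, hmax⟩ := hK.exists_isMaxOn hne
        (f := fun z : Metric.ball (0 : ℂ) 1 => ‖(z : ℂ)‖) (by fun_prop)
      exact ⟨‖(z : ℂ)‖, mem_ball_zero_iff.1 z.2, fun w hw => hmax hw⟩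
    have := h r hr
    rw [Metric.tendstoUniformlyOn_iff] at this ⊢
    intro ε hε
    filter_upwards [this ε hε] with i hi z hz
    rw [← formFun_eq, ← formFun_eq]
    exact hi z (by simpa using hKr z hz)

/-- Right multiplication by the form, the operator of the equation `∂g = g α`. -/
def rightMul (α : Forms G) (z : ℂ) : Mat V →L[ℂ] Mat V :=
  (ContinuousLinearMap.mul ℂ (Mat V)).flip (formFun α z)

theorem rightMul_differentiableOn (α : Forms G) :
    DifferentiableOn ℂ (rightMul α) (Metric.ball 0 1) :=
  (ContinuousLinearMap.mul ℂ (Mat V)).flip.differentiable.comp_differentiableOn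
    (formFun_differentiableOn α)

/-- The equation of a frame, in terms of derivatives. -/
theorem isFrame_iff {α : Forms G} {g : ℂ → Mat V} : IsFrame α g ↔ g 0 = 1 ∧
    ∀ z ∈ Metric.ball (0 : ℂ) 1, IsUnit (g z) ∧ HasDerivAt g (g z * formFun α z) z := by
  constructor
  · rintro ⟨hd, h0, h⟩
    refine ⟨h0, fun z hz => ⟨(h ⟨z, hz⟩).1, ?_⟩⟩
    have h1 := (hd.differentiableAt (Metric.isOpen_ball.mem_nhds hz)).hasDerivAt
    rwa [formFun_eq α ⟨z, hz⟩, ← (h ⟨z, hz⟩).2, Ring.mul_inverse_cancel_left _ _ (h ⟨z, hz⟩).1]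
  · rintro ⟨h0, h⟩
    refine ⟨fun z hz => (h z hz).2.differentiableAt.differentiableWithinAt, h0,
      fun z => ⟨(h z z.2).1, ?_⟩⟩
    rw [(h z z.2).2.deriv, Ring.inverse_mul_cancel_left _ _ (h z z.2).1, formFun_eq]

theorem exists_isFrame (α : Forms G) : ∃ g, IsFrame α g := by
  have hL : DifferentiableOn ℂ (fun z => -ContinuousLinearMap.mul ℂ (Mat V) (formFun α z))
      (Metric.ball 0 1) :=
    ((ContinuousLinearMap.mul ℂ (Mat V)).differentiable.comp_differentiableOn
      (formFun_differentiableOn α)).neg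
  obtain ⟨g, hg0, hg⟩ := exists_linearODE (rightMul_differentiableOn α) 1
  obtain ⟨h, hh0, hh⟩ := exists_linearODE hL 1
  have hg' : ∀ z ∈ Metric.ball (0 : ℂ) 1, HasDerivAt g (g z * formFun α z) z := hg
  have hh' : ∀ z ∈ Metric.ball (0 : ℂ) 1, HasDerivAt h (-(formFun α z * h z)) z := hh
  have h1 : ∀ z ∈ Metric.ball (0 : ℂ) 1, g z * h z = 1 := by
    intro z hz
    have := eq_zero_of_linearODE (L := fun _ => (0 : Mat V →L[ℂ] Mat V))
      (f := fun z => g z * h z - 1) continuousOn_const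
      (fun w hw => (((hg' w hw).mul (hh' w hw)).sub_const 1).congr_deriv (by
        simp [mul_assoc])) (by simp [hg0, hh0]) hz
    exact sub_eq_zero.1 this
  have h2 : ∀ z ∈ Metric.ball (0 : ℂ) 1, h z * g z = 1 := by
    intro z hz
    have := eq_zero_of_linearODE (L := fun z => rightMul α z -
      ContinuousLinearMap.mul ℂ (Mat V) (formFun α z)) (f := fun z => h z * g z - 1)
      ((rightMul_differentiableOn α).continuousOn.sub (hL.neg.continuousOn.congr fun w _ => by simp))
      (fun w hw => (((hh' w hw).mul (hg' w hw)).sub_const 1).congr_deriv (by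
        simp only [rightMul, sub_apply, ContinuousLinearMap.flip_apply,
          ContinuousLinearMap.mul_apply']
        noncomm_ring)) (by simp [hg0, hh0]) hz
    exact sub_eq_zero.1 this
  exact ⟨g, isFrame_iff.2 ⟨hg0, fun z hz => ⟨⟨⟨g z, h z, h1 z hz, h2 z hz⟩, rfl⟩, hg' z hz⟩⟩⟩

theorem isFrame_frame (α : Forms G) : IsFrame α (frame α) :=
  Classical.epsilon_spec (exists_isFrame α)

theorem frame_zero (α : Forms G) : frame α 0 = 1 := (isFrame_frame α).2.1

theorem differentiableOn_frame (α : Forms G) : DifferentiableOn ℂ (frame α) (Metric.ball 0 1) :=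
  (isFrame_frame α).1

theorem isUnit_frame (α : Forms G) {z : ℂ} (hz : z ∈ Metric.ball (0 : ℂ) 1) :
    IsUnit (frame α z) := ((isFrame_frame α).2.2 ⟨z, hz⟩).1

theorem hasDerivAt_frame (α : Forms G) {z : ℂ} (hz : z ∈ Metric.ball (0 : ℂ) 1) :
    HasDerivAt (frame α) (frame α z * formFun α z) z :=
  ((isFrame_iff.1 (isFrame_frame α)).2 z hz).2

theorem eqOn_frame {α : Forms G} {g : ℂ → Mat V} (hg : IsFrame α g) {z : ℂ}
    (hz : z ∈ Metric.ball (0 : ℂ) 1) : frame α z = g z := by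
  rw [isFrame_iff] at hg
  refine sub_eq_zero.1 (eq_zero_of_linearODE (f := fun z => frame α z - g z)
    (rightMul_differentiableOn α).continuousOn (fun w hw =>
      ((hasDerivAt_frame α hw).sub (hg.2 w hw).2).congr_deriv ?_)
    (by simp [frame_zero, hg.1]) hz)
  simp [rightMul, sub_mul]

theorem formFun_eq_of_frame (α : Forms G) {z : ℂ} (hz : z ∈ Metric.ball (0 : ℂ) 1) :
    formFun α z = Ring.inverse (frame α z) * deriv (frame α) z := by
  rw [formFun_eq α ⟨z, hz⟩, ((isFrame_frame α).2.2 ⟨z, hz⟩).2]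

theorem eq_of_frame_eq {α β : Forms G} (h : ∀ z ∈ Metric.ball (0 : ℂ) 1, frame α z = frame β z) :
    α = β := by
  refine forms_ext fun z hz => ?_
  have : frame α =ᶠ[𝓝 z] frame β := by
    filter_upwards [Metric.isOpen_ball.mem_nhds hz] with w hw using h w hw
  rw [formFun_eq_of_frame α hz, formFun_eq_of_frame β hz, h z hz, this.deriv_eq]

/-- A holomorphic map to the general linear group with logarithmic derivative in `𝔤_ℂ` is a
frame. -/
theorem exists_frame_eq {g : ℂ → Mat V} (hg : DifferentiableOn ℂ g (Metric.ball 0 1)) (h0 : g 0 = 1)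
    (hu : ∀ z ∈ Metric.ball (0 : ℂ) 1, IsUnit (g z))
    (hmem : ∀ z ∈ Metric.ball (0 : ℂ) 1, Ring.inverse (g z) * deriv g z ∈ complexLie G) :
    ∃ β : Forms G, ∀ z ∈ Metric.ball (0 : ℂ) 1, frame β z = g z := by
  have hd : DifferentiableOn ℂ (fun z => Ring.inverse (g z) * deriv g z) (Metric.ball 0 1) :=
    (differentiableOn_inverse hg hu).mul (hg.deriv Metric.isOpen_ball)
  let β : Forms G := ⟨⟨fun z => Ring.inverse (g z) * deriv g z,
    continuousOn_iff_continuous_domRestrict.1 hd.continuousOn⟩, fun z => hmem z z.2, _, hd,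
    fun z => rfl⟩
  exact ⟨β, fun z hz => eqOn_frame ⟨hg, h0, fun z => ⟨hu z z.2, rfl⟩⟩ hz⟩

theorem tendsto_gronwallBound (K C : ℝ) :
    Tendsto (fun e : ℝ => gronwallBound 0 K (C * e) 1) (𝓝[>] 0) (𝓝 0) := by
  have h1 : Continuous fun e : ℝ => gronwallBound 0 K (C * e) 1 :=
    (gronwallBound_continuous_ε 0 K 1).comp (continuous_const.mul continuous_id)
  have h2 := h1.tendsto 0
  simp only [mul_zero, gronwallBound_ε0_δ0] at h2
  exact h2.mono_left nhdsWithin_le_nhds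

/-- Frames depend continuously on the form: Grönwall's inequality along rays for `∂g = g α`. -/
theorem norm_frame_sub_le {α β : Forms G} {r C K e : ℝ} (hr : r < 1)
    (hC : ∀ z : ℂ, ‖z‖ ≤ r → ‖frame α z‖ ≤ C) (hK : ∀ z : ℂ, ‖z‖ ≤ r → ‖formFun β z‖ ≤ K)
    (he : ∀ z : ℂ, ‖z‖ ≤ r → ‖formFun β z - formFun α z‖ ≤ e) {z : ℂ} (hz : ‖z‖ ≤ r) :
    ‖frame β z - frame α z‖ ≤ gronwallBound 0 K (C * e) 1 := by
  have hmem : ∀ z : ℂ, ‖z‖ ≤ r → z ∈ Metric.ball (0 : ℂ) 1 := fun z hz => by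
    simpa using hz.trans_lt hr
  have hd : ∀ w : ℂ, ‖w‖ ≤ r → HasDerivAt (fun z => frame β z - frame α z)
      (frame β w * formFun β w - frame α w * formFun α w) w := fun w hw =>
    (hasDerivAt_frame β (hmem w hw)).sub (hasDerivAt_frame α (hmem w hw))
  have hb : ∀ w : ℂ, ‖w‖ ≤ r → ‖frame β w * formFun β w - frame α w * formFun α w‖ ≤
      K * ‖frame β w - frame α w‖ + C * e := by
    intro w hw
    have h3 : frame β w * formFun β w - frame α w * formFun α w =
        (frame β w - frame α w) * formFun β w + frame α w * (formFun β w - formFun α w) := by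
      rw [sub_mul, mul_sub]; abel
    have hC0 : 0 ≤ C := (norm_nonneg _).trans (hC w hw)
    rw [h3]
    refine (norm_add_le _ _).trans (add_le_add ((norm_mul_le _ _).trans ?_)
      ((norm_mul_le _ _).trans ?_))
    · rw [mul_comm]
      exact mul_le_mul_of_nonneg_right (hK w hw) (norm_nonneg _)
    · exact mul_le_mul (hC w hw) (he w hw) (norm_nonneg _) hC0
  have h0 : ‖frame β 0 - frame α 0‖ ≤ 0 := by rw [frame_zero, frame_zero, sub_self, norm_zero]
  exact norm_le_gronwall hr.le hd hb h0 hz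

/-- The frame depends continuously on the form. -/
theorem tendstoUniformlyOn_frame {ι : Type*} {l : Filter ι} {a : ι → Forms G} {α : Forms G}
    (h : Tendsto a l (𝓝 α)) {r : ℝ} (hr : r < 1) :
    TendstoUniformlyOn (fun i => frame (a i)) (frame α) l (Metric.closedBall 0 r) := by
  have hsub := Metric.closedBall_subset_ball (x := (0 : ℂ)) hr
  obtain ⟨C, hC⟩ := (isCompact_closedBall (0 : ℂ) r).exists_bound_of_continuousOn
    ((differentiableOn_frame α).continuousOn.mono hsub)
  obtain ⟨K, hK⟩ := (isCompact_closedBall (0 : ℂ) r).exists_bound_of_continuousOn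
    ((formFun_differentiableOn α).continuousOn.mono hsub)
  have h' := tendsto_forms_iff.1 h r hr
  rw [Metric.tendstoUniformlyOn_iff] at h' ⊢
  intro ε hε
  obtain ⟨e, ⟨he, he1⟩, he0⟩ := (((tendsto_gronwallBound (K + 1) C).eventually_lt_const hε).and
    ((eventually_lt_nhds one_pos).filter_mono nhdsWithin_le_nhds)).and
    self_mem_nhdsWithin |>.exists
  filter_upwards [h' e he0] with i hi z hz
  have hmem' : ∀ z : ℂ, ‖z‖ ≤ r → z ∈ Metric.closedBall (0 : ℂ) r := fun z hz => by simpa using hz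
  have hi' : ∀ w : ℂ, ‖w‖ ≤ r → ‖formFun (a i) w - formFun α w‖ ≤ e := fun w hw => by
    rw [← dist_eq_norm, dist_comm]; exact (hi w (hmem' w hw)).le
  rw [dist_comm, dist_eq_norm]
  refine (norm_frame_sub_le hr (fun w hw => hC w (hmem' w hw)) (fun w hw => ?_) hi'
    (by simpa using hz)).trans_lt he
  have := norm_le_norm_add_norm_sub' (formFun (a i) w) (formFun α w)
  have := hK w (hmem' w hw)
  have := hi' w hw
  linarith

/-- The frame of a form on a disc of radius `r < 1`. -/
def frameOn (r : ℝ) (α : Forms G) : Hol (Metric.ball 0 r) (Mat V) := Hol.of _ (frame α)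

theorem ev_frameOn {r : ℝ} (hr : r < 1) (α : Forms G) {z : ℂ} (hz : z ∈ Metric.ball (0 : ℂ) r) :
    (frameOn r α).ev z = frame α z :=
  Hol.ev_of_compact (differentiableOn_frame α) (isCompact_closedBall 0 r)
    (Metric.closedBall_subset_ball hr) Metric.ball_subset_closedBall hz

theorem isUnit_frameOn {r : ℝ} (hr : r < 1) (α : Forms G) : IsUnit (frameOn r α) := by
  have hsub := Metric.ball_subset_ball (x := (0 : ℂ)) hr.le
  have hinv : ∀ z ∈ Metric.ball (0 : ℂ) r,
      (Hol.of (Metric.ball 0 r) fun z => Ring.inverse (frame α z)).ev z =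
        Ring.inverse (frame α z) := fun z hz =>
    Hol.ev_of_compact (differentiableOn_inverse (differentiableOn_frame α)
      fun z hz => isUnit_frame α hz) (isCompact_closedBall 0 r)
      (Metric.closedBall_subset_ball hr) Metric.ball_subset_closedBall hz
  refine Hol.isUnit_of (g := Hol.of _ fun z => Ring.inverse (frame α z)) ?_ ?_ <;>
  · intro z hz
    rw [ev_frameOn hr α hz, hinv z hz]
    simp [Ring.mul_inverse_cancel _ (isUnit_frame α (hsub hz)),
      Ring.inverse_mul_cancel _ (isUnit_frame α (hsub hz))]

theorem continuous_frameOn {r : ℝ} (hr : r < 1) : Continuous (frameOn r : Forms G → _) := by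
  refine continuous_iff_continuousAt.2 fun α => Hol.tendsto_of ?_
  have := (tendstoUniformlyOn_frame (tendsto_id (x := 𝓝 α)) hr).mono Metric.ball_subset_closedBall
  refine (this.congr (Eventually.of_forall fun β z hz => ?_)).congr_right fun z hz => ?_
  · exact (ev_frameOn hr β hz).symm
  · exact (ev_frameOn hr α hz).symm

/-! ### The subalgebra `𝔤_ℂ` and its stabiliser -/

variable [FiniteDimensional ℂ V]

section LieSub

attribute [local instance 100] LieRing.ofAssociativeRing

theorem lie_mem_complexLie {X Y : Mat V} (hX : X ∈ complexLie G) (hY : Y ∈ complexLie G) :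
    X * Y - Y * X ∈ complexLie G := (complexLie G).lie_mem hX hY

variable (G) in
/-- `𝔤_ℂ` as a linear subspace. -/
def lieSub : Submodule ℂ (Mat V) := (complexLie G).toSubmodule

theorem mem_lieSub {X : Mat V} : X ∈ lieSub G ↔ X ∈ complexLie G := Iff.rfl

end LieSub

variable (G) in
theorem exists_projection : ∃ S : Mat V →L[ℂ] Mat V, (∀ X, S X ∈ complexLie G) ∧
    ∀ X ∈ complexLie G, S X = X := by
  obtain ⟨C, hC⟩ := (lieSub G).exists_isCompl
  exact ⟨LinearMap.toContinuousLinearMap ((lieSub G).projection C hC),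
    fun X => Submodule.projection_apply_mem hC X,
    fun X hX => Submodule.projection_apply_left hC ⟨X, hX⟩⟩

variable (G) in
/-- A linear projection of `gl(V)` onto `𝔤_ℂ`. -/
def lieProj : Mat V →L[ℂ] Mat V := (exists_projection G).choose

theorem lieProj_mem (X : Mat V) : lieProj G X ∈ complexLie G :=
  (exists_projection G).choose_spec.1 X

theorem lieProj_of_mem {X : Mat V} (hX : X ∈ complexLie G) : lieProj G X = X :=
  (exists_projection G).choose_spec.2 X hX

theorem mem_of_lieProj_eq {X : Mat V} (hX : X - lieProj G X = 0) : X ∈ complexLie G := by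
  rw [sub_eq_zero.1 hX]; exact lieProj_mem X

variable (G) in
/-- The defect of `g` to normalise `𝔤_ℂ`: the map `X ↦ g X g⁻¹` on `𝔤_ℂ`, modulo `𝔤_ℂ`. -/
def adDefect (g h : Mat V) : Mat V →L[ℂ] Mat V :=
  (1 - lieProj G) ∘L (ContinuousLinearMap.mul ℂ (Mat V) g) ∘L
    ((ContinuousLinearMap.mul ℂ (Mat V)).flip h) ∘L lieProj G

theorem adDefect_apply (g h X : Mat V) : adDefect G g h X =
    g * (lieProj G X * h) - lieProj G (g * (lieProj G X * h)) := rfl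

/-- Frames normalise `𝔤_ℂ`. -/
theorem frame_conj_mem (α : Forms G) {z : ℂ} (hz : z ∈ Metric.ball (0 : ℂ) 1) {X : Mat V}
    (hX : X ∈ complexLie G) : frame α z * X * Ring.inverse (frame α z) ∈ complexLie G := by
  set M := ContinuousLinearMap.mul ℂ (Mat V) with hM
  -- `z ↦ adDefect (g z) (g z)⁻¹` solves the linear equation `f' = f ∘ ad α`
  let L : ℂ → (Mat V →L[ℂ] Mat V) →L[ℂ] (Mat V →L[ℂ] Mat V) := fun z =>
    (ContinuousLinearMap.compL ℂ (Mat V) (Mat V) (Mat V)).flip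
      ((M (formFun α z) - M.flip (formFun α z)) ∘L lieProj G)
  have hL : ContinuousOn L (Metric.ball 0 1) := by
    have hc := (formFun_differentiableOn α).continuousOn
    refine (ContinuousLinearMap.continuous _).comp_continuousOn
      (ContinuousOn.clm_comp (ContinuousOn.sub ?_ ?_) continuousOn_const)
    · exact M.continuous.comp_continuousOn hc
    · exact M.flip.continuous.comp_continuousOn hc
  have key := eq_zero_of_linearODE hL
    (f := fun z => adDefect G (frame α z) (Ring.inverse (frame α z))) (fun w hw => ?_) ?_ hz
  · have h1 := congrArg (fun T => T X) key
    simp only [adDefect_apply, lieProj_of_mem hX, zero_apply] at h1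
    have := mem_of_lieProj_eq h1
    rwa [← mul_assoc] at this
  · have hu := isUnit_frame α hw
    have hg := hasDerivAt_frame α hw
    have hi := hasDerivAt_inverse hg hu
    have h1 : HasDerivAt (fun z => M (frame α z)) (M (frame α w * formFun α w)) w :=
      M.hasFDerivAt.comp_hasDerivAt w hg
    have h2 := M.flip.hasFDerivAt.comp_hasDerivAt w hi
    have h3 := (hasDerivAt_const w (1 - lieProj G)).clm_comp
      (h1.clm_comp (h2.clm_comp (hasDerivAt_const w (lieProj G))))
    refine h3.congr_deriv ?_
    ext1 Y
    have hmem := lie_mem_complexLie (formFun_mem α hw) (lieProj_mem (G := G) Y)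
    have : L w (adDefect G (frame α w) (Ring.inverse (frame α w))) Y =
        adDefect G (frame α w) (Ring.inverse (frame α w))
          (formFun α w * lieProj G Y - lieProj G Y * formFun α w) := by
      simp [L, hM]
    rw [this, adDefect_apply, lieProj_of_mem hmem]
    simp [hM]
    rw [Ring.inverse_mul_cancel_left _ _ hu]
    have e : frame α w * ((formFun α w * lieProj G Y - lieProj G Y * formFun α w) *
          Ring.inverse (frame α w)) =
        frame α w * formFun α w * (lieProj G Y * Ring.inverse (frame α w)) -
          frame α w * (lieProj G Y * (formFun α w * Ring.inverse (frame α w))) := by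
      noncomm_ring
    rw [e, map_sub]
    abel
  · ext1 Y
    simp [adDefect_apply, frame_zero, lieProj_of_mem (lieProj_mem Y)]

end

section

/-! ### The left action: uniqueness, composition and construction of frames -/

section Outer

variable {𝔸 : Type*} [NormedRing 𝔸] [NormedAlgebra ℂ 𝔸] [CompleteSpace 𝔸]

theorem isUnit_of_norm_sub_one_le_half {x : 𝔸} (h : ‖x - 1‖ ≤ 1 / 2) : IsUnit x :=
  Hol.isUnit_of_norm_sub_one_lt (h.trans_lt (by norm_num))

theorem isUnit_inverse {x : 𝔸} (h : IsUnit x) : IsUnit (Ring.inverse x) := by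
  obtain ⟨u, rfl⟩ := h
  rw [Ring.inverse_unit]; exact u⁻¹.isUnit

theorem inverse_inverse {x : 𝔸} (h : IsUnit x) : Ring.inverse (Ring.inverse x) = x := by
  obtain ⟨u, rfl⟩ := h
  rw [Ring.inverse_unit, Ring.inverse_unit, inv_inv]

theorem inverse_mul {x y : 𝔸} (hx : IsUnit x) (hy : IsUnit y) :
    Ring.inverse (x * y) = Ring.inverse y * Ring.inverse x := by
  obtain ⟨u, rfl⟩ := hx
  obtain ⟨v, rfl⟩ := hy
  rw [← Units.val_mul, Ring.inverse_unit, Ring.inverse_unit, Ring.inverse_unit, mul_inv_rev,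
    Units.val_mul]

theorem eq_of_inverse_mul_eq_one {x y : 𝔸} (hx : IsUnit x) (h : Ring.inverse x * y = 1) :
    y = x := by
  rw [← Ring.mul_inverse_cancel_left x y hx, h, mul_one]

/-- Uniqueness in the Birkhoff factorisation: `g₁ k₁ = g₂ k₂` on an annulus, with `gᵢ` holomorphic
and invertible on the disc and normalised at `0`, and `kᵢ` holomorphic and invertible on the
exterior domain, implies `g₁ = g₂`. -/
theorem birkhoff_unique {g₁ g₂ k₁ k₂ : ℂ → 𝔸} {r R : ℝ} (hr : 0 < r) (hR : r < R)
    (hg₁ : DifferentiableOn ℂ g₁ (Metric.ball 0 R)) (hg₂ : DifferentiableOn ℂ g₂ (Metric.ball 0 R))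
    (hu₂ : ∀ z ∈ Metric.ball (0 : ℂ) R, IsUnit (g₂ z)) (h0 : g₁ 0 = g₂ 0)
    (hk₁ : DifferentiableOn ℂ k₁ (Metric.ball 0 r⁻¹))
    (hk₂ : DifferentiableOn ℂ k₂ (Metric.ball 0 r⁻¹))
    (hv₁ : ∀ z ∈ Metric.ball (0 : ℂ) r⁻¹, IsUnit (k₁ z))
    (h : ∀ z ∈ ann r R, g₁ z * k₁ z⁻¹ = g₂ z * k₂ z⁻¹) {z : ℂ} (hz : z ∈ Metric.ball (0 : ℂ) R) :
    g₁ z = g₂ z := by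
  have key := (liouville_sphere hr hR ((differentiableOn_inverse hg₂ hu₂).mul hg₁)
    (hk₂.mul (differentiableOn_inverse hk₁ hv₁)) fun z hz => by
      have h1 := hv₁ _ (inv_mem_ball hr hz.1)
      have h2 := hu₂ z (ann_subset_ball r R hz)
      simp only [Pi.mul_apply]
      rw [← Ring.mul_inverse_cancel_right (k₁ z⁻¹) (g₁ z) h1, h z hz, mul_assoc,
        Ring.inverse_mul_cancel_left _ _ h2]).1
  have h0R : (0 : ℂ) ∈ Metric.ball (0 : ℂ) R := by simpa using hr.trans hR
  have h1 := (key z hz).trans (key 0 h0R).symm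
  simp only [Pi.mul_apply] at h1
  rw [h0, Ring.inverse_mul_cancel _ (hu₂ 0 h0R)] at h1
  exact eq_of_inverse_mul_eq_one (hu₂ z hz) h1

end Outer

variable {V : Type*} [NormedAddCommGroup V] [InnerProductSpace ℂ V] [CompleteSpace V]
  {G : Subgroup (unitary (Mat V))}

theorem annulus_eq_ann (ρ : ℝ) : annulus ρ = ann ρ ρ⁻¹ := rfl

theorem isOpen_annulus (ρ : ℝ) : IsOpen (annulus ρ) := isOpen_ann _ _

theorem annulus_mono {ρ ρ' : ℝ} (hρ : 0 < ρ) (h : ρ ≤ ρ') : annulus ρ' ⊆ annulus ρ :=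
  ann_mono h (inv_anti₀ hρ h)

theorem mem_annulus_of_lt_one {ρ : ℝ} (hρ : 0 < ρ) (h1 : ρ < 1) {z : ℂ} (hz : ρ < ‖z‖)
    (hz1 : ‖z‖ < 1) : z ∈ annulus ρ := ⟨hz, hz1.trans (one_lt_inv₀ hρ |>.2 h1)⟩

theorem circle_mem_annulus {ρ : ℝ} (hρ : 0 < ρ) (h1 : ρ < 1) (z : Circle) :
    (z : ℂ) ∈ annulus ρ := by
  refine ⟨?_, ?_⟩ <;> rw [Circle.norm_coe]
  · exact h1
  · exact one_lt_inv₀ hρ |>.2 h1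

theorem ActsTo.exists_of_le {χ : ℂ → Mat V} {α β : Forms G} (h : ActsTo χ α β) :
    ∃ ρ₀ : ℝ, 0 < ρ₀ ∧ ρ₀ < 1 ∧ ∀ ρ, ρ₀ ≤ ρ → ρ < 1 → DifferentiableOn ℂ χ (annulus ρ) ∧
      (∀ z ∈ annulus ρ, IsUnit (χ z)) ∧ ∃ k : ℂ → Mat V,
      DifferentiableOn ℂ k (Metric.ball 0 ρ⁻¹) ∧ (∀ w ∈ Metric.ball 0 ρ⁻¹, IsUnit (k w)) ∧
      ∀ z ∈ ann ρ 1, frame β z = χ z * frame α z * Ring.inverse (k z⁻¹) := by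
  obtain ⟨ρ, hρ, hρ1, hχ, hχu, k, hk, hku, h⟩ := h
  refine ⟨ρ, hρ, hρ1, fun ρ' h' h1 => ?_⟩
  have hsub := Metric.ball_subset_ball (x := (0 : ℂ)) (inv_anti₀ hρ h')
  exact ⟨hχ.mono (annulus_mono hρ h'), fun z hz => hχu z (annulus_mono hρ h' hz), k, hk.mono hsub,
    fun w hw => hku w (hsub hw), fun z hz => h z (h'.trans_lt hz.1) hz.2⟩

/-- The result of the action is determined by the loop near the unit circle. -/
theorem ActsTo.frame_eq {χ : ℂ → Mat V} {α β : Forms G} (h : ActsTo χ α β) {g k : ℂ → Mat V}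
    {ρ : ℝ} (hρ : 0 < ρ) (hρ1 : ρ < 1) (hg : DifferentiableOn ℂ g (Metric.ball 0 1))
    (hgu : ∀ z ∈ Metric.ball (0 : ℂ) 1, IsUnit (g z)) (hg0 : g 0 = 1)
    (hk : DifferentiableOn ℂ k (Metric.ball 0 ρ⁻¹))
    (hku : ∀ w ∈ Metric.ball (0 : ℂ) ρ⁻¹, IsUnit (k w))
    (hgk : ∀ z ∈ ann ρ 1, g z = χ z * frame α z * Ring.inverse (k z⁻¹)) {z : ℂ}
    (hz : z ∈ Metric.ball (0 : ℂ) 1) : frame β z = g z := by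
  obtain ⟨ρ₀, h0, h01, h⟩ := h.exists_of_le
  obtain ⟨-, -, k', hk', hku', h'⟩ := h (max ρ ρ₀) (le_max_right _ _) (max_lt hρ1 h01)
  have hm : 0 < max ρ ρ₀ := lt_max_of_lt_left hρ
  have hsub := Metric.ball_subset_ball (x := (0 : ℂ)) (inv_anti₀ hρ (le_max_left ρ ρ₀))
  refine birkhoff_unique hm (max_lt hρ1 h01) (differentiableOn_frame β) hg hgu
    (by rw [frame_zero, hg0]) hk' (hk.mono hsub) hku' (fun z hz => ?_) hz
  have h1 := inv_mem_ball hm hz.1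
  rw [h' z hz, hgk z ⟨(le_max_left _ _).trans_lt hz.1, hz.2⟩,
    Ring.inverse_mul_cancel_right _ _ (hku' _ h1),
    Ring.inverse_mul_cancel_right _ _ (hku _ (hsub h1))]

theorem ActsTo.congr {χ χ' : ℂ → Mat V} {α β : Forms G} (h : ActsTo χ α β) {ρ : ℝ}
    (hρ : 0 < ρ) (hρ1 : ρ < 1) (heq : ∀ z ∈ annulus ρ, χ z = χ' z) : ActsTo χ' α β := by
  obtain ⟨ρ₀, h0, h01, h⟩ := h.exists_of_le
  obtain ⟨hχ, hχu, k', hk', hku', h'⟩ := h (max ρ ρ₀) (le_max_right _ _) (max_lt hρ1 h01)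
  have heq' : ∀ z ∈ annulus (max ρ ρ₀), χ z = χ' z := fun z hz =>
    heq z (annulus_mono hρ (le_max_left _ _) hz)
  refine ⟨max ρ ρ₀, lt_max_of_lt_left hρ, max_lt hρ1 h01, hχ.congr fun z hz => (heq' z hz).symm,
    fun z hz => heq' z hz ▸ hχu z hz, k', hk', hku', fun z hz hz1 => ?_⟩
  rw [← heq' z (mem_annulus_of_lt_one (lt_max_of_lt_left hρ) (max_lt hρ1 h01) hz hz1)]
  exact h' z ⟨hz, hz1⟩

theorem ActsTo.unique {χ : ℂ → Mat V} {α β β' : Forms G} (h : ActsTo χ α β)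
    (h' : ActsTo χ α β') : β = β' := by
  obtain ⟨ρ, hρ, hρ1, -, -, k, hk, hku, hz⟩ := h'
  exact eq_of_frame_eq fun z hz' => h.frame_eq hρ hρ1 (differentiableOn_frame β')
    (fun z hz => isUnit_frame β' hz) (frame_zero β') hk hku (fun z hz' => hz z hz'.1 hz'.2) hz'

theorem ActsTo.one (α : Forms G) : ActsTo (fun _ => 1) α α :=
  ⟨1 / 2, by norm_num, by norm_num, differentiableOn_const 1, fun _ _ => isUnit_one, fun _ => 1,
    differentiableOn_const 1, fun _ _ => isUnit_one, fun z _ _ => by simp⟩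

theorem ActsTo.mul {χ χ' : ℂ → Mat V} {α β γ : Forms G} (h : ActsTo χ α β)
    (h' : ActsTo χ' β γ) : ActsTo (fun z => χ' z * χ z) α γ := by
  obtain ⟨ρ, hρ, hρ1, h⟩ := h.exists_of_le
  obtain ⟨ρ', hρ', hρ1', h'⟩ := h'.exists_of_le
  have hm := max_lt hρ1 hρ1'
  have hm0 : 0 < max ρ ρ' := lt_max_of_lt_left hρ
  obtain ⟨h1, h2, k, h3, h4, h5⟩ := h _ (le_max_left ρ ρ') hm
  obtain ⟨h1', h2', k', h3', h4', h5'⟩ := h' _ (le_max_right ρ ρ') hm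
  refine ⟨_, hm0, hm, h1'.mul h1, fun z hz => (h2' z hz).mul (h2 z hz),
    fun w => k' w * k w, h3'.mul h3, fun w hw => (h4' w hw).mul (h4 w hw), fun z hz hz1 => ?_⟩
  have hi := inv_mem_ball hm0 hz
  rw [h5' z ⟨hz, hz1⟩, h5 z ⟨hz, hz1⟩, inverse_mul (h4' _ hi) (h4 _ hi)]
  simp only [mul_assoc]

/-! #### The factorisation of `g⁻¹ η g` -/

/-- The function `g⁻¹ η g - 1` on an annulus `r < |z| < R` inside the disc, for the frame `g` of a
form and a loop `η`. -/
def conjDefect (r R : ℝ) (η : ℂ → Mat V) (α : Forms G) : Hol (ann r R) (Mat V) :=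
  Ring.inverse (toAnn r R (frameOn R α)) * Hol.of (ann r R) η * toAnn r R (frameOn R α) - 1

/-- The condition that the Birkhoff factors of `1 + a` exist and are `ε`-close to `1`. -/
def IsGoodDefect (r R ε : ℝ) (a : Hol (ann r R) (Mat V)) : Prop :=
  IsUnit (factorOp r R a) ∧ (∃ m : ℂ → Mat V, DifferentiableOn ℂ m (Metric.ball 0 r⁻¹) ∧
      (∀ z ∈ ann r R, (outerFactor r R a).ev z = m z⁻¹) ∧
      ∀ w ∈ Metric.ball (0 : ℂ) r⁻¹, ‖m w - 1‖ ≤ ε) ∧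
    ∀ z ∈ Metric.ball (0 : ℂ) R, ‖(innerFactor r R a).ev z - 1‖ ≤ ε

theorem eventually_isGoodDefect {r R ε : ℝ} (hr : 0 < r) (hR : r < R) (hε : 0 < ε) :
    ∀ᶠ a in 𝓝 (0 : Hol (ann r R) (Mat V)), IsGoodDefect r R ε a := by
  filter_upwards [eventually_exists_outer hr hR hε,
    (tendsto_innerFactor (𝔸 := Mat V) (r := r) (R := R)).eventually (Metric.ball_mem_nhds 1 hε)]
    with a ha ha'
  refine ⟨ha.1, ha.2, fun z hz => ?_⟩
  rw [← Hol.ev_one hz, ← Hol.ev_sub]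
  refine (Hol.norm_ev_le _ _).trans ?_
  rw [← dist_eq_norm]; exact ha'.le

theorem toAnn_frameOn_ev {r R : ℝ} (hR1 : R < 1) (α : Forms G) {z : ℂ} (hz : z ∈ ann r R) :
    (toAnn r R (frameOn R α)).ev z = frame α z := by
  rw [Hol.ev_res _ _ hz, ev_frameOn hR1 α (ann_subset_ball r R hz)]

theorem isUnit_toAnn {r R : ℝ} {x : Hol (Metric.ball 0 R) (Mat V)} (hx : IsUnit x) :
    IsUnit (toAnn r R x) := by
  obtain ⟨u, rfl⟩ := hx
  refine ⟨⟨toAnn r R u.1, toAnn r R u.2, ?_, ?_⟩, rfl⟩ <;>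
  · rw [← Hol.res_mul]; simp [Hol.res_one]

theorem closedAnn_subset {ρ r R : ℝ} (hρ : 0 < ρ) (hρ1 : ρ < 1) (hρr : ρ < r) (hR1 : R < 1) :
    Metric.closedBall (0 : ℂ) R \ Metric.ball 0 r ⊆ annulus ρ := by
  rintro z ⟨hz, hz'⟩
  simp only [Metric.mem_closedBall, dist_zero_right, Metric.mem_ball, not_lt] at hz hz'
  exact mem_annulus_of_lt_one hρ hρ1 (hρr.trans_le hz') (hz.trans_lt hR1)

theorem isCompact_closedAnn (r R : ℝ) :
    IsCompact (Metric.closedBall (0 : ℂ) R \ Metric.ball 0 r) :=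
  (isCompact_closedBall 0 R).diff Metric.isOpen_ball

theorem ann_subset_closedAnn (r R : ℝ) : ann r R ⊆ Metric.closedBall (0 : ℂ) R \ Metric.ball 0 r :=
  fun z hz => ⟨by simpa using hz.2.le, by simpa using hz.1.le⟩

theorem ev_of_annulus {ρ r R : ℝ} (hρ : 0 < ρ) (hρ1 : ρ < 1) (hρr : ρ < r) (hR1 : R < 1)
    {η : ℂ → Mat V} (hη : DifferentiableOn ℂ η (annulus ρ)) {z : ℂ} (hz : z ∈ ann r R) :
    (Hol.of (ann r R) η).ev z = η z :=
  Hol.ev_of_compact hη (isCompact_closedAnn r R) (closedAnn_subset hρ hρ1 hρr hR1)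
    (ann_subset_closedAnn r R) hz

theorem conjDefect_ev {ρ r R : ℝ} (hρ : 0 < ρ) (hρ1 : ρ < 1) (hρr : ρ < r) (hR1 : R < 1)
    {η : ℂ → Mat V} (hη : DifferentiableOn ℂ η (annulus ρ)) (α : Forms G) {z : ℂ}
    (hz : z ∈ ann r R) : 1 + (conjDefect r R η α).ev z =
      Ring.inverse (frame α z) * η z * frame α z := by
  rw [conjDefect, Hol.ev_sub, Hol.ev_mul, Hol.ev_mul,
    Hol.ev_inverse (isUnit_toAnn (isUnit_frameOn hR1 α)) hz, toAnn_frameOn_ev hR1 α hz,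
    ev_of_annulus hρ hρ1 hρr hR1 hη hz, Hol.ev_one hz, add_sub_cancel]

/-- The frame `η g k⁻¹` of the transformed form: on the smaller disc it is `g p`, for the inner
Birkhoff factor `p` of `g⁻¹ η g`. -/
theorem exists_glued_frame {ρ r R ε : ℝ} (hρ : 0 < ρ) (hρr : ρ < r) (hrR : r < R) (hR1 : R < 1)
    (hε : ε ≤ 1 / 2) {η : ℂ → Mat V} (hη : DifferentiableOn ℂ η (annulus ρ))
    (hηu : ∀ z ∈ annulus ρ, IsUnit (η z)) (α : Forms G)
    (ha : IsGoodDefect r R ε (conjDefect r R η α)) : ∃ g m : ℂ → Mat V,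
      DifferentiableOn ℂ g (Metric.ball 0 1) ∧ (∀ z ∈ Metric.ball (0 : ℂ) 1, IsUnit (g z)) ∧
      g 0 = 1 ∧ DifferentiableOn ℂ m (Metric.ball 0 r⁻¹) ∧
      (∀ w ∈ Metric.ball (0 : ℂ) r⁻¹, ‖m w - 1‖ ≤ ε) ∧
      (∀ z ∈ ann r 1, g z = η z * frame α z * m z⁻¹) ∧
      ∀ z ∈ Metric.ball (0 : ℂ) R, g z = frame α z * (innerFactor r R (conjDefect r R η α)).ev z := by
  classical
  have hr : 0 < r := hρ.trans hρr
  have hρ1 : ρ < 1 := hρr.trans (hrR.trans hR1)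
  obtain ⟨hunit, ⟨m, hm, hmo, hmε⟩, hp⟩ := ha
  set p := innerFactor r R (conjDefect r R η α) with hpdef
  have hann : ann r 1 ⊆ annulus ρ := fun z hz =>
    mem_annulus_of_lt_one hρ hρ1 (hρr.trans hz.1) hz.2
  have hsub := Metric.ball_subset_ball (x := (0 : ℂ)) hR1.le
  have hmu : ∀ w ∈ Metric.ball (0 : ℂ) r⁻¹, IsUnit (m w) := fun w hw =>
    isUnit_of_norm_sub_one_le_half ((hmε w hw).trans hε)
  have hoverlap : ∀ z ∈ ann r R, frame α z * p.ev z = η z * frame α z * m z⁻¹ := fun z hz => by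
    have h1 := mul_outerFactor hunit hz
    rw [conjDefect_ev hρ hρ1 hρr hR1 hη α hz, hmo z hz, ← hpdef] at h1
    rw [← h1, mul_assoc (Ring.inverse _), mul_assoc (Ring.inverse _),
      Ring.mul_inverse_cancel_left _ _ (isUnit_frame α (hsub (ann_subset_ball r R hz)))]
  refine ⟨fun z => if z ∈ Metric.ball (0 : ℂ) R then frame α z * p.ev z
    else η z * frame α z * m z⁻¹, m, ?_, fun z hz => ?_, ?_, hm, hmε, fun z hz => ?_,
    fun z hz => if_pos hz⟩
  · refine (differentiableOn_glue Metric.isOpen_ball (isOpen_ann r 1)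
      (((differentiableOn_frame α).mono hsub).mul p.differentiableOn)
      (((hη.mono hann).mul ((differentiableOn_frame α).mono (ann_subset_ball r 1))).mul
        ((differentiableOn_comp_inv hr hm).mono fun z hz => hz.1)) fun z hz hz' => ?_).mono ?_
    · exact hoverlap z ⟨hz'.1, by simpa using hz⟩
    · intro z hz
      rcases lt_or_ge ‖z‖ R with h | h
      · left; simpa using h
      · right; exact ⟨hrR.trans_le h, by simpa using hz⟩
  · simp only
    split_ifs with h
    · exact (isUnit_frame α hz).mul (isUnit_of_norm_sub_one_le_half ((hp z h).trans hε))
    · have hz' : z ∈ ann r 1 := ⟨hrR.trans_le (by simpa using h), by simpa using hz⟩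
      exact ((hηu z (hann hz')).mul (isUnit_frame α hz)).mul (hmu _ (inv_mem_ball hr hz'.1))
  · have h0 : (0 : ℂ) ∈ Metric.ball (0 : ℂ) R := by simpa using hr.trans hrR
    simp only [if_pos h0]
    rw [frame_zero, innerFactor_ev_zero hr hrR, mul_one]
  · simp only
    split_ifs with h
    · exact hoverlap z ⟨hz.1, by simpa using h⟩
    · rfl

/-- On a smaller disc, the frame of the transformed form is given by the Birkhoff
factorisation. -/
theorem ActsTo.frameOn_eq {ρ r R ε : ℝ} (hρ : 0 < ρ) (hρr : ρ < r) (hrR : r < R) (hR1 : R < 1)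
    (hε : ε ≤ 1 / 2) {η : ℂ → Mat V} (hη : DifferentiableOn ℂ η (annulus ρ))
    (hηu : ∀ z ∈ annulus ρ, IsUnit (η z)) {α β : Forms G}
    (ha : IsGoodDefect r R ε (conjDefect r R η α)) (h : ActsTo η α β) :
    frameOn R β = frameOn R α * innerFactor r R (conjDefect r R η α) := by
  obtain ⟨g, m, hg, hgu, hg0, hm, hmε, hgm, hgp⟩ :=
    exists_glued_frame hρ hρr hrR hR1 hε hη hηu α ha
  have hr : 0 < r := hρ.trans hρr
  have hmu : ∀ w ∈ Metric.ball (0 : ℂ) r⁻¹, IsUnit (m w) := fun w hw =>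
    isUnit_of_norm_sub_one_le_half ((hmε w hw).trans hε)
  refine Hol.ext_ev fun z hz => ?_
  have hz1 := Metric.ball_subset_ball (x := (0 : ℂ)) hR1.le hz
  rw [Hol.ev_mul, ev_frameOn hR1 β hz, ev_frameOn hR1 α hz, ← hgp z hz]
  refine h.frame_eq (k := fun w => Ring.inverse (m w)) hr (hrR.trans hR1) hg hgu hg0
    (differentiableOn_inverse hm hmu) (fun w hw => isUnit_inverse (hmu w hw)) (fun w hw => ?_) hz1
  rw [inverse_inverse (hmu _ (inv_mem_ball hr hw.1)), hgm w hw]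

end

section

/-! ### The left action stays among `𝔤_ℂ`-valued forms -/

variable {V : Type*} [NormedAddCommGroup V] [InnerProductSpace ℂ V] [CompleteSpace V]
  {G : Subgroup (unitary (Mat V))} [FiniteDimensional ℂ V]

/-- An invertible matrix that maps `𝔤_ℂ` into itself by conjugation normalises it, for dimensional
reasons. -/
theorem conj_inverse_mem {g : Mat V} (hg : IsUnit g)
    (h : ∀ X ∈ complexLie G, g * X * Ring.inverse g ∈ complexLie G) {X : Mat V}
    (hX : X ∈ complexLie G) : Ring.inverse g * X * g ∈ complexLie G := by
  let T : Mat V →ₗ[ℂ] Mat V := LinearMap.mulRight ℂ (Ring.inverse g) ∘ₗ LinearMap.mulLeft ℂ g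
  have hT : ∀ X, T X = g * X * Ring.inverse g := fun X => rfl
  have hinj : Function.Injective T := fun X Y hXY => by
    rw [hT, hT] at hXY
    have := congrArg (fun Z => Ring.inverse g * (Z * g)) hXY
    simpa [Ring.inverse_mul_cancel_right _ _ hg, Ring.inverse_mul_cancel_left _ _ hg] using this
  have hle : (lieSub G).map T ≤ lieSub G := by
    rintro _ ⟨X, hX, rfl⟩
    exact h X hX
  have heq : (lieSub G).map T = lieSub G :=
    Submodule.eq_of_le_of_finrank_eq hle
      (LinearEquiv.finrank_eq (Submodule.equivMapOfInjective T hinj (lieSub G))).symm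
  obtain ⟨Y, hY, hYX⟩ : X ∈ (lieSub G).map T := by rw [heq]; exact hX
  rw [← hYX, hT]
  have : Ring.inverse g * (g * Y * Ring.inverse g) * g = Y := by
    rw [mul_assoc, Ring.inverse_mul_cancel_right _ _ hg, Ring.inverse_mul_cancel_left _ _ hg]
  rw [this]; exact hY

variable (G) in
/-- The component of `X ↦ x⁻¹ X x` in the endomorphisms of `𝔤_ℂ`, extended by the identity on the
complement of `𝔤_ℂ`. -/
def adComp (x : Mat V) : Mat V →L[ℂ] Mat V :=
  lieProj G ∘L (ContinuousLinearMap.mul ℂ (Mat V) (Ring.inverse x)) ∘L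
    ((ContinuousLinearMap.mul ℂ (Mat V)).flip x) ∘L lieProj G + (1 - lieProj G)

theorem adComp_apply (x X : Mat V) : adComp G x X =
    lieProj G (Ring.inverse x * (lieProj G X * x)) + (X - lieProj G X) := rfl

theorem lieProj_lieProj (X : Mat V) : lieProj G (lieProj G X) = lieProj G X :=
  lieProj_of_mem (lieProj_mem X)

@[simp] theorem adComp_one : adComp G (1 : Mat V) = 1 := by
  ext1 X
  simp [adComp_apply, lieProj_lieProj]

theorem adDefect_one : adDefect G (Ring.inverse (1 : Mat V)) 1 = 0 := by
  ext1 X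
  simp [adDefect_apply, lieProj_lieProj]

theorem differentiableOn_adComp {x : ℂ → Mat V} {s : Set ℂ} (hx : DifferentiableOn ℂ x s)
    (hu : ∀ z ∈ s, IsUnit (x z)) : DifferentiableOn ℂ (fun z => adComp G (x z)) s := by
  refine ((differentiableOn_const _).clm_comp (DifferentiableOn.clm_comp ?_
    (DifferentiableOn.clm_comp ?_ (differentiableOn_const _)))).add_const _
  · exact (ContinuousLinearMap.mul ℂ (Mat V)).differentiable.comp_differentiableOn
      (differentiableOn_inverse hx hu)
  · exact (ContinuousLinearMap.mul ℂ (Mat V)).flip.differentiable.comp_differentiableOn hx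

theorem differentiableOn_adDefect {x : ℂ → Mat V} {s : Set ℂ} (hx : DifferentiableOn ℂ x s)
    (hu : ∀ z ∈ s, IsUnit (x z)) :
    DifferentiableOn ℂ (fun z => adDefect G (Ring.inverse (x z)) (x z)) s := by
  refine (differentiableOn_const _).clm_comp (DifferentiableOn.clm_comp ?_
    (DifferentiableOn.clm_comp ?_ (differentiableOn_const _)))
  · exact (ContinuousLinearMap.mul ℂ (Mat V)).differentiable.comp_differentiableOn
      (differentiableOn_inverse hx hu)
  · exact (ContinuousLinearMap.mul ℂ (Mat V)).flip.differentiable.comp_differentiableOn hx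

variable (G) in
/-- For `x` close to `1`, being close to the identity, the `𝔤_ℂ`-component of conjugation by `x` is
invertible. -/
theorem exists_lieRadius : ∃ ε > 0, ε ≤ 1 / 2 ∧ ∀ x : Mat V, ‖x - 1‖ ≤ ε → IsUnit (adComp G x) := by
  have hc : ContinuousAt (adComp G) (1 : Mat V) := by
    have hi : ContinuousAt Ring.inverse (1 : Mat V) := NormedRing.inverse_continuousAt 1
    refine ContinuousAt.add ?_ continuousAt_const
    refine continuousAt_const.clm_comp (ContinuousAt.clm_comp ?_ (ContinuousAt.clm_comp ?_
      continuousAt_const))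
    · exact (ContinuousLinearMap.mul ℂ (Mat V)).continuous.continuousAt.comp hi
    · exact (ContinuousLinearMap.mul ℂ (Mat V)).flip.continuous.continuousAt
  have hc' : Tendsto (adComp G) (𝓝 (1 : Mat V)) (𝓝 1) := by
    have := hc.tendsto
    rwa [adComp_one] at this
  have h := hc'.eventually (p := IsUnit) (Units.isOpen.mem_nhds isUnit_one)
  obtain ⟨ε, hε, h⟩ := Metric.nhds_basis_closedBall.eventually_iff.1 h
  refine ⟨min ε (1 / 2), lt_min hε (by norm_num), min_le_right _ _, fun x hx => h ?_⟩
  rw [Metric.mem_closedBall, dist_eq_norm]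
  exact hx.trans (min_le_left _ _)

variable (G) in
/-- A radius such that conjugation by matrices in the ball of this radius around `1` moves `𝔤_ℂ`
only a little. -/
def lieRadius : ℝ := (exists_lieRadius G).choose

theorem lieRadius_pos : 0 < lieRadius G := (exists_lieRadius G).choose_spec.1

theorem lieRadius_le : lieRadius G ≤ 1 / 2 := (exists_lieRadius G).choose_spec.2.1

theorem isUnit_adComp {x : Mat V} (hx : ‖x - 1‖ ≤ lieRadius G) : IsUnit (adComp G x) :=
  (exists_lieRadius G).choose_spec.2.2 x hx

theorem adComp_mul {c x : Mat V} (hc : IsUnit c) (hx : IsUnit x)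
    (hcn : ∀ X ∈ complexLie G, Ring.inverse c * X * c ∈ complexLie G) :
    adComp G (c * x) = adComp G x * adComp G c ∧
      adDefect G (Ring.inverse (c * x)) (c * x) =
        adDefect G (Ring.inverse x) x * adComp G c := by
  have key : ∀ X, lieProj G (adComp G c X) = Ring.inverse c * lieProj G X * c := fun X => by
    rw [adComp_apply, map_add, map_sub, lieProj_lieProj, lieProj_lieProj, sub_self, add_zero,
      ← mul_assoc]
    exact lieProj_of_mem (hcn _ (lieProj_mem X))
  have key' : ∀ X, Ring.inverse x * (lieProj G (adComp G c X) * x) =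
      Ring.inverse (c * x) * (lieProj G X * (c * x)) := fun X => by
    rw [key, inverse_mul hc hx]; simp only [mul_assoc]
  refine ⟨ContinuousLinearMap.ext fun X => ?_, ContinuousLinearMap.ext fun X => ?_⟩
  · rw [mul_apply_eq_comp, adComp_apply x, key', adComp_apply (c * x), key]
    rw [adComp_apply c, ← mul_assoc (Ring.inverse c), lieProj_of_mem (hcn _ (lieProj_mem X)),
      add_sub_cancel_left]
  · rw [mul_apply_eq_comp, adDefect_apply, adDefect_apply, key']

/-- If `p = c k⁻¹` is a Birkhoff factorisation close to the identity and `c` normalises `𝔤_ℂ`, then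
so do `p` and `k`: the subspace `p⁻¹ 𝔤_ℂ p = k 𝔤_ℂ k⁻¹` is a holomorphic function on the Riemann
sphere with values in an affine chart of the Grassmannian, hence constant. -/
theorem factors_normalise {r R : ℝ} (hr : 0 < r) (hR : r < R) {p m c : ℂ → Mat V}
    (hp : DifferentiableOn ℂ p (Metric.ball 0 R)) (hm : DifferentiableOn ℂ m (Metric.ball 0 r⁻¹))
    (hpε : ∀ z ∈ Metric.ball (0 : ℂ) R, ‖p z - 1‖ ≤ lieRadius G)
    (hmε : ∀ w ∈ Metric.ball (0 : ℂ) r⁻¹, ‖m w - 1‖ ≤ lieRadius G) (hp0 : p 0 = 1)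
    (hc : ∀ z ∈ ann r R, IsUnit (c z)) (hpc : ∀ z ∈ ann r R, p z = c z * m z⁻¹)
    (hcn : ∀ z ∈ ann r R, ∀ X ∈ complexLie G, Ring.inverse (c z) * X * c z ∈ complexLie G) :
    (∀ z ∈ Metric.ball (0 : ℂ) R, ∀ X ∈ complexLie G,
      Ring.inverse (p z) * X * p z ∈ complexLie G) ∧
    ∀ w ∈ Metric.ball (0 : ℂ) r⁻¹, ∀ X ∈ complexLie G,
      Ring.inverse (m w) * X * m w ∈ complexLie G := by
  have hpu : ∀ z ∈ Metric.ball (0 : ℂ) R, IsUnit (p z) := fun z hz =>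
    isUnit_of_norm_sub_one_le_half ((hpε z hz).trans lieRadius_le)
  have hmu : ∀ w ∈ Metric.ball (0 : ℂ) r⁻¹, IsUnit (m w) := fun z hz =>
    isUnit_of_norm_sub_one_le_half ((hmε z hz).trans lieRadius_le)
  have hT := (differentiableOn_adDefect (G := G) hp hpu).mul (differentiableOn_inverse
    (differentiableOn_adComp (G := G) hp hpu) fun z hz => isUnit_adComp (hpε z hz))
  have hT' := (differentiableOn_adDefect (G := G) hm hmu).mul (differentiableOn_inverse
    (differentiableOn_adComp (G := G) hm hmu) fun z hz => isUnit_adComp (hmε z hz))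
  obtain ⟨h1, h2⟩ := liouville_sphere hr hR hT hT' fun z hz => by
    have hi := inv_mem_ball hr hz.1
    have hb := ann_subset_ball r R hz
    obtain ⟨e1, e2⟩ := adComp_mul (hc z hz) (hmu _ hi) (hcn z hz)
    rw [← hpc z hz] at e1 e2
    have hA := isUnit_adComp (hmε _ hi)
    have hAc : IsUnit (adComp G (c z)) := by
      have : adComp G (c z) = Ring.inverse (adComp G (m z⁻¹)) * adComp G (p z) := by
        rw [e1, Ring.inverse_mul_cancel_left _ _ hA]
      rw [this]
      exact (isUnit_inverse hA).mul (isUnit_adComp (hpε z hb))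
    simp only [Pi.mul_apply]
    rw [e1, e2, inverse_mul hA hAc, ← mul_assoc, Ring.mul_inverse_cancel_right _ _ hAc]
  have h0R : (0 : ℂ) ∈ Metric.ball (0 : ℂ) R := by simpa using hr.trans hR
  have hzero := h1 0 h0R
  simp only [Pi.mul_apply, hp0, adDefect_one, zero_mul] at hzero
  simp only [Pi.mul_apply, ← hzero] at h1 h2
  have fin : ∀ x : Mat V, ‖x - 1‖ ≤ lieRadius G →
      adDefect G (Ring.inverse x) x * Ring.inverse (adComp G x) = 0 →
      ∀ X ∈ complexLie G, Ring.inverse x * X * x ∈ complexLie G := fun x hx h X hX => by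
    have h3 : adDefect G (Ring.inverse x) x = 0 := by
      rw [← Ring.inverse_mul_cancel_right (adComp G x) (adDefect G (Ring.inverse x) x)
        (isUnit_adComp hx), h, zero_mul]
    have h4 := congrArg (fun T => T X) h3
    simp only [adDefect_apply, lieProj_of_mem hX, zero_apply] at h4
    rw [mul_assoc]
    exact mem_of_lieProj_eq h4
  exact ⟨fun z hz => fin _ (hpε z hz) (h1 z hz), fun w hw => fin _ (hmε w hw) (h2 w hw)⟩

/-- In the situation of `factors_normalise`, if `c` has its logarithmic derivative in `𝔤_ℂ`, then so
does `p`: modulo `𝔤_ℂ`, the logarithmic derivatives of both factors agree up to sign, and the one of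
the exterior factor vanishes at infinity. -/
theorem logDeriv_factor_mem {r R : ℝ} (hr : 0 < r) (hR : r < R) {p m c : ℂ → Mat V}
    (hp : DifferentiableOn ℂ p (Metric.ball 0 R)) (hm : DifferentiableOn ℂ m (Metric.ball 0 r⁻¹))
    (hpu : ∀ z ∈ Metric.ball (0 : ℂ) R, IsUnit (p z))
    (hmu : ∀ w ∈ Metric.ball (0 : ℂ) r⁻¹, IsUnit (m w))
    (hcd : DifferentiableOn ℂ c (ann r R))
    (hc : ∀ z ∈ ann r R, IsUnit (c z)) (hpc : ∀ z ∈ ann r R, p z = c z * m z⁻¹)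
    (hmn : ∀ w ∈ Metric.ball (0 : ℂ) r⁻¹, ∀ X ∈ complexLie G,
      Ring.inverse (m w) * X * m w ∈ complexLie G)
    (hlog : ∀ z ∈ ann r R, Ring.inverse (c z) * deriv c z ∈ complexLie G) {z : ℂ}
    (hz : z ∈ Metric.ball (0 : ℂ) R) : Ring.inverse (p z) * deriv p z ∈ complexLie G := by
  have hf : DifferentiableOn ℂ (fun z => (1 - lieProj G) (Ring.inverse (p z) * deriv p z))
      (Metric.ball 0 R) := (1 - lieProj G).differentiable.comp_differentiableOn
    ((differentiableOn_inverse hp hpu).mul (hp.deriv Metric.isOpen_ball))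
  have hm' : DifferentiableOn ℂ
      (fun w : ℂ => (1 - lieProj G) (-(w ^ 2) • (Ring.inverse (m w) * deriv m w)))
      (Metric.ball 0 r⁻¹) := (1 - lieProj G).differentiable.comp_differentiableOn
    ((differentiableOn_id.pow 2).neg.fun_smul
      ((differentiableOn_inverse hm hmu).fun_mul (hm.deriv Metric.isOpen_ball)))
  have key := (liouville_sphere hr hR hf hm' fun z hz => by
    have hi := inv_mem_ball hr hz.1
    have hz0 : z ≠ 0 := norm_pos_iff.1 (hr.trans hz.1)
    have h1 : HasDerivAt c (deriv c z) z :=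
      (hcd.differentiableAt ((isOpen_ann r R).mem_nhds hz)).hasDerivAt
    have h2 : HasDerivAt (fun z => m z⁻¹) ((-(z ^ 2)⁻¹) • deriv m z⁻¹) z :=
      ((hm.differentiableAt (Metric.isOpen_ball.mem_nhds hi)).hasDerivAt).scomp z (hasDerivAt_inv hz0)
    have h3 : HasDerivAt p (deriv c z * m z⁻¹ + c z * ((-(z ^ 2)⁻¹) • deriv m z⁻¹)) z := by
      refine (h1.mul h2).congr_of_eventuallyEq ?_
      filter_upwards [(isOpen_ann r R).mem_nhds hz] with w hw using hpc w hw
    have h4 : Ring.inverse (p z) * deriv p z =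
        Ring.inverse (m z⁻¹) * (Ring.inverse (c z) * deriv c z) * m z⁻¹ +
          -(z⁻¹ ^ 2) • (Ring.inverse (m z⁻¹) * deriv m z⁻¹) := by
      rw [h3.deriv, hpc z hz, inverse_mul (hc z hz) (hmu _ hi), mul_add, mul_smul_comm,
        mul_smul_comm, mul_assoc _ _ (c z * _), Ring.inverse_mul_cancel_left _ _ (hc z hz),
        inv_pow]
      simp only [mul_assoc]
    have h5 : (1 - lieProj G) (Ring.inverse (m z⁻¹) * (Ring.inverse (c z) * deriv c z) * m z⁻¹)
        = 0 := by
      rw [sub_apply, one_apply_eq_self, lieProj_of_mem (hmn _ hi _ (hlog z hz)), sub_self]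
    rw [h4, map_add, h5, zero_add]).1 z hz
  simp only [ne_eq, OfNat.ofNat_ne_zero, not_false_eq_true, zero_pow, neg_zero, zero_smul,
    map_zero] at key
  exact mem_of_lieProj_eq key

/-- The left action of loops close to the identity that take values in the complexification of `G`
(expressed by their adjoint action and their logarithmic derivative). -/
theorem exists_actsTo {ρ r R : ℝ} (hρ : 0 < ρ) (hρr : ρ < r) (hrR : r < R) (hR1 : R < 1)
    {η : ℂ → Mat V} (hη : DifferentiableOn ℂ η (annulus ρ))
    (hηu : ∀ z ∈ annulus ρ, IsUnit (η z)) (α : Forms G)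
    (hηn : ∀ z ∈ annulus ρ, ∀ X ∈ complexLie G, Ring.inverse (η z) * X * η z ∈ complexLie G)
    (hlog : ∀ z ∈ annulus ρ, Ring.inverse (η z) * deriv η z ∈ complexLie G)
    (ha : IsGoodDefect r R (lieRadius G) (conjDefect r R η α)) : ∃ β, ActsTo η α β := by
  have hr : 0 < r := hρ.trans hρr
  have hρ1 : ρ < 1 := hρr.trans (hrR.trans hR1)
  obtain ⟨g, m, hg, hgu, hg0, hm, hmε, hgm, hgp⟩ :=
    exists_glued_frame hρ hρr hrR hR1 lieRadius_le hη hηu α ha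
  set p := innerFactor r R (conjDefect r R η α) with hpdef
  have hpε : ∀ z ∈ Metric.ball (0 : ℂ) R, ‖p.ev z - 1‖ ≤ lieRadius G := ha.2.2
  have hmu : ∀ w ∈ Metric.ball (0 : ℂ) r⁻¹, IsUnit (m w) := fun w hw =>
    isUnit_of_norm_sub_one_le_half ((hmε w hw).trans lieRadius_le)
  have hpu : ∀ w ∈ Metric.ball (0 : ℂ) R, IsUnit (p.ev w) := fun w hw =>
    isUnit_of_norm_sub_one_le_half ((hpε w hw).trans lieRadius_le)
  have hsub := Metric.ball_subset_ball (x := (0 : ℂ)) hR1.le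
  have hb1 : ∀ z ∈ ann r R, z ∈ Metric.ball (0 : ℂ) 1 := fun z hz => hsub (ann_subset_ball r R hz)
  have hann : ∀ z ∈ ann r R, z ∈ annulus ρ := fun z hz =>
    mem_annulus_of_lt_one hρ hρ1 (hρr.trans hz.1) (hz.2.trans hR1)
  -- `c = g⁻¹ η g` has Birkhoff factors `p` and `m`
  set c : ℂ → Mat V := fun z => Ring.inverse (frame α z) * η z * frame α z with hcdef
  have hfu := fun z hz => isUnit_frame α (hb1 z hz)
  have hcu : ∀ z ∈ ann r R, IsUnit (c z) := fun z hz =>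
    ((isUnit_inverse (hfu z hz)).mul (hηu z (hann z hz))).mul (hfu z hz)
  have hfd := (differentiableOn_frame α).mono hb1
  have hcd : DifferentiableOn ℂ c (ann r R) :=
    ((differentiableOn_inverse hfd hfu).mul (hη.mono hann)).mul hfd
  have hpc : ∀ z ∈ ann r R, p.ev z = c z * m z⁻¹ := fun z hz => by
    have h1 := hgm z ⟨hz.1, hz.2.trans hR1⟩
    rw [hgp z (ann_subset_ball r R hz)] at h1
    rw [← Ring.inverse_mul_cancel_left (frame α z) (p.ev z) (hfu z hz), h1, hcdef]
    simp only [mul_assoc]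
  have hfn : ∀ z ∈ Metric.ball (0 : ℂ) 1, ∀ X ∈ complexLie G,
      Ring.inverse (frame α z) * X * frame α z ∈ complexLie G := fun z hz X hX =>
    conj_inverse_mem (isUnit_frame α hz) (fun X hX => frame_conj_mem α hz hX) hX
  have hcinv : ∀ z ∈ ann r R, Ring.inverse (c z) =
      Ring.inverse (frame α z) * Ring.inverse (η z) * frame α z := fun z hz => by
    rw [hcdef]; simp only
    rw [inverse_mul ((isUnit_inverse (hfu z hz)).mul (hηu z (hann z hz))) (hfu z hz),
      inverse_mul (isUnit_inverse (hfu z hz)) (hηu z (hann z hz)), inverse_inverse (hfu z hz),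
      mul_assoc]
  have hcn : ∀ z ∈ ann r R, ∀ X ∈ complexLie G,
      Ring.inverse (c z) * X * c z ∈ complexLie G := fun z hz X hX => by
    have h1 := hfn z (hb1 z hz) _ (hηn z (hann z hz) _ (frame_conj_mem α (hb1 z hz) hX))
    rw [hcinv z hz, hcdef]
    simpa only [mul_assoc] using h1
  have hclog : ∀ z ∈ ann r R, Ring.inverse (c z) * deriv c z ∈ complexLie G := fun z hz => by
    have hf := hasDerivAt_frame α (hb1 z hz)
    have hi := hasDerivAt_inverse hf (hfu z hz)
    have he : HasDerivAt η (deriv η z) z :=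
      (hη.differentiableAt ((isOpen_annulus ρ).mem_nhds (hann z hz))).hasDerivAt
    have h1 := ((hi.mul he).mul hf).deriv
    have h2 : deriv c z = -(formFun α z * c z) +
        Ring.inverse (frame α z) * deriv η z * frame α z + c z * formFun α z := by
      refine h1.trans ?_
      rw [Ring.inverse_mul_cancel_left _ _ (hfu z hz), hcdef]
      noncomm_ring
    have h3 : Ring.inverse (c z) * deriv c z = -(Ring.inverse (c z) * formFun α z * c z) +
        Ring.inverse (frame α z) * (Ring.inverse (η z) * deriv η z) * frame α z +
          formFun α z := by
      rw [h2, mul_add, mul_add, Ring.inverse_mul_cancel_left _ _ (hcu z hz), hcinv z hz]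
      congr 2
      · rw [mul_neg]; simp only [mul_assoc]
      · simp only [mul_assoc]
        rw [Ring.mul_inverse_cancel_left _ _ (hfu z hz)]
    rw [h3]
    exact add_mem (add_mem (neg_mem (hcn z hz _ (formFun_mem α (hb1 z hz))))
      (hfn z (hb1 z hz) _ (hlog z (hann z hz)))) (formFun_mem α (hb1 z hz))
  obtain ⟨hpn, hmn⟩ := factors_normalise hr hrR p.differentiableOn hm hpε hmε
    (innerFactor_ev_zero hr hrR _) hcu hpc hcn
  have hplog : ∀ z ∈ Metric.ball (0 : ℂ) R,
      Ring.inverse (p.ev z) * deriv p.ev z ∈ complexLie G := fun z hz =>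
    logDeriv_factor_mem hr hrR p.differentiableOn hm hpu hmu hcd hcu hpc hmn hclog hz
  have hglog : ∀ z ∈ Metric.ball (0 : ℂ) R, Ring.inverse (g z) * deriv g z ∈ complexLie G := by
    intro z hz
    have h1 := (hasDerivAt_frame α (hsub hz)).mul
      (p.differentiableOn.differentiableAt (Metric.isOpen_ball.mem_nhds hz)).hasDerivAt
    have h2 : deriv g z = _ := (h1.congr_of_eventuallyEq (by
      filter_upwards [Metric.isOpen_ball.mem_nhds hz] with w hw using hgp w hw)).deriv
    have h3 : Ring.inverse (g z) * deriv g z =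
        Ring.inverse (p.ev z) * formFun α z * p.ev z + Ring.inverse (p.ev z) * deriv p.ev z := by
      rw [h2, hgp z hz, inverse_mul (isUnit_frame α (hsub hz)) (hpu z hz), mul_add]
      simp only [mul_assoc]
      rw [Ring.inverse_mul_cancel_left _ _ (isUnit_frame α (hsub hz)),
        Ring.inverse_mul_cancel_left _ _ (isUnit_frame α (hsub hz))]
    rw [h3]
    exact add_mem (hpn z hz _ (formFun_mem α (hsub hz))) (hplog z hz)
  have hgmem : ∀ z ∈ Metric.ball (0 : ℂ) 1, Ring.inverse (g z) * deriv g z ∈ complexLie G := by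
    intro z hz
    have hd : DifferentiableOn ℂ (fun z => (1 - lieProj G) (Ring.inverse (g z) * deriv g z))
        (Metric.ball 0 1) := (1 - lieProj G).differentiable.comp_differentiableOn
      ((differentiableOn_inverse hg hgu).mul (hg.deriv Metric.isOpen_ball))
    have h0 : (0 : ℂ) ∈ Metric.ball (0 : ℂ) 1 := by simp
    have h1 := (hd.analyticOnNhd Metric.isOpen_ball).eqOn_zero_of_preconnected_of_eventuallyEq_zero
      (convex_ball (0 : ℂ) 1).isPreconnected h0 (by
        filter_upwards [Metric.ball_mem_nhds (0 : ℂ) (hr.trans hrR)] with w hw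
        simp only [sub_apply, one_apply_eq_self, lieProj_of_mem (hglog w hw), sub_self,
          Pi.zero_apply]) hz
    exact mem_of_lieProj_eq h1
  obtain ⟨β, hβ⟩ := exists_frame_eq hg hg0 hgu hgmem
  have hr1 : r < 1 := hrR.trans hR1
  refine ⟨β, r, hr, hr1, hη.mono (annulus_mono hρ hρr.le), fun z hz =>
    hηu z (annulus_mono hρ hρr.le hz), fun w => Ring.inverse (m w), differentiableOn_inverse hm hmu,
    fun w hw => isUnit_inverse (hmu w hw), fun z hz hz1 => ?_⟩
  rw [hβ z (by simpa using hz1), inverse_inverse (hmu _ (inv_mem_ball hr hz)), hgm z ⟨hz, hz1⟩]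

end

section

/-! ### Continuity of the left action -/

section Derivative

variable {𝔸 : Type*} [NormedRing 𝔸] [NormedAlgebra ℂ 𝔸]

theorem norm_deriv_ev_le {r R : ℝ} (h : r < R) (f : Hol (Metric.ball 0 R) 𝔸) {z : ℂ}
    (hz : z ∈ Metric.ball (0 : ℂ) r) : ‖deriv f.ev z‖ ≤ (2 / (R - r)) * ‖f‖ := by
  have h2 : 0 < (R - r) / 2 := by linarith
  have hsub : Metric.closedBall z ((R - r) / 2) ⊆ Metric.ball 0 R := by
    refine Metric.closedBall_subset_ball' ?_
    have : dist z 0 < r := hz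
    linarith
  refine (Complex.norm_deriv_le_of_forall_mem_sphere_norm_le h2 (C := ‖f‖) ?_
    fun w _ => f.norm_ev_le w).trans_eq (by field_simp)
  refine DifferentiableOn.diffContOnCl (f.differentiableOn.mono ?_)
  rwa [closure_ball _ h2.ne']

theorem differentiableAt_ev {R : ℝ} (f : Hol (Metric.ball 0 R) 𝔸) {z : ℂ}
    (hz : z ∈ Metric.ball (0 : ℂ) R) : DifferentiableAt ℂ f.ev z :=
  f.differentiableOn.differentiableAt (Metric.isOpen_ball.mem_nhds hz)

variable [CompleteSpace 𝔸]

theorem differentiableOn_deriv_ev {r R : ℝ} (h : r < R) (f : Hol (Metric.ball 0 R) 𝔸) :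
    DifferentiableOn ℂ (deriv f.ev) (Metric.ball 0 r) :=
  (f.differentiableOn.deriv Metric.isOpen_ball).mono (Metric.ball_subset_ball h.le)

/-- Differentiation as a bounded operator between algebras of bounded holomorphic functions on
concentric discs. -/
def derivOn {r R : ℝ} (h : r < R) : Hol (Metric.ball 0 R) 𝔸 →L[ℂ] Hol (Metric.ball 0 r) 𝔸 :=
  LinearMap.mkContinuous
    { toFun := fun f => Hol.mk (deriv f.ev) (differentiableOn_deriv_ev h f) _
        fun _ hz => norm_deriv_ev_le h f hz
      map_add' := fun f g => Hol.ext_ev fun z hz => by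
        have hz' := Metric.ball_subset_ball h.le hz
        rw [Hol.ev_add, Hol.ev_mk _ _ hz, Hol.ev_mk _ _ hz, Hol.ev_mk _ _ hz,
          ← deriv_add (differentiableAt_ev f hz') (differentiableAt_ev g hz')]
        congr 1
        ext1 w
        exact Hol.ev_add f g w
      map_smul' := fun a f => Hol.ext_ev fun z hz => by
        have hz' := Metric.ball_subset_ball h.le hz
        rw [RingHom.id_apply, Hol.ev_smul, Hol.ev_mk _ _ hz, Hol.ev_mk _ _ hz,
          ← deriv_const_smul a (differentiableAt_ev f hz')]
        congr 1
        ext1 w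
        exact Hol.ev_smul a f w }
    (2 / (R - r)) fun f => by
      have : 0 < R - r := by linarith
      refine Hol.norm_le _ (by positivity) fun z hz => ?_
      simp only [LinearMap.coe_mk, AddHom.coe_mk]
      rw [Hol.ev_mk _ _ hz]
      exact norm_deriv_ev_le h f hz

theorem ev_derivOn {r R : ℝ} (h : r < R) (f : Hol (Metric.ball 0 R) 𝔸) {z : ℂ}
    (hz : z ∈ Metric.ball (0 : ℂ) r) : (derivOn h f).ev z = deriv f.ev z :=
  Hol.ev_mk (differentiableOn_deriv_ev h f) (fun _ hz => norm_deriv_ev_le h f hz) hz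

end Derivative

variable {V : Type*} [NormedAddCommGroup V] [InnerProductSpace ℂ V] [CompleteSpace V]
  {G : Subgroup (unitary (Mat V))}

theorem isUnit_res {𝔸 : Type*} [NormedRing 𝔸] [NormedAlgebra ℂ 𝔸] {Ω Ω' : Set ℂ} (h : Ω' ⊆ Ω)
    {x : Hol Ω 𝔸} (hx : IsUnit x) : IsUnit (Hol.res h x) := by
  obtain ⟨u, rfl⟩ := hx
  refine ⟨⟨Hol.res h u.1, Hol.res h u.2, ?_, ?_⟩, rfl⟩ <;>
  · rw [← Hol.res_mul]; simp [Hol.res_one]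

theorem res_frameOn {r R : ℝ} (h : r ≤ R) (hR : R < 1) (α : Forms G) :
    Hol.res (Metric.ball_subset_ball h) (frameOn R α) = frameOn r α :=
  Hol.ext_ev fun z hz => by
    rw [Hol.ev_res _ _ hz, ev_frameOn hR α (Metric.ball_subset_ball h hz),
      ev_frameOn (h.trans_lt hR) α hz]

theorem deriv_ev_frameOn {R : ℝ} (hR : R < 1) (α : Forms G) {z : ℂ}
    (hz : z ∈ Metric.ball (0 : ℂ) R) : deriv (frameOn R α).ev z = deriv (frame α) z :=
  Filter.EventuallyEq.deriv_eq <| by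
    filter_upwards [Metric.isOpen_ball.mem_nhds hz] with w hw using ev_frameOn hR α hw

/-- Forms depend continuously on their frames. -/
theorem tendsto_of_tendsto_frameOn {ι : Type*} {l : Filter ι} {a : ι → Forms G} {α : Forms G}
    {ρ : ℝ} (hρ : ρ < 1) (h : ∀ R, ρ < R → R < 1 → Tendsto (fun i => frameOn R (a i)) l (𝓝 (frameOn R α))) :
    Tendsto a l (𝓝 α) := by
  rw [tendsto_forms_iff]
  intro r hr
  obtain ⟨r', hr', hr'1⟩ := exists_between hr
  obtain ⟨R, hR, hR1⟩ := exists_between (max_lt hr'1 hρ)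
  have hrR : r' < R := (le_max_left _ _).trans_lt hR
  have hF := h R ((le_max_right _ _).trans_lt hR) hR1
  have hsub := Metric.ball_subset_ball (x := (0 : ℂ)) hrR.le
  have := Hol.completeSpace (𝔸 := Mat V) (Metric.isOpen_ball (x := (0 : ℂ)) (ε := r'))
  have hu := isUnit_res hsub (isUnit_frameOn hR1 α)
  have hev : ∀ β : Forms G, ∀ z ∈ Metric.ball (0 : ℂ) r',
      (Ring.inverse (Hol.res hsub (frameOn R β)) * derivOn hrR (frameOn R β)).ev z =
        formFun β z := fun β z hz => by
    rw [Hol.ev_mul, Hol.ev_inverse (isUnit_res hsub (isUnit_frameOn hR1 β)) hz, Hol.ev_res _ _ hz,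
      ev_derivOn hrR _ hz, deriv_ev_frameOn hR1 β (hsub hz), ev_frameOn hR1 β (hsub hz),
      formFun_eq_of_frame β (Metric.ball_subset_ball hr'1.le hz)]
  have hlim : Tendsto (fun i => Ring.inverse (Hol.res hsub (frameOn R (a i))) *
      derivOn hrR (frameOn R (a i))) l (𝓝 (Ring.inverse (Hol.res hsub (frameOn R α)) *
      derivOn hrR (frameOn R α))) := by
    refine Tendsto.mul ?_ (((derivOn hrR).continuous.tendsto _).comp hF)
    obtain ⟨u, hu⟩ := hu
    have h1 := NormedRing.inverse_continuousAt u
    rw [hu] at h1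
    exact h1.tendsto.comp (((Hol.res hsub).continuous.tendsto _).comp hF)
  have hsub' : Metric.closedBall (0 : ℂ) r ⊆ Metric.ball 0 r' := Metric.closedBall_subset_ball hr'
  exact ((Hol.tendstoUniformly hlim).tendstoUniformlyOn.congr
    (Eventually.of_forall fun i z hz => hev (a i) z (hsub' hz))).congr_right
      fun z hz => hev α z (hsub' hz)

section Action

variable {ι : Type*} {l : Filter ι} {η : ι → ℂ → Mat V} {a b : ι → Forms G} {α : Forms G} {ρ : ℝ}

/-- When the loops `η` tend to `1`, so do the functions `g⁻¹ η g`, locally uniformly in the form. -/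
theorem tendsto_conjDefect (hρ : 0 < ρ) (hη : ∀ᶠ i in l, DifferentiableOn ℂ (η i) (annulus ρ))
    (hlim : TendstoUniformlyOn η 1 l (annulus ρ)) (ha : Tendsto a l (𝓝 α)) {r R : ℝ} (hr : ρ < r)
    (hrR : r < R) (hR : R < 1) : Tendsto (fun i => conjDefect r R (η i) (a i)) l (𝓝 0) := by
  have hρ1 : ρ < 1 := hr.trans (hrR.trans hR)
  have hcomp := Hol.completeSpace (𝔸 := Mat V) (isOpen_ann r R)
  have hx := ((toAnn r R).continuous.tendsto (frameOn R α)).comp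
    (((continuous_frameOn hR).tendsto α).comp ha)
  have hu := isUnit_toAnn (r := r) (isUnit_frameOn hR α)
  have hi : Tendsto (fun i => Ring.inverse (toAnn r R (frameOn R (a i)))) l
      (𝓝 (Ring.inverse (toAnn r R (frameOn R α)))) := by
    obtain ⟨u, hu⟩ := hu
    have h1 := NormedRing.inverse_continuousAt u
    rw [hu] at h1
    exact h1.tendsto.comp hx
  have hs : ann r R ⊆ annulus ρ := fun z hz =>
    closedAnn_subset hρ hρ1 hr hR (ann_subset_closedAnn r R hz)
  have hη1 : Tendsto (fun i => Hol.of (ann r R) (η i)) l (𝓝 1) := by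
    refine Hol.tendsto_of (((hlim.mono hs).congr ?_).congr_right fun z hz => (Hol.ev_one hz).symm)
    filter_upwards [hη] with i hi z hz
    exact (ev_of_annulus hρ hρ1 hr hR hi hz).symm
  have := ((hi.mul hη1).mul hx).sub_const 1
  rwa [mul_one, Ring.inverse_mul_cancel _ hu, sub_self] at this

theorem eventually_isUnit_of_tendsto_one (hlim : TendstoUniformlyOn η 1 l (annulus ρ)) :
    ∀ᶠ i in l, ∀ z ∈ annulus ρ, IsUnit (η i z) := by
  filter_upwards [Metric.tendstoUniformlyOn_iff.1 hlim (1 / 2) (by norm_num)] with i hi z hz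
  refine isUnit_of_norm_sub_one_le_half ?_
  have := hi z hz
  rw [dist_comm, dist_eq_norm] at this
  exact this.le

/-- Continuity of the left action near the identity. -/
theorem tendsto_of_actsTo (hρ : 0 < ρ) (hρ1 : ρ < 1)
    (hη : ∀ᶠ i in l, DifferentiableOn ℂ (η i) (annulus ρ))
    (hlim : TendstoUniformlyOn η 1 l (annulus ρ)) (ha : Tendsto a l (𝓝 α))
    (hb : ∀ᶠ i in l, ActsTo (η i) (a i) (b i)) : Tendsto b l (𝓝 α) := by
  refine tendsto_of_tendsto_frameOn hρ1 fun R hR hR1 => ?_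
  obtain ⟨r, hr, hrR⟩ := exists_between hR
  have hd := tendsto_conjDefect hρ hη hlim ha hr hrR hR1
  have h1 := (((continuous_frameOn hR1).tendsto α).comp ha).mul (tendsto_innerFactor.comp hd)
  rw [mul_one] at h1
  refine h1.congr' ?_
  filter_upwards [hη, eventually_isUnit_of_tendsto_one hlim, hb,
    hd.eventually (eventually_isGoodDefect (hρ.trans hr) hrR (one_half_pos (α := ℝ)))]
    with i h1 h2 h3 h4
  exact (ActsTo.frameOn_eq hρ hr hrR hR1 le_rfl h1 h2 h4 h3).symm

/-- Loops close to `1` act near a given form: the frame of `η · α` is `g` times the factor,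
extending over the disc, of the Birkhoff factorisation of `g⁻¹ η g`. -/
theorem eventually_exists_actsTo [FiniteDimensional ℂ V] (hρ : 0 < ρ) (hρ1 : ρ < 1)
    (hη : ∀ᶠ i in l, DifferentiableOn ℂ (η i) (annulus ρ) ∧
      (∀ z ∈ annulus ρ, ∀ X ∈ complexLie G, Ring.inverse (η i z) * X * η i z ∈ complexLie G) ∧
      ∀ z ∈ annulus ρ, Ring.inverse (η i z) * deriv (η i) z ∈ complexLie G)
    (hlim : TendstoUniformlyOn η 1 l (annulus ρ)) (ha : Tendsto a l (𝓝 α)) :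
    ∀ᶠ i in l, ∃ β, ActsTo (η i) (a i) β := by
  obtain ⟨r, hr, hr1⟩ := exists_between hρ1
  obtain ⟨R, hR, hR1⟩ := exists_between hr1
  have hd := tendsto_conjDefect hρ (hη.mono fun i hi => hi.1) hlim ha hr hR hR1
  filter_upwards [hη, eventually_isUnit_of_tendsto_one hlim,
    hd.eventually (eventually_isGoodDefect (hρ.trans hr) hR (lieRadius_pos (G := G)))] with i h1 h2 h3
  exact exists_actsTo hρ hr hR hR1 h1.1 h2 (a i) h1.2.1 h1.2.2 h3

end Action

end

section

/-! ### The Lie algebra of a closed subgroup of the unitary group -/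

variable {V : Type*} [NormedAddCommGroup V] [InnerProductSpace ℂ V] [CompleteSpace V]
  {G : Subgroup (unitary (Mat V))}

theorem real_smul_eq (t : ℝ) (X : Mat V) : t • X = (t : ℂ) • X := by
  ext v; simp

variable (G) in
/-- The elements of `G` as a monoid of matrices. -/
def matGroup : Submonoid (Mat V) := G.toSubmonoid.map (unitary (Mat V)).subtype

theorem mem_matGroup {X : Mat V} : X ∈ matGroup G ↔ ∃ g ∈ G, X = (g : Mat V) :=
  ⟨fun ⟨g, hg, h⟩ => ⟨g, hg, h.symm⟩, fun ⟨g, hg, h⟩ => ⟨g, hg, h.symm⟩⟩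

theorem mem_realLie {X : Mat V} :
    X ∈ realLie G ↔ ∀ t : ℝ, NormedSpace.exp ((t : ℂ) • X) ∈ matGroup G := by
  simp only [realLie, Set.mem_ofPred_eq, real_smul_eq, mem_matGroup, eq_comm]

theorem isClosed_matGroup (hclosed : IsClosed (G : Set (unitary (Mat V)))) :
    IsClosed (matGroup G : Set (Mat V)) :=
  (isClosed_unitary (R := Mat V)).isClosedEmbedding_subtypeVal.isClosedMap _ hclosed

theorem star_mem_matGroup {g : Mat V} (hg : g ∈ matGroup G) : star g ∈ matGroup G := by
  obtain ⟨x, hx, rfl⟩ := mem_matGroup.1 hg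
  exact mem_matGroup.2 ⟨x⁻¹, G.inv_mem hx, rfl⟩

theorem star_mul_self_of_mem {g : Mat V} (hg : g ∈ matGroup G) : star g * g = 1 := by
  obtain ⟨x, hx, rfl⟩ := mem_matGroup.1 hg
  exact Unitary.coe_star_mul_self x

theorem self_mul_star_of_mem {g : Mat V} (hg : g ∈ matGroup G) : g * star g = 1 := by
  obtain ⟨x, hx, rfl⟩ := mem_matGroup.1 hg
  exact Unitary.coe_mul_star_self x

theorem isUnit_of_mem_matGroup {g : Mat V} (hg : g ∈ matGroup G) : IsUnit g :=
  ⟨⟨g, star g, self_mul_star_of_mem hg, star_mul_self_of_mem hg⟩, rfl⟩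

theorem inverse_of_mem_matGroup {g : Mat V} (hg : g ∈ matGroup G) : Ring.inverse g = star g :=
  Ring.inverse_unit ⟨g, star g, self_mul_star_of_mem hg, star_mul_self_of_mem hg⟩

theorem norm_mul_of_mem_matGroup {g : Mat V} (hg : g ∈ matGroup G) (X : Mat V) :
    ‖g * X‖ = ‖X‖ := by
  obtain ⟨x, hx, rfl⟩ := mem_matGroup.1 hg
  exact CStarRing.norm_coe_unitary_mul x X

section Exp

variable {𝔸 : Type*} [NormedRing 𝔸] [NormedAlgebra ℂ 𝔸] [CompleteSpace 𝔸]

theorem exp_pow (X : 𝔸) (n : ℕ) : NormedSpace.exp X ^ n = NormedSpace.exp (n • X) := by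
  letI := NormedAlgebra.restrictScalars ℚ ℂ 𝔸
  exact (NormedSpace.exp_nsmul n X).symm

theorem isUnit_exp (X : 𝔸) : IsUnit (NormedSpace.exp X) := by
  letI := NormedAlgebra.restrictScalars ℚ ℂ 𝔸
  exact NormedSpace.isUnit_exp X

theorem exp_mul_exp {X Y : 𝔸} (h : Commute X Y) :
    NormedSpace.exp X * NormedSpace.exp Y = NormedSpace.exp (X + Y) := by
  letI := NormedAlgebra.restrictScalars ℚ ℂ 𝔸
  exact (NormedSpace.exp_add_of_commute h).symm

theorem exp_neg_eq_inverse (X : 𝔸) : NormedSpace.exp (-X) = Ring.inverse (NormedSpace.exp X) := by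
  have h : NormedSpace.exp X * NormedSpace.exp (-X) = 1 := by
    rw [exp_mul_exp (Commute.neg_right (Commute.refl X)), add_neg_cancel, NormedSpace.exp_zero]
  rw [← Ring.inverse_mul_cancel_left _ (NormedSpace.exp (-X)) (isUnit_exp X), h, mul_one]

theorem conj_exp {g : 𝔸} (hg : IsUnit g) (X : 𝔸) :
    NormedSpace.exp (g * X * Ring.inverse g) = g * NormedSpace.exp X * Ring.inverse g := by
  letI := NormedAlgebra.restrictScalars ℚ ℂ 𝔸
  obtain ⟨u, rfl⟩ := hg
  rw [Ring.inverse_unit]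
  exact NormedSpace.exp_units_conj u X

end Exp

theorem hasDerivAt_exp_smul (X : Mat V) (t : ℂ) :
    HasDerivAt (fun s : ℂ => NormedSpace.exp (s • X)) (NormedSpace.exp (t • X) * X) t :=
  hasDerivAt_exp_smul_const X t

theorem hasDerivAt_exp_real (X : Mat V) (t : ℝ) :
    HasDerivAt (fun s : ℝ => NormedSpace.exp ((s : ℂ) • X)) (NormedSpace.exp ((t : ℂ) • X) * X) t :=
  by simpa [Function.comp_def] using (hasDerivAt_exp_smul X (t : ℂ)).scomp t (Complex.ofRealCLM.hasDerivAt (x := t))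

theorem norm_pow_sub_pow_le {a b : Mat V} (ha : a ∈ matGroup G) {C : ℝ} {n : ℕ}
    (hb : ∀ k < n, ‖b ^ k‖ ≤ C) : ‖a ^ n - b ^ n‖ ≤ n * (C * ‖a - b‖) := by
  induction n with
  | zero => simp
  | succ n ih =>
    have h : a ^ (n + 1) - b ^ (n + 1) = a * (a ^ n - b ^ n) + (a - b) * b ^ n := by
      rw [pow_succ', pow_succ']; noncomm_ring
    rw [h]
    refine (norm_add_le _ _).trans ?_
    rw [norm_mul_of_mem_matGroup ha]
    have h1 := ih fun k hk => hb k (hk.trans n.lt_succ_self)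
    have h2 : ‖(a - b) * b ^ n‖ ≤ ‖a - b‖ * C :=
      (norm_mul_le _ _).trans (by gcongr; exact hb n n.lt_succ_self)
    push_cast
    linarith

/-- The velocity of a curve in a closed group lies in its Lie algebra: `γ(s/n)^n → exp(sX)`. -/
theorem mem_realLie_of_hasDerivAt (hclosed : IsClosed (G : Set (unitary (Mat V))))
    {γ : ℝ → Mat V} (hγ : ∀ᶠ t in 𝓝 (0 : ℝ), γ t ∈ matGroup G) (h0 : γ 0 = 1) {X : Mat V}
    (hX : HasDerivAt γ X 0) : X ∈ realLie G := by
  rw [mem_realLie]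
  intro s
  set e : ℝ → Mat V := fun t => NormedSpace.exp ((t : ℂ) • X) with he
  have he0 : e 0 = 1 := by simp [he]
  have hd : HasDerivAt (fun t => γ t - e t) 0 0 := by
    have h := hX.fun_sub (hasDerivAt_exp_real X 0)
    simpa [he] using h
  have hcont : Continuous e :=
    continuous_iff_continuousAt.2 fun t => (hasDerivAt_exp_real X t).continuousAt
  obtain ⟨C, hC⟩ := (isCompact_Icc (a := -|s|) (b := |s|)).exists_bound_of_continuousOn
    hcont.continuousOn
  have hC0 : 0 ≤ C := (norm_nonneg _).trans (hC 0 (by simp))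
  have hlim : Tendsto (fun n : ℕ => s / n) atTop (𝓝 0) := tendsto_const_div_atTop_nhds_zero_nat s
  have hpow : ∀ (k : ℕ) (t : ℝ), e t ^ k = e (k * t) := fun k t => by
    simp only [he]
    rw [exp_pow, ← Nat.cast_smul_eq_nsmul ℂ, smul_smul]
    push_cast
    rfl
  refine (isClosed_matGroup hclosed).mem_of_tendsto (b := atTop)
    (f := fun n : ℕ => γ (s / n) ^ n) ?_ ?_
  · rw [tendsto_iff_norm_sub_tendsto_zero, Metric.tendsto_atTop']
    intro ε hε
    have ho := (hasDerivAt_iff_isLittleO_nhds_zero.1 hd).def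
      (show 0 < ε / ((C + 1) * (|s| + 1)) by positivity)
    obtain ⟨N, hN⟩ := ((hlim.eventually ho).and (hlim.eventually hγ)).exists_forall_of_atTop
    refine ⟨N, fun n hn => ?_⟩
    have hn0 : (0 : ℝ) < n := by exact_mod_cast (Nat.zero_le N).trans_lt hn
    obtain ⟨h1, h2⟩ := hN n hn.le
    simp only [zero_add, h0, he0, sub_self, sub_zero, smul_zero] at h1
    have h3 : e (s / n) ^ n = e s := by
      rw [hpow]; congr 1; field_simp
    have h4 := norm_pow_sub_pow_le (b := e (s / n)) h2 (C := C) (n := n) fun k hk => by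
      rw [hpow]
      refine hC _ (abs_le.1 ?_)
      rw [abs_mul, abs_div, Nat.abs_cast, Nat.abs_cast, ← mul_div_assoc, div_le_iff₀ hn0, mul_comm]
      have : (k : ℝ) ≤ n := by exact_mod_cast hk.le
      gcongr
    rw [h3] at h4
    rw [Real.dist_eq, sub_zero, abs_of_nonneg (norm_nonneg _)]
    refine h4.trans_lt ?_
    rw [Real.norm_eq_abs, abs_div, Nat.abs_cast] at h1
    calc (n : ℝ) * (C * ‖γ (s / n) - e (s / n)‖)
        ≤ n * (C * (ε / ((C + 1) * (|s| + 1)) * (|s| / n))) := by gcongr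
      _ = ε * (C / (C + 1)) * (|s| / (|s| + 1)) := by field_simp
      _ < ε := by
        have h5 : C / (C + 1) < 1 := (div_lt_one (by positivity)).2 (by linarith)
        have h6 : |s| / (|s| + 1) < 1 := (div_lt_one (by positivity)).2 (by linarith)
        have h7 : 0 ≤ C / (C + 1) := by positivity
        have h8 : 0 ≤ |s| / (|s| + 1) := by positivity
        have h9 : C / (C + 1) * (|s| / (|s| + 1)) < 1 := mul_lt_one_of_nonneg_of_lt_one_left h7 h5 h6.le
        nlinarith
  · filter_upwards [hlim.eventually hγ] with n hn using pow_mem hn n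

/-- `𝔤` as a real linear subspace. -/
def realSub (hclosed : IsClosed (G : Set (unitary (Mat V)))) : Submodule ℝ (Mat V) where
  carrier := realLie G
  zero_mem' := mem_realLie.2 fun t => by simp
  add_mem' {X Y} hX hY := by
    refine mem_realLie_of_hasDerivAt hclosed
      (γ := fun t => NormedSpace.exp ((t : ℂ) • X) * NormedSpace.exp ((t : ℂ) • Y))
      (Eventually.of_forall fun t => mul_mem (mem_realLie.1 hX t) (mem_realLie.1 hY t)) (by simp) ?_
    simpa using (hasDerivAt_exp_real X 0).fun_mul (hasDerivAt_exp_real Y 0)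
  smul_mem' a X hX := mem_realLie.2 fun t => by
    rw [real_smul_eq, smul_smul]
    simpa using mem_realLie.1 hX (t * a)

theorem star_eq_neg_of_mem_realLie {X : Mat V} (hX : X ∈ realLie G) : star X = -X := by
  have h : ∀ t : ℝ, NormedSpace.exp ((t : ℂ) • star X) * NormedSpace.exp ((t : ℂ) • X) = 1 := by
    intro t
    have := star_mul_self_of_mem (mem_realLie.1 hX t)
    rwa [NormedSpace.star_exp, star_smul, Complex.star_def, Complex.conj_ofReal] at this
  have hd := (hasDerivAt_exp_real (star X) 0).mul (hasDerivAt_exp_real X 0)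
  have h1 : (fun s : ℝ => NormedSpace.exp ((s : ℂ) • star X)) *
      (fun s : ℝ => NormedSpace.exp ((s : ℂ) • X)) = fun _ => 1 := funext h
  rw [h1] at hd
  have := hd.unique (hasDerivAt_const 0 1)
  simp only [Complex.ofReal_zero, zero_smul, NormedSpace.exp_zero, one_mul, mul_one] at this
  exact eq_neg_of_add_eq_zero_left this

theorem conj_mem_realLie {g X : Mat V} (hg : g ∈ matGroup G) (hX : X ∈ realLie G) :
    g * X * Ring.inverse g ∈ realLie G := by
  refine mem_realLie.2 fun t => ?_
  rw [show (t : ℂ) • (g * X * Ring.inverse g) = g * ((t : ℂ) • X) * Ring.inverse g by simp,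
    conj_exp (isUnit_of_mem_matGroup hg), inverse_of_mem_matGroup hg]
  exact mul_mem (mul_mem hg (mem_realLie.1 hX t)) (star_mem_matGroup hg)

theorem mem_of_hasDerivAt {E : Type*} [NormedAddCommGroup E] [NormedSpace ℝ E] {S : Submodule ℝ E}
    (hS : IsClosed (S : Set E)) {γ : ℝ → E} (hγ : ∀ t, γ t ∈ S) {X : E} {t : ℝ}
    (hX : HasDerivAt γ X t) : X ∈ S := by
  refine hS.mem_of_tendsto (hasDerivAt_iff_tendsto_slope.1 hX) (Eventually.of_forall fun s => ?_)
  exact S.smul_mem _ (S.sub_mem (hγ s) (hγ t))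

variable [FiniteDimensional ℂ V]

theorem isClosed_realSub (hclosed : IsClosed (G : Set (unitary (Mat V)))) :
    IsClosed (realSub hclosed : Set (Mat V)) := by
  have : FiniteDimensional ℝ (Mat V) := inferInstance
  exact Submodule.closed_of_finiteDimensional _

theorem lie_mem_realLie (hclosed : IsClosed (G : Set (unitary (Mat V)))) {X Y : Mat V}
    (hX : X ∈ realLie G) (hY : Y ∈ realLie G) : X * Y - Y * X ∈ realLie G := by
  refine mem_of_hasDerivAt (isClosed_realSub hclosed) (t := 0)
    (γ := fun t : ℝ => NormedSpace.exp ((t : ℂ) • X) * Y * NormedSpace.exp ((t : ℂ) • (-X)))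
    (fun t => ?_) ?_
  · rw [smul_neg, exp_neg_eq_inverse]
    exact conj_mem_realLie (mem_realLie.1 hX t) hY
  · have := ((hasDerivAt_exp_real X 0).mul_const Y).fun_mul (hasDerivAt_exp_real (-X) 0)
    simpa [sub_eq_add_neg] using this

section LieSub

attribute [local instance 100] LieRing.ofAssociativeRing

theorem realLie_subset {X : Mat V} (hX : X ∈ realLie G) : X ∈ complexLie G :=
  LieSubalgebra.subset_lieSpan hX

/-- `𝔤_ℂ = 𝔤 + i𝔤`. -/
theorem exists_eq_add_I_smul (hclosed : IsClosed (G : Set (unitary (Mat V)))) {X : Mat V}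
    (hX : X ∈ complexLie G) :
    ∃ A ∈ realLie G, ∃ B ∈ realLie G, X = A + Complex.I • B := by
  have hsub : ∀ {A B : Mat V}, A ∈ realLie G → B ∈ realLie G → A - B ∈ realLie G :=
    fun hA hB => (realSub hclosed).sub_mem hA hB
  have hadd : ∀ {A B : Mat V}, A ∈ realLie G → B ∈ realLie G → A + B ∈ realLie G :=
    fun hA hB => (realSub hclosed).add_mem hA hB
  have hsmul : ∀ (a : ℝ) {A : Mat V}, A ∈ realLie G → (a : ℂ) • A ∈ realLie G :=
    fun a A hA => real_smul_eq a A ▸ (realSub hclosed).smul_mem a hA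
  have h0 : (0 : Mat V) ∈ realLie G := (realSub hclosed).zero_mem
  induction hX using LieSubalgebra.lieSpan_induction with
  | mem X hX => exact ⟨X, hX, 0, h0, by simp⟩
  | zero => exact ⟨0, h0, 0, h0, by simp⟩
  | add X Y _ _ hX hY =>
    obtain ⟨A, hA, B, hB, rfl⟩ := hX
    obtain ⟨A', hA', B', hB', rfl⟩ := hY
    exact ⟨A + A', hadd hA hA', B + B', hadd hB hB', by rw [smul_add]; abel⟩
  | smul a X _ hX =>
    obtain ⟨A, hA, B, hB, rfl⟩ := hX
    refine ⟨_, hsub (hsmul a.re hA) (hsmul a.im hB), _, hadd (hsmul a.re hB) (hsmul a.im hA), ?_⟩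
    have hI : a * Complex.I = Complex.I * a.re - a.im := by
      conv_lhs => rw [← Complex.re_add_im a]
      linear_combination (a.im : ℂ) * Complex.I_mul_I
    rw [smul_add, smul_add, smul_smul, smul_smul, smul_smul, hI, sub_smul]
    nth_rewrite 1 [← Complex.re_add_im a]
    rw [add_smul, mul_comm (a.im : ℂ)]
    abel
  | lie X Y _ _ hX hY =>
    obtain ⟨A, hA, B, hB, rfl⟩ := hX
    obtain ⟨A', hA', B', hB', rfl⟩ := hY
    refine ⟨_, hsub (lie_mem_realLie hclosed hA hA') (lie_mem_realLie hclosed hB hB'),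
      _, hadd (lie_mem_realLie hclosed hA hB') (lie_mem_realLie hclosed hB hA'), ?_⟩
    rw [Ring.lie_def]
    simp only [mul_add, add_mul, smul_mul_assoc, mul_smul_comm, smul_smul, Complex.I_mul_I,
      smul_sub, smul_add, neg_smul, one_smul]
    abel

end LieSub

theorem star_mem_complexLie (hclosed : IsClosed (G : Set (unitary (Mat V)))) {X : Mat V}
    (hX : X ∈ complexLie G) : star X ∈ complexLie G := by
  obtain ⟨A, hA, B, hB, rfl⟩ := exists_eq_add_I_smul hclosed hX
  rw [star_add, star_smul, star_eq_neg_of_mem_realLie hA, star_eq_neg_of_mem_realLie hB]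
  have h : ∀ {A : Mat V}, A ∈ realLie G → A ∈ lieSub G := realLie_subset
  exact mem_lieSub.1 ((lieSub G).add_mem ((lieSub G).neg_mem (h hA))
    ((lieSub G).smul_mem _ ((lieSub G).neg_mem (h hB))))

/-- The skew-Hermitian elements of `𝔤_ℂ` form `𝔤`. -/
theorem mem_realLie_of_star_eq_neg (hclosed : IsClosed (G : Set (unitary (Mat V)))) {X : Mat V}
    (hX : X ∈ complexLie G) (hs : star X = -X) : X ∈ realLie G := by
  obtain ⟨A, hA, B, hB, rfl⟩ := exists_eq_add_I_smul hclosed hX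
  rw [star_add, star_smul, star_eq_neg_of_mem_realLie hA, star_eq_neg_of_mem_realLie hB,
    Complex.star_def, Complex.conj_I, neg_smul, smul_neg, neg_neg, neg_add,
    add_right_inj] at hs
  have h2 : (2 : ℂ) • Complex.I • B = 0 := by
    rw [two_smul]; nth_rewrite 1 [hs]; simp
  have h3 : Complex.I • B = 0 := by simpa using h2
  rwa [h3, add_zero]

theorem conj_mem_complexLie (hclosed : IsClosed (G : Set (unitary (Mat V)))) {g X : Mat V}
    (hg : g ∈ matGroup G) (hX : X ∈ complexLie G) :
    g * X * Ring.inverse g ∈ complexLie G := by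
  obtain ⟨A, hA, B, hB, rfl⟩ := exists_eq_add_I_smul hclosed hX
  have h : ∀ {A : Mat V}, A ∈ realLie G → A ∈ lieSub G := realLie_subset
  rw [show g * (A + Complex.I • B) * Ring.inverse g =
    g * A * Ring.inverse g + Complex.I • (g * B * Ring.inverse g) by
      simp [mul_add, add_mul]]
  exact mem_lieSub.1 ((lieSub G).add_mem (h (conj_mem_realLie hg hA))
    ((lieSub G).smul_mem _ (h (conj_mem_realLie hg hB))))

end

section

/-! ### The identity theorem on annuli around the unit circle -/

section Identity

variable {E : Type*} [NormedAddCommGroup E] [NormedSpace ℂ E]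

theorem exists_annulus_subset {W : Set ℂ} (hW : IsOpen W) (h : Metric.sphere (0 : ℂ) 1 ⊆ W) :
    ∃ ρ : ℝ, 0 < ρ ∧ ρ < 1 ∧ annulus ρ ⊆ W := by
  obtain ⟨δ, hδ, hsub⟩ := (isCompact_sphere (0 : ℂ) 1).exists_thickening_subset_open hW h
  refine ⟨(1 + δ)⁻¹, by positivity, inv_lt_one_of_one_lt₀ (by linarith), fun z hz => hsub ?_⟩
  obtain ⟨h1, h2⟩ := hz
  rw [inv_inv] at h2
  have h0 : 0 < ‖z‖ := lt_trans (by positivity) h1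
  have h3 : 1 - δ < ‖z‖ := by
    refine lt_of_le_of_lt ?_ h1
    rw [← one_div, le_div_iff₀ (by positivity)]
    nlinarith
  refine Metric.mem_thickening_iff.2 ⟨(‖z‖⁻¹ : ℝ) • z, by
    rw [mem_sphere_zero_iff_norm, norm_smul, norm_inv, norm_norm, inv_mul_cancel₀ h0.ne'], ?_⟩
  have h4 : z - (‖z‖⁻¹ : ℝ) • z = ((‖z‖ - 1) * ‖z‖⁻¹ : ℝ) • z := by
    rw [sub_mul, mul_inv_cancel₀ h0.ne', one_mul, sub_smul, one_smul]
  rw [dist_eq_norm, h4, norm_smul, norm_mul, norm_inv, norm_norm, mul_assoc,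
    inv_mul_cancel₀ h0.ne', mul_one, Real.norm_eq_abs, abs_lt]
  constructor <;> linarith

variable [CompleteSpace E] {ρ : ℝ}

theorem log_norm_mem {z : ℂ} (hρ : 0 < ρ) (hz : z ∈ annulus ρ) :
    Complex.log z ∈ {w : ℂ | Complex.exp w ∈ annulus ρ} := by
  have : z ≠ 0 := norm_pos_iff.1 (hρ.trans hz.1)
  simpa [Complex.exp_log this] using hz

/-- A holomorphic function on an annulus that vanishes on the unit circle is zero. -/
theorem eq_zero_of_circle (hρ : 0 < ρ) (hρ1 : ρ < 1) {f : ℂ → E}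
    (hf : DifferentiableOn ℂ f (annulus ρ)) (h : ∀ z : Circle, f z = 0) {z : ℂ}
    (hz : z ∈ annulus ρ) : f z = 0 := by
  set S : Set ℂ := {w | Complex.exp w ∈ annulus ρ} with hS
  have hSeq : S = Complex.re ⁻¹' Set.Ioo (Real.log ρ) (Real.log ρ⁻¹) := by
    ext w
    simp only [hS, annulus, Set.mem_ofPred_eq, Complex.norm_exp, Set.mem_preimage, Set.mem_Ioo]
    rw [Real.log_lt_iff_lt_exp hρ, Real.lt_log_iff_exp_lt (inv_pos.2 hρ)]
  have hconv : Convex ℝ S := by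
    rw [hSeq]
    exact (convex_Ioo _ _).linear_preimage Complex.reLm
  have hopen : IsOpen S := (isOpen_annulus ρ).preimage Complex.continuous_exp
  have han : AnalyticOnNhd ℂ (fun w => f (Complex.exp w)) S :=
    (hf.comp Complex.differentiable_exp.differentiableOn fun w hw => hw).analyticOnNhd hopen
  have h0 : (0 : ℂ) ∈ S := by
    simp [hS, annulus, hρ1, one_lt_inv₀ hρ]
  have hfreq : ∃ᶠ w in 𝓝[≠] (0 : ℂ), f (Complex.exp w) = 0 := by
    have hlim : Tendsto (fun t : ℝ => (t : ℂ) * Complex.I) (𝓝[≠] 0) (𝓝[≠] 0) := by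
      refine tendsto_nhdsWithin_iff.2 ⟨?_, ?_⟩
      · have : Continuous fun t : ℝ => (t : ℂ) * Complex.I := by fun_prop
        exact (this.tendsto' 0 0 (by simp)).mono_left nhdsWithin_le_nhds
      · filter_upwards [self_mem_nhdsWithin] with t ht
        simpa using ht
    refine hlim.frequently (Eventually.of_forall fun t => ?_).frequently
    simpa using h (Circle.exp t)
  have := han.eqOn_of_preconnected_of_frequently_eq (analyticOnNhd_const (v := (0 : E)))
    hconv.isPreconnected h0 hfreq (log_norm_mem hρ hz)
  simpa [Complex.exp_log (norm_pos_iff.1 (hρ.trans hz.1))] using this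

theorem eqOn_of_circle (hρ : 0 < ρ) (hρ1 : ρ < 1) {f g : ℂ → E}
    (hf : DifferentiableOn ℂ f (annulus ρ)) (hg : DifferentiableOn ℂ g (annulus ρ))
    (h : ∀ z : Circle, f z = g z) {z : ℂ} (hz : z ∈ annulus ρ) : f z = g z :=
  sub_eq_zero.1 (eq_zero_of_circle hρ hρ1 (f := fun z => f z - g z) (hf.sub hg)
    (fun z => sub_eq_zero.2 (h z)) hz)

end Identity

variable {V : Type*} [NormedAddCommGroup V] [InnerProductSpace ℂ V] [CompleteSpace V]
  {G : Subgroup (unitary (Mat V))}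

/-! ### Analytic loops -/

theorem loopExt_apply (u : loopAlgebra G) (z : Circle) : loopExt u z = u.1 z :=
  u.2.2.choose_spec.2 z

theorem exists_differentiableOn_of_analyticOnNhd {U : ℂ → Mat V}
    (hU : AnalyticOnNhd ℂ U (Metric.sphere 0 1)) :
    ∃ ρ : ℝ, 0 < ρ ∧ ρ < 1 ∧ DifferentiableOn ℂ U (annulus ρ) := by
  obtain ⟨ρ, h0, h1, h⟩ := exists_annulus_subset (isOpen_analyticAt ℂ U) hU
  exact ⟨ρ, h0, h1, fun z hz => (h hz).differentiableAt.differentiableWithinAt⟩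

theorem exists_differentiableOn_loopExt (u : loopAlgebra G) :
    ∃ ρ : ℝ, 0 < ρ ∧ ρ < 1 ∧ DifferentiableOn ℂ (loopExt u) (annulus ρ) :=
  exists_differentiableOn_of_analyticOnNhd u.2.2.choose_spec.1

theorem loop_add_apply (u v : loopAlgebra G) (z : Circle) : (u + v).1 z = u.1 z + v.1 z := rfl

theorem loop_smul_apply (a : ℂ) (u : loopAlgebra G) (z : Circle) : (a • u).1 z = a • u.1 z := rfl

theorem loop_lie_apply (u v : loopAlgebra G) (z : Circle) :
    (⁅u, v⁆ : loopAlgebra G).1 z = u.1 z * v.1 z - v.1 z * u.1 z := rfl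

theorem mem_complexLie_of_circle [FiniteDimensional ℂ V] {ρ : ℝ} (hρ : 0 < ρ) (hρ1 : ρ < 1)
    {U : ℂ → Mat V} (hU : DifferentiableOn ℂ U (annulus ρ))
    (h : ∀ z : Circle, U z ∈ complexLie G) {z : ℂ} (hz : z ∈ annulus ρ) : U z ∈ complexLie G :=
  mem_of_lieProj_eq (eq_zero_of_circle hρ hρ1 (f := fun z => U z - lieProj G (U z))
    (hU.sub ((lieProj G).differentiable.comp_differentiableOn hU))
    (fun z => sub_eq_zero.2 (lieProj_of_mem (h z)).symm) hz)

theorem loopExt_mem [FiniteDimensional ℂ V] (u : loopAlgebra G) {ρ : ℝ} (hρ : 0 < ρ) (hρ1 : ρ < 1)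
    (hU : DifferentiableOn ℂ (loopExt u) (annulus ρ)) {z : ℂ} (hz : z ∈ annulus ρ) :
    loopExt u z ∈ complexLie G :=
  mem_complexLie_of_circle hρ hρ1 hU (fun z => loopExt_apply u z ▸ u.2.1 z) hz

/-- A holomorphic loop with values in `G` normalises `𝔤_ℂ` near the circle. -/
theorem conj_mem_of_loop [FiniteDimensional ℂ V]
    (hclosed : IsClosed (G : Set (unitary (Mat V)))) {ρ : ℝ} (hρ : 0 < ρ) (hρ1 : ρ < 1)
    {η : ℂ → Mat V} (hη : DifferentiableOn ℂ η (annulus ρ)) (hu : ∀ z ∈ annulus ρ, IsUnit (η z))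
    (hG : ∀ z : Circle, η z ∈ matGroup G) {z : ℂ} (hz : z ∈ annulus ρ) {X : Mat V}
    (hX : X ∈ complexLie G) : Ring.inverse (η z) * X * η z ∈ complexLie G := by
  refine mem_complexLie_of_circle (U := fun z => Ring.inverse (η z) * X * η z) hρ hρ1
    (((differentiableOn_inverse hη hu).mul_const X).mul hη) (fun z => ?_) hz
  have h1 := inverse_of_mem_matGroup (hG z)
  have h2 := conj_mem_complexLie hclosed (star_mem_matGroup (hG z)) hX
  rwa [← h1, inverse_inverse (isUnit_of_mem_matGroup (hG z))] at h2

/-- The logarithmic derivative of a holomorphic loop with values in `G` lies in `𝔤_ℂ`. -/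
theorem logDeriv_mem_of_loop [FiniteDimensional ℂ V]
    (hclosed : IsClosed (G : Set (unitary (Mat V)))) {ρ : ℝ} (hρ : 0 < ρ) (hρ1 : ρ < 1)
    {η : ℂ → Mat V} (hη : DifferentiableOn ℂ η (annulus ρ)) (hu : ∀ z ∈ annulus ρ, IsUnit (η z))
    (hG : ∀ z : Circle, η z ∈ matGroup G) {z : ℂ} (hz : z ∈ annulus ρ) :
    Ring.inverse (η z) * deriv η z ∈ complexLie G := by
  refine mem_complexLie_of_circle (U := fun z => Ring.inverse (η z) * deriv η z) hρ hρ1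
    ((differentiableOn_inverse hη hu).mul (hη.deriv (isOpen_annulus ρ))) (fun z => ?_) hz
  have hzu := isUnit_of_mem_matGroup (hG z)
  have hd : HasDerivAt η (deriv η z) z := (hη.differentiableAt
    ((isOpen_annulus ρ).mem_nhds (circle_mem_annulus hρ hρ1 z))).hasDerivAt
  have hc : HasDerivAt (fun t : ℝ => (z : ℂ) * Complex.exp (t * Complex.I)) (z * Complex.I) 0 := by
    have h1 : HasDerivAt (fun t : ℂ => (z : ℂ) * Complex.exp (t * Complex.I)) (z * Complex.I)
        ((0 : ℝ) : ℂ) := by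
      simpa using (((hasDerivAt_id (0 : ℂ)).mul_const Complex.I).cexp).const_mul (z : ℂ)
    exact h1.comp_ofReal
  have hγ : HasDerivAt (fun t : ℝ => Ring.inverse (η z) * η (z * Complex.exp (t * Complex.I)))
      (Ring.inverse (η z) * ((z * Complex.I) • deriv η z)) 0 := by
    refine HasDerivAt.const_mul _ (HasDerivAt.scomp (h := fun t : ℝ => (z : ℂ) *
      Complex.exp (t * Complex.I)) (0 : ℝ) ?_ hc)
    simpa using hd
  have hmem := mem_realLie_of_hasDerivAt hclosed (Eventually.of_forall fun t => ?_) ?_ hγ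
  · have h1 : ((z : ℂ) * Complex.I) • (Ring.inverse (η z) * deriv η z) ∈ lieSub G := by
      rw [← mul_smul_comm]
      exact realLie_subset hmem
    have h2 := (lieSub G).smul_mem ((z : ℂ) * Complex.I)⁻¹ h1
    rwa [smul_smul, inv_mul_cancel₀ (mul_ne_zero z.coe_ne_zero Complex.I_ne_zero), one_smul] at h2
  · rw [inverse_of_mem_matGroup (hG z)]
    exact mul_mem (star_mem_matGroup (hG z)) (by simpa using hG (z * Circle.exp t))
  · simpa using Ring.inverse_mul_cancel _ hzu

/-! ### Real loops -/

/-- A loop is real if its values lie in `𝔤`. -/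
def IsReal (X : loopAlgebra G) : Prop := ∀ z : Circle, X.1 z ∈ realLie G

section Real

variable [FiniteDimensional ℂ V]

theorem IsReal.add (hclosed : IsClosed (G : Set (unitary (Mat V)))) {X Y : loopAlgebra G}
    (hX : IsReal X) (hY : IsReal Y) : IsReal (X + Y) :=
  fun z => (realSub hclosed).add_mem (hX z) (hY z)

theorem IsReal.smul (hclosed : IsClosed (G : Set (unitary (Mat V)))) {X : loopAlgebra G} (a : ℝ)
    (hX : IsReal X) : IsReal ((a : ℂ) • X) := fun z => by
  rw [loop_smul_apply, ← real_smul_eq]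
  exact (realSub hclosed).smul_mem a (hX z)

theorem IsReal.lie (hclosed : IsClosed (G : Set (unitary (Mat V)))) {X Y : loopAlgebra G}
    (hX : IsReal X) (hY : IsReal Y) : IsReal ⁅X, Y⁆ :=
  fun z => lie_mem_realLie hclosed (hX z) (hY z)

theorem conj_inv_circle (z : Circle) : conj (z : ℂ)⁻¹ = z := by
  rw [← Circle.coe_inv, Circle.coe_inv_eq_conj, Complex.conj_conj]

theorem analyticOnNhd_star {U : ℂ → Mat V} (hU : AnalyticOnNhd ℂ U (Metric.sphere 0 1)) :
    AnalyticOnNhd ℂ (fun z => -star (U (conj z⁻¹))) (Metric.sphere 0 1) := by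
  intro z₀ hz₀
  obtain ⟨z, rfl⟩ : ∃ z : Circle, (z : ℂ) = z₀ :=
    ⟨⟨z₀, hz₀⟩, rfl⟩
  have hz0 := z.coe_ne_zero
  have hcont : ContinuousAt (fun w : ℂ => conj w⁻¹) z :=
    Complex.continuous_conj.continuousAt.comp (continuousAt_inv₀ hz0)
  have hev : ∀ᶠ w in 𝓝 (z : ℂ), AnalyticAt ℂ U (conj w⁻¹) := by
    refine hcont.eventually ((isOpen_analyticAt ℂ U).mem_nhds ?_)
    simp only [conj_inv_circle]
    exact hU z (by rw [mem_sphere_zero_iff_norm]; exact Circle.norm_coe z)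
  rw [Complex.analyticAt_iff_eventually_differentiableAt]
  filter_upwards [hev, isOpen_ne.mem_nhds hz0] with w hw hw0
  have h1 := hw.differentiableAt.star_conj
  rw [Complex.conj_conj] at h1
  exact (h1.comp w (differentiableAt_inv hw0)).fun_neg

/-- The conjugate loop `u^*`, with extension `z ↦ -(U(1/z̄))^†`. -/
theorem exists_conj_loop (hclosed : IsClosed (G : Set (unitary (Mat V)))) (u : loopAlgebra G) :
    ∃ v : loopAlgebra G, ∀ z : Circle, v.1 z = -star (u.1 z) := by
  obtain ⟨hu, U, hU, hUu⟩ := u.2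
  refine ⟨⟨fun z => -star (u.1 z), fun z => ?_, fun z => -star (U (conj z⁻¹)),
    analyticOnNhd_star hU, fun z => ?_⟩, fun z => rfl⟩
  · exact (lieSub G).neg_mem (star_mem_complexLie hclosed (hu z))
  · simp only [conj_inv_circle, hUu]

/-- Every loop is `x + i y` for real loops `x` and `y`. -/
theorem exists_real_add (hclosed : IsClosed (G : Set (unitary (Mat V)))) (u : loopAlgebra G) :
    ∃ x y : loopAlgebra G, IsReal x ∧ IsReal y ∧ u = x + Complex.I • y := by
  obtain ⟨v, hv⟩ := exists_conj_loop hclosed u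
  set x : loopAlgebra G := (2⁻¹ : ℂ) • (u + v) with hx
  set y : loopAlgebra G := (2⁻¹ : ℂ) • (-Complex.I) • (u + (-1 : ℂ) • v) with hy
  refine ⟨x, y, fun z => ?_, fun z => ?_, Subtype.ext (funext fun z => ?_)⟩
  · refine mem_realLie_of_star_eq_neg hclosed (x.2.1 z) ?_
    rw [hx, loop_smul_apply, loop_add_apply, hv]
    simp [← smul_neg]
  · refine mem_realLie_of_star_eq_neg hclosed (y.2.1 z) ?_
    rw [hy, loop_smul_apply, loop_smul_apply, loop_add_apply, loop_smul_apply, hv]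
    simp [← smul_neg]
  · rw [hx, hy, loop_add_apply, loop_smul_apply, loop_smul_apply, loop_smul_apply,
      loop_smul_apply, loop_add_apply, loop_add_apply, loop_smul_apply, hv]
    rw [smul_comm Complex.I (2⁻¹ : ℂ), smul_smul Complex.I, mul_neg, Complex.I_mul_I, neg_neg,
      one_smul, ← smul_add, neg_smul, one_smul]
    rw [show u.1 z + -star (u.1 z) + (u.1 z + - -star (u.1 z)) = (2 : ℂ) • u.1 z by
      rw [two_smul]; abel, smul_smul, inv_mul_cancel₀ two_ne_zero, one_smul]

end Real

end

section

/-! ### The action of the one-parameter groups of real loops -/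

variable {V : Type*} [NormedAddCommGroup V] [InnerProductSpace ℂ V] [CompleteSpace V]
  {G : Subgroup (unitary (Mat V))}

theorem exists_bounded_loopExt (X : loopAlgebra G) : ∃ ρ C : ℝ, 0 < ρ ∧ ρ < 1 ∧
    DifferentiableOn ℂ (loopExt X) (annulus ρ) ∧ ∀ z ∈ annulus ρ, ‖loopExt X z‖ ≤ C := by
  obtain ⟨ρ, h0, h1, hd⟩ := exists_differentiableOn_loopExt X
  obtain ⟨ρ', h, h'⟩ := exists_between h1
  have hK : IsCompact (Metric.closedBall (0 : ℂ) ρ'⁻¹ \ Metric.ball 0 ρ') :=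
    isCompact_closedAnn ρ' ρ'⁻¹
  have hK' : Metric.closedBall (0 : ℂ) ρ'⁻¹ \ Metric.ball 0 ρ' ⊆ annulus ρ := by
    rintro z ⟨hz, hz'⟩
    simp only [Metric.mem_closedBall, dist_zero_right, Metric.mem_ball, not_lt] at hz hz'
    exact ⟨h.trans_le hz', hz.trans_lt (inv_strictAnti₀ h0 h)⟩
  obtain ⟨C, hC⟩ := hK.exists_bound_of_continuousOn (hd.continuousOn.mono hK')
  exact ⟨ρ', C, h0.trans h, h', hd.mono (annulus_mono h0 h.le), fun z hz =>
    hC z (ann_subset_closedAnn _ _ hz)⟩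

/-- The one-parameter group `exp(sX)` of loops. -/
def expLoop (X : loopAlgebra G) (s : ℝ) (z : ℂ) : Mat V :=
  NormedSpace.exp ((s : ℂ) • loopExt X z)

theorem expLoop_mem {X : loopAlgebra G} (hX : IsReal X) (s : ℝ) (z : Circle) :
    expLoop X s z ∈ matGroup G := by
  rw [expLoop, loopExt_apply]
  exact mem_realLie.1 (hX z) s

@[simp] theorem expLoop_zero (X : loopAlgebra G) (z : ℂ) : expLoop X 0 z = 1 := by
  simp [expLoop]

theorem expLoop_mul (X : loopAlgebra G) (s t : ℝ) (z : ℂ) :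
    expLoop X s z * expLoop X t z = expLoop X (s + t) z := by
  rw [expLoop, expLoop, exp_mul_exp, expLoop, ← add_smul, Complex.ofReal_add]
  exact ((Commute.refl _).smul_left _).smul_right _

theorem isUnit_expLoop (X : loopAlgebra G) (s : ℝ) (z : ℂ) : IsUnit (expLoop X s z) :=
  isUnit_exp _

theorem inverse_expLoop (X : loopAlgebra G) (s : ℝ) (z : ℂ) :
    Ring.inverse (expLoop X s z) = expLoop X (-s) z := by
  rw [expLoop, ← exp_neg_eq_inverse, expLoop, Complex.ofReal_neg, neg_smul]

theorem differentiable_exp : Differentiable ℂ (NormedSpace.exp : Mat V → Mat V) := fun X =>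
  (NormedSpace.exp_analytic (𝕂 := ℂ) X).differentiableAt

theorem differentiableOn_expLoop {X : loopAlgebra G} {ρ : ℝ}
    (h : DifferentiableOn ℂ (loopExt X) (annulus ρ)) (s : ℝ) :
    DifferentiableOn ℂ (expLoop X s) (annulus ρ) :=
  differentiable_exp.comp_differentiableOn (h.const_smul (s : ℂ))

theorem tendstoUniformlyOn_expLoop {X : loopAlgebra G} {ρ C : ℝ}
    (h : ∀ z ∈ annulus ρ, ‖loopExt X z‖ ≤ C) {ι : Type*} {l : Filter ι} {s : ι → ℝ}
    (hs : Tendsto s l (𝓝 0)) :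
    TendstoUniformlyOn (fun i => expLoop X (s i)) 1 l (annulus ρ) := by
  rw [Metric.tendstoUniformlyOn_iff]
  intro ε hε
  have hc : ContinuousAt (NormedSpace.exp : Mat V → Mat V) 0 :=
    (differentiable_exp (V := V)).continuous.continuousAt
  obtain ⟨δ, hδ, hδ'⟩ := Metric.continuousAt_iff.1 hc ε hε
  have hlim : Tendsto (fun i => |s i| * (|C| + 1)) l (𝓝 0) := by
    simpa using hs.abs.mul_const (|C| + 1)
  filter_upwards [hlim.eventually_lt_const hδ] with i hi z hz
  rw [Pi.one_apply, dist_comm, ← NormedSpace.exp_zero (𝔸 := Mat V)]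
  refine hδ' ?_
  rw [dist_zero_right, norm_smul, Complex.norm_real, Real.norm_eq_abs]
  refine lt_of_le_of_lt ?_ hi
  gcongr
  exact (h z hz).trans ((le_abs_self C).trans (by linarith))

theorem ActsTo.symm {χ χ' : ℂ → Mat V} {α β : Forms G} (h : ActsTo χ α β)
    (hχ' : ∀ z, χ' z = Ring.inverse (χ z)) : ActsTo χ' β α := by
  obtain ⟨ρ, h0, h1, hd, hu, k, hk, hku, hz⟩ := h
  obtain rfl : χ' = fun z => Ring.inverse (χ z) := funext hχ'
  refine ⟨ρ, h0, h1, differentiableOn_inverse hd hu, fun z hz => isUnit_inverse (hu z hz),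
    fun w => Ring.inverse (k w), differentiableOn_inverse hk hku,
    fun w hw => isUnit_inverse (hku w hw), fun z hz1 hz2 => ?_⟩
  have h3 := hku _ (inv_mem_ball h0 hz1)
  rw [hz z hz1 hz2, inverse_inverse h3, ← mul_assoc, mul_assoc _ _ (k z⁻¹),
    Ring.inverse_mul_cancel _ h3, mul_one,
    Ring.inverse_mul_cancel_left _ _ (hu z (mem_annulus_of_lt_one h0 h1 hz1 hz2))]

variable [FiniteDimensional ℂ V]

instance : Nonempty (Forms G) := ⟨⟨0, fun _ => mem_lieSub.1 (lieSub G).zero_mem, fun _ => 0,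
  differentiableOn_const 0, fun _ => rfl⟩⟩

/-- The form `e^{sX} · α` (if it exists). -/
def act (X : loopAlgebra G) (s : ℝ) (α : Forms G) : Forms G :=
  Classical.epsilon (ActsTo (expLoop X s) α)

theorem act_eq {X : loopAlgebra G} {s : ℝ} {α β : Forms G} (h : ActsTo (expLoop X s) α β) :
    act X s α = β :=
  ActsTo.unique (Classical.epsilon_spec (p := ActsTo (expLoop X s) α) ⟨β, h⟩) h

theorem actsTo_zero (X : loopAlgebra G) (α : Forms G) : ActsTo (expLoop X 0) α α :=
  (ActsTo.one α).congr (ρ := 1 / 2) (by norm_num) (by norm_num) fun z _ => (expLoop_zero X z).symm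

@[simp] theorem act_zero (X : loopAlgebra G) (α : Forms G) : act X 0 α = α :=
  act_eq (actsTo_zero X α)

theorem ActsTo.exp_sub {X : loopAlgebra G} {s t : ℝ} {α β γ : Forms G}
    (h : ActsTo (expLoop X s) α β) (h' : ActsTo (expLoop X t) α γ) :
    ActsTo (expLoop X (t - s)) β γ := by
  refine ((h.symm fun z => (inverse_expLoop X s z).symm).mul h').congr (ρ := 1 / 2) (by norm_num)
    (by norm_num) fun z _ => ?_
  rw [expLoop_mul, sub_eq_add_neg]

/-- Elements `e^{sX}` close to the identity act, locally uniformly. -/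
theorem eventually_actsTo (hclosed : IsClosed (G : Set (unitary (Mat V)))) {X : loopAlgebra G}
    (hX : IsReal X) (α : Forms G) :
    ∀ᶠ p : ℝ × Forms G in 𝓝 (0, α), ActsTo (expLoop X p.1) p.2 (act X p.1 p.2) := by
  obtain ⟨ρ, C, h0, h1, hd, hC⟩ := exists_bounded_loopExt X
  have hs : Tendsto (fun p : ℝ × Forms G => p.1) (𝓝 (0, α)) (𝓝 0) := continuous_fst.tendsto _
  have ha : Tendsto (fun p : ℝ × Forms G => p.2) (𝓝 (0, α)) (𝓝 α) := continuous_snd.tendsto _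
  have h := eventually_exists_actsTo (η := fun p : ℝ × Forms G => expLoop X p.1) h0 h1
    (Eventually.of_forall fun p => ?_) (tendstoUniformlyOn_expLoop hC hs) ha
  · filter_upwards [h] with p hp
    exact Classical.epsilon_spec hp
  · have h2 := differentiableOn_expLoop hd p.1
    have h3 : ∀ z ∈ annulus ρ, IsUnit (expLoop X p.1 z) := fun z _ => isUnit_expLoop X p.1 z
    exact ⟨h2, fun z hz Y hY => conj_mem_of_loop hclosed h0 h1 h2 h3 (expLoop_mem hX p.1) hz hY,
      fun z hz => logDeriv_mem_of_loop hclosed h0 h1 h2 h3 (expLoop_mem hX p.1) hz⟩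

theorem tendsto_act (hclosed : IsClosed (G : Set (unitary (Mat V)))) {X : loopAlgebra G}
    (hX : IsReal X) (α : Forms G) :
    Tendsto (fun p : ℝ × Forms G => act X p.1 p.2) (𝓝 (0, α)) (𝓝 α) := by
  obtain ⟨ρ, C, h0, h1, hd, hC⟩ := exists_bounded_loopExt X
  exact tendsto_of_actsTo h0 h1 (Eventually.of_forall fun p => differentiableOn_expLoop hd p.1)
    (tendstoUniformlyOn_expLoop hC (continuous_fst.tendsto _)) (continuous_snd.tendsto _)
    (eventually_actsTo hclosed hX α)

end

section

/-! ### Continuously differentiable curves of loops -/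

variable {V : Type*} [NormedAddCommGroup V] [InnerProductSpace ℂ V] [CompleteSpace V]
  {G : Subgroup (unitary (Mat V))}

/-- A family `p τ z` of matrices that is differentiable in the real variable `τ`, with `p` and the
derivative `p'` jointly continuous, for `z` in an annulus. -/
structure IsC1Curve (ρ : ℝ) (p p' : ℝ → ℂ → Mat V) : Prop where
  hasDerivAt : ∀ τ, ∀ z ∈ annulus ρ, HasDerivAt (fun σ => p σ z) (p' τ z) τ
  continuousAt : ∀ τ, ∀ z ∈ annulus ρ, ContinuousAt (fun q : ℝ × ℂ => p q.1 q.2) (τ, z)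
  continuousAt_deriv : ∀ τ, ∀ z ∈ annulus ρ, ContinuousAt (fun q : ℝ × ℂ => p' q.1 q.2) (τ, z)

namespace IsC1Curve

variable {ρ : ℝ} {p p' q q' : ℝ → ℂ → Mat V}

theorem mul (hp : IsC1Curve ρ p p') (hq : IsC1Curve ρ q q') :
    IsC1Curve ρ (fun τ z => p τ z * q τ z) (fun τ z => p' τ z * q τ z + p τ z * q' τ z) where
  hasDerivAt τ z hz := (hp.1 τ z hz).fun_mul (hq.1 τ z hz)
  continuousAt τ z hz := (hp.2 τ z hz).mul (hq.2 τ z hz)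
  continuousAt_deriv τ z hz :=
    ((hp.3 τ z hz).mul (hq.2 τ z hz)).add ((hp.2 τ z hz).mul (hq.3 τ z hz))

theorem sub (hp : IsC1Curve ρ p p') (hq : IsC1Curve ρ q q') :
    IsC1Curve ρ (fun τ z => p τ z - q τ z) (fun τ z => p' τ z - q' τ z) where
  hasDerivAt τ z hz := (hp.1 τ z hz).fun_sub (hq.1 τ z hz)
  continuousAt τ z hz := (hp.2 τ z hz).sub (hq.2 τ z hz)
  continuousAt_deriv τ z hz := (hp.3 τ z hz).sub (hq.3 τ z hz)

theorem continuousAt_of_differentiableOn {U : ℂ → Mat V} (hU : DifferentiableOn ℂ U (annulus ρ))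
    (τ : ℝ) {z : ℂ} (hz : z ∈ annulus ρ) : ContinuousAt (fun q : ℝ × ℂ => U q.2) (τ, z) :=
  (hU.continuousOn.continuousAt ((isOpen_annulus ρ).mem_nhds hz)).comp
    (f := fun q : ℝ × ℂ => q.2) continuousAt_snd

theorem const {U : ℂ → Mat V} (hU : DifferentiableOn ℂ U (annulus ρ)) :
    IsC1Curve ρ (fun _ z => U z) (fun _ _ => 0) where
  hasDerivAt _ _ _ := hasDerivAt_const _ _
  continuousAt τ _ hz := continuousAt_of_differentiableOn hU τ hz
  continuousAt_deriv _ _ _ := continuousAt_const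

theorem exp {X : loopAlgebra G} (hX : DifferentiableOn ℂ (loopExt X) (annulus ρ)) :
    IsC1Curve ρ (expLoop X) (fun s z => expLoop X s z * loopExt X z) := by
  have hc : ∀ τ : ℝ, ∀ z ∈ annulus ρ,
      ContinuousAt (fun q : ℝ × ℂ => expLoop X q.1 q.2) (τ, z) := fun τ z hz => by
    refine (differentiable_exp (V := V)).continuous.continuousAt.comp
      (f := fun q : ℝ × ℂ => (q.1 : ℂ) • loopExt X q.2) ?_
    have h1 : ContinuousAt (fun q : ℝ × ℂ => (q.1 : ℂ)) (τ, z) := by fun_prop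
    exact h1.smul (continuousAt_of_differentiableOn hX τ hz)
  exact ⟨fun τ z _ => hasDerivAt_exp_real _ _, hc,
    fun τ z hz => (hc τ z hz).mul (continuousAt_of_differentiableOn hX τ hz)⟩

theorem one_add (hp : IsC1Curve ρ p p') : IsC1Curve ρ (fun τ z => 1 + p τ z) p' where
  hasDerivAt τ z hz := (hp.1 τ z hz).const_add 1
  continuousAt τ z hz := continuousAt_const.add (hp.2 τ z hz)
  continuousAt_deriv := hp.3

theorem congr (hp : IsC1Curve ρ p p') (h : ∀ τ z, q τ z = p τ z) (h' : ∀ τ z, q' τ z = p' τ z) :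
    IsC1Curve ρ q q' := by
  obtain rfl : q = p := funext₂ h
  obtain rfl : q' = p' := funext₂ h'
  exact hp

theorem neg (hp : IsC1Curve ρ p p') :
    IsC1Curve ρ (fun τ z => p (-τ) z) (fun τ z => -p' (-τ) z) where
  hasDerivAt τ z hz := by
    simpa [Function.comp_def] using (hp.1 (-τ) z hz).scomp τ (hasDerivAt_neg τ)
  continuousAt τ z hz := (hp.2 (-τ) z hz).comp (f := fun q : ℝ × ℂ => (-q.1, q.2))
    (x := (τ, z)) (by fun_prop)
  continuousAt_deriv τ z hz := ((hp.3 (-τ) z hz).comp (f := fun q : ℝ × ℂ => (-q.1, q.2))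
    (x := (τ, z)) (by fun_prop)).neg

/-- The difference quotients at `0` converge locally uniformly. -/
theorem tendsto_slope (hp : IsC1Curve ρ p p') (h0 : ∀ z ∈ annulus ρ, p 0 z = 0) {z : ℂ}
    (hz : z ∈ annulus ρ) : Tendsto (fun q : ℝ × ℂ => q.1⁻¹ • p q.1 q.2) (𝓝[>] 0 ×ˢ 𝓝 z)
      (𝓝 (p' 0 z)) := by
  rw [Metric.tendsto_nhds]
  intro ε hε
  have hc := Metric.continuousAt_iff.1 (hp.3 0 z hz) (ε / 2) (by positivity)
  obtain ⟨δ, hδ, hδ'⟩ := hc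
  have h1 : ∀ᶠ s in 𝓝[>] (0 : ℝ), 0 < s ∧ s < δ :=
    Filter.Eventually.and self_mem_nhdsWithin ((eventually_lt_nhds hδ).filter_mono nhdsWithin_le_nhds)
  have h2 : ∀ᶠ w in 𝓝 z, dist w z < δ ∧ w ∈ annulus ρ :=
    Filter.Eventually.and (Metric.ball_mem_nhds z hδ) ((isOpen_annulus ρ).mem_nhds hz)
  filter_upwards [h1.prod_mk h2] with ⟨s, w⟩ ⟨⟨hs, hs'⟩, hw, hwρ⟩
  have hb : ∀ σ ∈ Set.Icc (0 : ℝ) s, ‖p' σ w - p' 0 z‖ ≤ ε / 2 := fun σ hσ => by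
    rw [← dist_eq_norm]
    refine (hδ' (x := (σ, w)) (max_lt ?_ hw)).le
    rw [Real.dist_eq, sub_zero, abs_of_nonneg hσ.1]
    exact hσ.2.trans_lt hs'
  have hm := (convex_Icc (0 : ℝ) s).norm_image_sub_le_of_norm_hasDerivWithin_le
    (f := fun σ => p σ w - σ • p' 0 z) (f' := fun σ => p' σ w - p' 0 z) (C := ε / 2)
    (fun σ hσ => ((hp.1 σ w hwρ).sub (by simpa using (hasDerivAt_id σ).smul_const (p' 0 z))).hasDerivWithinAt)
    hb (Set.left_mem_Icc.2 hs.le) (Set.right_mem_Icc.2 hs.le)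
  simp only [h0 w hwρ, zero_smul, sub_zero, Real.norm_eq_abs, abs_of_pos hs] at hm
  rw [dist_eq_norm]
  have h3 : s⁻¹ • p s w - p' 0 z = s⁻¹ • (p s w - s • p' 0 z) := by
    rw [smul_sub, smul_smul, inv_mul_cancel₀ hs.ne', one_smul]
  show ‖s⁻¹ • p s w - p' 0 z‖ < ε
  rw [h3, norm_smul, norm_inv, Real.norm_eq_abs, abs_of_pos hs]
  calc s⁻¹ * ‖p s w - s • p' 0 z‖ ≤ s⁻¹ * (ε / 2 * s) := by gcongr
    _ = ε / 2 := by field_simp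
    _ < ε := half_lt_self hε

end IsC1Curve

/-! #### The commutator curve -/

theorem expLoop_comm (X : loopAlgebra G) (s : ℝ) (z : ℂ) :
    expLoop X s z * loopExt X z = loopExt X z * expLoop X s z :=
  (((Commute.refl (loopExt X z)).smul_right (s : ℂ)).exp_right.eq).symm

/-- The group commutator `e^{sX} e^{sY} e^{-sX} e^{-sY}`. -/
def commLoop (X Y : loopAlgebra G) (s : ℝ) (z : ℂ) : Mat V :=
  expLoop X s z * expLoop Y s z * (expLoop X (-s) z * expLoop Y (-s) z)

/-- The curve `τ ↦ c(√τ)`, for `c` the group commutator of `e^{sX}` and `e^{sY}`, continued by the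
one-parameter group of `[X,Y]` to negative `τ`. -/
def commCurve (X Y : loopAlgebra G) (τ : ℝ) (z : ℂ) : Mat V :=
  if 0 < τ then commLoop X Y √τ z else expLoop ⁅X, Y⁆ τ z

/-- The curve `τ ↦ c(√τ)` is continuously differentiable at `τ = 0`, with derivative `[X, Y]`, since
`c(s) = 1 + s² [X, Y] + O(s³)`. -/
theorem exists_isC1Curve_commCurve (X Y : loopAlgebra G) : ∃ ρ : ℝ, 0 < ρ ∧ ρ < 1 ∧
    (∀ τ, DifferentiableOn ℂ (commCurve X Y τ) (annulus ρ)) ∧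
    ∃ D, IsC1Curve ρ (commCurve X Y) D ∧ ∀ z ∈ annulus ρ, D 0 z = loopExt ⁅X, Y⁆ z := by
  obtain ⟨ρ₁, h01, h11, hX⟩ := exists_differentiableOn_loopExt X
  obtain ⟨ρ₂, h02, h12, hY⟩ := exists_differentiableOn_loopExt Y
  obtain ⟨ρ₃, h03, h13, hZ⟩ := exists_differentiableOn_loopExt ⁅X, Y⁆
  set ρ := max ρ₁ (max ρ₂ ρ₃) with hρdef
  have hρ : 0 < ρ := lt_max_of_lt_left h01
  have hρ1 : ρ < 1 := max_lt h11 (max_lt h12 h13)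
  replace hX := hX.mono (annulus_mono h01 (le_max_left _ _ : ρ₁ ≤ ρ))
  replace hY := hY.mono (annulus_mono h02 ((le_max_left _ _).trans (le_max_right _ _) : ρ₂ ≤ ρ))
  replace hZ := hZ.mono (annulus_mono h03 ((le_max_right _ _).trans (le_max_right _ _) : ρ₃ ≤ ρ))
  have hbr : ∀ z ∈ annulus ρ, loopExt ⁅X, Y⁆ z =
      loopExt X z * loopExt Y z - loopExt Y z * loopExt X z := fun z hz =>
    eqOn_of_circle hρ hρ1 hZ ((hX.mul hY).sub (hY.mul hX)) (fun z => by
      simp only [Pi.sub_apply, Pi.mul_apply, loopExt_apply, loop_lie_apply]) hz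
  have eX := IsC1Curve.exp hX
  have eY := IsC1Curve.exp hY
  have eZ := IsC1Curve.exp hZ
  have hS := IsC1Curve.const (hX.add hY)
  -- `P = e^{sX} e^{sY} - e^{sY} e^{sX}` vanishes to second order, and `c = 1 + P Q`
  set P := fun (s : ℝ) (z : ℂ) => expLoop X s z * expLoop Y s z - expLoop Y s z * expLoop X s z
    with hPdef
  set P₁ := fun (s : ℝ) (z : ℂ) => expLoop X s z * (loopExt X z + loopExt Y z) * expLoop Y s z -
    expLoop Y s z * (loopExt X z + loopExt Y z) * expLoop X s z with hP₁def
  set Q := fun (s : ℝ) (z : ℂ) => expLoop X (-s) z * expLoop Y (-s) z with hQdef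
  obtain ⟨P₂, hP₁, hP₂⟩ : ∃ P₂, IsC1Curve ρ P₁ P₂ ∧ ∀ z ∈ annulus ρ,
      P₂ 0 z = (2 : ℝ) • loopExt ⁅X, Y⁆ z := by
    refine ⟨_, ((eX.mul hS).mul eY).sub ((eY.mul hS).mul eX), fun z hz => ?_⟩
    simp only [expLoop_zero, Pi.add_apply, hbr z hz, two_smul]
    noncomm_ring
  have hP : IsC1Curve ρ P P₁ := ((eX.mul eY).sub (eY.mul eX)).congr (fun _ _ => rfl)
    fun τ z => by
      simp only [hP₁def]
      rw [show expLoop X τ z * (expLoop Y τ z * loopExt Y z) =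
        expLoop X τ z * (loopExt Y z * expLoop Y τ z) by rw [expLoop_comm Y],
        show expLoop Y τ z * (expLoop X τ z * loopExt X z) =
        expLoop Y τ z * (loopExt X z * expLoop X τ z) by rw [expLoop_comm X]]
      noncomm_ring
  obtain ⟨Q₁, hQ⟩ : ∃ Q₁, IsC1Curve ρ Q Q₁ := ⟨_, eX.neg.mul eY.neg⟩
  have hP0 : ∀ z ∈ annulus ρ, P 0 z = 0 := fun z _ => by simp [hPdef]
  have hP10 : ∀ z ∈ annulus ρ, P₁ 0 z = 0 := fun z _ => by simp [hP₁def]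
  have hQ0 : ∀ z, Q 0 z = 1 := fun z => by simp [hQdef]
  set c₁ := fun (s : ℝ) (z : ℂ) => P₁ s z * Q s z + P s z * Q₁ s z with hc₁def
  have hc : IsC1Curve ρ (commLoop X Y) c₁ := (hP.mul hQ).one_add.congr (fun τ z => by
    have h1 : expLoop Y τ z * expLoop X τ z * (expLoop X (-τ) z * expLoop Y (-τ) z) = 1 := by
      rw [← mul_assoc, mul_assoc (expLoop Y τ z), expLoop_mul, add_neg_cancel, expLoop_zero, mul_one,
        expLoop_mul, add_neg_cancel, expLoop_zero]
    simp only [hPdef, hQdef]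
    rw [sub_mul, h1, commLoop]
    abel) fun τ z => rfl
  have hc0 : ∀ z, commLoop X Y 0 z = 1 := fun z => by simp [commLoop]
  set D := fun (τ : ℝ) (z : ℂ) => if 0 < τ then (2 : ℝ)⁻¹ • (√τ)⁻¹ • c₁ √τ z else
    expLoop ⁅X, Y⁆ τ z * loopExt ⁅X, Y⁆ z with hDdef
  have hD0 : ∀ z, D 0 z = loopExt ⁅X, Y⁆ z := fun z => by simp [hDdef]
  have hsqrt : ∀ z, Tendsto (fun q : ℝ × ℂ => (√q.1, q.2)) (𝓝 (0, z) ⊓ 𝓟 {q | 0 < q.1})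
      (𝓝[>] 0 ×ˢ 𝓝 z) := fun z => by
    refine Tendsto.prodMk (tendsto_nhdsWithin_iff.2 ⟨?_, ?_⟩) ?_
    · have : Continuous fun q : ℝ × ℂ => √q.1 := Real.continuous_sqrt.comp continuous_fst
      exact (this.tendsto' (0, z) 0 (by simp)).mono_left inf_le_left
    · exact mem_inf_of_right fun q hq => Real.sqrt_pos.2 hq
    · exact (continuous_snd.tendsto (0, z)).mono_left inf_le_left
  have hle : ∀ z : ℂ, 𝓝[>] (0 : ℝ) ×ˢ 𝓝 z ≤ 𝓝 ((0 : ℝ), z) := fun z => by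
    rw [nhds_prod_eq]; exact prod_mono_left _ nhdsWithin_le_nhds
  -- continuity of the curve and of its derivative
  have hcont : ∀ τ, ∀ z ∈ annulus ρ,
      ContinuousAt (fun q : ℝ × ℂ => commCurve X Y q.1 q.2) (τ, z) ∧
      ContinuousAt (fun q : ℝ × ℂ => D q.1 q.2) (τ, z) := by
    intro τ z hz
    rcases lt_trichotomy τ 0 with h | rfl | h
    · have hev : ∀ᶠ q : ℝ × ℂ in 𝓝 (τ, z), ¬ 0 < q.1 :=
        (continuous_fst.tendsto (τ, z)).eventually ((eventually_lt_nhds h).mono fun _ h => not_lt.2 h.le)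
      exact ⟨(eZ.2 τ z hz).congr (hev.mono fun q hq => (if_neg hq).symm),
        (eZ.3 τ z hz).congr (hev.mono fun q hq => (if_neg hq).symm)⟩
    · constructor
      · refine Tendsto.if ?_ ?_
        · have := (hc.2 0 z hz).tendsto.comp ((hsqrt z).mono_right (hle z))
          simpa [commCurve, hc0, Function.comp_def] using this
        · have := (eZ.2 0 z hz).tendsto
          simp only [expLoop_zero] at this
          simpa [commCurve] using this.mono_left inf_le_left
      · refine Tendsto.if ?_ ?_
        · have h1 := ((hP₁.tendsto_slope hP10 hz).mul ((hQ.2 0 z hz).tendsto.mono_left (hle z))).add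
            ((hP.tendsto_slope hP0 hz).mul ((hQ.3 0 z hz).tendsto.mono_left (hle z)))
          have h2 := (h1.const_smul (2 : ℝ)⁻¹).comp (hsqrt z)
          rw [hP₂ z hz, hP10 z hz, hQ0, mul_one, zero_mul, add_zero, smul_smul,
            inv_mul_cancel₀ two_ne_zero, one_smul] at h2
          simp only [hD0]
          refine h2.congr fun q => ?_
          simp [hc₁def, smul_add]
        · have := (eZ.3 0 z hz).tendsto
          simp only [expLoop_zero, one_mul] at this
          simpa only [hD0] using this.mono_left inf_le_left
    · have hev : ∀ᶠ q : ℝ × ℂ in 𝓝 (τ, z), 0 < q.1 :=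
        (continuous_fst.tendsto (τ, z)).eventually (eventually_gt_nhds h)
      have hs : ContinuousAt (fun q : ℝ × ℂ => √q.1) (τ, z) :=
        (Real.continuous_sqrt.comp continuous_fst).continuousAt
      have hs' : ContinuousAt (fun q : ℝ × ℂ => (√q.1, q.2)) (τ, z) := hs.prodMk continuousAt_snd
      have h1 := (hc.2 √τ z hz).comp (f := fun q : ℝ × ℂ => (√q.1, q.2)) (x := (τ, z)) hs'
      have h2 := (hc.3 √τ z hz).comp (f := fun q : ℝ × ℂ => (√q.1, q.2)) (x := (τ, z)) hs'
      exact ⟨h1.congr (hev.mono fun q hq => (if_pos hq).symm),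
        (((hs.inv₀ (Real.sqrt_pos.2 h).ne').smul h2).const_smul (2 : ℝ)⁻¹).congr
          (hev.mono fun q hq => (if_pos hq).symm)⟩
  have hpair : ∀ (z : ℂ) (τ : ℝ), ContinuousAt (fun σ : ℝ => (σ, z)) τ := fun z τ => by fun_prop
  refine ⟨ρ, hρ, hρ1, fun τ => ?_, D, ⟨fun τ z hz => ?_, fun τ z hz => (hcont τ z hz).1,
    fun τ z hz => (hcont τ z hz).2⟩, fun z _ => hD0 z⟩
  · by_cases h : 0 < τ
    · refine DifferentiableOn.congr (f := commLoop X Y √τ) ?_ fun z _ => if_pos h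
      exact ((differentiableOn_expLoop hX _).mul (differentiableOn_expLoop hY _)).mul
        ((differentiableOn_expLoop hX _).mul (differentiableOn_expLoop hY _))
    · exact (differentiableOn_expLoop hZ τ).congr fun z _ => if_neg h
  · have hne : ∀ σ, σ ≠ 0 → HasDerivAt (fun σ => commCurve X Y σ z) (D σ z) σ := by
      intro σ hσ
      rcases hσ.lt_or_gt with h | h
      · have h1 := eZ.1 σ z hz
        simp only [hDdef, if_neg (not_lt.2 h.le)]
        exact h1.congr_of_eventuallyEq ((eventually_lt_nhds h).mono fun x hx =>
          if_neg (not_lt.2 (le_of_lt hx)))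
      · have h1 := (hc.1 √σ z hz).scomp σ (Real.hasDerivAt_sqrt h.ne')
        have h2 : (1 / (2 * √σ)) • c₁ √σ z = D σ z := by
          simp only [hDdef, if_pos h, smul_smul]
          congr 1
          rw [one_div, mul_inv]
        rw [h2] at h1
        exact h1.congr_of_eventuallyEq ((eventually_gt_nhds h).mono fun x hx => if_pos hx)
    rcases eq_or_ne τ 0 with rfl | h
    · exact hasDerivAt_of_hasDerivAt_of_ne' (f := fun σ => commCurve X Y σ z)
        (g := fun σ => D σ z) hne
        ((hcont 0 z hz).1.comp (f := fun σ : ℝ => (σ, z)) (hpair z 0))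
        ((hcont 0 z hz).2.comp (f := fun σ : ℝ => (σ, z)) (hpair z 0)) 0
    · exact hne τ h

end

section

/-! ### Construction of `C¹`-families -/

theorem tendstoUniformlyOn_of_continuousAt {P E : Type*} [TopologicalSpace P]
    [NormedAddCommGroup E] {f : P → ℂ → E} {x₀ : P} {K : Set ℂ} (hK : IsCompact K)
    (hf : ∀ z ∈ K, ContinuousAt (fun q : P × ℂ => f q.1 q.2) (x₀, z)) :
    TendstoUniformlyOn f (f x₀) (𝓝 x₀) K := by
  rw [Metric.tendstoUniformlyOn_iff]
  intro ε hε
  refine hK.eventually_forall_of_forall_eventually fun z hz => ?_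
  have h1 : ContinuousAt (fun q : P × ℂ => f x₀ q.2) (x₀, z) :=
    ContinuousAt.comp (g := fun q : P × ℂ => f q.1 q.2) (f := fun q : P × ℂ => (x₀, q.2)) (hf z hz)
      (by fun_prop)
  have h2 := Tendsto.dist h1 (hf z hz)
  simp only [dist_self] at h2
  exact h2.eventually_lt_const hε

variable {V : Type*} [NormedAddCommGroup V] [InnerProductSpace ℂ V] [CompleteSpace V]
  {G : Subgroup (unitary (Mat V))}

theorem closedAnn_subset_annulus {ρ ρ' : ℝ} (hρ : 0 < ρ) (h : ρ < ρ') :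
    Metric.closedBall (0 : ℂ) ρ'⁻¹ \ Metric.ball 0 ρ' ⊆ annulus ρ := by
  rintro z ⟨hz, hz'⟩
  simp only [Metric.mem_closedBall, dist_zero_right, Metric.mem_ball, not_lt] at hz hz'
  exact ⟨h.trans_le hz', hz.trans_lt (inv_strictAnti₀ hρ h)⟩

/-- Loops close to the identity have a Birkhoff factorisation with trivial homomorphism. -/
theorem eventually_isLoopOne {χ : ℂ → ℂ → Mat V} {ρ : ℝ} (hρ : 0 < ρ) (hρ1 : ρ < 1)
    (hd : ∀ t, DifferentiableOn ℂ (χ t) (annulus ρ))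
    (hG : ∀ t, ∀ z : Circle, χ t z ∈ matGroup G)
    (hc : ∀ z ∈ annulus ρ, ContinuousAt (fun q : ℂ × ℂ => χ q.1 q.2) (0, z))
    (h0 : ∀ z ∈ annulus ρ, χ 0 z = 1) : ∀ᶠ t in 𝓝 0, IsLoopOne G (χ t) := by
  obtain ⟨ρ', h1, h2⟩ := exists_between hρ1
  have hρ' : 0 < ρ' := hρ.trans h1
  have hlt : ρ' < ρ'⁻¹ := h2.trans ((one_lt_inv₀ hρ').2 h2)
  have hK := isCompact_closedAnn ρ' ρ'⁻¹
  have hsub := closedAnn_subset_annulus hρ h1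
  have hev : ∀ t, ∀ z ∈ ann ρ' ρ'⁻¹, (Hol.of (ann ρ' ρ'⁻¹) (χ t)).ev z = χ t z := fun t z hz =>
    Hol.ev_of_compact (hd t) hK hsub (ann_subset_closedAnn _ _) hz
  have hlim : Tendsto (fun t => Hol.of (ann ρ' ρ'⁻¹) (χ t) - 1) (𝓝 0) (𝓝 0) := by
    rw [← sub_self (1 : Hol (ann ρ' ρ'⁻¹) (Mat V))]
    refine (Hol.tendsto_of ?_).sub_const 1
    have := (tendstoUniformlyOn_of_continuousAt hK fun z hz => hc z (hsub hz)).mono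
      (ann_subset_closedAnn ρ' ρ'⁻¹)
    refine (this.congr (Eventually.of_forall fun t z hz => (hev t z hz).symm)).congr_right
      fun z hz => ?_
    rw [h0 z (hsub (ann_subset_closedAnn _ _ hz)), Hol.ev_one hz]
  filter_upwards [hlim.eventually (eventually_isGoodDefect hρ' hlt (one_half_pos (α := ℝ)))]
    with t ⟨hunit, ⟨m, hm, hmo, hmε⟩, hp⟩
  refine ⟨fun z => ?_, ρ', hρ', h2, (hd t).mono (annulus_mono hρ h1.le), _, m,
    (innerFactor ρ' ρ'⁻¹ (Hol.of (ann ρ' ρ'⁻¹) (χ t) - 1)).differentiableOn,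
    fun z hz => isUnit_of_norm_sub_one_le_half (hp z hz), innerFactor_ev_zero hρ' hlt _, hm,
    fun w hw => isUnit_of_norm_sub_one_le_half (hmε w hw), fun z hz => ?_⟩
  · obtain ⟨x, hx, h⟩ := mem_matGroup.1 (hG t z)
    exact ⟨x, hx, h⟩
  · rw [annulus_eq_ann] at hz
    rw [← mul_outerFactor hunit hz, Hol.ev_sub, Hol.ev_one hz, hev t z hz, hmo z hz,
      add_sub_cancel]

/-- Products of two curves of loops, composed with real-linear functions of `t`, form
`C¹`-families. -/
theorem isC1Family_mul {u : loopAlgebra G} {ρ : ℝ} (hρ : 0 < ρ) (hρ1 : ρ < 1)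
    {p p' q q' : ℝ → ℂ → Mat V} (hp : IsC1Curve ρ p p') (hq : IsC1Curve ρ q q')
    (hpd : ∀ τ, DifferentiableOn ℂ (p τ) (annulus ρ))
    (hqd : ∀ τ, DifferentiableOn ℂ (q τ) (annulus ρ))
    (hpG : ∀ τ, ∀ z : Circle, p τ z ∈ matGroup G) (hqG : ∀ τ, ∀ z : Circle, q τ z ∈ matGroup G)
    (hp0 : ∀ z ∈ annulus ρ, p 0 z = 1) (hq0 : ∀ z ∈ annulus ρ, q 0 z = 1) (ℓ ℓ' : ℂ →L[ℝ] ℝ)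
    (hD : ∀ (z : Circle) (s : ℂ),
      ℓ s • p' 0 z + ℓ' s • q' 0 z = s • u.1 z + conj s • -star (u.1 z)) :
    IsC1Family u (fun t z => p (ℓ t) z * q (ℓ' t) z) := by
  have hl : ∀ (ℓ : ℂ →L[ℝ] ℝ) (t z : ℂ), ContinuousAt (fun a : ℂ × ℂ => (ℓ a.1, a.2)) (t, z) :=
    fun ℓ t z => (ℓ.continuous.comp continuous_fst).continuousAt.prodMk continuousAt_snd
  have hcomp : ∀ {f : ℝ → ℂ → Mat V} (ℓ : ℂ →L[ℝ] ℝ) (t z : ℂ),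
      ContinuousAt (fun a : ℝ × ℂ => f a.1 a.2) (ℓ t, z) →
      ContinuousAt (fun a : ℂ × ℂ => f (ℓ a.1) a.2) (t, z) := fun {f} ℓ t z h =>
    ContinuousAt.comp (g := fun a : ℝ × ℂ => f a.1 a.2) (f := fun a : ℂ × ℂ => (ℓ a.1, a.2)) h
      (hl ℓ t z)
  have hloop := eventually_isLoopOne (G := G) (χ := fun t z => p (ℓ t) z * q (ℓ' t) z) hρ hρ1
    (fun t => (hpd _).mul (hqd _)) (fun t z => mul_mem (hpG _ z) (hqG _ z))
    (fun z hz => (hcomp ℓ 0 z (hp.2 _ z hz)).mul (hcomp ℓ' 0 z (hq.2 _ z hz)))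
    (fun z hz => by simp [hp0 z hz, hq0 z hz])
  obtain ⟨ε, hε, hball⟩ := Metric.eventually_nhds_iff_ball.1 hloop
  refine ⟨ε, ρ, hε, hρ, hρ1, fun t ht => ⟨(hpd _).mul (hqd _), hball t ht⟩,
    fun z hz => by simp [hp0 z hz, hq0 z hz],
    fun t z => ℓ.smulRight (p' (ℓ t) z * q (ℓ' t) z) + ℓ'.smulRight (p (ℓ t) z * q' (ℓ' t) z),
    fun t _ z hz => ?_, ?_, fun z s => ?_⟩
  · have h1 := (hp.1 (ℓ t) z hz).hasFDerivAt.comp t ℓ.hasFDerivAt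
    have h2 := (hq.1 (ℓ' t) z hz).hasFDerivAt.comp t ℓ'.hasFDerivAt
    refine (h1.mul' h2).congr_fderiv ?_
    ext1 s
    simp [add_comm]
  · rintro ⟨t, z⟩ ⟨-, hz⟩
    refine ContinuousAt.continuousWithinAt ?_
    have h1 := (hcomp ℓ t z (hp.3 _ z hz)).mul (hcomp ℓ' t z (hq.2 _ z hz))
    have h2 := (hcomp ℓ t z (hp.2 _ z hz)).mul (hcomp ℓ' t z (hq.3 _ z hz))
    exact (((ContinuousLinearMap.smulRightL ℝ ℂ (Mat V) ℓ).continuous.continuousAt).comp h1).add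
      (((ContinuousLinearMap.smulRightL ℝ ℂ (Mat V) ℓ').continuous.continuousAt).comp h2)
  · have hz := circle_mem_annulus hρ hρ1 z
    simpa [hp0 _ hz, hq0 _ hz] using hD z s

/-- A curve of loops with velocity the real loop `X` at `0`, composed with `t ↦ 2 Re t`. -/
theorem isC1Family_real {X : loopAlgebra G} (hX : IsReal X) {ρ : ℝ} (hρ : 0 < ρ) (hρ1 : ρ < 1)
    {p p' : ℝ → ℂ → Mat V} (hp : IsC1Curve ρ p p')
    (hpd : ∀ τ, DifferentiableOn ℂ (p τ) (annulus ρ))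
    (hpG : ∀ τ, ∀ z : Circle, p τ z ∈ matGroup G) (hp0 : ∀ z ∈ annulus ρ, p 0 z = 1)
    (hD : ∀ z : Circle, p' 0 z = X.1 z) : IsC1Family X (fun t z => p (2 * t.re) z) := by
  have := isC1Family_mul (u := X) hρ hρ1 hp (IsC1Curve.const (differentiableOn_const 1)) hpd
    (fun _ => differentiableOn_const 1) hpG (fun _ _ => one_mem _) hp0 (fun _ _ => rfl)
    ((2 : ℝ) • Complex.reCLM) 0 fun z s => ?_
  · simpa using this
  · rw [hD, star_eq_neg_of_mem_realLie (hX z), neg_neg, ← add_smul, Complex.add_conj,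
      real_smul_eq]
    simp

end

section

/-! ### Lie derivatives along real loops -/

variable {V : Type*} [NormedAddCommGroup V] [InnerProductSpace ℂ V] [CompleteSpace V]
  {G : Subgroup (unitary (Mat V))} [FiniteDimensional ℂ V]

theorem ActsTo.inverse_exp_mul {x y : loopAlgebra G} {s t : ℝ} {α β γ : Forms G}
    (h : ActsTo (expLoop x (-s)) α β) (h' : ActsTo (expLoop y (-t)) β γ) :
    ActsTo (fun z => Ring.inverse (expLoop x s z * expLoop y t z)) α γ := by
  refine (h.mul h').congr (ρ := 1 / 2) (by norm_num) (by norm_num) fun z _ => ?_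
  rw [inverse_mul (isUnit_expLoop x s z) (isUnit_expLoop y t z), inverse_expLoop, inverse_expLoop]

theorem exists_common_annulus (x y : loopAlgebra G) : ∃ ρ : ℝ, 0 < ρ ∧ ρ < 1 ∧
    DifferentiableOn ℂ (loopExt x) (annulus ρ) ∧ DifferentiableOn ℂ (loopExt y) (annulus ρ) := by
  obtain ⟨ρ₁, h01, h11, hX⟩ := exists_differentiableOn_loopExt x
  obtain ⟨ρ₂, h02, h12, hY⟩ := exists_differentiableOn_loopExt y
  exact ⟨max ρ₁ ρ₂, lt_max_of_lt_left h01, max_lt h11 h12,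
    hX.mono (annulus_mono h01 (le_max_left _ _)), hY.mono (annulus_mono h02 (le_max_right _ _))⟩

/-- For `u = x + i y`, the family `e^{2 Re t x} e^{-2 Im t y}`. -/
theorem isC1Family_exp_mul_exp {x y : loopAlgebra G} (hx : IsReal x) (hy : IsReal y) :
    IsC1Family (x + Complex.I • y)
      (fun t z => expLoop x (2 * t.re) z * expLoop y (-2 * t.im) z) := by
  obtain ⟨ρ, h0, h1, hX, hY⟩ := exists_common_annulus x y
  refine isC1Family_mul h0 h1 (IsC1Curve.exp hX) (IsC1Curve.exp hY)
    (differentiableOn_expLoop hX) (differentiableOn_expLoop hY)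
    (expLoop_mem hx) (expLoop_mem hy) (fun z _ => expLoop_zero x z) (fun z _ => expLoop_zero y z)
    ((2 : ℝ) • Complex.reCLM) ((-2 : ℝ) • Complex.imCLM) fun z s => ?_
  have e1 : ((2 * s.re : ℝ) : ℂ) = s + conj s := (Complex.add_conj s).symm ▸ by push_cast; ring
  have e2 : ((-2 * s.im : ℝ) : ℂ) = Complex.I * s - Complex.I * conj s := by
    rw [← mul_sub, Complex.sub_conj]
    push_cast
    linear_combination (-2 * s.im : ℂ) * Complex.I_mul_I
  simp only [expLoop_zero, one_mul, loopExt_apply, loop_add_apply, loop_smul_apply, star_add,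
    star_smul, star_eq_neg_of_mem_realLie (hx z), star_eq_neg_of_mem_realLie (hy z)]
  simp only [smul_apply, Complex.reCLM_apply, Complex.imCLM_apply, smul_eq_mul]
  rw [real_smul_eq, real_smul_eq, e1, e2]
  simp only [Complex.star_def, Complex.conj_I]
  module

/-- The real loop `0` acts trivially. -/
theorem act_zero_loop (s : ℝ) (α : Forms G) : act (0 : loopAlgebra G) s α = α := by
  obtain ⟨ρ, h0, h1, hd⟩ := exists_differentiableOn_loopExt (0 : loopAlgebra G)
  refine act_eq ((ActsTo.one α).congr h0 h1 fun z hz => ?_)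
  have : loopExt (0 : loopAlgebra G) z = 0 := eq_zero_of_circle h0 h1 hd
    (fun z => by rw [loopExt_apply]; rfl) hz
  rw [expLoop, this, smul_zero, NormedSpace.exp_zero]

theorem tendsto_act_comp (hclosed : IsClosed (G : Set (unitary (Mat V)))) {X : loopAlgebra G}
    (hX : IsReal X) {α : Forms G} {ι : Type*} {l : Filter ι} {s : ι → ℝ} {b : ι → Forms G}
    (hs : Tendsto s l (𝓝 0)) (hb : Tendsto b l (𝓝 α)) :
    Tendsto (fun i => act X (s i) (b i)) l (𝓝 α) ∧
      ∀ᶠ i in l, ActsTo (expLoop X (s i)) (b i) (act X (s i) (b i)) := by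
  have h1 := tendsto_act hclosed hX α
  have h2 := eventually_actsTo hclosed hX α
  rw [nhds_prod_eq] at h1 h2
  have h := hs.prodMk hb
  exact ⟨Tendsto.comp (g := fun p : ℝ × Forms G => act X p.1 p.2) (f := fun i => (s i, b i)) h1 h,
    h.eventually (p := fun q => ActsTo (expLoop X q.1) q.2 (act X q.1 q.2)) h2⟩

/-- The derivatives along `u = x + i y` are those along the flows of the real loops `x` and `y`. -/
theorem HasLeftDeriv.hasDerivAt_act (hclosed : IsClosed (G : Set (unitary (Mat V))))
    {x y : loopAlgebra G} (hx : IsReal x) (hy : IsReal y) {F : Forms G → ℂ} {α : Forms G} {a b : ℂ}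
    (h : HasLeftDeriv F α (x + Complex.I • y) a b) :
    HasDerivAt (fun s : ℝ => F (act x (-s) α)) ((a + b) / 2) 0 ∧
    HasDerivAt (fun s : ℝ => F (act y (-s) α)) (-Complex.I * (a - b) / 2) 0 := by
  have hre : Tendsto (fun t : ℂ => -(2 * t.re)) (𝓝 0) (𝓝 0) :=
    Continuous.tendsto' (by fun_prop) _ _ (by simp)
  have him : Tendsto (fun t : ℂ => -(-2 * t.im)) (𝓝 0) (𝓝 0) :=
    Continuous.tendsto' (by fun_prop) _ _ (by simp)
  obtain ⟨h1, h1'⟩ := tendsto_act_comp hclosed hx hre (tendsto_const_nhds (x := α))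
  obtain ⟨h2, h2'⟩ := tendsto_act_comp hclosed hy him h1
  have ho := h _ (isC1Family_exp_mul_exp hx hy)
    (fun t => act y (-(-2 * t.im)) (act x (-(2 * t.re)) α)) (by
      filter_upwards [h1', h2'] with t ht ht' using ht.inverse_exp_mul ht')
  constructor
  · rw [hasDerivAt_iff_isLittleO_nhds_zero]
    have hlim : Tendsto (fun s : ℝ => ((s / 2 : ℝ) : ℂ)) (𝓝 0) (𝓝 0) :=
      Continuous.tendsto' (by fun_prop) _ _ (by simp)
    refine ((ho.comp_tendsto hlim).congr_left fun s => ?_).trans_isBigO ?_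
    · simp only [Function.comp_apply, Complex.ofReal_re, Complex.ofReal_im, mul_zero, neg_zero,
        act_zero, Complex.conj_ofReal, zero_add, Complex.real_smul]
      rw [show 2 * (s / 2) = s by ring]
      push_cast; ring
    · refine IsBigO.of_bound 1 (Eventually.of_forall fun s => ?_)
      simp only [Function.comp_apply, Complex.norm_real, Real.norm_eq_abs, abs_div, abs_two, one_mul]
      have := abs_nonneg s
      linarith
  · rw [hasDerivAt_iff_isLittleO_nhds_zero]
    have hlim : Tendsto (fun s : ℝ => -((s / 2 : ℝ) : ℂ) * Complex.I) (𝓝 0) (𝓝 0) :=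
      Continuous.tendsto' (by fun_prop) _ _ (by simp)
    refine ((ho.comp_tendsto hlim).congr_left fun s => ?_).trans_isBigO ?_
    · simp only [Function.comp_apply, Complex.mul_re, Complex.mul_im, Complex.neg_re, Complex.neg_im,
        Complex.ofReal_re, Complex.ofReal_im, Complex.I_re, Complex.I_im, mul_zero, mul_one,
        neg_zero, sub_zero, zero_mul, add_zero, zero_add, act_zero, Complex.real_smul, map_mul,
        map_neg, Complex.conj_ofReal, Complex.conj_I]
      rw [show -(-2 * -(s / 2)) = -s by ring]
      push_cast; ring
    · refine IsBigO.of_bound 1 (Eventually.of_forall fun s => ?_)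
      simp only [Function.comp_apply, norm_mul, norm_neg, Complex.norm_real, Complex.norm_I, mul_one,
        Real.norm_eq_abs, abs_div, abs_two, one_mul]
      have := abs_nonneg s
      linarith

/-- The derivative is determined by `F`: `C¹`-families with a given velocity exist, and for `u = x +
i y` with `x`, `y` real they give the derivatives of `F` along the flows of `x` and `y`. -/
theorem HasLeftDeriv.unique (hclosed : IsClosed (G : Set (unitary (Mat V)))) {u : loopAlgebra G}
    {F : Forms G → ℂ} {α : Forms G} {a b a' b' : ℂ} (h : HasLeftDeriv F α u a b)
    (h' : HasLeftDeriv F α u a' b') : a = a' := by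
  obtain ⟨x, y, hx, hy, rfl⟩ := exists_real_add hclosed u
  obtain ⟨h1, h2⟩ := h.hasDerivAt_act hclosed hx hy
  obtain ⟨h1', h2'⟩ := h'.hasDerivAt_act hclosed hx hy
  have e1 := h1.unique h1'
  have e2 := h2.unique h2'
  linear_combination e1 + Complex.I * e2 + (a - b - (a' - b')) / 2 * Complex.I_sq

theorem HasLeftDeriv.lieDeriv_eq (hclosed : IsClosed (G : Set (unitary (Mat V))))
    {u : loopAlgebra G} {F : Forms G → ℂ} {α : Forms G} {a b : ℂ} (h : HasLeftDeriv F α u a b) :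
    lieDeriv u F α = a := by
  obtain ⟨b', h'⟩ := Classical.epsilon_spec (p := fun a => ∃ b, HasLeftDeriv F α u a b) ⟨a, b, h⟩
  exact h'.unique hclosed h

/-- Along a real loop, the two derivatives agree. -/
theorem HasLeftDeriv.eq_of_isReal (hclosed : IsClosed (G : Set (unitary (Mat V))))
    {X : loopAlgebra G} (hX : IsReal X) {F : Forms G → ℂ} {α : Forms G} {a b : ℂ}
    (h : HasLeftDeriv F α X a b) :
    a = b ∧ HasDerivAt (fun s : ℝ => F (act X (-s) α)) a 0 := by
  have h0 : IsReal (0 : loopAlgebra G) := fun z => (realSub hclosed).zero_mem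
  rw [show X = X + Complex.I • (0 : loopAlgebra G) by rw [smul_zero, add_zero]] at h
  obtain ⟨h1, h2⟩ := h.hasDerivAt_act hclosed hX h0
  simp only [act_zero_loop] at h2
  have e := h2.unique (hasDerivAt_const 0 _)
  have hab : a = b := by
    linear_combination Complex.I * 2 * e + (a - b) * Complex.I_sq
  refine ⟨hab, ?_⟩
  subst hab
  simpa using h1

/-- A function of class `C^{n+1}` has a derivative `ℒ_u F` everywhere, of class `C^n`. -/
theorem IsCk.exists_hasLeftDeriv (hclosed : IsClosed (G : Set (unitary (Mat V)))) {n : ℕ}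
    {F : Forms G → ℂ} (h : IsCk (n + 1) F) (u : loopAlgebra G) :
    IsCk n (lieDeriv u F) ∧ ∀ α, ∃ b, HasLeftDeriv F α u (lieDeriv u F α) b := by
  obtain ⟨A, B, hd, hA⟩ := h.2 u
  obtain rfl : lieDeriv u F = A := funext fun α => (hd α).lieDeriv_eq hclosed
  exact ⟨hA, fun α => ⟨B α, hd α⟩⟩

theorem IsCk.continuous {n : ℕ} {F : Forms G → ℂ} (h : IsCk n F) : Continuous F := by
  cases n with
  | zero => exact h
  | succ n => exact h.1

theorem IsCk.pred {n : ℕ} {F : Forms G → ℂ} (h : IsCk (n + 1) F) : IsCk n F := by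
  induction n generalizing F with
  | zero => exact h.1
  | succ n ih =>
    refine ⟨h.1, fun u => ?_⟩
    obtain ⟨A, B, hd, hA⟩ := h.2 u
    exact ⟨A, B, hd, ih hA⟩

/-- The derivative along the orbits of the flow of a real loop. -/
theorem hasDerivAt_act (hclosed : IsClosed (G : Set (unitary (Mat V)))) {X : loopAlgebra G}
    (hX : IsReal X) {F : Forms G → ℂ} (hF : IsCk 1 F) (k : ℝ) {α : Forms G} {s : ℝ}
    (h : ∀ᶠ r in 𝓝 (k * s), ActsTo (expLoop X r) α (act X r α)) :
    HasDerivAt (fun r => F (act X (k * r) α)) (-k * lieDeriv X F (act X (k * s) α)) s := by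
  obtain ⟨b, hb⟩ := (hF.exists_hasLeftDeriv hclosed X).2 (act X (k * s) α)
  have hd := (hb.eq_of_isReal hclosed hX).2
  have h1 : HasDerivAt (fun r : ℝ => k * s - k * r) (-k) s := by
    simpa using ((hasDerivAt_id s).const_mul k).const_sub (k * s)
  have h2 := HasDerivAt.scomp (h := fun r : ℝ => k * s - k * r) s (by simpa using hd) h1
  have hcont : Tendsto (fun r => k * r) (𝓝 s) (𝓝 (k * s)) := (continuous_const_mul k).tendsto s
  have h3 : (fun r => F (act X (k * r) α)) =ᶠ[𝓝 s]
      (fun t : ℝ => F (act X (-t) (act X (k * s) α))) ∘ fun r => k * s - k * r := by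
    filter_upwards [hcont.eventually h] with r hr
    have h4 := h.self_of_nhds.exp_sub hr
    rw [← neg_sub] at h4
    simp only [Function.comp_apply]
    rw [act_eq h4]
  simpa using h2.congr_of_eventuallyEq h3

end

section

/-! ### Second-order expansions along paths of forms -/

variable {V : Type*} [NormedAddCommGroup V] [InnerProductSpace ℂ V] [CompleteSpace V]
  {G : Subgroup (unitary (Mat V))} [FiniteDimensional ℂ V]

section Segment

variable {P : ℝ → Forms G → Prop} {α : Forms G}

theorem eventually_segment (h : ∀ᶠ p in 𝓝 (0 : ℝ) ×ˢ 𝓝 α, P p.1 p.2) {b : ℝ → Forms G}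
    (hb : Tendsto b (𝓝[>] 0) (𝓝 α)) (k : ℝ) :
    ∀ᶠ s in 𝓝[>] (0 : ℝ), ∀ σ ∈ Set.Icc 0 s, P (k * σ) (b s) := by
  obtain ⟨p, hp, q, hq, hpq⟩ := eventually_prod_iff.1 h
  obtain ⟨δ, hδ, hδ'⟩ := Metric.eventually_nhds_iff.1 hp
  have hlim : Tendsto (fun s : ℝ => |k| * s) (𝓝[>] 0) (𝓝 0) :=
    (Continuous.tendsto' (by fun_prop) _ _ (by simp)).mono_left nhdsWithin_le_nhds
  filter_upwards [hb.eventually hq, hlim.eventually_lt_const hδ] with s h1 h2 σ hσ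
  have h3 : p (k * σ) := hδ' (by
    rw [Real.dist_eq, sub_zero, abs_mul, abs_of_nonneg hσ.1]
    exact (mul_le_mul_of_nonneg_left hσ.2 (abs_nonneg k)).trans_lt h2)
  exact hpq h3 h1

theorem eventually_nhds_of_prod (h : ∀ᶠ p in 𝓝 (0 : ℝ) ×ˢ 𝓝 α, P p.1 p.2) :
    ∀ᶠ p : ℝ × Forms G in 𝓝 (0 : ℝ) ×ˢ 𝓝 α, ∀ᶠ r in 𝓝 p.1, P r p.2 := by
  obtain ⟨p, hp, q, hq, hpq⟩ := eventually_prod_iff.1 h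
  filter_upwards [(eventually_eventually_nhds.2 hp).prod_mk hq] with a ha
  exact ha.1.mono fun r hr => hpq hr ha.2

end Segment

/-- Along the path `b`, `F (b s) = F α + s P₁ F + s² P₂ F + o(s²)` as `s ↓ 0`. -/
structure HasJet (b : ℝ → Forms G) (α : Forms G) (P₁ P₂ : (Forms G → ℂ) → ℂ) : Prop where
  tendsto : Tendsto b (𝓝[>] 0) (𝓝 α)
  order_one : ∀ F, IsCk 1 F →
    (fun s : ℝ => F (b s) - F α - s * P₁ F) =o[𝓝[>] 0] fun s : ℝ => s
  order_two : ∀ F, IsCk 2 F →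
    (fun s : ℝ => F (b s) - F α - s * P₁ F - s ^ 2 * P₂ F) =o[𝓝[>] 0] fun s : ℝ => s ^ 2

section Flow

variable {X : loopAlgebra G} {α : Forms G} {b : ℝ → Forms G}

/-- For small `s`, the flow is differentiable on the segment `[0, s]`, and continuous functions stay
close to their values at `α`. -/
theorem eventually_flow (hclosed : IsClosed (G : Set (unitary (Mat V)))) (hX : IsReal X)
    (hb : Tendsto b (𝓝[>] 0) (𝓝 α)) (k : ℝ) {H : Forms G → ℂ} (hH : Continuous H) {ε : ℝ}
    (hε : 0 < ε) : ∀ᶠ s in 𝓝[>] (0 : ℝ), ∀ σ ∈ Set.Icc 0 s,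
      (∀ F, IsCk 1 F → HasDerivAt (fun r => F (act X (k * r) (b s)))
        (-k * lieDeriv X F (act X (k * σ) (b s))) σ) ∧
      ‖H (act X (k * σ) (b s)) - H α‖ ≤ ε := by
  have h1 := eventually_actsTo hclosed hX α
  have h2 := (hH.tendsto α).comp (tendsto_act hclosed hX α)
  rw [nhds_prod_eq] at h1 h2
  have h3 : ∀ᶠ p : ℝ × Forms G in 𝓝 0 ×ˢ 𝓝 α, ‖H (act X p.1 p.2) - H α‖ ≤ ε := by
    filter_upwards [Metric.tendsto_nhds.1 h2 ε hε] with p hp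
    rw [← dist_eq_norm]; exact hp.le
  filter_upwards [eventually_segment (P := fun r β => ‖H (act X r β) - H α‖ ≤ ε) h3 hb k,
    eventually_segment (P := fun r β => ∀ᶠ r' in 𝓝 r, ActsTo (expLoop X r') β (act X r' β))
      (eventually_nhds_of_prod (P := fun r β => ActsTo (expLoop X r) β (act X r β)) h1) hb k]
    with s hs hs' σ hσ
  exact ⟨fun F hF => hasDerivAt_act hclosed hX hF k (hs' σ hσ), hs σ hσ⟩

theorem norm_le_of_deriv {f f' : ℝ → ℂ} {s C : ℝ} (hs : 0 ≤ s)
    (hf : ∀ σ ∈ Set.Icc 0 s, HasDerivAt f (f' σ) σ) (hC : ∀ σ ∈ Set.Icc 0 s, ‖f' σ‖ ≤ C) :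
    ‖f s - f 0‖ ≤ C * s := by
  have := (convex_Icc (0 : ℝ) s).norm_image_sub_le_of_norm_hasDerivWithin_le
    (fun σ hσ => (hf σ hσ).hasDerivWithinAt) hC (Set.left_mem_Icc.2 hs) (Set.right_mem_Icc.2 hs)
  simpa [abs_of_nonneg hs] using this

/-- First-order expansion of `F` along a step of the flow of `kX`, started on a path tending to `α`.
-/
theorem flow_order_one (hclosed : IsClosed (G : Set (unitary (Mat V)))) (hX : IsReal X)
    (hb : Tendsto b (𝓝[>] 0) (𝓝 α)) (k : ℝ) {F : Forms G → ℂ} (hF : IsCk 1 F) :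
    (fun s : ℝ => F (act X (k * s) (b s)) - F (b s) + s * (k * lieDeriv X F α))
      =o[𝓝[>] 0] fun s : ℝ => s := by
  refine isLittleO_iff.2 fun c hc => ?_
  filter_upwards [eventually_flow hclosed hX hb k
    (hF.exists_hasLeftDeriv hclosed X).1.continuous (ε := c / (|k| + 1)) (by positivity),
    self_mem_nhdsWithin] with s hs h0
  have h0 : 0 < s := h0
  have := norm_le_of_deriv (f := fun σ => F (act X (k * σ) (b s)) + σ * (k * lieDeriv X F α))
    (f' := fun σ => -k * lieDeriv X F (act X (k * σ) (b s)) + 1 * (k * lieDeriv X F α))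
    (C := c) h0.le (fun σ hσ => ((hs σ hσ).1 F hF).add
      ((Complex.ofRealCLM.hasDerivAt (x := σ)).mul_const _)) fun σ hσ => ?_
  · simp only [mul_zero, act_zero, Complex.ofReal_zero, zero_mul, add_zero] at this
    rw [Real.norm_eq_abs, abs_of_pos h0]
    convert this using 2
    ring
  · rw [show -(k : ℂ) * lieDeriv X F (act X (k * σ) (b s)) + 1 * (k * lieDeriv X F α) =
      -k * (lieDeriv X F (act X (k * σ) (b s)) - lieDeriv X F α) by ring, norm_mul, norm_neg,
      Complex.norm_real, Real.norm_eq_abs]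
    calc _ ≤ |k| * (c / (|k| + 1)) := by gcongr; exact (hs σ hσ).2
      _ = c * (|k| / (|k| + 1)) := by ring
      _ ≤ c * 1 := by gcongr; exact (div_le_one (by positivity)).2 (by linarith)
      _ = c := mul_one c

/-- Second-order expansion of `F` along a step of the flow of `kX`, started on a path tending to
`α`. -/
theorem flow_order_two (hclosed : IsClosed (G : Set (unitary (Mat V)))) (hX : IsReal X)
    (hb : Tendsto b (𝓝[>] 0) (𝓝 α)) (k : ℝ) {F : Forms G → ℂ} (hF : IsCk 2 F) :
    (fun s : ℝ => F (act X (k * s) (b s)) - F (b s) + s * (k * lieDeriv X F (b s)) -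
      s ^ 2 * (k ^ 2 / 2 * lieDeriv X (lieDeriv X F) α)) =o[𝓝[>] 0] fun s : ℝ => s ^ 2 := by
  refine isLittleO_iff.2 fun c hc => ?_
  have hF' := (hF.exists_hasLeftDeriv hclosed X).1
  filter_upwards [eventually_flow hclosed hX hb k
    (hF'.exists_hasLeftDeriv hclosed X).1.continuous (ε := c / (k ^ 2 + 1)) (by positivity),
    self_mem_nhdsWithin] with s hs h0
  have h0 : 0 < s := h0
  set L := lieDeriv X (lieDeriv X F) α
  set E := lieDeriv X F (b s)
  have hsq : ∀ σ : ℝ, HasDerivAt (fun σ : ℝ => (σ : ℂ) ^ 2 * (k ^ 2 / 2 * L))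
      (σ * (k ^ 2 * L)) σ := fun σ => by
    have := ((Complex.ofRealCLM.hasDerivAt (x := σ)).fun_pow 2).mul_const (k ^ 2 / 2 * L)
    refine this.congr_deriv ?_
    simp; ring
  have h1 : ∀ τ ∈ Set.Icc 0 s, ‖-k * lieDeriv X F (act X (k * τ) (b s)) + k * E -
      τ * (k ^ 2 * L)‖ ≤ c * s := by
    intro τ hτ
    have := norm_le_of_deriv
      (f := fun σ => -k * lieDeriv X F (act X (k * σ) (b s)) + k * E - σ * (k ^ 2 * L))
      (f' := fun σ => -k * (-k * lieDeriv X (lieDeriv X F) (act X (k * σ) (b s))) -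
        1 * (k ^ 2 * L))
      (C := c) hτ.1 (fun σ hσ => ((((hs σ ⟨hσ.1, hσ.2.trans hτ.2⟩).1 _ hF').const_mul (-k : ℂ)).add_const
        (k * E)).sub ((Complex.ofRealCLM.hasDerivAt (x := σ)).mul_const _)) fun σ hσ => ?_
    · simp only [mul_zero, act_zero, Complex.ofReal_zero, zero_mul, sub_zero] at this
      rw [show -(k : ℂ) * lieDeriv X F (b s) + k * E = 0 by ring, sub_zero] at this
      exact this.trans (by gcongr; exact hτ.2)
    · rw [show -(k : ℂ) * (-k * lieDeriv X (lieDeriv X F) (act X (k * σ) (b s))) -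
        1 * (k ^ 2 * L) = ((k ^ 2 : ℝ) : ℂ) *
          (lieDeriv X (lieDeriv X F) (act X (k * σ) (b s)) - L) by push_cast; ring,
        norm_mul, Complex.norm_real, Real.norm_eq_abs, abs_of_nonneg (sq_nonneg k)]
      calc _ ≤ k ^ 2 * (c / (k ^ 2 + 1)) := by
            gcongr; exact (hs σ ⟨hσ.1, hσ.2.trans hτ.2⟩).2
        _ = c * (k ^ 2 / (k ^ 2 + 1)) := by ring
        _ ≤ c * 1 := by gcongr; exact (div_le_one (by positivity)).2 (by linarith)
        _ = c := mul_one c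
  have := norm_le_of_deriv
    (f := fun σ => F (act X (k * σ) (b s)) + σ * (k * E) - (σ : ℂ) ^ 2 * (k ^ 2 / 2 * L))
    (f' := fun σ => -k * lieDeriv X F (act X (k * σ) (b s)) + 1 * (k * E) - σ * (k ^ 2 * L))
    (C := c * s) h0.le (fun σ hσ => (((hs σ hσ).1 F hF.pred).add
      ((Complex.ofRealCLM.hasDerivAt (x := σ)).mul_const _)).sub (hsq σ)) fun σ hσ => ?_
  · simp only [mul_zero, act_zero, Complex.ofReal_zero, zero_mul, add_zero, ne_eq, OfNat.ofNat_ne_zero,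
      not_false_eq_true, zero_pow, sub_zero] at this
    rw [Real.norm_eq_abs, abs_of_pos (pow_pos h0 2)]
    refine le_trans (le_of_eq ?_) (this.trans_eq (by ring))
    congr 1
    ring
  · rw [one_mul]
    exact h1 σ hσ

theorem HasJet.const (α : Forms G) : HasJet (fun _ => α) α (fun _ => 0) (fun _ => 0) :=
  ⟨tendsto_const_nhds, fun F _ => by simp, fun F _ => by simp⟩

/-- The effect of the flow of a real loop on the expansion along a path. -/
theorem HasJet.act (hclosed : IsClosed (G : Set (unitary (Mat V)))) (hX : IsReal X)
    {P₁ P₂ : (Forms G → ℂ) → ℂ} (h : HasJet b α P₁ P₂) (k : ℝ) :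
    HasJet (fun s => act X (k * s) (b s)) α (fun F => P₁ F - k * lieDeriv X F α)
      (fun F => P₂ F - k * P₁ (lieDeriv X F) + k ^ 2 / 2 * lieDeriv X (lieDeriv X F) α) := by
  have hlim : Tendsto (fun s : ℝ => k * s) (𝓝[>] 0) (𝓝 0) :=
    (Continuous.tendsto' (by fun_prop) _ _ (by simp)).mono_left nhdsWithin_le_nhds
  refine ⟨(tendsto_act_comp hclosed hX hlim h.tendsto).1, fun F hF => ?_, fun F hF => ?_⟩
  · refine ((flow_order_one hclosed hX h.tendsto k hF).add (h.order_one F hF)).congr_left fun s => ?_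
    ring
  · have hF' := (hF.exists_hasLeftDeriv hclosed X).1
    have h1 : (fun s : ℝ => (s : ℂ) * (-k * (lieDeriv X F (b s) - lieDeriv X F α -
        s * P₁ (lieDeriv X F)))) =o[𝓝[>] 0] fun s : ℝ => s ^ 2 := by
      simp only [pow_two]
      exact IsBigO.mul_isLittleO (IsBigO.of_bound 1 (Eventually.of_forall fun s => by simp))
        ((h.order_one _ hF').const_mul_left (-k : ℂ))
    refine (((flow_order_two hclosed hX h.tendsto k hF).add (h.order_two F hF)).add h1).congr_left
      fun s => ?_
    ring

end Flow

end

section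

/-! ### Linearity of the Lie derivative and its commutators -/

variable {V : Type*} [NormedAddCommGroup V] [InnerProductSpace ℂ V] [CompleteSpace V]
  {G : Subgroup (unitary (Mat V))} [FiniteDimensional ℂ V]

theorem eq_zero_of_isLittleO {c : ℂ} {n : ℕ}
    (h : (fun s : ℝ => (s : ℂ) ^ n * c) =o[𝓝[>] 0] fun s : ℝ => s ^ n) : c = 0 := by
  by_contra hc
  have h0 : 0 < ‖c‖ := norm_pos_iff.2 hc
  obtain ⟨s, hs, hs0⟩ := ((h.def (half_pos h0)).and self_mem_nhdsWithin).exists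
  have hs0 : 0 < s := hs0
  rw [norm_mul, norm_pow, norm_pow, Complex.norm_real, Real.norm_eq_abs, abs_of_pos hs0,
    mul_comm] at hs
  have := le_of_mul_le_mul_right hs (pow_pos hs0 n)
  linarith

/-- The Lie derivative along a real loop can be computed with any curve of loops. -/
theorem isLittleO_of_curve (hclosed : IsClosed (G : Set (unitary (Mat V)))) {Z : loopAlgebra G}
    (hZ : IsReal Z) {F : Forms G → ℂ} (hF : IsCk 1 F) {α : Forms G} {p : ℝ → ℂ → Mat V}
    (hp : IsC1Family Z (fun t z => p (2 * t.re) z)) {β : ℝ → Forms G}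
    (hβ : ∀ᶠ τ in 𝓝 (0 : ℝ), ActsTo (fun z => Ring.inverse (p τ z)) α (β τ)) :
    (fun τ : ℝ => F (β τ) - F α - τ * lieDeriv Z F α) =o[𝓝 0] fun τ : ℝ => τ := by
  obtain ⟨b, hb⟩ := (hF.exists_hasLeftDeriv hclosed Z).2 α
  obtain rfl := (hb.eq_of_isReal hclosed hZ).1
  have hre : Tendsto (fun t : ℂ => 2 * t.re) (𝓝 0) (𝓝 0) :=
    Continuous.tendsto' (by fun_prop) _ _ (by simp)
  have ho := hb _ hp (fun t => β (2 * t.re)) (hre.eventually hβ)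
  have hlim : Tendsto (fun s : ℝ => ((s / 2 : ℝ) : ℂ)) (𝓝 0) (𝓝 0) :=
    Continuous.tendsto' (by fun_prop) _ _ (by simp)
  refine ((ho.comp_tendsto hlim).congr_left fun s => ?_).trans_isBigO ?_
  · simp only [Function.comp_apply, Complex.ofReal_re, Complex.conj_ofReal]
    rw [show 2 * (s / 2) = s by ring]
    push_cast; ring
  · refine IsBigO.of_bound 1 (Eventually.of_forall fun s => ?_)
    simp only [Function.comp_apply, Complex.norm_real, Real.norm_eq_abs, abs_div, abs_two, one_mul]
    have := abs_nonneg s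
    linarith

/-- The product of the one-parameter groups of `X` and `Y` is a `C¹`-family with velocity `X + Y`,
and its effect on `F` to first order is that of the two flows in succession. -/
theorem lieDeriv_add_of_isReal (hclosed : IsClosed (G : Set (unitary (Mat V))))
    {X Y : loopAlgebra G} (hX : IsReal X) (hY : IsReal Y) {F : Forms G → ℂ} (hF : IsCk 1 F)
    (α : Forms G) : lieDeriv (X + Y) F α = lieDeriv X F α + lieDeriv Y F α := by
  obtain ⟨ρ, h0, h1, hdX, hdY⟩ := exists_common_annulus X Y
  have hfam : IsC1Family (X + Y)
      (fun t z => expLoop X (2 * t.re) z * expLoop Y (2 * t.re) z) :=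
    isC1Family_real (p := fun τ z => expLoop X τ z * expLoop Y τ z) (hX.add hclosed hY) h0 h1
      ((IsC1Curve.exp hdX).mul (IsC1Curve.exp hdY))
      (fun τ => (differentiableOn_expLoop hdX τ).mul (differentiableOn_expLoop hdY τ))
      (fun τ z => mul_mem (expLoop_mem hX τ z) (expLoop_mem hY τ z)) (fun z _ => by simp)
      (fun z => by simp [loopExt_apply, loop_add_apply])
  have hlim : Tendsto (fun s : ℝ => -1 * s) (𝓝 0) (𝓝 0) :=
    Continuous.tendsto' (by fun_prop) _ _ (by simp)
  obtain ⟨ha, ha'⟩ := tendsto_act_comp hclosed hX hlim (tendsto_const_nhds (x := α))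
  obtain ⟨hb, hb'⟩ := tendsto_act_comp hclosed hY hlim ha
  have ho := isLittleO_of_curve hclosed (hX.add hclosed hY) hF (α := α)
    (p := fun τ z => expLoop X τ z * expLoop Y τ z)
    (β := fun s => act Y (-1 * s) (act X (-1 * s) α)) hfam (by
      filter_upwards [ha', hb'] with s hs hs'
      rw [neg_one_mul] at hs hs' ⊢
      exact hs.inverse_exp_mul hs')
  have hj := (((HasJet.const α).act hclosed hX (-1)).act hclosed hY (-1)).order_one F hF
  have := (hj.sub (ho.mono nhdsWithin_le_nhds))
  refine sub_eq_zero.1 (eq_zero_of_isLittleO (n := 1) ?_)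
  simp only [pow_one]
  refine this.congr_left fun s => ?_
  push_cast
  ring

/-- The commutator of two flows: `[ℒ_X, ℒ_Y] = ℒ_{[X,Y]}`. -/
theorem lieDeriv_lie_of_isReal (hclosed : IsClosed (G : Set (unitary (Mat V))))
    {X Y : loopAlgebra G} (hX : IsReal X) (hY : IsReal Y) {F : Forms G → ℂ} (hF : IsCk 2 F)
    (α : Forms G) : lieDeriv ⁅X, Y⁆ F α =
      lieDeriv X (lieDeriv Y F) α - lieDeriv Y (lieDeriv X F) α := by
  obtain ⟨ρ, h0, h1, hd, D, hD, hD0⟩ := exists_isC1Curve_commCurve X Y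
  have hZ : IsReal ⁅X, Y⁆ := hX.lie hclosed hY
  have hc0 : ∀ z, commCurve X Y 0 z = 1 := fun z => by simp [commCurve]
  have hfam : IsC1Family ⁅X, Y⁆ (fun t z => commCurve X Y (2 * t.re) z) :=
    isC1Family_real hZ h0 h1 hD hd (fun τ z => by
      unfold commCurve
      split_ifs
      · exact mul_mem (mul_mem (expLoop_mem hX _ z) (expLoop_mem hY _ z))
          (mul_mem (expLoop_mem hX _ z) (expLoop_mem hY _ z))
      · exact expLoop_mem hZ τ z) (fun z _ => hc0 z)
      (fun z => by rw [hD0 z (circle_mem_annulus h0 h1 z), loopExt_apply])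
  have hsqrt : ∀ k : ℝ, Tendsto (fun τ : ℝ => k * √τ) (𝓝 0) (𝓝 0) := fun k =>
    Continuous.tendsto' (continuous_const.mul Real.continuous_sqrt) _ _ (by simp)
  obtain ⟨ha, ha'⟩ := tendsto_act_comp hclosed hX (hsqrt (-1)) (tendsto_const_nhds (x := α))
  obtain ⟨hb, hb'⟩ := tendsto_act_comp hclosed hY (hsqrt (-1)) ha
  obtain ⟨hc, hc'⟩ := tendsto_act_comp hclosed hX (hsqrt 1) hb
  obtain ⟨hd, hd'⟩ := tendsto_act_comp hclosed hY (hsqrt 1) hc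
  have hneg : Tendsto (fun τ : ℝ => -τ) (𝓝 0) (𝓝 0) :=
    Continuous.tendsto' continuous_neg 0 0 (by simp)
  obtain ⟨-, he'⟩ := tendsto_act_comp hclosed hZ hneg (tendsto_const_nhds (x := α))
  set β : ℝ → Forms G := fun s =>
    act Y (1 * s) (act X (1 * s) (act Y (-1 * s) (act X (-1 * s) α))) with hβ
  have ho := isLittleO_of_curve hclosed hZ hF.pred (α := α) (p := commCurve X Y)
    (β := fun τ => if 0 < τ then β √τ else act ⁅X, Y⁆ (-τ) α) hfam (by
      filter_upwards [ha', hb', hc', hd', he'] with τ h1 h2 h3 h4 h5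
      by_cases h : 0 < τ
      · simp only [commCurve, if_pos h, hβ]
        have hn : -(-√τ) = 1 * √τ := by ring
        have hm : -√τ = -1 * √τ := by ring
        rw [← hm] at h1 h2 h3 h4
        rw [← hn] at h3 h4
        rw [← hm, ← hn]
        have e1 := h1.inverse_exp_mul h2
        have e2 := h3.inverse_exp_mul h4
        refine (e1.mul e2).congr (ρ := 1 / 2) (by norm_num) (by norm_num) fun z _ => ?_
        rw [commLoop, inverse_mul ((isUnit_expLoop X _ z).mul (isUnit_expLoop Y _ z))
          ((isUnit_expLoop X _ z).mul (isUnit_expLoop Y _ z))]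
      · simp only [commCurve, if_neg h, inverse_expLoop]
        exact h5)
  have hsq : Tendsto (fun s : ℝ => s ^ 2) (𝓝[>] 0) (𝓝 0) :=
    (Continuous.tendsto' (by fun_prop) _ _ (by simp)).mono_left nhdsWithin_le_nhds
  have hj := (((((HasJet.const α).act hclosed hX (-1)).act hclosed hY (-1)).act hclosed hX 1).act
    hclosed hY 1).order_two F hF
  have := hj.sub (ho.comp_tendsto hsq)
  refine (sub_eq_zero.1 (eq_zero_of_isLittleO (n := 2) ?_))
  refine this.congr' ?_ EventuallyEq.rfl
  filter_upwards [self_mem_nhdsWithin] with s hs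
  have hs : 0 < s := hs
  simp only [Function.comp_apply, if_pos (pow_pos hs 2), Real.sqrt_sq hs.le, hβ]
  push_cast
  ring

theorem act_smul (a : ℝ) (X : loopAlgebra G) (s : ℝ) (α : Forms G) :
    act ((a : ℂ) • X) s α = act X (a * s) α := by
  obtain ⟨ρ, h0, h1, hdX, hdY⟩ := exists_common_annulus X ((a : ℂ) • X)
  have h : ∀ z ∈ annulus ρ, expLoop ((a : ℂ) • X) s z = expLoop X (a * s) z := fun z hz => by
    have : loopExt ((a : ℂ) • X) z = (a : ℂ) • loopExt X z :=
      eqOn_of_circle h0 h1 hdY (hdX.const_smul (a : ℂ)) (fun z => by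
        simp only [Pi.smul_apply, loopExt_apply, loop_smul_apply]) hz
    rw [expLoop, expLoop, this, smul_smul, Complex.ofReal_mul, mul_comm]
  unfold act
  congr 1
  ext β
  exact ⟨fun hβ => hβ.congr h0 h1 h, fun hβ => hβ.congr h0 h1 fun z hz => (h z hz).symm⟩

theorem lieDeriv_smul_of_isReal (hclosed : IsClosed (G : Set (unitary (Mat V))))
    {X : loopAlgebra G} (hX : IsReal X) (a : ℝ) {F : Forms G → ℂ} (hF : IsCk 1 F) (α : Forms G) :
    lieDeriv ((a : ℂ) • X) F α = a * lieDeriv X F α := by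
  obtain ⟨b, hb⟩ := (hF.exists_hasLeftDeriv hclosed ((a : ℂ) • X)).2 α
  obtain ⟨b', hb'⟩ := (hF.exists_hasLeftDeriv hclosed X).2 α
  have h1 := (hb.eq_of_isReal hclosed (hX.smul hclosed a)).2
  have h2 := (hb'.eq_of_isReal hclosed hX).2
  have h3 := HasDerivAt.scomp (h := fun s : ℝ => a * s) (0 : ℝ) (by simpa using h2)
    ((hasDerivAt_id (0 : ℝ)).const_mul a)
  refine h1.unique ((h3.congr_of_eventuallyEq (Eventually.of_forall fun s => ?_)).congr_deriv ?_)
  · simp only [Function.comp_apply, act_smul, mul_neg]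
  · simp

/-- The Lie derivative along `x + i y` is `ℒ_x + i ℒ_y`. -/
theorem lieDeriv_add_I_smul (hclosed : IsClosed (G : Set (unitary (Mat V))))
    {x y : loopAlgebra G} (hx : IsReal x) (hy : IsReal y) {F : Forms G → ℂ} (hF : IsCk 1 F)
    (α : Forms G) :
    lieDeriv (x + Complex.I • y) F α = lieDeriv x F α + Complex.I * lieDeriv y F α := by
  obtain ⟨b, hb⟩ := (hF.exists_hasLeftDeriv hclosed (x + Complex.I • y)).2 α
  obtain ⟨b₁, hb₁⟩ := (hF.exists_hasLeftDeriv hclosed x).2 α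
  obtain ⟨b₂, hb₂⟩ := (hF.exists_hasLeftDeriv hclosed y).2 α
  obtain ⟨h1, h2⟩ := hb.hasDerivAt_act hclosed hx hy
  have e1 := h1.unique (hb₁.eq_of_isReal hclosed hx).2
  have e2 := h2.unique (hb₂.eq_of_isReal hclosed hy).2
  rw [← e1, ← e2]
  linear_combination (lieDeriv (x + Complex.I • y) F α - b) / 2 * Complex.I_sq

theorem lieDeriv_add (hclosed : IsClosed (G : Set (unitary (Mat V)))) (u v : loopAlgebra G)
    {F : Forms G → ℂ} (hF : IsCk 1 F) (α : Forms G) :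
    lieDeriv (u + v) F α = lieDeriv u F α + lieDeriv v F α := by
  obtain ⟨x, y, hx, hy, rfl⟩ := exists_real_add hclosed u
  obtain ⟨x', y', hx', hy', rfl⟩ := exists_real_add hclosed v
  rw [show x + Complex.I • y + (x' + Complex.I • y') = (x + x') + Complex.I • (y + y') by
    rw [smul_add]; abel, lieDeriv_add_I_smul hclosed (hx.add hclosed hx') (hy.add hclosed hy') hF,
    lieDeriv_add_I_smul hclosed hx hy hF, lieDeriv_add_I_smul hclosed hx' hy' hF,
    lieDeriv_add_of_isReal hclosed hx hx' hF, lieDeriv_add_of_isReal hclosed hy hy' hF]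
  ring

theorem lieDeriv_smul (hclosed : IsClosed (G : Set (unitary (Mat V)))) (a : ℂ) (u : loopAlgebra G)
    {F : Forms G → ℂ} (hF : IsCk 1 F) (α : Forms G) :
    lieDeriv (a • u) F α = a * lieDeriv u F α := by
  obtain ⟨x, y, hx, hy, rfl⟩ := exists_real_add hclosed u
  have h : a • (x + Complex.I • y) = ((a.re : ℂ) • x + ((-a.im : ℝ) : ℂ) • y) +
      Complex.I • ((a.re : ℂ) • y + (a.im : ℂ) • x) := by
    have hI : a * Complex.I = Complex.I * a.re + ((-a.im : ℝ) : ℂ) := by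
      conv_lhs => rw [← Complex.re_add_im a]
      push_cast
      linear_combination (a.im : ℂ) * Complex.I_mul_I
    rw [smul_add, smul_add, smul_smul, smul_smul, smul_smul, hI, add_smul]
    nth_rewrite 1 [← Complex.re_add_im a]
    rw [add_smul, mul_comm (a.im : ℂ)]
    abel
  rw [h, lieDeriv_add_I_smul hclosed ((hx.smul hclosed _).add hclosed (hy.smul hclosed _))
      ((hy.smul hclosed _).add hclosed (hx.smul hclosed _)) hF,
    lieDeriv_add_of_isReal hclosed (hx.smul hclosed _) (hy.smul hclosed _) hF,
    lieDeriv_add_of_isReal hclosed (hy.smul hclosed _) (hx.smul hclosed _) hF,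
    lieDeriv_smul_of_isReal hclosed hx _ hF, lieDeriv_smul_of_isReal hclosed hx _ hF,
    lieDeriv_smul_of_isReal hclosed hy _ hF, lieDeriv_smul_of_isReal hclosed hy _ hF,
    lieDeriv_add_I_smul hclosed hx hy hF]
  push_cast
  linear_combination (lieDeriv x F α + Complex.I * lieDeriv y F α) * Complex.re_add_im a -
    a.im * lieDeriv y F α * Complex.I_sq

theorem HasLeftDeriv.add {F F' : Forms G → ℂ} {α : Forms G} {u : loopAlgebra G} {a b a' b' : ℂ}
    (h : HasLeftDeriv F α u a b) (h' : HasLeftDeriv F' α u a' b') :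
    HasLeftDeriv (F + F') α u (a + a') (b + b') := fun χ hχ β hβ => by
  refine ((h χ hχ β hβ).add (h' χ hχ β hβ)).congr_left fun t => ?_
  simp only [Pi.add_apply]
  ring

theorem HasLeftDeriv.smul {F : Forms G → ℂ} {α : Forms G} {u : loopAlgebra G} {a b : ℂ}
    (c : ℂ) (h : HasLeftDeriv F α u a b) :
    HasLeftDeriv (c • F) α u (c * a) (c * b) := fun χ hχ β hβ => by
  refine ((h χ hχ β hβ).const_mul_left c).congr_left fun t => ?_
  simp only [Pi.smul_apply, smul_eq_mul]
  ring

theorem lieDeriv_apply_add (hclosed : IsClosed (G : Set (unitary (Mat V)))) (u : loopAlgebra G)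
    {F F' : Forms G → ℂ} (hF : IsCk 1 F) (hF' : IsCk 1 F') :
    lieDeriv u (F + F') = lieDeriv u F + lieDeriv u F' := funext fun α => by
  obtain ⟨b, hb⟩ := (hF.exists_hasLeftDeriv hclosed u).2 α
  obtain ⟨b', hb'⟩ := (hF'.exists_hasLeftDeriv hclosed u).2 α
  exact (hb.add hb').lieDeriv_eq hclosed

theorem lieDeriv_apply_smul (hclosed : IsClosed (G : Set (unitary (Mat V)))) (u : loopAlgebra G)
    (c : ℂ) {F : Forms G → ℂ} (hF : IsCk 1 F) :
    lieDeriv u (c • F) = c • lieDeriv u F := funext fun α => by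
  obtain ⟨b, hb⟩ := (hF.exists_hasLeftDeriv hclosed u).2 α
  exact (hb.smul c).lieDeriv_eq hclosed

theorem loop_lie_add_I_smul (x y x' y' : loopAlgebra G) :
    ⁅x + Complex.I • y, x' + Complex.I • y'⁆ =
      (⁅x, x'⁆ + ((-1 : ℝ) : ℂ) • ⁅y, y'⁆) + Complex.I • (⁅x, y'⁆ + ⁅y, x'⁆) := by
  simp only [add_lie, lie_add, lie_smul, smul_lie, smul_add, smul_smul, Complex.I_mul_I]
  push_cast
  abel

/-- The commutator of Lie derivatives. For real `X` and `Y` the commutator path `c(s)` moves `α`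
with vanishing first-order term and second-order term given by the commutator of `ℒ_X` and `ℒ_Y`;
with `τ = s²` it is a `C¹`-curve of velocity `[X, Y]`. The general case follows by complex
bilinearity. -/
theorem lieDeriv_lie (hclosed : IsClosed (G : Set (unitary (Mat V)))) (u v : loopAlgebra G)
    {F : Forms G → ℂ} (hF : IsCk 2 F) (α : Forms G) :
    lieDeriv ⁅u, v⁆ F α = lieDeriv u (lieDeriv v F) α - lieDeriv v (lieDeriv u F) α := by
  obtain ⟨x, y, hx, hy, rfl⟩ := exists_real_add hclosed u
  obtain ⟨x', y', hx', hy', rfl⟩ := exists_real_add hclosed v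
  have h1 : IsCk 1 F := hF.pred
  have hC : ∀ w : loopAlgebra G, IsCk 1 (lieDeriv w F) := fun w =>
    (hF.exists_hasLeftDeriv hclosed w).1
  have hfun : ∀ {x y : loopAlgebra G}, IsReal x → IsReal y →
      lieDeriv (x + Complex.I • y) F = lieDeriv x F + Complex.I • lieDeriv y F :=
    fun hx hy => funext fun α => lieDeriv_add_I_smul hclosed hx hy h1 α
  have h2 : ∀ {w a b : loopAlgebra G}, lieDeriv w (lieDeriv a F + Complex.I • lieDeriv b F) α =
      lieDeriv w (lieDeriv a F) α + Complex.I * lieDeriv w (lieDeriv b F) α := fun {w a b} => by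
    rw [lieDeriv_apply_add hclosed w (hC a) ((hC b).smul _), lieDeriv_apply_smul hclosed w _ (hC b)]
    rfl
  rw [loop_lie_add_I_smul, lieDeriv_add_I_smul hclosed
    ((hx.lie hclosed hx').add hclosed ((hy.lie hclosed hy').smul hclosed _))
    ((hx.lie hclosed hy').add hclosed (hy.lie hclosed hx')) h1,
    lieDeriv_add_of_isReal hclosed (hx.lie hclosed hx') ((hy.lie hclosed hy').smul hclosed _) h1,
    lieDeriv_smul_of_isReal hclosed (hy.lie hclosed hy') _ h1,
    lieDeriv_add_of_isReal hclosed (hx.lie hclosed hy') (hy.lie hclosed hx') h1,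
    lieDeriv_lie_of_isReal hclosed hx hx' hF, lieDeriv_lie_of_isReal hclosed hy hy' hF,
    lieDeriv_lie_of_isReal hclosed hx hy' hF, lieDeriv_lie_of_isReal hclosed hy hx' hF,
    hfun hx hy, hfun hx' hy', h2, h2]
  have h3 : ∀ {x y : loopAlgebra G}, IsReal x → IsReal y → ∀ w : loopAlgebra G,
      lieDeriv (x + Complex.I • y) (lieDeriv w F) α =
        lieDeriv x (lieDeriv w F) α + Complex.I * lieDeriv y (lieDeriv w F) α :=
    fun hx hy w => lieDeriv_add_I_smul hclosed hx hy (hC w) α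
  rw [h3 hx hy, h3 hx hy, h3 hx' hy', h3 hx' hy']
  push_cast
  linear_combination (lieDeriv y' (lieDeriv y F) α - lieDeriv y (lieDeriv y' F) α) * Complex.I_sq

end

section

/-! ### Variation of frames along families of loops -/

variable {V : Type*} [NormedAddCommGroup V] [InnerProductSpace ℂ V] [CompleteSpace V]
  {G : Subgroup (unitary (Mat V))} [FiniteDimensional ℂ V]

/-- Joint continuity of the derivative makes the first-order expansion in `t` uniform for `z` in a
compact set. -/
theorem eventually_norm_sub_le_of_hasFDerivAt {E : Type*} [NormedAddCommGroup E] [NormedSpace ℝ E]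
    {χ : ℂ → ℂ → E} {D : ℂ → ℂ → (ℂ →L[ℝ] E)} {ε : ℝ} {Ω K : Set ℂ} (hε : 0 < ε) (hΩ : IsOpen Ω)
    (hK : IsCompact K) (hKΩ : K ⊆ Ω)
    (hD : ∀ t ∈ Metric.ball (0 : ℂ) ε, ∀ z ∈ Ω, HasFDerivAt (fun s => χ s z) (D t z) t)
    (hc : ContinuousOn (fun p : ℂ × ℂ => D p.1 p.2) (Metric.ball (0 : ℂ) ε ×ˢ Ω))
    {δ : ℝ} (hδ : 0 < δ) :
    ∀ᶠ t in 𝓝 (0 : ℂ), ∀ z ∈ K, ‖χ t z - χ 0 z - D 0 z t‖ ≤ δ * ‖t‖ := by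
  have hu := tendstoUniformlyOn_of_continuousAt (f := D) (x₀ := (0 : ℂ)) hK fun z hz =>
    hc.continuousAt ((Metric.isOpen_ball.prod hΩ).mem_nhds
      ⟨Metric.mem_ball_self hε, hKΩ hz⟩)
  obtain ⟨η, hη, hball⟩ := Metric.eventually_nhds_iff_ball.1
    ((Metric.tendstoUniformlyOn_iff.1 hu δ hδ).and (Metric.ball_mem_nhds (0 : ℂ) hε))
  filter_upwards [Metric.ball_mem_nhds (0 : ℂ) hη] with t ht z hz
  have := (convex_ball (0 : ℂ) η).norm_image_sub_le_of_norm_hasFDerivWithin_le'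
    (f := fun s => χ s z) (f' := fun s => D s z) (φ := D 0 z) (C := δ)
    (fun s hs => (hD s (hball s hs).2 z (hKΩ hz)).hasFDerivWithinAt)
    (fun s hs => by
      rw [← dist_eq_norm, dist_comm]
      exact ((hball s hs).1 z hz).le) (Metric.mem_ball_self hη) ht
  simpa using this

/-- The real-linear map `s ↦ s x + s̄ y`. -/
def linConj {E : Type*} [NormedAddCommGroup E] [NormedSpace ℂ E] (x y : E) : ℂ →L[ℝ] E :=
  (ContinuousLinearMap.id ℝ ℂ).smulRight x + (Complex.conjCLE : ℂ →L[ℝ] ℂ).smulRight y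

theorem linConj_apply {E : Type*} [NormedAddCommGroup E] [NormedSpace ℂ E] (x y : E) (s : ℂ) :
    linConj x y s = s • x + conj s • y := by
  simp [linConj]

/-- A `C¹`-family is differentiable at `0` as a family of bounded holomorphic functions. -/
theorem IsC1Family.exists_hasFDerivAt {u u' : loopAlgebra G} {χ : ℂ → ℂ → Mat V}
    (h : IsC1Family u χ) (hu' : ∀ z : Circle, u'.1 z = -star (u.1 z)) :
    ∃ ρ : ℝ, 0 < ρ ∧ ρ < 1 ∧ DifferentiableOn ℂ (loopExt u) (annulus ρ) ∧
      DifferentiableOn ℂ (loopExt u') (annulus ρ) ∧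
      (∀ᶠ t in 𝓝 (0 : ℂ), DifferentiableOn ℂ (χ t) (annulus ρ)) ∧
      TendstoUniformlyOn χ 1 (𝓝 0) (annulus ρ) ∧
      ∀ r R, ρ < r → r < R → R < 1 → Hol.of (ann r R) (χ 0) = 1 ∧
        HasFDerivAt (fun t => Hol.of (ann r R) (χ t))
        (linConj (Hol.of (ann r R) (loopExt u)) (Hol.of (ann r R) (loopExt u'))) 0 := by
  obtain ⟨ε, ρ₁, hε, h01, h11, hχ, hχ0, D, hD, hDc, hDu⟩ := h
  obtain ⟨ρ₂, h02, h12, hdu, hdu'⟩ := exists_common_annulus u u'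
  obtain ⟨ρ, hρm, hρ1⟩ := exists_between (max_lt h11 h12)
  have h1ρ : ρ₁ < ρ := (le_max_left _ _).trans_lt hρm
  have h2ρ : ρ₂ < ρ := (le_max_right _ _).trans_lt hρm
  have hρ : 0 < ρ := h01.trans h1ρ
  have hKs := closedAnn_subset_annulus h01 h1ρ
  have hsubK : annulus ρ ⊆ Metric.closedBall (0 : ℂ) ρ⁻¹ \ Metric.ball 0 ρ :=
    ann_subset_closedAnn ρ ρ⁻¹
  have hsub : annulus ρ ⊆ annulus ρ₁ := hsubK.trans hKs
  have key : ∀ {δ : ℝ}, 0 < δ → ∀ᶠ t in 𝓝 (0 : ℂ), ∀ z ∈ annulus ρ,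
      ‖χ t z - 1 - D 0 z t‖ ≤ δ * ‖t‖ := fun {δ} hδ => by
    filter_upwards [eventually_norm_sub_le_of_hasFDerivAt hε (isOpen_annulus ρ₁)
      (isCompact_closedAnn ρ ρ⁻¹) hKs hD hDc hδ] with t ht z hz
    have := ht z (hsubK hz)
    rwa [hχ0 z (hsub hz)] at this
  have hdiff : ∀ᶠ t in 𝓝 (0 : ℂ), DifferentiableOn ℂ (χ t) (annulus ρ) := by
    filter_upwards [Metric.ball_mem_nhds (0 : ℂ) hε] with t ht using (hχ t ht).1.mono hsub
  have hdu := hdu.mono (annulus_mono h02 h2ρ.le)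
  have hdu' := hdu'.mono (annulus_mono h02 h2ρ.le)
  -- The derivative at `0` is holomorphic, as a locally uniform limit of difference quotients.
  have hD0 : ∀ s, DifferentiableOn ℂ (fun z => D 0 z s) (annulus ρ) := fun s => by
    have hlim : Tendsto (fun τ : ℝ => (τ : ℂ) * s) (𝓝[≠] 0) (𝓝 0) :=
      (Continuous.tendsto' (by fun_prop) 0 0 (by simp)).mono_left nhdsWithin_le_nhds
    refine TendstoLocallyUniformlyOn.differentiableOn
      (F := fun (τ : ℝ) z => (τ : ℂ)⁻¹ • (χ (τ * s) z - 1)) (φ := 𝓝[≠] 0)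
      (TendstoUniformlyOn.tendstoLocallyUniformlyOn ?_) ?_ (isOpen_annulus ρ)
    · rw [Metric.tendstoUniformlyOn_iff]
      intro δ hδ
      have hδ' : 0 < δ / (2 * (‖s‖ + 1)) := by positivity
      filter_upwards [hlim.eventually (key hδ'), self_mem_nhdsWithin] with τ hτ hτ0 z hz
      have hτ0 : (τ : ℂ) ≠ 0 := Complex.ofReal_ne_zero.2 hτ0
      have h3 : (τ : ℂ)⁻¹ • (χ (τ * s) z - 1) - D 0 z s =
          (τ : ℂ)⁻¹ • (χ (τ * s) z - 1 - D 0 z (τ * s)) := by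
        rw [← Complex.real_smul, map_smul, real_smul_eq, smul_sub _ _ ((τ : ℂ) • _), smul_smul,
          inv_mul_cancel₀ hτ0, one_smul]
      rw [dist_comm, dist_eq_norm, h3, norm_smul, norm_inv]
      have hn : 0 < ‖(τ : ℂ)‖ := norm_pos_iff.2 hτ0
      have hs := norm_nonneg s
      calc ‖(τ : ℂ)‖⁻¹ * ‖χ (τ * s) z - 1 - D 0 z (τ * s)‖
          ≤ ‖(τ : ℂ)‖⁻¹ * (δ / (2 * (‖s‖ + 1)) * (‖(τ : ℂ)‖ * ‖s‖)) := by
            rw [← norm_mul]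
            gcongr
            exact hτ z hz
        _ = δ / 2 * (‖s‖ / (‖s‖ + 1)) := by field_simp
        _ ≤ δ / 2 * 1 := by
            gcongr
            exact div_le_one_of_le₀ (by linarith) (by linarith)
        _ < δ := by linarith
    · filter_upwards [hlim.eventually hdiff] with τ hτ
      exact (hτ.sub_const 1).const_smul (τ : ℂ)⁻¹
  have hDeq : ∀ s, ∀ z ∈ annulus ρ, D 0 z s = s • loopExt u z + conj s • loopExt u' z :=
    fun s z hz => eqOn_of_circle hρ hρ1 (hD0 s) (g := fun z => s • loopExt u z + conj s • loopExt u' z)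
      ((hdu.const_smul s).add (hdu'.const_smul (conj s))) (fun z => by
        rw [hDu, loopExt_apply, loopExt_apply, hu']) hz
  refine ⟨ρ, hρ, hρ1, hdu, hdu', hdiff, ?_, fun r R hr hrR hR => ?_⟩
  · obtain ⟨C, hC⟩ := (isCompact_closedAnn ρ ρ⁻¹).exists_bound_of_continuousOn (f := D 0)
      ((hDc.comp (f := fun z : ℂ => ((0 : ℂ), z)) (by fun_prop)
        fun z hz => ⟨Metric.mem_ball_self hε, hKs hz⟩))
    have hlim : Tendsto (fun t : ℂ => (1 + C) * ‖t‖) (𝓝 0) (𝓝 0) :=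
      Continuous.tendsto' (by fun_prop) 0 0 (by simp)
    rw [Metric.tendstoUniformlyOn_iff]
    intro δ hδ
    filter_upwards [key one_pos, hlim.eventually_lt_const hδ] with t ht htδ z hz
    rw [dist_comm, dist_eq_norm, Pi.one_apply]
    calc ‖χ t z - 1‖ = ‖(χ t z - 1 - D 0 z t) + D 0 z t‖ := by rw [sub_add_cancel]
      _ ≤ 1 * ‖t‖ + C * ‖t‖ := (norm_add_le _ _).trans
          (add_le_add (ht z hz) ((D 0 z).le_of_opNorm_le (hC z (hsubK hz)) t))
      _ < δ := by rwa [← add_mul]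
  · have hev : ∀ {f : ℂ → Mat V}, DifferentiableOn ℂ f (annulus ρ) → ∀ z ∈ ann r R,
        (Hol.of (ann r R) f).ev z = f z := fun hf z hz => ev_of_annulus hρ hρ1 hr hR hf hz
    have hsA : ann r R ⊆ annulus ρ := fun z hz =>
      closedAnn_subset hρ hρ1 hr hR (ann_subset_closedAnn r R hz)
    have h0 : Hol.of (ann r R) (χ 0) = 1 := Hol.ext_ev fun z hz => by
      rw [hev hdiff.self_of_nhds z hz, hχ0 z (hsub (hsA hz)), Hol.ev_one hz]
    refine ⟨h0, HasFDerivAt.of_isLittleO (isLittleO_iff.2 fun δ hδ => ?_)⟩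
    filter_upwards [key hδ, hdiff] with t ht htd
    rw [sub_zero, h0]
    refine Hol.norm_le _ (by positivity) fun z hz => ?_
    rw [linConj_apply, Hol.ev_sub, Hol.ev_sub, Hol.ev_add, Hol.ev_smul, Hol.ev_smul, hev htd z hz,
      hev hdu z hz, hev hdu' z hz, Hol.ev_one hz, ← hDeq t z (hsA hz)]
    exact ht z (hsA hz)

end

section

open scoped ContDiff

variable {V : Type*} [NormedAddCommGroup V] [InnerProductSpace ℂ V] [CompleteSpace V]
  {G : Subgroup (unitary (Mat V))} [FiniteDimensional ℂ V]

/-! ### The velocity of the frame -/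

/-- The positive modes do not depend on the annulus. -/
theorem posPart_ev_eq {𝔸 : Type*} [NormedRing 𝔸] [NormedAlgebra ℂ 𝔸] [CompleteSpace 𝔸]
    {r R r' R' : ℝ} (hr : 0 < r) (hrr : r ≤ r') (hR : r' < R') (hRR : R' ≤ R)
    {f : Hol (ann r R) 𝔸} {f' : Hol (ann r' R') 𝔸} (h : ∀ z ∈ ann r' R', f.ev z = f'.ev z) {z : ℂ}
    (hz : z ∈ Metric.ball (0 : ℂ) R') : (posPart r R f).ev z = (posPart r' R' f').ev z := by
  have hrR : r < R := hrr.trans_lt (hR.trans_le hRR)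
  have hr' := hr.trans_le hrr
  obtain ⟨m, hm, hm'⟩ := exists_ev_eq_posPart_add hr hrR f
  obtain ⟨n, hn, hn'⟩ := exists_ev_eq_posPart_add hr' hR f'
  refine eq_of_splitting hr' hR
    ((posPart r R f).differentiableOn.mono (Metric.ball_subset_ball hRR))
    (posPart r' R' f').differentiableOn (hm.mono (Metric.ball_subset_ball (inv_anti₀ hr hrr))) hn
    (by rw [posPart_ev_zero hr hrR, posPart_ev_zero hr' hR]) (fun z hz => ?_) hz
  rw [← hm' z (ann_mono hrr hRR hz), ← hn' z hz, h z hz]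

/-- The function `x⁻¹ U x` on an annulus inside the disc. -/
def conjBy (r R : ℝ) (U : ℂ → Mat V) (x : Hol (Metric.ball 0 R) (Mat V)) : Hol (ann r R) (Mat V) :=
  Ring.inverse (toAnn r R x) * Hol.of (ann r R) U * toAnn r R x

/-- The velocity `-g (g⁻¹ U g)₊` of the frame `g = x` under the action of the loops `e^{-tU}`. -/
def leftVelocity (r R : ℝ) (U : ℂ → Mat V) (x : Hol (Metric.ball 0 R) (Mat V)) :
    Hol (Metric.ball 0 R) (Mat V) :=
  -(x * posPart r R (conjBy r R U x))

theorem ev_conjBy {ρ r R : ℝ} (hρ : 0 < ρ) (hr : ρ < r) (hrR : r < R) (hR : R < 1)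
    {U : ℂ → Mat V} (hU : DifferentiableOn ℂ U (annulus ρ)) (α : Forms G) {z : ℂ}
    (hz : z ∈ ann r R) : (conjBy r R U (frameOn R α)).ev z =
      Ring.inverse (frame α z) * U z * frame α z := by
  rw [conjBy, Hol.ev_mul, Hol.ev_mul, Hol.ev_inverse (isUnit_toAnn (isUnit_frameOn hR α)) hz,
    toAnn_frameOn_ev hR α hz, ev_of_annulus hρ (hr.trans (hrR.trans hR)) hr hR hU hz]

/-- The velocity of the frame does not depend on the annulus used for the factorisation. -/
theorem ev_leftVelocity_eq {ρ r R r' R' : ℝ} (hρ : 0 < ρ) (hr : ρ < r) (hrR : r < R) (hR : R < 1)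
    (hr' : ρ < r') (hrR' : r' < R') (hR' : R' < 1)
    {U : ℂ → Mat V} (hU : DifferentiableOn ℂ U (annulus ρ)) (α : Forms G) {z : ℂ}
    (hz : z ∈ Metric.ball (0 : ℂ) R) (hz' : z ∈ Metric.ball (0 : ℂ) R') :
    (leftVelocity r R U (frameOn R α)).ev z = (leftVelocity r' R' U (frameOn R' α)).ev z := by
  have hm : ρ < min r r' := lt_min hr hr'
  have hmM : min r r' < max R R' := (min_le_left r r').trans_lt (hrR.trans_le (le_max_left R R'))
  have hM : max R R' < 1 := max_lt hR hR'
  have key : ∀ {s S : ℝ}, ρ < s → s < S → S < 1 → min r r' ≤ s → S ≤ max R R' →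
      z ∈ Metric.ball (0 : ℂ) S → (posPart s S (conjBy s S U (frameOn S α))).ev z =
        (posPart _ _ (conjBy (min r r') (max R R') U (frameOn (max R R') α))).ev z :=
    fun h1 h2 h3 h4 h5 hz => (posPart_ev_eq (hρ.trans hm) h4 h2 h5 (fun w hw => by
      rw [ev_conjBy hρ hm hmM hM hU α (ann_mono h4 h5 hw), ev_conjBy hρ h1 h2 h3 hU α hw]) hz).symm
  rw [leftVelocity, leftVelocity, Hol.ev_neg, Hol.ev_neg, Hol.ev_mul, Hol.ev_mul,
    ev_frameOn hR α hz, ev_frameOn hR' α hz', key hr hrR hR (min_le_left _ _) (le_max_left _ _) hz,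
    key hr' hrR' hR' (min_le_right _ _) (le_max_right _ _) hz']

/-- Frames vary differentiably under the action of a `C¹`-family of loops. -/
theorem exists_hasFDerivAt_frameOn {u u' : loopAlgebra G} {χ : ℂ → ℂ → Mat V}
    (h : IsC1Family u χ) (hu' : ∀ z : Circle, u'.1 z = -star (u.1 z)) {α : Forms G}
    {β : ℂ → Forms G} (hβ : ∀ᶠ t in 𝓝 (0 : ℂ), ActsTo (fun z => Ring.inverse (χ t z)) α (β t)) :
    ∃ ρ : ℝ, 0 < ρ ∧ ρ < 1 ∧ ∀ r R, ρ < r → r < R → R < 1 →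
      HasFDerivAt (fun t => frameOn R (β t))
        (linConj (leftVelocity r R (loopExt u) (frameOn R α))
          (leftVelocity r R (loopExt u') (frameOn R α))) 0 := by
  obtain ⟨ρ, hρ, hρ1, hdu, hdu', hd, hlim, hW⟩ := h.exists_hasFDerivAt hu'
  refine ⟨ρ, hρ, hρ1, fun r R hr hrR hR => ?_⟩
  have hcomp := Hol.completeSpace (𝔸 := Mat V) (isOpen_ann r R)
  obtain ⟨hW0, hW⟩ := hW r R hr hrR hR
  set x := frameOn R α with hx
  have hxu : IsUnit (toAnn r R x) := isUnit_toAnn (isUnit_frameOn hR α)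
  have hunits := eventually_isUnit_of_tendsto_one hlim
  -- The family `x⁻¹ χ_t⁻¹ x - 1`.
  set ξ := toAnn r R x with hξ
  set A : Hol (ann r R) (Mat V) →L[ℂ] Hol (ann r R) (Mat V) :=
    (ContinuousLinearMap.mul ℂ _).flip ξ ∘L ContinuousLinearMap.mul ℂ _ (Ring.inverse ξ) with hA
  have hAapp : ∀ y, A y = Ring.inverse ξ * y * ξ := fun y => by simp [hA]
  have hinv := hasFDerivAt_ringInverse (𝕜 := ℂ) (1 : (Hol (ann r R) (Mat V))ˣ)
  have h1 : HasFDerivAt (fun t => Ring.inverse (Hol.of (ann r R) (χ t)))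
      (-linConj (Hol.of (ann r R) (loopExt u)) (Hol.of (ann r R) (loopExt u'))) 0 := by
    have h2 := HasFDerivAt.comp (g := Ring.inverse) (f := fun t => Hol.of (ann r R) (χ t)) (0 : ℂ)
      (by rw [hW0]; exact hinv.restrictScalars ℝ) hW
    refine h2.congr_fderiv ?_
    ext1 s
    simp
  have h2 : HasFDerivAt (fun t => A (Ring.inverse (Hol.of (ann r R) (χ t))) - 1)
      ((A.restrictScalars ℝ) ∘L (-linConj (Hol.of (ann r R) (loopExt u))
        (Hol.of (ann r R) (loopExt u')))) 0 :=
    (((A.restrictScalars ℝ).hasFDerivAt.comp (0 : ℂ) h1).sub_const 1)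
  have h20 : A (Ring.inverse (Hol.of (ann r R) (χ 0))) - 1 = 0 := by
    rw [hW0, hAapp, Ring.inverse_one, mul_one, Ring.inverse_mul_cancel _ hxu, sub_self]
  have h3 := HasFDerivAt.comp (g := innerFactor r R)
    (f := fun t => A (Ring.inverse (Hol.of (ann r R) (χ t))) - 1) (0 : ℂ)
    (by rw [h20]; exact (hasFDerivAt_innerFactor (𝔸 := Mat V) (r := r) (R := R)).restrictScalars ℝ)
    h2
  have h4 := ((ContinuousLinearMap.mul ℂ _ x).restrictScalars ℝ).hasFDerivAt.comp (0 : ℂ) h3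
  have hev : (fun t => frameOn R (β t)) =ᶠ[𝓝 0] fun t =>
      x * innerFactor r R (A (Ring.inverse (Hol.of (ann r R) (χ t))) - 1) := by
    have hlim0 : Tendsto (fun t => A (Ring.inverse (Hol.of (ann r R) (χ t))) - 1) (𝓝 0) (𝓝 0) := by
      have := h2.continuousAt.tendsto
      rwa [h20] at this
    have hunit : ∀ᶠ t in 𝓝 (0 : ℂ), IsUnit (Hol.of (ann r R) (χ t)) :=
      hW.continuousAt.eventually (p := IsUnit)
        (Units.isOpen.mem_nhds (by beta_reduce; rw [hW0]; exact isUnit_one))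
    filter_upwards [hβ, hd, hunits, hunit, hlim0.eventually
      (eventually_isGoodDefect (hρ.trans hr) hrR (one_half_pos (α := ℝ)))] with t h1 h2 h3 h5 h4
    have hη : DifferentiableOn ℂ (fun z => Ring.inverse (χ t z)) (annulus ρ) :=
      differentiableOn_inverse h2 h3
    have hof : Hol.of (ann r R) (fun z => Ring.inverse (χ t z)) =
        Ring.inverse (Hol.of (ann r R) (χ t)) := Hol.ext_ev fun z hz => by
      rw [ev_of_annulus hρ hρ1 hr hR hη hz, Hol.ev_inverse h5 hz,
        ev_of_annulus hρ hρ1 hr hR h2 hz]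
    have hdef : conjDefect r R (fun z => Ring.inverse (χ t z)) α =
        A (Ring.inverse (Hol.of (ann r R) (χ t))) - 1 := by
      rw [conjDefect, hof, hAapp]
    rw [← hdef] at h4 ⊢
    exact ActsTo.frameOn_eq hρ hr hrR hR le_rfl hη (fun z hz => isUnit_inverse (h3 z hz)) h4 h1
  refine (HasFDerivAt.congr_of_eventuallyEq h4 hev).congr_fderiv ?_
  ext1 s
  simp only [linConj_apply, leftVelocity, conjBy, ContinuousLinearMap.comp_apply,
    ContinuousLinearMap.coe_restrictScalars', neg_apply, hAapp, ContinuousLinearMap.mul_apply',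
    mul_neg, map_neg, smul_neg, mul_add, add_mul, map_add, mul_smul_comm, smul_mul_assoc, map_smul,
    neg_add]
  rfl

/-- Functions of the frame are left-differentiable. -/
theorem hasLeftDeriv_of_frameOn {F : Forms G → ℂ} {R₀ : ℝ} {Φ : Hol (Metric.ball 0 R₀) (Mat V) → ℂ}
    (hF : ∀ α, F α = Φ (frameOn R₀ α)) {α : Forms G} (hΦ : DifferentiableAt ℂ Φ (frameOn R₀ α))
    {u u' : loopAlgebra G} (hu' : ∀ z : Circle, u'.1 z = -star (u.1 z)) {ρ r R : ℝ} (hρ : 0 < ρ)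
    (hdu : DifferentiableOn ℂ (loopExt u) (annulus ρ))
    (hdu' : DifferentiableOn ℂ (loopExt u') (annulus ρ)) (hr : ρ < r) (hrR : r < R) (hR : R < 1)
    (hR₀ : R₀ ≤ R) :
    HasLeftDeriv F α u
      (fderiv ℂ Φ (frameOn R₀ α) (Hol.res (Metric.ball_subset_ball hR₀)
        (leftVelocity r R (loopExt u) (frameOn R α))))
      (fderiv ℂ Φ (frameOn R₀ α) (Hol.res (Metric.ball_subset_ball hR₀)
        (leftVelocity r R (loopExt u') (frameOn R α)))) := by
  intro χ hχ β hβ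
  obtain ⟨ρ', hρ', hρ1', h⟩ := exists_hasFDerivAt_frameOn hχ hu' hβ
  obtain ⟨r', hr', hr1'⟩ := exists_between (max_lt hρ1' hR)
  obtain ⟨R', hrR', hR1'⟩ := exists_between hr1'
  have hRr : R < r' := (le_max_right _ _).trans_lt hr'
  have hR₀' : R₀ ≤ R' := hR₀.trans (hRr.trans hrR').le
  have hd := h r' R' ((le_max_left _ _).trans_lt hr') hrR' hR1'
  have hres : ∀ U : ℂ → Mat V, DifferentiableOn ℂ U (annulus ρ) →
      Hol.res (Metric.ball_subset_ball hR₀') (leftVelocity r' R' U (frameOn R' α)) =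
      Hol.res (Metric.ball_subset_ball hR₀) (leftVelocity r R U (frameOn R α)) := fun U hU =>
    Hol.ext_ev fun z hz => by
      rw [Hol.ev_res _ _ hz, Hol.ev_res _ _ hz]
      exact ev_leftVelocity_eq hρ (hr.trans (hrR.trans hRr)) hrR' hR1' hr hrR hR hU α
        (Metric.ball_subset_ball hR₀' hz) (Metric.ball_subset_ball hR₀ hz)
  have h0 : β 0 = α := by
    refine hβ.self_of_nhds.unique ?_
    obtain ⟨ε, ρ, hε, hρ, hρ1, -, hχ0, -⟩ := hχ
    exact (ActsTo.one α).congr hρ hρ1 fun z hz => by rw [hχ0 z hz, Ring.inverse_one]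
  have h1 := ((Hol.res (𝔸 := Mat V) (Metric.ball_subset_ball (x := (0 : ℂ)) hR₀')).restrictScalars
    ℝ).hasFDerivAt.comp (0 : ℂ) hd
  have h2 := HasFDerivAt.comp (g := Φ) (0 : ℂ) (by
    simp only [Function.comp_apply, ContinuousLinearMap.coe_restrictScalars', h0,
      res_frameOn hR₀' hR1']
    exact hΦ.hasFDerivAt.restrictScalars ℝ) h1
  have h3 := h2.isLittleO
  simp only [Function.comp_apply, ContinuousLinearMap.coe_restrictScalars', 
    res_frameOn hR₀' hR1', ← hF, h0, sub_zero] at h3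
  refine h3.congr_left fun t => ?_
  simp only [ContinuousLinearMap.comp_apply, ContinuousLinearMap.coe_restrictScalars',
    linConj_apply, map_add, map_smul, hres _ hdu, hres _ hdu', smul_eq_mul]
  ring

/-! ### Smooth functions of the frame -/

/-- The functions on `𝒜` that are smooth functions of the restriction of the frame to a disc
`|z| < R` with `R < 1`. -/
def IsFrameSmooth (F : Forms G → ℂ) : Prop :=
  ∃ R : ℝ, 0 < R ∧ R < 1 ∧ ∃ Φ : Hol (Metric.ball 0 R) (Mat V) → ℂ,
    (∀ α : Forms G, ContDiffAt ℂ ∞ Φ (frameOn R α)) ∧ ∀ α, F α = Φ (frameOn R α)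

theorem contDiffAt_leftVelocity {r R : ℝ} (hR : R < 1) (U : ℂ → Mat V) (α : Forms G) :
    ContDiffAt ℂ ∞ (leftVelocity r R U) (frameOn R α) := by
  have hcomp := Hol.completeSpace (𝔸 := Mat V) (isOpen_ann r R)
  obtain ⟨w, hw⟩ := isUnit_toAnn (r := r) (isUnit_frameOn hR α)
  have h1 : ContDiffAt ℂ ∞ (fun x : Hol (Metric.ball 0 R) (Mat V) => Ring.inverse (toAnn r R x))
      (frameOn R α) := by
    refine ContDiffAt.comp (g := Ring.inverse) (f := fun x => toAnn r R x) _ ?_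
      (toAnn r R).contDiff.contDiffAt
    rw [← hw]
    exact contDiffAt_ringInverse ℂ w
  have h2 : ContDiffAt ℂ ∞ (conjBy r R U) (frameOn R α) :=
    (h1.mul contDiffAt_const).mul (toAnn r R).contDiff.contDiffAt
  exact (contDiffAt_id.mul ((posPart r R).contDiff.contDiffAt.comp _ h2)).neg

theorem IsFrameSmooth.continuous {F : Forms G → ℂ} (h : IsFrameSmooth F) : Continuous F := by
  obtain ⟨R, h0, h1, Φ, hΦ, hF⟩ := h
  refine continuous_iff_continuousAt.2 fun α => ?_
  rw [funext hF]
  exact (hΦ α).continuousAt.comp (f := frameOn R) (continuous_frameOn h1).continuousAt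

/-- If `F = Φ(g)`, then `ℒ_u F = DΦ(g)(-g (g⁻¹ U g)₊)` is again a smooth function of the frame, on a
larger disc because the velocity is computed with an annulus inside the disc. -/
theorem IsFrameSmooth.exists_hasLeftDeriv (hclosed : IsClosed (G : Set (unitary (Mat V))))
    {F : Forms G → ℂ} (h : IsFrameSmooth F) (u : loopAlgebra G) :
    ∃ A B : Forms G → ℂ, (∀ α, HasLeftDeriv F α u (A α) (B α)) ∧ IsFrameSmooth A := by
  obtain ⟨R₀, h0, h1, Φ, hΦ, hF⟩ := h
  obtain ⟨u', hu'⟩ := exists_conj_loop hclosed u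
  obtain ⟨ρ, hρ, hρ1, hdu, hdu'⟩ := exists_common_annulus u u'
  obtain ⟨r, hr, hr1⟩ := exists_between (max_lt h1 hρ1)
  obtain ⟨R, hrR, hR1⟩ := exists_between hr1
  have hρr : ρ < r := (le_max_right _ _).trans_lt hr
  have hR₀ : R₀ ≤ R := ((le_max_left _ _).trans_lt (hr.trans hrR)).le
  refine ⟨_, _, fun α => hasLeftDeriv_of_frameOn hF ((hΦ α).differentiableAt (by simp)) hu' hρ hdu
    hdu' hρr hrR hR1 hR₀, R, h0.trans_le hR₀, hR1, fun x => fderiv ℂ Φ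
      (Hol.res (Metric.ball_subset_ball hR₀) x) (Hol.res (Metric.ball_subset_ball hR₀)
        (leftVelocity r R (loopExt u) x)), fun α => ?_, fun α => by beta_reduce; rw [res_frameOn hR₀ hR1]⟩
  have hres := (Hol.res (𝔸 := Mat V) (Metric.ball_subset_ball (x := (0 : ℂ)) hR₀)).contDiff
    (n := ∞)
  refine ContDiffAt.clm_apply (ContDiffAt.comp (g := fderiv ℂ Φ) _ ?_ hres.contDiffAt)
    (hres.contDiffAt.comp _ (contDiffAt_leftVelocity hR1 _ α))
  rw [res_frameOn hR₀ hR1]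
  exact (hΦ α).fderiv_right (by simp)

/-- Smooth functions of the frame belong to `C^∞(𝒜)`, as this class is stable under Lie derivatives.
-/
theorem IsFrameSmooth.mem_smooth (hclosed : IsClosed (G : Set (unitary (Mat V))))
    {F : Forms G → ℂ} (h : IsFrameSmooth F) : F ∈ Smooth G := fun n => by
  induction n generalizing F with
  | zero => exact h.continuous
  | succ n ih =>
    refine ⟨h.continuous, fun u => ?_⟩
    obtain ⟨A, B, hd, hA⟩ := h.exists_hasLeftDeriv hclosed u
    exact ⟨A, B, hd, ih hA⟩

end

section

open scoped ContDiff

variable {V : Type*} [NormedAddCommGroup V] [InnerProductSpace ℂ V] [CompleteSpace V]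
  {G : Subgroup (unitary (Mat V))} [FiniteDimensional ℂ V]

/-! ### The invariant form -/

section InvForm

attribute [local instance 100] LieRing.ofAssociativeRing

variable (G) in
/-- The projection onto `𝔤_ℂ` as a map to this subalgebra. -/
def lieProjTo : Mat V →ₗ[ℂ] complexLie G where
  toFun X := ⟨lieProj G X, lieProj_mem X⟩
  map_add' X Y := Subtype.ext (map_add (lieProj G) X Y)
  map_smul' a X := Subtype.ext (map_smul (lieProj G) a X)

theorem toLie_eq {X : Mat V} (hX : X ∈ complexLie G) : toLie G X = lieProjTo G X := by
  rw [toLie, dif_pos hX]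
  exact Subtype.ext (lieProj_of_mem hX).symm

variable (G) in
/-- The invariant form `tr = c κ_ad`, extended to `gl(V)` by a projection onto `𝔤_ℂ`. -/
def invForm (c : ℂ) : Mat V →L[ℂ] Mat V →L[ℂ] ℂ :=
  LinearMap.toContinuousBilinearMap
    (c • (killingForm ℂ (complexLie G)).compl₁₂ (lieProjTo G) (lieProjTo G))

theorem invForm_apply (c : ℂ) (X Y : Mat V) :
    invForm G c X Y = c * killingForm ℂ (complexLie G) (lieProjTo G X) (lieProjTo G Y) := rfl

theorem trForm_eq (c : ℂ) {X Y : Mat V} (hX : X ∈ complexLie G) (hY : Y ∈ complexLie G) :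
    trForm G c X Y = invForm G c X Y := by
  rw [trForm, toLie_eq hX, toLie_eq hY, invForm_apply]

theorem invForm_comm (c : ℂ) (X Y : Mat V) : invForm G c X Y = invForm G c Y X := by
  rw [invForm_apply, invForm_apply, LieModule.traceForm_comm]

theorem lieProjTo_lie {X Y : Mat V} (hX : X ∈ complexLie G) (hY : Y ∈ complexLie G) :
    lieProjTo G (X * Y - Y * X) = ⁅lieProjTo G X, lieProjTo G Y⁆ := by
  refine Subtype.ext ?_
  change lieProj G (X * Y - Y * X) = lieProj G X * lieProj G Y - lieProj G Y * lieProj G X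
  rw [lieProj_of_mem hX, lieProj_of_mem hY, lieProj_of_mem (lie_mem_complexLie hX hY)]

theorem invForm_lie (c : ℂ) {X Y Z : Mat V} (hX : X ∈ complexLie G) (hY : Y ∈ complexLie G)
    (hZ : Z ∈ complexLie G) :
    invForm G c (X * Y - Y * X) Z = invForm G c X (Y * Z - Z * Y) := by
  rw [invForm_apply, invForm_apply, lieProjTo_lie hX hY, lieProjTo_lie hY hZ,
    LieModule.traceForm_apply_lie_apply]

variable (G) in
/-- Conjugation by a matrix that normalises `𝔤_ℂ`. -/
def conjHom (g : Mat V) (hg : IsUnit g)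
    (h : ∀ X ∈ complexLie G, g * X * Ring.inverse g ∈ complexLie G) :
    complexLie G →ₗ⁅ℂ⁆ complexLie G where
  toFun X := ⟨g * X * Ring.inverse g, h X X.2⟩
  map_add' X Y := Subtype.ext (by simp [mul_add, add_mul])
  map_smul' a X := Subtype.ext (by simp)
  map_lie' {X Y} := Subtype.ext (by
    change g * ((X : Mat V) * Y - Y * X) * Ring.inverse g =
      g * X * Ring.inverse g * (g * Y * Ring.inverse g) -
        g * Y * Ring.inverse g * (g * X * Ring.inverse g)
    have h1 : ∀ A B : Mat V, g * A * Ring.inverse g * (g * B * Ring.inverse g) =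
        g * (A * B) * Ring.inverse g := fun A B => by
      rw [mul_assoc g B, mul_assoc (g * A), Ring.inverse_mul_cancel_left _ _ hg]
      simp only [mul_assoc]
    rw [h1, h1, mul_sub, sub_mul])

variable (G) in
theorem bijective_conjHom (g : Mat V) (hg : IsUnit g)
    (h : ∀ X ∈ complexLie G, g * X * Ring.inverse g ∈ complexLie G) :
    Function.Bijective (conjHom G g hg h) := by
  have hi : Function.Injective (conjHom G g hg h) := fun X Y hXY => by
    have h1 : g * (X : Mat V) * Ring.inverse g = g * Y * Ring.inverse g := congrArg Subtype.val hXY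
    exact Subtype.ext (hg.mul_left_cancel ((isUnit_inverse hg).mul_right_cancel h1))
  have : FiniteDimensional ℂ (complexLie G) :=
    inferInstanceAs (FiniteDimensional ℂ (lieSub G))
  exact ⟨hi, LinearMap.surjective_of_injective (f := (conjHom G g hg h).toLinearMap) hi⟩

theorem conj_mem_of_normalises {g : Mat V} (hg : IsUnit g)
    (h : ∀ X ∈ complexLie G, g * X * Ring.inverse g ∈ complexLie G) {X : Mat V}
    (hX : X ∈ complexLie G) : Ring.inverse g * X * g ∈ complexLie G := by
  obtain ⟨Y, hY⟩ := (bijective_conjHom G g hg h).2 ⟨X, hX⟩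
  have h1 : g * (Y : Mat V) * Ring.inverse g = X := congrArg Subtype.val hY
  rw [← h1, mul_assoc g, Ring.inverse_mul_cancel_left _ _ hg, Ring.inverse_mul_cancel_right _ _ hg]
  exact Y.2

/-- The form is invariant under matrices that normalise `𝔤_ℂ`, as these act on `𝔤_ℂ` by
automorphisms. -/
theorem invForm_conj (c : ℂ) {g : Mat V} (hg : IsUnit g)
    (h : ∀ X ∈ complexLie G, g * X * Ring.inverse g ∈ complexLie G) {X Y : Mat V}
    (hX : X ∈ complexLie G) (hY : Y ∈ complexLie G) :
    invForm G c (g * X * Ring.inverse g) (g * Y * Ring.inverse g) = invForm G c X Y := by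
  have key : ∀ {Z : Mat V} (hZ : Z ∈ complexLie G), lieProjTo G (g * Z * Ring.inverse g) =
      LieEquiv.ofBijective _ (bijective_conjHom G g hg h) (lieProjTo G Z) := fun {Z} hZ => by
    refine Subtype.ext ?_
    change lieProj G (g * Z * Ring.inverse g) = g * lieProj G Z * Ring.inverse g
    rw [lieProj_of_mem hZ, lieProj_of_mem (h Z hZ)]
  rw [invForm_apply, invForm_apply, key hX, key hY, LieAlgebra.killingForm_of_equiv_apply]

end InvForm

/-! ### An integral identity -/

section Integral

variable {E : Type*} [NormedAddCommGroup E] [NormedSpace ℂ E]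

theorem circleIntegral_eq_zero_of_ball {f : ℂ → ℂ} {s R : ℝ} (hs : 0 ≤ s) (hsR : s < R)
    (hf : DifferentiableOn ℂ f (Metric.ball 0 R)) : (∮ z in C(0, s), f z) = 0 := by
  refine Complex.circleIntegral_eq_zero_of_differentiable_on_off_countable hs Set.countable_empty
    (hf.continuousOn.mono (Metric.closedBall_subset_ball hsR)) fun z hz => ?_
  exact hf.differentiableAt (Metric.isOpen_ball.mem_nhds (Metric.ball_subset_ball hsR.le hz.1))

theorem sphere_subset_ann {r s R : ℝ} (hr : r < s) (hR : s < R) :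
    Metric.sphere (0 : ℂ) s ⊆ ann r R := fun z hz => by
  rw [mem_sphere_zero_iff_norm] at hz
  exact ⟨hz ▸ hr, hz ▸ hR⟩

theorem circleIntegrable_of_ann {f : ℂ → ℂ} {r s R : ℝ} (hs : 0 ≤ s) (hr : r < s) (hR : s < R)
    (hf : DifferentiableOn ℂ f (ann r R)) : CircleIntegrable f 0 s :=
  (hf.continuousOn.mono (sphere_subset_ann hr hR)).circleIntegrable hs

variable [CompleteSpace E]

/-- Let `f = p + n` and `f' = p' + n'` be Laurent decompositions. Expanding `∮ B(f', ∂f)`, the terms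
with two inner or two outer parts vanish by Cauchy's theorem, and integration by parts moves the
derivative in `∮ B(p', ∂n)`. -/
theorem integral_pairing_deriv (B : E →L[ℂ] E →L[ℂ] ℂ) (hB : ∀ x y, B x y = B y x) {r s R : ℝ}
    (hr : 0 < r) (hrs : r < s) (hsR : s < R) {f f' p p' m m' : ℂ → E}
    (hp : DifferentiableOn ℂ p (Metric.ball 0 R)) (hp' : DifferentiableOn ℂ p' (Metric.ball 0 R))
    (hm : DifferentiableOn ℂ m (Metric.ball 0 r⁻¹)) (hm' : DifferentiableOn ℂ m' (Metric.ball 0 r⁻¹))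
    (hf : ∀ z ∈ ann r R, f z = p z + m z⁻¹) (hf' : ∀ z ∈ ann r R, f' z = p' z + m' z⁻¹) :
    (∮ z in C(0, s), B (f' z) (deriv p z)) - (∮ z in C(0, s), B (f z) (deriv p' z)) =
      ∮ z in C(0, s), B (f' z) (deriv f z) := by
  have hs : 0 < s := hr.trans hrs
  have hA := isOpen_ann r R
  have hsub : ann r R ⊆ Metric.ball 0 R := ann_subset_ball r R
  have hBd : ∀ {S : Set ℂ} {a b : ℂ → E}, DifferentiableOn ℂ a S → DifferentiableOn ℂ b S →
      DifferentiableOn ℂ (fun z => B (a z) (b z)) S := fun ha hb =>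
    (B.differentiable.comp_differentiableOn ha).clm_apply hb
  have hn : ∀ {m : ℂ → E}, DifferentiableOn ℂ m (Metric.ball 0 r⁻¹) →
      DifferentiableOn ℂ (fun z => m z⁻¹) (ann r R) := fun hm =>
    (differentiableOn_comp_inv hr hm).mono fun z hz => hz.1
  have hdp := hp.deriv Metric.isOpen_ball
  have hdp' := hp'.deriv Metric.isOpen_ball
  have hdn := (hn hm).deriv hA
  have hderiv : ∀ z ∈ ann r R, deriv f z = deriv p z + deriv (fun z => m z⁻¹) z := fun z hz => by
    rw [EventuallyEq.deriv_eq (f := fun z => p z + m z⁻¹)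
      (by filter_upwards [hA.mem_nhds hz] with w hw using hf w hw)]
    exact deriv_add (hp.differentiableAt (Metric.isOpen_ball.mem_nhds (hsub hz)))
      ((hn hm).differentiableAt (hA.mem_nhds hz))
  -- The three contributions that vanish.
  have h1 : (∮ z in C(0, s), B (p z) (deriv p' z)) = 0 :=
    circleIntegral_eq_zero_of_ball hs.le hsR (hBd hp hdp')
  have h2 : (∮ z in C(0, s), (B (m z⁻¹) (deriv p' z) + B (deriv (fun z => m z⁻¹) z) (p' z))) = 0 := by
    refine circleIntegral.integral_eq_zero_of_hasDerivWithinAt hs.le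
      (f := fun z => B (m z⁻¹) (p' z)) fun z hz => HasDerivAt.hasDerivWithinAt ?_
    have hz' := sphere_subset_ann hrs hsR hz
    have e1 := ((hn hm).differentiableAt (hA.mem_nhds hz')).hasDerivAt
    have e2 := (hp'.differentiableAt (Metric.isOpen_ball.mem_nhds (hsub hz'))).hasDerivAt
    have e3 : HasDerivAt (fun z => B (m z⁻¹)) (B (deriv (fun z => m z⁻¹) z)) z :=
      B.hasFDerivAt.comp_hasDerivAt z e1
    exact (e3.clm_apply e2).congr_deriv (add_comm _ _)
  have h3 : (∮ z in C(0, s), B (m' z⁻¹) (deriv (fun z => m z⁻¹) z)) = 0 := by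
    rw [circleIntegral_inversion]
    have hs' : s⁻¹ < r⁻¹ := inv_strictAnti₀ hr hrs
    rw [circleIntegral.integral_congr (g := fun w => (-1 : ℂ) * B (m' w) (deriv m w)) (inv_pos.2 hs).le]
    · rw [circleIntegral.integral_const_mul, circleIntegral_eq_zero_of_ball (inv_pos.2 hs).le hs'
        (hBd hm' (hm.deriv Metric.isOpen_ball)), mul_zero]
    · intro w hw
      rw [mem_sphere_zero_iff_norm] at hw
      have hw0 : w ≠ 0 := norm_pos_iff.1 (hw ▸ inv_pos.2 hs)
      have hwb : w ∈ Metric.ball (0 : ℂ) r⁻¹ := by simpa [hw] using hs'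
      have e1 : HasDerivAt (fun z => m z⁻¹) (-(w⁻¹ ^ 2)⁻¹ • deriv m w) w⁻¹ := by
        refine HasDerivAt.scomp (h := fun z : ℂ => z⁻¹) w⁻¹ ?_ (hasDerivAt_inv (inv_ne_zero hw0))
        rw [inv_inv]
        exact (hm.differentiableAt (Metric.isOpen_ball.mem_nhds hwb)).hasDerivAt
      simp only [e1.deriv, inv_inv, map_smul, smul_eq_mul]
      field_simp
  have i1 := circleIntegrable_of_ann hs.le hrs hsR (hBd ((hp'.mono hsub).add (hn hm')) (hdp.mono hsub))
  have i2 := circleIntegrable_of_ann hs.le hrs hsR (hBd ((hp.mono hsub)) (hdp'.mono hsub))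
  have i3 := circleIntegrable_of_ann hs.le hrs hsR ((hBd (hn hm) (hdp'.mono hsub)).add
    (hBd hdn (hp'.mono hsub)))
  have i4 := circleIntegrable_of_ann hs.le hrs hsR (hBd (hn hm') hdn)
  have i5 := circleIntegrable_of_ann hs.le hrs hsR (hBd ((hp.mono hsub).add (hn hm)) (hdp'.mono hsub))
  have i6 := circleIntegrable_of_ann hs.le hrs hsR (hBd ((hp'.mono hsub).add (hn hm'))
    ((hdp.mono hsub).add hdn))
  have hS := sphere_subset_ann hrs hsR
  rw [circleIntegral.integral_congr hs.le
      (fun z hz => by beta_reduce; rw [hf' z (hS hz)] : Set.EqOn (fun z => B (f' z) (deriv p z))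
        (fun z => B (p' z + m' z⁻¹) (deriv p z)) _),
    circleIntegral.integral_congr hs.le
      (fun z hz => by beta_reduce; rw [hf z (hS hz)] : Set.EqOn (fun z => B (f z) (deriv p' z))
        (fun z => B (p z + m z⁻¹) (deriv p' z)) _),
    circleIntegral.integral_congr hs.le
      (fun z hz => by beta_reduce; rw [hf' z (hS hz), hderiv z (hS hz)] :
        Set.EqOn (fun z => B (f' z) (deriv f z))
        (fun z => B (p' z + m' z⁻¹) (deriv p z + deriv (fun z => m z⁻¹) z)) _)]
  have e1 := circleIntegral.integral_sub i1 i5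
  have e2 := circleIntegral.integral_add (i2.add i3) i4
  have e4 := circleIntegral.integral_add i2 i3
  have e3 := circleIntegral.integral_sub (i1.sub i5) i6
  simp only [Pi.add_apply, Pi.sub_apply] at e1 e2 e3 e4
  rw [e4, h1, h2, h3, add_zero, add_zero] at e2
  rw [← sub_eq_zero, ← e1, ← e3, ← neg_eq_zero, ← e2, ← neg_one_mul,
    ← circleIntegral.integral_const_mul]
  congr 1
  ext z
  simp only [map_add, add_apply, Pi.add_apply, Pi.sub_apply]
  rw [hB (deriv (fun z => m z⁻¹) z) (p' z)]
  ring

end Integral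

end

section

open scoped ContDiff

variable {V : Type*} [NormedAddCommGroup V] [InnerProductSpace ℂ V] [CompleteSpace V]
  {G : Subgroup (unitary (Mat V))} [FiniteDimensional ℂ V]

/-! ### The pairing with the reflected form -/

/-- The form `∂g g⁻¹` of the frame `g` (the negative of the reflected form). -/
def rightForm (α : Forms G) (z : ℂ) : Mat V := deriv (frame α) z * Ring.inverse (frame α z)

theorem rightForm_mem (α : Forms G) {z : ℂ} (hz : z ∈ Metric.ball (0 : ℂ) 1) :
    rightForm α z ∈ complexLie G := by
  rw [rightForm, (hasDerivAt_frame α hz).deriv]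
  exact frame_conj_mem α hz (formFun_mem α hz)

theorem differentiableOn_rightForm (α : Forms G) :
    DifferentiableOn ℂ (rightForm α) (Metric.ball 0 1) :=
  ((differentiableOn_frame α).deriv Metric.isOpen_ball).mul
    (differentiableOn_inverse (differentiableOn_frame α) fun _ hz => isUnit_frame α hz)

theorem differentiableOn_invForm (c : ℂ) {S : Set ℂ} {X Y : ℂ → Mat V}
    (hX : DifferentiableOn ℂ X S) (hY : DifferentiableOn ℂ Y S) :
    DifferentiableOn ℂ (fun z => invForm G c (X z) (Y z)) S :=
  ((invForm G c).differentiable.comp_differentiableOn hX).clm_apply hY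

theorem ann_one_subset {ρ : ℝ} (hρ : 0 < ρ) (hρ1 : ρ < 1) : ann ρ 1 ⊆ annulus ρ :=
  fun _ hz => mem_annulus_of_lt_one hρ hρ1 hz.1 hz.2

/-- The pairing is given by any circle inside the disc near the unit circle. -/
theorem reflectedPairing_eq (c : ℂ) (α : Forms G) (v : loopAlgebra G) {ρ s : ℝ} (hρ : 0 < ρ)
    (hs : ρ < s) (hs1 : s < 1) (hv : DifferentiableOn ℂ (loopExt v) (annulus ρ)) :
    reflectedPairing c α v = -(2 * (Real.pi : ℂ) * Complex.I)⁻¹ *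
      ∮ z in C(0, s), invForm G c (loopExt v z) (rightForm α z) := by
  have hρ1 := hs.trans hs1
  have hd : DifferentiableOn ℂ (fun z => invForm G c (loopExt v z) (rightForm α z)) (ann ρ 1) :=
    differentiableOn_invForm c (hv.mono (ann_one_subset hρ hρ1))
      ((differentiableOn_rightForm α).mono (ann_subset_ball ρ 1))
  refine (tendsto_const_nhds.congr' ?_).limUnder_eq
  filter_upwards [Ioo_mem_nhdsLT hρ1] with r hr
  rw [circleIntegral_eq_of_ann hρ.le hd ⟨hs, hs1⟩ hr, neg_mul, ← mul_neg]
  congr 1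
  rw [← neg_one_mul, ← circleIntegral.integral_const_mul]
  refine circleIntegral.integral_congr (hρ.trans hr.1).le fun z hz => ?_
  have hz := sphere_subset_ann hr.1 hr.2 hz
  have hmem := rightForm_mem α (ann_subset_ball ρ 1 hz)
  have hneg : reflected α z = -rightForm α z := rfl
  rw [hneg, trForm_eq c (loopExt_mem v hρ hρ1 hv (ann_one_subset hρ hρ1 hz))
    ((lieSub G).neg_mem hmem), map_neg, neg_one_mul]

/-- Pairing with a fixed loop along a circle is a continuous functional. -/
theorem exists_pairing (c : ℂ) {U : ℂ → Mat V} {r s R : ℝ} (hr : 0 < r) (hrs : r < s) (hsR : s < R)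
    (hU : DifferentiableOn ℂ U (ann r R)) : ∃ T : Hol (Metric.ball 0 R) (Mat V) →L[ℂ] ℂ,
      ∀ f, T f = ∮ z in C(0, s), invForm G c (U z) (f.ev z) := by
  have hs := hr.trans hrs
  have hsub := sphere_subset_ann hrs hsR
  obtain ⟨C, hC⟩ := (isCompact_sphere (0 : ℂ) s).exists_bound_of_continuousOn
    ((invForm G c).continuous.comp_continuousOn (hU.continuousOn.mono hsub))
  have hi : ∀ f : Hol (Metric.ball 0 R) (Mat V),
      CircleIntegrable (fun z => invForm G c (U z) (f.ev z)) 0 s := fun f =>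
    circleIntegrable_of_ann hs.le hrs hsR (differentiableOn_invForm c hU
      (f.differentiableOn.mono (ann_subset_ball r R)))
  refine ⟨LinearMap.mkContinuous
    { toFun := fun f => ∮ z in C(0, s), invForm G c (U z) (f.ev z)
      map_add' := fun f g => by
        simp only [Hol.ev_add, map_add]
        exact circleIntegral.integral_add (hi f) (hi g)
      map_smul' := fun a f => by
        simp only [Hol.ev_smul, map_smul, smul_eq_mul, RingHom.id_apply]
        exact circleIntegral.integral_const_mul a _ _ _ } (2 * Real.pi * s * C) fun f => ?_,
    fun f => rfl⟩
  have h1 : ‖∮ z in C(0, s), invForm G c (U z) (f.ev z)‖ ≤ 2 * Real.pi * s * (C * ‖f‖) :=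
    circleIntegral.norm_integral_le_of_norm_le_const hs.le fun z hz =>
      ((invForm G c (U z)).le_opNorm _).trans
        (mul_le_mul (hC z hz) (f.norm_ev_le z) (norm_nonneg _) ((norm_nonneg _).trans (hC z hz)))
  rwa [← mul_assoc] at h1

section Quotient

variable {𝔸 : Type*} [NormedRing 𝔸] [NormedAlgebra ℂ 𝔸] [CompleteSpace 𝔸] {R R' : ℝ}

/-- The operator `x ↦ ∂x x⁻¹`. -/
def rightQuotient (h : R < R') (x : Hol (Metric.ball 0 R') 𝔸) : Hol (Metric.ball 0 R) 𝔸 :=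
  derivOn h x * Ring.inverse (Hol.res (Metric.ball_subset_ball h.le) x)

theorem contDiffAt_rightQuotient (h : R < R') {x : Hol (Metric.ball 0 R') 𝔸} (hx : IsUnit x) :
    ContDiffAt ℂ ∞ (rightQuotient h) x := by
  have := Hol.completeSpace (𝔸 := 𝔸) (Metric.isOpen_ball (x := (0 : ℂ)) (ε := R))
  obtain ⟨w, hw⟩ := isUnit_res (Metric.ball_subset_ball h.le) hx
  refine (derivOn h).contDiff.contDiffAt.mul (ContDiffAt.comp (g := Ring.inverse)
    (f := fun x => Hol.res (Metric.ball_subset_ball h.le) x) _ ?_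
    (Hol.res (Metric.ball_subset_ball h.le)).contDiff.contDiffAt)
  rw [← hw]
  exact contDiffAt_ringInverse ℂ w

/-- The variation of `∂x x⁻¹` under `δx = -x q` is `-x ∂q x⁻¹`. -/
theorem ev_fderiv_rightQuotient (h : R < R') {x : Hol (Metric.ball 0 R') 𝔸} (hx : IsUnit x)
    (q : Hol (Metric.ball 0 R') 𝔸) {z : ℂ} (hz : z ∈ Metric.ball (0 : ℂ) R) :
    (fderiv ℂ (rightQuotient h) x (-(x * q))).ev z =
      -(x.ev z * deriv q.ev z * Ring.inverse (x.ev z)) := by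
  have := Hol.completeSpace (𝔸 := 𝔸) (Metric.isOpen_ball (x := (0 : ℂ)) (ε := R))
  have hr := isUnit_res (Metric.ball_subset_ball (x := (0 : ℂ)) h.le) hx
  have hz' := Metric.ball_subset_ball h.le hz
  have hxz := Hol.isUnit_ev hx hz'
  have hd : HasFDerivAt (rightQuotient h) _ x :=
    (derivOn h).hasFDerivAt.mul' (HasFDerivAt.comp (g := Ring.inverse) (f := fun x =>
      Hol.res (Metric.ball_subset_ball (x := (0 : ℂ)) h.le) x) x (by
        have := hasFDerivAt_ringInverse (𝕜 := ℂ) hr.unit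
        rwa [IsUnit.unit_spec] at this)
      (Hol.res (𝔸 := 𝔸) (Metric.ball_subset_ball (x := (0 : ℂ)) h.le)).hasFDerivAt)
  rw [hd.fderiv]
  have hinv : (↑hr.unit⁻¹ : Hol (Metric.ball 0 R) 𝔸) =
      Ring.inverse (Hol.res (Metric.ball_subset_ball h.le) x) := by
    conv_rhs => rw [← hr.unit_spec, Ring.inverse_unit]
  have hD : deriv (-(x * q)).ev z = -(deriv x.ev z * q.ev z + x.ev z * deriv q.ev z) := by
    have e : (-(x * q)).ev = fun z => -(x.ev z * q.ev z) := by ext1 w; simp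
    rw [e]
    exact ((differentiableAt_ev x hz').hasDerivAt.fun_mul
      (differentiableAt_ev q hz').hasDerivAt).fun_neg.deriv
  simp only [add_apply, smul_apply, ContinuousLinearMap.comp_apply, neg_apply,
    ContinuousLinearMap.mulLeftRight_apply, Function.comp_apply, hinv, Hol.ev_add, smul_eq_mul,
    MulOpposite.smul_eq_mul_unop, MulOpposite.unop_op, Hol.ev_mul, Hol.ev_neg, ev_derivOn h _ hz,
    Hol.ev_res _ _ hz, Hol.ev_inverse hr hz, hD]
  rw [mul_neg (Ring.inverse (x.ev z)), Ring.inverse_mul_cancel_left _ _ hxz]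
  noncomm_ring

end Quotient

end

section

open scoped ContDiff

variable {V : Type*} [NormedAddCommGroup V] [InnerProductSpace ℂ V] [CompleteSpace V]
  {G : Subgroup (unitary (Mat V))} [FiniteDimensional ℂ V]

/-! ### The Lie derivative of the pairing -/

/-- The positive modes of a `𝔤_ℂ`-valued function are `𝔤_ℂ`-valued, by uniqueness of the Laurent
decomposition of its projection. -/
theorem posPart_mem {r R : ℝ} (hr : 0 < r) (hR : r < R) {f : Hol (ann r R) (Mat V)}
    (hf : ∀ z ∈ ann r R, f.ev z ∈ complexLie G) {z : ℂ} (hz : z ∈ Metric.ball (0 : ℂ) R) :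
    (posPart r R f).ev z ∈ complexLie G := by
  obtain ⟨m, hm, hfm⟩ := exists_ev_eq_posPart_add hr hR f
  have hq := (posPart r R f).differentiableOn
  refine mem_of_lieProj_eq (sub_eq_zero.2 (eq_of_splitting hr hR hq
    ((lieProj G).differentiable.comp_differentiableOn hq) hm
    ((lieProj G).differentiable.comp_differentiableOn hm) ?_ (fun w hw => ?_) hz))
  · rw [Function.comp_apply, posPart_ev_zero hr hR, map_zero]
  · rw [Function.comp_apply, Function.comp_apply, ← map_add, ← hfm w hw, lieProj_of_mem (hf w hw)]

theorem deriv_mem_complexLie {S : Set ℂ} (hS : IsOpen S) {f : ℂ → Mat V}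
    (hf : DifferentiableOn ℂ f S) (h : ∀ z ∈ S, f z ∈ complexLie G) {z : ℂ} (hz : z ∈ S) :
    deriv f z ∈ complexLie G := by
  have hd := (hf.differentiableAt (hS.mem_nhds hz)).hasDerivAt
  have h1 : HasDerivAt f (lieProj G (deriv f z)) z :=
    ((lieProj G).hasFDerivAt.comp_hasDerivAt z hd).congr_of_eventuallyEq (by
      filter_upwards [hS.mem_nhds hz] with w hw using (lieProj_of_mem (h w hw)).symm)
  rw [hd.unique h1]
  exact lieProj_mem _

theorem mul_conj_mul_inverse {g : Mat V} (hg : IsUnit g) (X : Mat V) :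
    g * (Ring.inverse g * X * g) * Ring.inverse g = X := by
  rw [mul_assoc (Ring.inverse g), Ring.mul_inverse_cancel_left _ _ hg,
    Ring.mul_inverse_cancel_right _ _ hg]

theorem frame_inverse_conj_mem (α : Forms G) {z : ℂ} (hz : z ∈ Metric.ball (0 : ℂ) 1) {X : Mat V}
    (hX : X ∈ complexLie G) : Ring.inverse (frame α z) * X * frame α z ∈ complexLie G :=
  conj_mem_of_normalises (isUnit_frame α hz) (fun _ h => frame_conj_mem α hz h) hX

theorem invForm_conj_right (c : ℂ) (α : Forms G) {z : ℂ} (hz : z ∈ Metric.ball (0 : ℂ) 1)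
    {X Y : Mat V} (hX : X ∈ complexLie G) (hY : Y ∈ complexLie G) :
    invForm G c X (frame α z * Y * Ring.inverse (frame α z)) =
      invForm G c (Ring.inverse (frame α z) * X * frame α z) Y := by
  rw [← invForm_conj c (isUnit_frame α hz) (fun _ h => frame_conj_mem α hz h)
    (frame_inverse_conj_mem α hz hX) hY, mul_conj_mul_inverse (isUnit_frame α hz)]

theorem exists_reflectedPairing_eq (c : ℂ) (v : loopAlgebra G) {ρ s R R' : ℝ} (hρ : 0 < ρ)
    (hs : ρ < s) (hsR : s < R) (hRR : R < R') (hR1 : R' < 1)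
    (hv : DifferentiableOn ℂ (loopExt v) (annulus ρ)) :
    ∃ T : Hol (Metric.ball 0 R) (Mat V) →L[ℂ] ℂ,
      (∀ f, T f = ∮ z in C(0, s), invForm G c (loopExt v z) (f.ev z)) ∧
      ∀ α, reflectedPairing c α v = -(2 * (Real.pi : ℂ) * Complex.I)⁻¹ *
        T (rightQuotient hRR (frameOn R' α)) := by
  have hR := hRR.trans hR1
  obtain ⟨T, hT⟩ := exists_pairing (G := G) c hρ hs hsR (hv.mono fun z hz =>
    ann_one_subset hρ (hs.trans (hsR.trans hR)) (ann_mono le_rfl hR.le hz))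
  refine ⟨T, hT, fun α => ?_⟩
  rw [hT, reflectedPairing_eq c α v hρ hs (hsR.trans hR) hv]
  congr 1
  refine circleIntegral.integral_congr (hρ.trans hs).le fun z hz => ?_
  have hzR := ann_subset_ball ρ R (sphere_subset_ann hs hsR hz)
  have hzR' := Metric.ball_subset_ball hRR.le hzR
  simp only [rightQuotient, Hol.ev_mul, ev_derivOn hRR _ hzR, Hol.ev_inverse
    (isUnit_res (Metric.ball_subset_ball hRR.le) (isUnit_frameOn hR1 α)) hzR, Hol.ev_res _ _ hzR,
    deriv_ev_frameOn hR1 α hzR', ev_frameOn hR1 α hzR', rightForm]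

theorem reflectedPairing_mem_smooth (hclosed : IsClosed (G : Set (unitary (Mat V)))) (c : ℂ)
    (v : loopAlgebra G) : (fun α => reflectedPairing c α v) ∈ Smooth G := by
  obtain ⟨ρ, hρ, hρ1, hv⟩ := exists_differentiableOn_loopExt v
  obtain ⟨s, hs, hs1⟩ := exists_between hρ1
  obtain ⟨R, hR, hR1⟩ := exists_between hs1
  obtain ⟨R', hR', hR1'⟩ := exists_between hR1
  obtain ⟨T, -, hT⟩ := exists_reflectedPairing_eq c v hρ hs hR hR' hR1' hv
  refine IsFrameSmooth.mem_smooth hclosed ⟨R', (hρ.trans hs).trans (hR.trans hR'), hR1',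
    fun x => -(2 * (Real.pi : ℂ) * Complex.I)⁻¹ * T (rightQuotient hR' x), fun α => ?_, hT⟩
  exact contDiffAt_const.mul
    (T.contDiff.contDiffAt.comp _ (contDiffAt_rightQuotient hR' (isUnit_frameOn hR1' α)))

/-- The positive modes of `g⁻¹ U g`, for the frame `g` of `α`. -/
abbrev posModes (r R : ℝ) (α : Forms G) (U : ℂ → Mat V) : Hol (Metric.ball 0 R) (Mat V) :=
  posPart r R (conjBy r R U (frameOn R α))

/-- With `g_t` the frame along the family, `∂g_t g_t⁻¹` varies by `-g ∂(g⁻¹ U g)₊ g⁻¹`; conjugating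
by `g` under the invariant form gives `ℒ_u α^r(v) = (1/2πi) ∮ tr(g⁻¹ V g, ∂(g⁻¹ U g)₊)`. -/
theorem lieDeriv_reflectedPairing (hclosed : IsClosed (G : Set (unitary (Mat V)))) (c : ℂ)
    (α : Forms G) {u u' v : loopAlgebra G} (hu' : ∀ z : Circle, u'.1 z = -star (u.1 z))
    {ρ r s R : ℝ} (hρ : 0 < ρ) (hr : ρ < r) (hrs : r < s) (hsR : s < R) (hR : R < 1)
    (hdu : DifferentiableOn ℂ (loopExt u) (annulus ρ))
    (hdu' : DifferentiableOn ℂ (loopExt u') (annulus ρ))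
    (hdv : DifferentiableOn ℂ (loopExt v) (annulus ρ)) :
    lieDeriv u (fun β => reflectedPairing c β v) α = (2 * (Real.pi : ℂ) * Complex.I)⁻¹ *
      ∮ z in C(0, s), invForm G c (Ring.inverse (frame α z) * loopExt v z * frame α z)
        (deriv (posModes r R α (loopExt u)).ev z) := by
  have hρ1 : ρ < 1 := hr.trans (hrs.trans (hsR.trans hR))
  obtain ⟨R₁, h1, hR₁⟩ := exists_between hsR
  obtain ⟨T, hT, hF⟩ := exists_reflectedPairing_eq c v hρ (hr.trans hrs) h1 hR₁ hR hdv
  have hxu := isUnit_frameOn hR α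
  have hQ := (contDiffAt_rightQuotient hR₁ hxu).differentiableAt (by simp)
  have hΦ : HasFDerivAt (fun x : Hol (Metric.ball 0 R) (Mat V) =>
      -(2 * (Real.pi : ℂ) * Complex.I)⁻¹ * T (rightQuotient hR₁ x)) _ (frameOn R α) :=
    (T.hasFDerivAt.comp _ hQ.hasFDerivAt).const_mul (-(2 * (Real.pi : ℂ) * Complex.I)⁻¹)
  have h := hasLeftDeriv_of_frameOn hF hΦ.differentiableAt hu' hρ hdu hdu' hr (hrs.trans hsR) hR
    le_rfl
  rw [h.lieDeriv_eq hclosed, hΦ.fderiv]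
  have hid : Hol.res (Metric.ball_subset_ball le_rfl) (leftVelocity r R (loopExt u) (frameOn R α)) =
      -(frameOn R α * posModes r R α (loopExt u)) :=
    Hol.ext_ev fun z hz => by rw [Hol.ev_res _ _ hz, leftVelocity]
  rw [hid]
  simp only [smul_apply, ContinuousLinearMap.comp_apply, hT, smul_eq_mul]
  rw [neg_mul, ← mul_neg]
  congr 1
  rw [← neg_one_mul, ← circleIntegral.integral_const_mul]
  refine circleIntegral.integral_congr (hρ.trans (hr.trans hrs)).le fun z hz => ?_
  have hz' := sphere_subset_ann hrs h1 hz
  have hzR := ann_subset_ball r R₁ hz'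
  have hzR' := Metric.ball_subset_ball hR₁.le hzR
  have hz1 := Metric.ball_subset_ball hR.le hzR'
  have hsub : ∀ {w : ℂ}, w ∈ ann r R → w ∈ annulus ρ := fun hw =>
    ann_one_subset hρ hρ1 (ann_mono hr.le hR.le hw)
  have hmem : deriv (posModes r R α (loopExt u)).ev z ∈ complexLie G := by
    refine deriv_mem_complexLie Metric.isOpen_ball (posModes r R α (loopExt u)).differentiableOn
      (fun w hw => posPart_mem (hρ.trans hr) (hrs.trans hsR) (fun w hw => ?_) hw) hzR'
    rw [ev_conjBy hρ hr (hrs.trans hsR) hR hdu α hw]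
    exact frame_inverse_conj_mem α (Metric.ball_subset_ball hR.le (ann_subset_ball r R hw))
      (loopExt_mem u hρ hρ1 hdu (hsub hw))
  have hev := ev_fderiv_rightQuotient hR₁ hxu (posModes r R α (loopExt u)) hzR
  rw [ev_frameOn hR α hzR'] at hev
  beta_reduce
  rw [hev, map_neg, invForm_conj_right c α hz1 (loopExt_mem v hρ hρ1 hdv
    (hsub (ann_mono le_rfl hR₁.le hz'))) hmem]
  ring

/-- The Kac--Moody cocycle. -/
theorem lieDeriv_reflectedPairing_sub (hclosed : IsClosed (G : Set (unitary (Mat V)))) (c : ℂ)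
    (u v : loopAlgebra G) (α : Forms G) :
    lieDeriv u (fun β => reflectedPairing c β v) α - lieDeriv v (fun β => reflectedPairing c β u) α
      - reflectedPairing c α ⁅u, v⁆ = Complex.I * omegaKM G c u v := by
  obtain ⟨u', hu'⟩ := exists_conj_loop hclosed u
  obtain ⟨v', hv'⟩ := exists_conj_loop hclosed v
  obtain ⟨ρ₁, h01, h11, hdu, hdu'⟩ := exists_common_annulus u u'
  obtain ⟨ρ₂, h02, h12, hdv, hdv'⟩ := exists_common_annulus v v'
  obtain ⟨ρ₃, h03, h13, hdl⟩ := exists_differentiableOn_loopExt ⁅u, v⁆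
  obtain ⟨ρ, hm, hρ1⟩ := exists_between (max_lt h11 (max_lt h12 h13))
  obtain ⟨h1, hm⟩ := max_lt_iff.1 hm
  obtain ⟨h2, h3⟩ := max_lt_iff.1 hm
  have hρ := h01.trans h1
  replace hdu := hdu.mono (annulus_mono h01 h1.le)
  replace hdu' := hdu'.mono (annulus_mono h01 h1.le)
  replace hdv := hdv.mono (annulus_mono h02 h2.le)
  replace hdv' := hdv'.mono (annulus_mono h02 h2.le)
  replace hdl := hdl.mono (annulus_mono h03 h3.le)
  obtain ⟨r, hr, hr1⟩ := exists_between hρ1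
  obtain ⟨s, hrs, hs1⟩ := exists_between hr1
  obtain ⟨R, hsR, hR⟩ := exists_between hs1
  have hs : 0 < s := hρ.trans (hr.trans hrs)
  have hAρ : ∀ {w : ℂ}, w ∈ ann r R → w ∈ annulus ρ := fun hw =>
    ann_one_subset hρ hρ1 (ann_mono hr.le hR.le hw)
  have hAb : ∀ {w : ℂ}, w ∈ ann r R → w ∈ Metric.ball (0 : ℂ) 1 := fun hw =>
    Metric.ball_subset_ball hR.le (ann_subset_ball r R hw)
  rw [lieDeriv_reflectedPairing hclosed c α hu' hρ hr hrs hsR hR hdu hdu' hdv,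
    lieDeriv_reflectedPairing hclosed c α hv' hρ hr hrs hsR hR hdv hdv' hdu,
    reflectedPairing_eq c α _ hρ (hr.trans hrs) hs1 hdl]
  obtain ⟨m, hmd, hm⟩ := exists_ev_eq_posPart_add (hρ.trans hr) (hrs.trans hsR)
    (conjBy r R (loopExt u) (frameOn R α))
  obtain ⟨m', hmd', hm'⟩ := exists_ev_eq_posPart_add (hρ.trans hr) (hrs.trans hsR)
    (conjBy r R (loopExt v) (frameOn R α))
  have hU : ∀ z ∈ ann r R, _ := fun z hz => ev_conjBy hρ hr (hrs.trans hsR) hR hdu α hz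
  have hV : ∀ z ∈ ann r R, _ := fun z hz => ev_conjBy hρ hr (hrs.trans hsR) hR hdv α hz
  have key := integral_pairing_deriv (invForm G c) (invForm_comm c) (hρ.trans hr) hrs hsR
    (f := fun z => Ring.inverse (frame α z) * loopExt u z * frame α z)
    (f' := fun z => Ring.inverse (frame α z) * loopExt v z * frame α z)
    (posModes r R α (loopExt u)).differentiableOn (posModes r R α (loopExt v)).differentiableOn
    hmd hmd' (fun z hz => by rw [← hU z hz, hm z hz]) (fun z hz => by rw [← hV z hz, hm' z hz])
  rw [← mul_sub, key]
  have hdu1 := hdu.deriv (isOpen_annulus ρ)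
  have hdv1 := hdv.deriv (isOpen_annulus ρ)
  -- The integrand `B(𝒱, 𝒰')`, for `𝒰 = g⁻¹ U g` and `𝒱 = g⁻¹ V g`.
  have hint : Set.EqOn (fun z => invForm G c (Ring.inverse (frame α z) * loopExt v z * frame α z)
      (deriv (fun z => Ring.inverse (frame α z) * loopExt u z * frame α z) z))
      (fun z => invForm G c (loopExt v z) (deriv (loopExt u) z) -
        invForm G c (loopExt ⁅u, v⁆ z) (rightForm α z)) (Metric.sphere 0 s) := fun z hz => by
    have hz' := sphere_subset_ann hrs hsR hz
    have hz1 := hAb hz'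
    have hzρ := hAρ hz'
    have hg := isUnit_frame α hz1
    have hum := loopExt_mem u hρ hρ1 hdu hzρ
    have hvm := loopExt_mem v hρ hρ1 hdv hzρ
    have ham := rightForm_mem α hz1
    have hum' := deriv_mem_complexLie (isOpen_annulus ρ) hdu
      (fun w hw => loopExt_mem u hρ hρ1 hdu hw) hzρ
    have hl : loopExt ⁅u, v⁆ z = loopExt u z * loopExt v z - loopExt v z * loopExt u z :=
      eqOn_of_circle hρ hρ1 hdl ((hdu.mul hdv).sub (hdv.mul hdu)) (fun w => by
        simp only [Pi.sub_apply, Pi.mul_apply, loopExt_apply, loop_lie_apply]) hzρ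
    have hd1 := ((differentiableOn_frame α).differentiableAt
      (Metric.isOpen_ball.mem_nhds hz1)).hasDerivAt
    have hd2 := (hdu.differentiableAt ((isOpen_annulus ρ).mem_nhds hzρ)).hasDerivAt
    have hderiv : deriv (fun z => Ring.inverse (frame α z) * loopExt u z * frame α z) z =
        Ring.inverse (frame α z) * (deriv (loopExt u) z +
          (loopExt u z * rightForm α z - rightForm α z * loopExt u z)) * frame α z := by
      rw [(((hasDerivAt_inverse hd1 hg).fun_mul hd2).fun_mul hd1).deriv, rightForm]
      have e : loopExt u z * (deriv (frame α) z * Ring.inverse (frame α z)) * frame α z =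
          loopExt u z * deriv (frame α) z := by
        rw [mul_assoc, Ring.inverse_mul_cancel_right _ _ hg]
      rw [mul_assoc, mul_assoc (Ring.inverse (frame α z)) (_ + _), add_mul (deriv _ _), sub_mul, e]
      noncomm_ring
    have hW := (lieSub G).add_mem hum' (lie_mem_complexLie hum ham)
    have hn : invForm G c (loopExt v z * loopExt u z - loopExt u z * loopExt v z) (rightForm α z) =
        -invForm G c (loopExt ⁅u, v⁆ z) (rightForm α z) := by
      rw [hl, ← neg_sub (loopExt u z * loopExt v z), map_neg, neg_apply]
    beta_reduce
    rw [hderiv, ← invForm_conj_right c α hz1 hvm (frame_inverse_conj_mem α hz1 hW),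
      mul_conj_mul_inverse hg, map_add, ← invForm_lie c hvm hum ham, hn, sub_eq_add_neg]
  have hS := sphere_subset_ann hrs hsR
  have hsubA : ann r R ⊆ annulus ρ := fun w hw => hAρ hw
  have i1 := circleIntegrable_of_ann hs.le hrs hsR
    (differentiableOn_invForm (G := G) c (hdv.mono hsubA) (hdu1.mono hsubA))
  have i2 := circleIntegrable_of_ann hs.le hrs hsR
    (differentiableOn_invForm (G := G) c (hdl.mono hsubA)
      ((differentiableOn_rightForm α).mono fun w hw => hAb hw))
  have i3 := circleIntegrable_of_ann hs.le hrs hsR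
    (differentiableOn_invForm (G := G) c (hdu.mono hsubA) (hdv1.mono hsubA))
  rw [circleIntegral.integral_congr hs.le hint, circleIntegral.integral_sub i1 i2]
  -- Integration by parts.
  have hparts : (∮ z in C(0, s), (invForm G c (loopExt v z) (deriv (loopExt u) z) +
      invForm G c (loopExt u z) (deriv (loopExt v) z))) = 0 := by
    refine circleIntegral.integral_eq_zero_of_hasDerivWithinAt hs.le
      (f := fun z => invForm G c (loopExt v z) (loopExt u z)) fun z hz =>
        HasDerivAt.hasDerivWithinAt ?_
    have hzρ := hAρ (hS hz)
    have e1 := (hdu.differentiableAt ((isOpen_annulus ρ).mem_nhds hzρ)).hasDerivAt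
    have e2 := (hdv.differentiableAt ((isOpen_annulus ρ).mem_nhds hzρ)).hasDerivAt
    have e3 : HasDerivAt (fun z => invForm G c (loopExt v z))
        (invForm G c (deriv (loopExt v) z)) z := (invForm G c).hasFDerivAt.comp_hasDerivAt z e2
    refine (e3.clm_apply e1).congr_deriv ?_
    rw [invForm_comm c (deriv (loopExt v) z), add_comm]
  rw [circleIntegral.integral_add i1 i3] at hparts
  have homega : omegaKM G c u v = (2 * (Real.pi : ℂ))⁻¹ *
      ∮ z in C(0, s), invForm G c (loopExt u z) (deriv (loopExt v) z) := by
    have h1ρ : (1 : ℝ) < ρ⁻¹ := (one_lt_inv₀ hρ).2 hρ1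
    rw [omegaKM, circleIntegral_eq_of_ann hρ.le (r := ρ) (R := ρ⁻¹)
      (differentiableOn_invForm (G := G) c hdu hdv1) ⟨hr.trans hrs, hs1.trans h1ρ⟩ ⟨hρ1, h1ρ⟩]
    congr 1
    refine circleIntegral.integral_congr zero_le_one fun z hz => ?_
    have hzρ : z ∈ annulus ρ := sphere_subset_ann hρ1 h1ρ hz
    exact trForm_eq c (loopExt_mem u hρ hρ1 hdu hzρ) (deriv_mem_complexLie (isOpen_annulus ρ) hdv
      (fun w hw => loopExt_mem v hρ hρ1 hdv hw) hzρ)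
  rw [homega, eq_neg_of_add_eq_zero_left hparts, mul_inv_rev (2 * (Real.pi : ℂ)), Complex.inv_I]
  ring

end

section

variable {V : Type*} [NormedAddCommGroup V] [InnerProductSpace ℂ V] [CompleteSpace V]
  {G : Subgroup (unitary (Mat V))}

/-! ### Products of smooth functions -/

theorem isBigO_linear (a b : ℂ) : (fun t : ℂ => t * a + conj t * b) =O[𝓝 0] fun t : ℂ => t := by
  refine IsBigO.of_bound (‖a‖ + ‖b‖) (Eventually.of_forall fun t => ?_)
  refine (norm_add_le _ _).trans_eq ?_
  rw [norm_mul, norm_mul, RCLike.norm_conj]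
  ring

/-- The Leibniz rule. -/
theorem HasLeftDeriv.mul {F F' : Forms G → ℂ} {α : Forms G} {u : loopAlgebra G} {a b a' b' : ℂ}
    (h : HasLeftDeriv F α u a b) (h' : HasLeftDeriv F' α u a' b') :
    HasLeftDeriv (F * F') α u (F α * a' + a * F' α) (F α * b' + b * F' α) := fun χ hχ β hβ => by
  have e := h χ hχ β hβ
  have e' := h' χ hχ β hβ
  have hid : Tendsto (fun t : ℂ => t) (𝓝 0) (𝓝 0) := tendsto_id
  have hO : (fun t => F' (β t) - F' α) =O[𝓝 0] fun t : ℂ => t :=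
    (e'.isBigO.add (isBigO_linear a' b')).congr_left fun t => by ring
  have h0 : (fun t => F' (β t) - F' α) =o[𝓝 0] fun _ => (1 : ℂ) :=
    (isLittleO_one_iff ℂ).2 (hO.trans_tendsto hid)
  have h1 : (fun t => F' (β t)) =O[𝓝 0] fun _ => (1 : ℂ) :=
    (h0.isBigO.add (isBigO_const_const (F' α) one_ne_zero (𝓝 (0 : ℂ)))).congr_left fun t => by ring
  have s1 := e.mul_isBigO h1
  have s2 := e'.const_mul_left (F α)
  have s3 := (isBigO_linear a b).mul_isLittleO h0
  simp only [mul_one] at s1 s3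
  refine ((s1.add s2).add s3).congr_left fun t => ?_
  simp only [Pi.mul_apply]
  ring

variable [FiniteDimensional ℂ V]

theorem IsCk.mul {n : ℕ} {F F' : Forms G → ℂ} (h : IsCk n F) (h' : IsCk n F') :
    IsCk n (F * F') := by
  induction n generalizing F F' with
  | zero => exact Continuous.mul h h'
  | succ n ih =>
    refine ⟨h.1.mul h'.1, fun u => ?_⟩
    obtain ⟨A, B, hd, hA⟩ := h.2 u
    obtain ⟨A', B', hd', hA'⟩ := h'.2 u
    exact ⟨F * A' + A * F', F * B' + B * F', fun α => (hd α).mul (hd' α),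
      (ih h.pred hA').add (ih hA h'.pred)⟩

theorem lieDeriv_mul (hclosed : IsClosed (G : Set (unitary (Mat V)))) (u : loopAlgebra G)
    {F F' : Forms G → ℂ} (hF : IsCk 1 F) (hF' : IsCk 1 F') :
    lieDeriv u (F * F') = F * lieDeriv u F' + lieDeriv u F * F' := funext fun α => by
  obtain ⟨b, hb⟩ := (hF.exists_hasLeftDeriv hclosed u).2 α
  obtain ⟨b', hb'⟩ := (hF'.exists_hasLeftDeriv hclosed u).2 α
  exact (hb.mul hb').lieDeriv_eq hclosed

theorem lieDeriv_mem_smooth (hclosed : IsClosed (G : Set (unitary (Mat V)))) (u : loopAlgebra G)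
    {F : Forms G → ℂ} (hF : F ∈ Smooth G) : lieDeriv u F ∈ Smooth G :=
  fun n => ((hF (n + 1)).exists_hasLeftDeriv hclosed u).1

/-! ### The representation -/

theorem reflectedPairing_add (c : ℂ) (α : Forms G) (u v : loopAlgebra G) :
    reflectedPairing c α (u + v) = reflectedPairing c α u + reflectedPairing c α v := by
  obtain ⟨ρ₁, h01, h11, hdu, hdv⟩ := exists_common_annulus u v
  obtain ⟨ρ₂, h02, h12, hdw⟩ := exists_differentiableOn_loopExt (u + v)
  have hρ : 0 < max ρ₁ ρ₂ := lt_max_of_lt_left h01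
  have hρ1 := max_lt h11 h12
  replace hdu := hdu.mono (annulus_mono h01 (le_max_left ρ₁ ρ₂))
  replace hdv := hdv.mono (annulus_mono h01 (le_max_left ρ₁ ρ₂))
  replace hdw := hdw.mono (annulus_mono h02 (le_max_right ρ₁ ρ₂))
  obtain ⟨s, hs, hs1⟩ := exists_between hρ1
  have hi : ∀ {w : loopAlgebra G}, DifferentiableOn ℂ (loopExt w) (annulus (max ρ₁ ρ₂)) →
      CircleIntegrable (fun z => invForm G c (loopExt w z) (rightForm α z)) 0 s := fun hw =>
    circleIntegrable_of_ann (hρ.trans hs).le hs hs1 (differentiableOn_invForm c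
      (hw.mono (ann_one_subset hρ hρ1)) ((differentiableOn_rightForm α).mono (ann_subset_ball _ 1)))
  rw [reflectedPairing_eq c α _ hρ hs hs1 hdw, reflectedPairing_eq c α _ hρ hs hs1 hdu,
    reflectedPairing_eq c α _ hρ hs hs1 hdv, ← mul_add,
    ← circleIntegral.integral_add (hi hdu) (hi hdv)]
  congr 1
  refine circleIntegral.integral_congr (hρ.trans hs).le fun z hz => ?_
  have hz := ann_one_subset hρ hρ1 (sphere_subset_ann hs hs1 hz)
  have : loopExt (u + v) z = loopExt u z + loopExt v z :=
    eqOn_of_circle hρ hρ1 hdw (hdu.add hdv) (fun w => by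
      simp only [Pi.add_apply, loopExt_apply, loop_add_apply]) hz
  simp only [this, map_add, add_apply]

theorem reflectedPairing_smul (c : ℂ) (α : Forms G) (a : ℂ) (u : loopAlgebra G) :
    reflectedPairing c α (a • u) = a * reflectedPairing c α u := by
  obtain ⟨ρ, hρ, hρ1, hdu, hdw⟩ := exists_common_annulus u (a • u)
  obtain ⟨s, hs, hs1⟩ := exists_between hρ1
  rw [reflectedPairing_eq c α _ hρ hs hs1 hdw, reflectedPairing_eq c α _ hρ hs hs1 hdu,
    mul_left_comm, ← circleIntegral.integral_const_mul a]
  congr 1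
  refine circleIntegral.integral_congr (hρ.trans hs).le fun z hz => ?_
  have hz := ann_one_subset hρ hρ1 (sphere_subset_ann hs hs1 hz)
  have : loopExt (a • u) z = a • loopExt u z :=
    eqOn_of_circle hρ hρ1 (f := loopExt (a • u)) (g := fun z => a • loopExt u z)
      hdw (hdu.const_smul a) (fun w => by
      simp only [Pi.smul_apply, loopExt_apply, loop_smul_apply]) hz
  simp only [this, map_smul, smul_apply, smul_eq_mul]

/-- The operator `𝐋_u` on smooth functions. -/
def opSmooth (hclosed : IsClosed (G : Set (unitary (Mat V)))) (c κ : ℂ) (u : loopAlgebra G) :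
    Module.End ℂ (Smooth G) where
  toFun F := ⟨opL c κ u F.1, by
    have h : opL c κ u F.1 = lieDeriv u F.1 + κ • ((fun α => reflectedPairing c α u) * F.1) := by
      ext α
      simp [opL, mul_assoc]
    rw [h]
    exact (Smooth G).add_mem (lieDeriv_mem_smooth hclosed u F.2) ((Smooth G).smul_mem κ fun n =>
      (reflectedPairing_mem_smooth hclosed c u n).mul (F.2 n))⟩
  map_add' F F' := by
    ext α
    have := congrFun (lieDeriv_apply_add hclosed u (F.2 1) (F'.2 1)) α
    simp only [Submodule.coe_add, opL, Pi.add_apply] at this ⊢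
    rw [this]
    ring
  map_smul' a F := by
    ext α
    have := congrFun (lieDeriv_apply_smul hclosed u a (F.2 1)) α
    simp only [Submodule.coe_smul, opL, Pi.smul_apply, smul_eq_mul, RingHom.id_apply] at this ⊢
    rw [this]
    ring

/-- The map `u ↦ 𝐋_u`. -/
def opLinear (hclosed : IsClosed (G : Set (unitary (Mat V)))) (c κ : ℂ) :
    loopAlgebra G →ₗ[ℂ] Module.End ℂ (Smooth G) where
  toFun := opSmooth hclosed c κ
  map_add' u v := by
    ext F α
    change opL c κ (u + v) F.1 α = opL c κ u F.1 α + opL c κ v F.1 α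
    rw [opL, opL, opL, lieDeriv_add hclosed u v (F.2 1), reflectedPairing_add]
    ring
  map_smul' a u := by
    ext F α
    change opL c κ (a • u) F.1 α = a * opL c κ u F.1 α
    rw [opL, opL, lieDeriv_smul hclosed a u (F.2 1), reflectedPairing_smul]
    ring

/-- The composition of two of the operators `𝐋_u = ℒ_u + κ α^r(u)`, expanded by the Leibniz rule. -/
theorem opL_opL (hclosed : IsClosed (G : Set (unitary (Mat V)))) (c κ : ℂ) (u v : loopAlgebra G)
    {F : Forms G → ℂ} (hF : F ∈ Smooth G) (α : Forms G) :
    opL c κ u (opL c κ v F) α = lieDeriv u (lieDeriv v F) α +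
      κ * (reflectedPairing c α v * lieDeriv u F α +
        lieDeriv u (fun β => reflectedPairing c β v) α * F α) +
      κ * reflectedPairing c α u * (lieDeriv v F α + κ * reflectedPairing c α v * F α) := by
  have hρ := reflectedPairing_mem_smooth hclosed c v
  have h : opL c κ v F = lieDeriv v F + κ • ((fun α => reflectedPairing c α v) * F) := by
    ext α
    simp [opL, mul_assoc]
  have hm : IsCk 1 ((fun α => reflectedPairing c α v) * F) := (hρ 1).mul (hF 1)
  have e := congrFun (lieDeriv_apply_add hclosed u (lieDeriv_mem_smooth hclosed v hF 1)
    (hm.smul κ)) α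
  rw [lieDeriv_apply_smul hclosed u κ hm, lieDeriv_mul hclosed u (hρ 1) (hF 1)] at e
  rw [opL, h, e]
  simp only [Pi.add_apply, Pi.smul_apply, Pi.mul_apply, smul_eq_mul]
  ring

end

end LoopRep

end

theorem proposition4p2 {V : Type*} [NormedAddCommGroup V] [InnerProductSpace ℂ V]
    [FiniteDimensional ℂ V] [CompleteSpace V] (G : Subgroup (unitary (LoopRep.Mat V)))
    (hclosed : IsClosed (G : Set (unitary (LoopRep.Mat V))))
    (hconn : IsConnected (G : Set (unitary (LoopRep.Mat V))))
    (c κ : ℂ) :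
    (∀ v : LoopRep.loopAlgebra G,
      (fun α : LoopRep.Forms G => LoopRep.reflectedPairing c α v) ∈ LoopRep.Smooth G) ∧
    (∀ (u v : LoopRep.loopAlgebra G) (α : LoopRep.Forms G),
      LoopRep.lieDeriv u (fun β => LoopRep.reflectedPairing c β v) α
        - LoopRep.lieDeriv v (fun β => LoopRep.reflectedPairing c β u) α
        - LoopRep.reflectedPairing c α ⁅u, v⁆ = Complex.I * LoopRep.omegaKM G c u v) ∧
    ∃ L : LoopRep.loopAlgebra G →ₗ[ℂ] Module.End ℂ (LoopRep.Smooth G),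
      (∀ (u : LoopRep.loopAlgebra G) (F : LoopRep.Smooth G),
        (L u F : LoopRep.Forms G → ℂ) = LoopRep.opL c κ u F) ∧
      ∀ u v : LoopRep.loopAlgebra G,
        ⁅L u, L v⁆ = L ⁅u, v⁆ + (Complex.I * κ * LoopRep.omegaKM G c u v) • 1 := by
  refine ⟨LoopRep.reflectedPairing_mem_smooth hclosed c,
    LoopRep.lieDeriv_reflectedPairing_sub hclosed c, LoopRep.opLinear hclosed c κ,
    fun _ _ => rfl, fun u v => ?_⟩
  ext F α
  have h1 := LoopRep.opL_opL hclosed c κ u v F.2 α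
  have h2 := LoopRep.opL_opL hclosed c κ v u F.2 α
  have h3 := LoopRep.lieDeriv_lie hclosed u v (F.2 2) α
  have h4 := LoopRep.lieDeriv_reflectedPairing_sub hclosed c u v α
  change LoopRep.opL c κ u (LoopRep.opL c κ v F.1) α - LoopRep.opL c κ v (LoopRep.opL c κ u F.1) α =
    LoopRep.opL c κ ⁅u, v⁆ F.1 α + (Complex.I * κ * LoopRep.omegaKM G c u v) * F.1 α
  rw [h1, h2, LoopRep.opL, h3]
  linear_combination κ * F.1 α * h4
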